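/- **Setting.** Let $\Gamma$ be a finite weighted plane graph whose edges are of two kinds: unoriented *vertical* edges $R$ with weights $H(R)\in\mathbb R$, and oriented *horizontal* edges. A *width function* $W$ assigns a real number to each vertex; the weight of a horizontal edge is the absolute value of the increment of $W$ along it. For a vertex $V$ put ${\rm ord}(V)=d_{|}(V)+2d_{in}(V)-2$, where $d_{|}$ is the number of vertical edges and $d_{in}$ the number of incoming horizontal edges at $V$ (counted with multiplicity). $V$ is a *branchpoint* if ${\rm ord}(V)$ is odd. Consider the following conditions. * (T1) $\Gamma$ is a tree, (T1$_{sym}$) having a mirror symmetry (an orientation-reversing involution of the weighted plane graph). * (T2) At each vertex the outgoing horizontal edges are separated, in the cyclic order, by vertical or incoming edges (in particular, no vertex is incident to just one edge which is outgoing). * (T3) If ${\rm ord}(V)=0$, then $V$ is incident both to a vertical and to a horizontal edge. * (W1*) $W$ does not decrease along oriented edges, and $W(V)=0$ if $V$ is incident to a vertical edge. * (W2*) The weights of the vertical edges are nonnegative and their sum is $\pi$. The *extended graph* ${\rm Ext}\,\Gamma$ is obtained by drawing from the vertices disjoint outgoing horizontal rays to infinity, so that at each vertex the outgoing edges and rays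 alternate with the vertical and incoming edges. Each vertical edge is adjacent to two half-strips of the complement of ${\rm Ext}\,\Gamma$; the two sides of a half-strip start at the ends of the edge, consist of horizontal edges and end with rays. *Contraction* of a horizontal edge of zero weight shrinks it to a point. *Zipping* of a vertical edge of zero weight collapses each of the two adjacent half-strips to a ray, by identifying the points of its sides with equal values of $W$ (where $W$ grows from the value at the vertex to $+\infty$ along a ray; zero weight edges on the sides are contracted thereby); afterwards the rays to infinity are removed. **Lemma.** Let $\Gamma$ satisfy (T1), without the symmetry, (T2), (T3), (W1\*), (W2\*), and let any two different branchpoints be at positive graph distance (the length of a path being the sum of the weights of its edges). Let $\Gamma'$ be obtained from $\Gamma$ by contraction of a zero weight horizontal edge or by zipping of a zero weight vertical edge $R$. Then: 1. $\Gamma'$ satisfies (T1), without the symmetry, (T2), (T3), (W1\*), (W2\*). 2. $\Gamma'$ has strictly fewer edges of zero weight than $\Gamma$. 3. The vertices of $\Gamma'$ arise by merging vertices of $\Gamma$ with equal values of $W$, namely the two ends of $R$ for a contraction, and the vertices identified by the collapse of the half-strips for a zipping; $W$ is preserved, and the order of each vertex of $\Gamma'$ is the sum of the orders of the vertices of $\Gamma$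 merged in it. 4. Let $\Gamma$ moreover have a mirror symmetry $\tau$. If $\tau R=R$, then $\Gamma'$ has a mirror symmetry. If $\tau R\ne R$, then the graph $\Gamma''$ obtained from $\Gamma'$ by the same operation applied to the edge $\tau R$ satisfies (T1) together with (T1$_{sym}$), (T2), (T3), (W1\*), (W2\*), and it has strictly fewer zero weight edges than $\Gamma'$. -/

import Mathlib

/-- The type of a dart (half-edge) of a graph: a half of an unoriented vertical edge, the tail half
or the head half of an oriented horizontal edge, or a horizontal ray leaving for infinity (rays
occur only in extended graphs and are always leaving their vertex). -/
inductive DartKind : Type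
  | vertical
  | outgoing
  | incoming
  | ray

/-- Raw data of a finite weighted graph drawn on an oriented surface, given by its darts:
`rot d` is the dart following `d` in the counterclockwise order around the initial vertex of `d`,
`opp d` is the other half of the edge of `d`. The vertices are the cycles of `rot` on `darts`.
`W d` is the value of the width function at the initial vertex of `d`, and `H d` is the weight of
the edge of `d` if this edge is vertical. Values at elements outside `darts` are irrelevant. -/
structure WGraph (α : Type*) where
  darts : Finset α
  rot : Equiv.Perm α
  opp : α → α
  kind : α → DartKind
  W : α → ℝ
  H : α → ℝ

namespace WGraph

noncomputable section

open scoped Classical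

variable {α β : Type*}

/-- The laws of a weighted graph (without rays). Such a graph is drawn on an oriented
surface by its rotation `rot`; for a tree this surface is automatically a sphere, i.e. the tree is
drawn in the plane. -/
structure IsGraph (G : WGraph α) : Prop where
  rot_mem : ∀ d, G.rot d ∈ G.darts ↔ d ∈ G.darts
  opp_mem : ∀ d ∈ G.darts, G.opp d ∈ G.darts
  opp_opp : ∀ d ∈ G.darts, G.opp (G.opp d) = d
  opp_ne : ∀ d ∈ G.darts, G.opp d ≠ d
  kind_ne_ray : ∀ d ∈ G.darts, G.kind d ≠ DartKind.ray
  kind_opp_vertical : ∀ d ∈ G.darts,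
    G.kind d = DartKind.vertical → G.kind (G.opp d) = DartKind.vertical
  kind_opp_outgoing : ∀ d ∈ G.darts,
    G.kind d = DartKind.outgoing → G.kind (G.opp d) = DartKind.incoming
  kind_opp_incoming : ∀ d ∈ G.darts,
    G.kind d = DartKind.incoming → G.kind (G.opp d) = DartKind.outgoing
  W_rot : ∀ d ∈ G.darts, G.W (G.rot d) = G.W d
  H_opp : ∀ d ∈ G.darts, G.kind d = DartKind.vertical → G.H (G.opp d) = G.H d

/-- The initial vertex of a dart: the set of all darts starting there. -/
def vert (G : WGraph α) (d : α) : Finset α := G.darts.filter (fun x => G.rot.SameCycle d x)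

/-- The set of vertices. -/
def verts (G : WGraph α) : Finset (Finset α) := G.darts.image G.vert

/-- The set of edges. -/
def edges (G : WGraph α) : Finset (Finset α) := G.darts.image (fun d => {d, G.opp d})

/-- `ord V = d_vertical V + 2 d_in V - 2`. -/
def ord (G : WGraph α) (V : Finset α) : ℤ :=
  ((V.filter (fun x => G.kind x = DartKind.vertical)).card : ℤ)
    + 2 * ((V.filter (fun x => G.kind x = DartKind.incoming)).card : ℤ) - 2

/-- The weight (length) of the edge of a dart: for a horizontal edge, the increment of `W`. -/
def weight (G : WGraph α) (d : α) : ℝ :=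
  if G.kind d = DartKind.vertical then G.H d else |G.W (G.opp d) - G.W d|

/-- The set of edges of zero weight. -/
def zeroEdges (G : WGraph α) : Finset (Finset α) :=
  (G.darts.filter (fun d => G.weight d = 0)).image (fun d => {d, G.opp d})

/-! ### The axioms -/

/-- The underlying graph is a tree: it is connected and has one vertex more than it has edges. -/
def IsTree (G : WGraph α) : Prop :=
  (∀ d ∈ G.darts, ∀ e ∈ G.darts,
      Relation.ReflTransGen (fun x y => y = G.rot x ∨ y = G.opp x) d e) ∧
    G.verts.card = G.edges.card + 1

/-- `τ` is a mirror symmetry: an involution of the weighted graph reversing the orientation. -/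
structure IsMirror (G : WGraph α) (τ : α → α) : Prop where
  mem : ∀ d ∈ G.darts, τ d ∈ G.darts
  invol : ∀ d ∈ G.darts, τ (τ d) = d
  opp : ∀ d ∈ G.darts, τ (G.opp d) = G.opp (τ d)
  rot : ∀ d ∈ G.darts, τ (G.rot d) = G.rot⁻¹ (τ d)
  kind : ∀ d ∈ G.darts, G.kind (τ d) = G.kind d
  W : ∀ d ∈ G.darts, G.W (τ d) = G.W d
  H : ∀ d ∈ G.darts, G.kind d = DartKind.vertical → G.H (τ d) = G.H d

/-- The weighted graph has a real symmetry axis. -/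
def MirrorSymmetric (G : WGraph α) : Prop := ∃ τ : α → α, G.IsMirror τ

/-- No outgoing dart is followed, around its vertex, by an outgoing dart (possibly itself). -/
def OutgoingSeparated (G : WGraph α) : Prop :=
  ∀ d ∈ G.darts, G.kind d = DartKind.outgoing → G.kind (G.rot d) ≠ DartKind.outgoing

/-- Each vertex of order zero is incident both to vertical and to horizontal edges. -/
def OrderZeroCondition (G : WGraph α) : Prop :=
  ∀ V ∈ G.verts, G.ord V = 0 →
    (∃ d ∈ V, G.kind d = DartKind.vertical) ∧
      (∃ d ∈ V, G.kind d = DartKind.outgoing ∨ G.kind d = DartKind.incoming)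

/-- `W` does not decrease along oriented edges and vanishes on the vertical part. -/
def WeakWidth (G : WGraph α) : Prop :=
  (∀ d ∈ G.darts, G.kind d = DartKind.outgoing → G.W d ≤ G.W (G.opp d)) ∧
    (∀ d ∈ G.darts, G.kind d = DartKind.vertical → G.W d = 0)

/-- The weights of vertical edges are nonnegative with sum `π` (each edge consists of two darts). -/
def WeakHeights (G : WGraph α) : Prop :=
  (∀ d ∈ G.darts, G.kind d = DartKind.vertical → 0 ≤ G.H d) ∧
    (∑ d ∈ G.darts.filter (fun d => G.kind d = DartKind.vertical), G.H d) / 2 = Real.pi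

/-- A weighted plane tree with all the topological and weak weight axioms except the symmetry. -/
structure WeaklyAdmissible (G : WGraph α) : Prop where
  isGraph : G.IsGraph
  isTree : G.IsTree
  outgoingSeparated : G.OutgoingSeparated
  orderZero : G.OrderZeroCondition
  weakWidth : G.WeakWidth
  weakHeights : G.WeakHeights

/-- `G.HasWalk d e l`: there is a walk of length `l` from the initial vertex of `d` to the initial
vertex of `e`. -/
inductive HasWalk (G : WGraph α) : α → α → ℝ → Prop
  | nil (d e : α) : G.rot.SameCycle d e → HasWalk G d e 0
  | cons (d c e : α) (l : ℝ) : G.rot.SameCycle d c → HasWalk G (G.opp c) e l →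
      HasWalk G d e (G.weight c + l)

/-- The graph distance between the initial vertices of two darts. -/
def dist (G : WGraph α) (d e : α) : ℝ := sInf {l | G.HasWalk d e l}

/-- Any two different branchpoints (vertices of odd order) are at positive graph distance. -/
def BranchpointsApart (G : WGraph α) : Prop :=
  ∀ d ∈ G.darts, ∀ e ∈ G.darts, Odd (G.ord (G.vert d)) → Odd (G.ord (G.vert e)) →
    G.vert d ≠ G.vert e → 0 < G.dist d e

/-! ### Elementary modifications of the rotation -/

/-- Delete the dart `d` from its cycle (it becomes a fixed point). -/
def del (d : α) (σ : Equiv.Perm α) : Equiv.Perm α := Equiv.swap d (σ d) * σ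

/-- Insert the fixed point `b` into the cycle of `a`, right after `a`. -/
def insertAfter (a b : α) (σ : Equiv.Perm α) : Equiv.Perm α := σ * Equiv.swap a b

/-! ### Contraction -/

/-- Contraction of the edge of the dart `r`: the edge disappears and its ends are merged; the darts
at the one end take the place of the edge in the cyclic order at the other end. -/
def contract (G : WGraph α) (r : α) : WGraph α :=
  { G with
    darts := (G.darts.erase r).erase (G.opp r)
    rot := del r (del (G.opp r) (G.rot * Equiv.swap r (G.opp r))) }

/-! ### The extended graph -/

/-- The darts after which a ray is drawn: both the dart and its successor are not outgoing. -/
def rayCorners (G : WGraph α) : Finset α :=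
  G.darts.filter (fun h => G.kind h ≠ DartKind.outgoing ∧ G.kind (G.rot h) ≠ DartKind.outgoing)

/-- The involution exchanging `inl h` and `inr h` for `h ∈ S`, and fixing all other elements. -/
def exchange (S : Finset α) : Equiv.Perm (α ⊕ α) :=
  Function.Involutive.toPerm
    (Sum.elim (fun h => if h ∈ S then Sum.inr h else Sum.inl h)
      (fun h => if h ∈ S then Sum.inl h else Sum.inr h))
    (by
      rintro (h | h) <;> by_cases hS : h ∈ S <;> simp [hS])

/-- The extended graph: for each `h` in `rayCorners` a ray `inr h` to infinity is drawn right
after the dart `inl h`, so that the darts leaving a vertex (the old ones and the rays) alternate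
with the vertical and incoming ones. -/
def ext (G : WGraph α) : WGraph (α ⊕ α) where
  darts := G.darts.disjSum G.rayCorners
  rot := Equiv.sumCongr G.rot 1 * exchange G.rayCorners
  opp := Sum.map G.opp id
  kind := Sum.elim G.kind (fun _ => DartKind.ray)
  W := Sum.elim G.W G.W
  H := Sum.elim G.H (fun _ => 0)

/-- The value of the width function at the far end of a leaving horizontal edge or ray. -/
def level (E : WGraph α) (o : α) : EReal :=
  if E.kind o = DartKind.ray then ⊤ else ((E.W (E.opp o) : ℝ) : EReal)

/-- In an extended graph `E`, each vertical dart `v` has a half-strip `Σ_v` on its left.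
Its first side starts at the initial vertex of `v`, goes outwards to infinity and has the strip on
its right. -/
inductive FirstSide (E : WGraph α) (v : α) : α → Prop
  | start : FirstSide E v (E.rot v)
  | next (o : α) : FirstSide E v o → E.kind o = DartKind.outgoing →
      FirstSide E v (E.rot (E.opp o))

/-- The second side of `Σ_v` starts at the terminal vertex of `v`, goes outwards to infinity and has
the strip on its left. -/
inductive SecondSide (E : WGraph α) (v : α) : α → Prop
  | start : SecondSide E v (E.rot⁻¹ (E.opp v))
  | next (o : α) : SecondSide E v o → E.kind o = DartKind.outgoing →
      SecondSide E v (E.rot⁻¹ (E.opp o))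

/-- Points of the horizontal part of an extended graph are denoted by pairs: `(x, W x)` is the
initial vertex of the dart `x`, and `(o, w)` with `W o < w < level o` is the interior point with
width `w` of the horizontal edge or ray `o`. This is the predicate that a point lies on one of the
two sides of the half-strip `Σ_v`. (The end of an edge of a side is the beginning of the next one.) -/
def OnStripSides (E : WGraph α) (v : α) (P : α × ℝ) : Prop :=
  (E.FirstSide v P.1 ∨ E.SecondSide v P.1) ∧
    (P.2 = E.W P.1 ∨ (E.W P.1 < P.2 ∧ (P.2 : EReal) < E.level P.1))

/-- Elementary identifications of points of the extended graph in the zipping of the vertical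
edge of `r`: pairs denoting the same vertex, and points with equal values of the width function on
the sides of one of the two half-strips adjacent to the edge. -/
inductive ZipGlue (G : WGraph α) (r : α) : (α ⊕ α) × ℝ → (α ⊕ α) × ℝ → Prop
  | vertex (x y : α ⊕ α) : G.ext.rot.SameCycle x y → ZipGlue G r (x, G.ext.W x) (y, G.ext.W y)
  | strip (v : α) (x y : α ⊕ α) (w : ℝ) : v = r ∨ v = G.opp r →
      G.ext.OnStripSides (Sum.inl v) (x, w) → G.ext.OnStripSides (Sum.inl v) (y, w) →
      ZipGlue G r (x, w) (y, w)

/-! ### Zipping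

A half-strip of zero height is collapsed progressively, starting from its vertical edge. Its still
unzipped part is represented by a marker dart `m`, the slider of the zipper, standing in the cyclic
order at the current vertex between the two sides `p = rot⁻¹ m` and `q = rot m` of the unzipped
part. -/

/-- One step of zipping: the slider moves up to the nearest vertex on the sides `p`, `q`.
* If both sides are rays there are no more vertices and nothing is done.
* A side edge of zero weight is contracted.
* If the end of `p` is lower than the end of `q`, then `p` is glued to the initial part of `q`: the
  remaining part of `q` now starts at the end of `p`; and similarly with `p` and `q` exchanged.
* If the ends of the edges `p` and `q` are on the same level, then `q` is glued to `p`, and the ends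
  are merged. -/
def zipStep (m : α) (G : WGraph α) : WGraph α :=
  let p := G.rot⁻¹ m
  let q := G.rot m
  let p' := G.opp p
  let q' := G.opp q
  if G.kind p = DartKind.ray ∧ G.kind q = DartKind.ray then G
  else if G.kind p = DartKind.outgoing ∧ G.W p' = G.W p then G.contract p
  else if G.kind q = DartKind.outgoing ∧ G.W q' = G.W q then G.contract q
  else if G.level p < G.level q then
    { G with
      rot := insertAfter m q (insertAfter (G.rot⁻¹ p') m (del q (del m G.rot)))
      W := Function.update (Function.update G.W q (G.W p')) m (G.W p') }
  else if G.level q < G.level p then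
    { G with
      rot := insertAfter p m (insertAfter q' p (del p (del m G.rot)))
      W := Function.update (Function.update G.W p (G.W q')) m (G.W q') }
  else
    { G with
      darts := (G.darts.erase q).erase q'
      rot := del q' (insertAfter (G.rot⁻¹ p') m (Equiv.swap p' q' * del q (del m G.rot)))
      W := Function.update G.W m (G.W p') }

/-- When both sides of the unzipped part are rays, they are glued to a single ray. -/
def zipRays (m : α) (G : WGraph α) : WGraph α :=
  { G with
    darts := (G.darts.erase (G.rot m)).erase m
    rot := del (G.rot m) (del m G.rot) }

/-- Complete zipping of the half-strip marked by the slider `m`. Each step that does something passes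
at least one edge, so the number of darts bounds the number of steps. -/
def zipStrip (m : α) (G : WGraph α) : WGraph α := zipRays m ((zipStep m)^[G.darts.card] G)

/-- Delete all rays. -/
def removeRays (G : WGraph α) : WGraph α :=
  { G with
    darts := G.darts.filter (fun d => G.kind d ≠ DartKind.ray)
    rot := (G.darts.filter (fun d => G.kind d = DartKind.ray)).toList.foldr del G.rot }

/-- The first stage of zipping of the vertical edge of `r` in an extended graph: the ends of the edge
are merged. The darts of the edge are kept and become sliders: the multiplication of the rotation by
the transposition puts `opp r` between the first edges of the sides of the half-strip `Σ_r`, and puts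
`r` between those of the half-strip `Σ_(opp r)`. -/
def openZipper (E : WGraph α) (r : α) : WGraph α :=
  { E with rot := E.rot * Equiv.swap r (E.opp r) }

/-- Zipping of the vertical edge of `r`: both adjacent half-strips of the extended graph are
collapsed to rays so that points of the sides with equal width are identified, and then
the edges leaving for infinity are removed. A dart `d` of `G` that survives becomes `inl d`. -/
def zip (G : WGraph α) (r : α) : WGraph (α ⊕ α) :=
  removeRays (zipStrip (Sum.inl r) (zipStrip (Sum.inl (G.opp r)) (openZipper G.ext (Sum.inl r))))

/-! ### Merging of vertices -/

/-- The vertices of `G'` are obtained by merging those of `G`: there is a surjection `π` of the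
vertices of `G` onto the vertices of `G'` which identifies the vertices exactly as prescribed by the
relation `same` (on initial vertices of darts), agrees with the surviving vertical and incoming
darts (where `ι` embeds the darts of `G`), and preserves the width function; and the order of a
vertex of `G'` is the sum of the orders of the vertices of `G` merged in it. -/
def MergesAddingOrders (G : WGraph α) (G' : WGraph β) (ι : α → β) (same : α → α → Prop) : Prop :=
  ∃ π : Finset α → Finset β,
    (∀ V ∈ G.verts, π V ∈ G'.verts) ∧
    (∀ V' ∈ G'.verts, ∃ V ∈ G.verts, π V = V') ∧
    (∀ d ∈ G.darts, ∀ e ∈ G.darts, π (G.vert d) = π (G.vert e) ↔ same d e) ∧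
    (∀ d ∈ G.darts, G.kind d ≠ DartKind.outgoing → ι d ∈ G'.darts →
      π (G.vert d) = G'.vert (ι d)) ∧
    (∀ d ∈ G.darts, ∀ d' ∈ G'.darts, π (G.vert d) = G'.vert d' → G'.W d' = G.W d) ∧
    (∀ V' ∈ G'.verts, G'.ord V' = ∑ V ∈ G.verts.filter (fun V => π V = V'), G.ord V)

/-- Two vertices are merged in the contraction of the edge of `r`: they coincide or both are ends of
the edge. -/
def ContractSame (G : WGraph α) (r d e : α) : Prop :=
  G.vert d = G.vert e ∨
    ((G.vert d = G.vert r ∨ G.vert d = G.vert (G.opp r)) ∧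
      (G.vert e = G.vert r ∨ G.vert e = G.vert (G.opp r)))

/-- Two vertices are merged in the zipping of the edge of `r`: they are equivalent under the
identification of points of the extended graph. -/
def ZipSame (G : WGraph α) (r d e : α) : Prop :=
  Relation.EqvGen (G.ZipGlue r) (Sum.inl d, G.W d) (Sum.inl e, G.W e)

end

end WGraph

/-!
A half-strip is not collapsed at once: the definition of zipping decomposes the collapse into
elementary moves of a slider, and so does the proof. It deals with trees which have rays and sliders
(`Frame`, `State`) and shows that each move is a *folding* (`Folding`): between the points of the
tree before the move and those of the tree after it there are maps in both directions, inverse to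
each other up to the identifications by the half-strips which remain to be collapsed, and the
induced map of vertices adds the orders. The moves are the opening of the zipper, the contraction
of an edge of zero weight, the passage of the slider along an edge, and the gluing of two rays; the
gluing of two edges with ends on the same level is a passage followed by a contraction. Foldings
can be composed, which for all moves together gives `zipStrip_spec`, `zip_spec` and finally
`zipData`: the vertices of the zipped tree are the classes of vertices under the identification of
points, and orders are added. The slider never meets an edge twice, as in a tree there are no
oriented cycles (`not_above`) and the two sides of a half-strip do not meet (`eq_of_above`); both
follow from the fact that each edge is a bridge (`bridge`). So the number of oriented edges above
the slider decreases (`zipStep_spec`). Reflection exchanges the two sides of a half-strip, hence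
only one side has to be considered in each move.

The assumption on the branchpoints is used for the vertices of order zero. All orders are at least
`-1`, and the merged vertices are connected by edges of zero weight (`zeroConn_of_ident`), so at
most one of them has odd order. If the sum of their orders is zero, then all these orders vanish
(`ord_zero_of_merge`), and the required vertical and horizontal edges are inherited. Similarly, two
leaves at the ends of the zipped edge would be branchpoints at distance zero (`openable`), hence
the opening leaves a vertical or incoming edge at the merged vertex. After the operation two
branchpoints connected by edges of zero weight still coincide, at least on the level where the
second operation needs it (`apart_zip`).

A mirror symmetry permutes the half-strips collapsed by the zipping of an edge, or of two symmetric
edges, so it acts on the points of the zipped tree as an involution reversing the orientation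
(`MirrorHom`). A tree is determined by its points: the sides of the half-strips, described by
the chains of edges that start at the vertical darts, reach every horizontal edge, and the
involution respects them. It therefore comes from a map of darts (`MirrorHom.mirrorSymmetric`). In
particular it does not matter in which order the two symmetric edges are zipped. For contractions
the symmetry is kept by the darts themselves, since the rotation of the contracted tree goes around
the contracted part of the original one (`Next`, `IsMirror.of_next`).
-/

namespace WGraph

noncomputable section

open scoped Classical

open Relation
open Finset (mem_filter mem_singleton mem_image mem_erase mem_insert mem_union mem_coe
  mem_image_of_mem card_erase_add_one)
open Equiv.Perm (inv_eq_iff_eq)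
open Sum (inl inr inl_injective)

variable {α β γ δ : Type*} {G : WGraph α} {E : WGraph β} {M : Set β}
  {a d e o x y : β} {w : ℝ} {P Q : β × ℝ} {S : Set (β × β)}
  {E' : WGraph γ} {M' : Set γ} {S' : Set (γ × γ)}

/-! ### Permutations and cycles -/

theorem apply_inv (σ : Equiv.Perm β) (x : β) : σ (σ⁻¹ x) = x := by simp

theorem inv_apply (σ : Equiv.Perm β) (x : β) : σ⁻¹ (σ x) = x := by simp

theorem perm_mem_iff {σ : Equiv.Perm β} {D : Finset β} (h : ∀ d ∈ D, σ d ∈ D) (d : β) :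
    σ d ∈ D ↔ d ∈ D := by
  refine ⟨fun hd => ?_, h d⟩
  have hsurj : Set.SurjOn σ D D :=
    Finset.surjOn_of_injOn_of_card_le σ (fun x hx => h x hx) σ.injective.injOn le_rfl
  obtain ⟨x, hx, hxd⟩ := hsurj hd
  rwa [← σ.injective hxd]

theorem perm_inv_mem {σ : Equiv.Perm β} {D : Finset β} (h : ∀ d ∈ D, σ d ∈ D)
    (hd : d ∈ D) : σ⁻¹ d ∈ D := by
  rw [← perm_mem_iff h]; simpa using hd

/-- A relation that holds between each dart and its successor holds along a cycle. -/
theorem sameCycle_induct {σ : Equiv.Perm β} {D : Finset β} (hD : ∀ d ∈ D, σ d ∈ D)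
    {R : β → β → Prop} (hR : Equivalence R) (h : ∀ x ∈ D, R x (σ x)) (hx : x ∈ D)
    (hxy : σ.SameCycle x y) : y ∈ D ∧ R x y := by
  obtain ⟨i, rfl⟩ := hxy
  induction i using Int.induction_on with
  | zero => simpa using ⟨hx, hR.refl x⟩
  | succ n ih =>
    rw [add_comm, zpow_add, zpow_one, Equiv.Perm.mul_apply]
    exact ⟨hD _ ih.1, hR.trans ih.2 (h _ ih.1)⟩
  | pred n ih =>
    have hm := perm_inv_mem hD ih.1
    have h2 := h _ hm
    rw [apply_inv] at h2
    rw [sub_eq_add_neg, add_comm, zpow_add, zpow_neg, zpow_one, Equiv.Perm.mul_apply]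
    exact ⟨hm, hR.trans ih.2 (hR.symm h2)⟩

theorem sameCycle_equivalence (σ : Equiv.Perm β) : Equivalence σ.SameCycle :=
  ⟨Equiv.Perm.SameCycle.refl σ, Equiv.Perm.SameCycle.symm, Equiv.Perm.SameCycle.trans⟩

theorem equivalence_comap {R : γ → γ → Prop} (hR : Equivalence R) (g : β → γ) :
    Equivalence (fun x y => R (g x) (g y)) :=
  ⟨fun _ => hR.refl _, fun h => hR.symm h, fun h k => hR.trans h k⟩

theorem sameCycle_map {σ : Equiv.Perm β} {ρ : Equiv.Perm γ} {D : Finset β}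
    (hD : ∀ d ∈ D, σ d ∈ D) (g : β → γ) (h : ∀ x ∈ D, ρ.SameCycle (g x) (g (σ x)))
    (hx : x ∈ D) (hxy : σ.SameCycle x y) : ρ.SameCycle (g x) (g y) :=
  (sameCycle_induct hD (equivalence_comap (sameCycle_equivalence ρ) g) h hx hxy).2

theorem sameCycle_mem {σ : Equiv.Perm β} {D : Finset β} (hD : ∀ d ∈ D, σ d ∈ D)
    (hx : x ∈ D) (hxy : σ.SameCycle x y) : y ∈ D :=
  (sameCycle_induct hD (R := fun _ _ => True) ⟨fun _ => trivial, fun _ => trivial,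
    fun _ _ => trivial⟩ (fun _ _ => trivial) hx hxy).1

theorem same_rot (σ : Equiv.Perm β) (x : β) : σ.SameCycle x (σ x) :=
  Equiv.Perm.sameCycle_apply_right.2 (Equiv.Perm.SameCycle.refl _ _)

theorem same_rot_inv (σ : Equiv.Perm β) (x : β) : σ.SameCycle x (σ⁻¹ x) :=
  ⟨-1, by simp⟩

/-! ### Vertices and maps of vertices -/

/-- The darts `x` and `y` start at the same vertex. -/
abbrev Same (E : WGraph β) (x y : β) : Prop := E.rot.SameCycle x y

theorem mem_vert : x ∈ E.vert d ↔ x ∈ E.darts ∧ E.Same d x := by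
  simp [vert]

theorem self_mem_vert (hd : d ∈ E.darts) : d ∈ E.vert d :=
  mem_vert.2 ⟨hd, .refl _ _⟩

theorem vert_eq_of_same (h : E.Same d e) :
    E.vert d = E.vert e := by
  ext x
  simp only [mem_vert]
  exact and_congr_right fun _ => ⟨fun k => h.symm.trans k, fun k => h.trans k⟩

theorem vert_eq_iff (hd : d ∈ E.darts) :
    E.vert d = E.vert e ↔ E.Same d e := by
  refine ⟨fun h => ?_, vert_eq_of_same⟩
  have := self_mem_vert hd
  rw [h, mem_vert] at this
  exact this.2.symm

theorem vert_mem_verts (hd : d ∈ E.darts) : E.vert d ∈ E.verts :=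
  mem_image_of_mem _ hd

theorem mem_verts {V : Finset β} :
    V ∈ E.verts ↔ ∃ d ∈ E.darts, E.vert d = V := by
  simp [verts]

/-- The map of vertices induced by a map of darts: the vertex of `x` is sent to that of `g x`, for
an arbitrary representative `x`. -/
def vmap (E' : WGraph γ) (g : β → γ) (V : Finset β) : Finset γ :=
  if h : V.Nonempty then E'.vert (g h.choose) else ∅

theorem vmap_vert {g : β → γ}
    (hg : ∀ d ∈ E.darts, ∀ e ∈ E.darts, E.Same d e → E'.Same (g d) (g e))
    (hd : d ∈ E.darts) : vmap E' g (E.vert d) = E'.vert (g d) := by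
  have h : (E.vert d).Nonempty := ⟨d, self_mem_vert hd⟩
  rw [vmap, dif_pos h]
  have hc := mem_vert.1 h.choose_spec
  exact (vert_eq_of_same (hg _ hd _ hc.1 hc.2)).symm

/-- The order of a vertex of a graph in which the darts of `M` are sliders: these darts are not
counted. -/
def ordM (E : WGraph β) (M : Set β) (V : Finset β) : ℤ :=
  ((V.filter (fun x => E.kind x = .vertical ∧ x ∉ M)).card : ℤ)
    + 2 * ((V.filter (fun x => E.kind x = .incoming)).card : ℤ) - 2

theorem ordM_empty (E : WGraph β) (V : Finset β) : E.ordM ∅ V = E.ord V := by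
  simp [ordM, ord]

/-- The order is determined by the vertical darts other than sliders and the incoming darts. -/
theorem ordM_congr {E' : WGraph β} {M' : Set β} {V V' : Finset β}
    (hv : ∀ x, x ∈ V' ∧ E'.kind x = .vertical ∧ x ∉ M' ↔ x ∈ V ∧ E.kind x = .vertical ∧ x ∉ M)
    (hi : ∀ x, x ∈ V' ∧ E'.kind x = .incoming ↔ x ∈ V ∧ E.kind x = .incoming) :
    E'.ordM M' V' = E.ordM M V := by
  have h1 : V'.filter (fun x => E'.kind x = .vertical ∧ x ∉ M') =
      V.filter (fun x => E.kind x = .vertical ∧ x ∉ M) := by ext x; simpa using hv x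
  have h2 : V'.filter (fun x => E'.kind x = .incoming) =
      V.filter (fun x => E.kind x = .incoming) := by ext x; simpa using hi x
  rw [ordM, ordM, h1, h2]

/-- The map `g` of darts induces a surjective map of vertices which preserves the width and adds the
orders of the merged vertices. -/
structure VertexMap (E : WGraph β) (M : Set β) (E' : WGraph γ) (M' : Set γ) (g : β → γ) :
    Prop where
  mem : ∀ d ∈ E.darts, g d ∈ E'.darts
  same : ∀ d ∈ E.darts, ∀ e ∈ E.darts, E.Same d e → E'.Same (g d) (g e)
  surj : ∀ d' ∈ E'.darts, ∃ d ∈ E.darts, E'.Same (g d) d'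
  W : ∀ d ∈ E.darts, E'.W (g d) = E.W d
  ord : ∀ V' ∈ E'.verts,
    E'.ordM M' V' = ∑ V ∈ E.verts.filter (fun V => vmap E' g V = V'), E.ordM M V

namespace VertexMap

theorem vmap_mem {g : β → γ}
    (h : VertexMap E M E' M' g) {V : Finset β} (hV : V ∈ E.verts) : vmap E' g V ∈ E'.verts := by
  obtain ⟨d, hd, rfl⟩ := mem_verts.1 hV
  rw [vmap_vert h.same hd]
  exact vert_mem_verts (h.mem d hd)

theorem trans {g : β → γ}
    {E'' : WGraph δ} {M'' : Set δ} {g' : γ → δ}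
    (h : VertexMap E M E' M' g) (h' : VertexMap E' M' E'' M'' g') :
    VertexMap E M E'' M'' (fun d => g' (g d)) := by
  have hsame : ∀ d ∈ E.darts, ∀ e ∈ E.darts, E.Same d e →
      E''.Same (g' (g d)) (g' (g e)) := fun d hd e he hde =>
    h'.same _ (h.mem d hd) _ (h.mem e he) (h.same d hd e he hde)
  refine ⟨fun d hd => h'.mem _ (h.mem d hd), hsame, fun d'' hd'' => ?_, fun d hd => ?_,
    fun V'' hV'' => ?_⟩
  · obtain ⟨d', hd', hd2⟩ := h'.surj d'' hd''
    obtain ⟨d, hd, hd3⟩ := h.surj d' hd'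
    exact ⟨d, hd, (h'.same _ (h.mem d hd) _ hd' hd3).trans hd2⟩
  · rw [h'.W _ (h.mem d hd), h.W d hd]
  · rw [h'.ord V'' hV'']
    have hcomp : ∀ V ∈ E.verts, vmap E'' (fun d => g' (g d)) V = vmap E'' g' (vmap E' g V) := by
      intro V hV
      obtain ⟨d, hd, rfl⟩ := mem_verts.1 hV
      rw [vmap_vert hsame hd, vmap_vert h.same hd, vmap_vert h'.same (h.mem d hd)]
    have h1 : ∀ V' ∈ E'.verts.filter (fun V' => vmap E'' g' V' = V''), E'.ordM M' V' =
        ∑ V ∈ (E.verts.filter (fun V => vmap E'' (fun d => g' (g d)) V = V'')).filter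
          (fun V => vmap E' g V = V'), E.ordM M V := by
      intro V' hV'
      rw [mem_filter] at hV'
      rw [h.ord V' hV'.1, Finset.filter_filter]
      refine Finset.sum_congr (Finset.filter_congr fun V hV => ?_) fun _ _ => rfl
      rw [hcomp V hV]
      constructor
      · intro h3; exact ⟨by rw [h3]; exact hV'.2, h3⟩
      · exact fun h3 => h3.2
    rw [Finset.sum_congr rfl h1]
    refine Finset.sum_fiberwise_of_maps_to (fun V hV => ?_) _
    rw [mem_filter] at hV ⊢
    exact ⟨h.vmap_mem hV.1, by rw [← hcomp V hV.1]; exact hV.2⟩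

end VertexMap

section Fibers

variable {g : β → γ}

theorem mem_fiber (mem : ∀ d ∈ E.darts, g d ∈ E'.darts)
    (hs : ∀ d ∈ E.darts, ∀ e ∈ E.darts, E.Same d e → E'.Same (g d) (g e))
    {V : Finset β} {d' : γ} : V ∈ E.verts.filter (fun V => vmap E' g V = E'.vert d') ↔
      ∃ e ∈ E.darts, E.vert e = V ∧ E'.Same (g e) d' := by
  rw [mem_filter, mem_verts]
  constructor
  · rintro ⟨⟨e, he, rfl⟩, h⟩
    exact ⟨e, he, rfl, by rwa [vmap_vert hs he, vert_eq_iff (mem e he)] at h⟩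
  · rintro ⟨e, he, rfl, h⟩
    exact ⟨⟨e, he, rfl⟩, by rwa [vmap_vert hs he, vert_eq_iff (mem e he)]⟩

theorem exists_vert_eq (surj : ∀ d' ∈ E'.darts, ∃ d ∈ E.darts, E'.Same (g d) d')
    {V' : Finset γ} (hV' : V' ∈ E'.verts) : ∃ d ∈ E.darts, E'.vert (g d) = V' := by
  obtain ⟨d', hd', rfl⟩ := mem_verts.1 hV'
  obtain ⟨d, hd, h⟩ := surj d' hd'
  exact ⟨d, hd, vert_eq_of_same h⟩

theorem verts_eq_image (mem : ∀ d ∈ E.darts, g d ∈ E'.darts)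
    (hs : ∀ d ∈ E.darts, ∀ e ∈ E.darts, E.Same d e → E'.Same (g d) (g e))
    (surj : ∀ d' ∈ E'.darts, ∃ d ∈ E.darts, E'.Same (g d) d') :
    E'.verts = E.verts.image (vmap E' g) := by
  ext V'
  rw [mem_image]
  constructor
  · intro hV'
    obtain ⟨d, hd, rfl⟩ := exists_vert_eq surj hV'
    exact ⟨_, vert_mem_verts hd, vmap_vert hs hd⟩
  · rintro ⟨V, hV, rfl⟩
    obtain ⟨d, hd, rfl⟩ := mem_verts.1 hV
    rw [vmap_vert hs hd]; exact vert_mem_verts (mem d hd)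

/-- A bijection of vertices preserving the orders. -/
theorem vertexMap_of_bijective (mem : ∀ d ∈ E.darts, g d ∈ E'.darts)
    (same : ∀ d ∈ E.darts, ∀ e ∈ E.darts, E.Same d e ↔ E'.Same (g d) (g e))
    (surj : ∀ d' ∈ E'.darts, ∃ d ∈ E.darts, E'.Same (g d) d')
    (hW : ∀ d ∈ E.darts, E'.W (g d) = E.W d)
    (ord : ∀ d ∈ E.darts, E'.ordM M' (E'.vert (g d)) = E.ordM M (E.vert d)) :
    VertexMap E M E' M' g ∧ E'.verts.card = E.verts.card := by
  have hs : ∀ d ∈ E.darts, ∀ e ∈ E.darts, E.Same d e → E'.Same (g d) (g e) :=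
    fun d hd e he => (same d hd e he).1
  refine ⟨⟨mem, hs, surj, hW, fun V' hV' => ?_⟩, ?_⟩
  · obtain ⟨d, hd, rfl⟩ := exists_vert_eq surj hV'
    have : E.verts.filter (fun V => vmap E' g V = E'.vert (g d)) = {E.vert d} := by
      ext V
      rw [mem_fiber mem hs, mem_singleton]
      exact ⟨fun ⟨e, he, h1, h2⟩ => h1 ▸ vert_eq_of_same ((same e he d hd).2 h2),
        fun h => ⟨d, hd, h.symm, .refl _ _⟩⟩
    rw [this, Finset.sum_singleton, ← ord d hd]
  · rw [verts_eq_image mem hs surj, Finset.card_image_of_injOn]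
    intro V hV U hU h
    obtain ⟨d, hd, rfl⟩ := mem_verts.1 hV
    obtain ⟨e, he, rfl⟩ := mem_verts.1 hU
    simp only [vmap_vert hs hd, vmap_vert hs he, vert_eq_iff (mem d hd)] at h
    exact vert_eq_of_same ((same d hd e he).2 h)

/-- A map of vertices merging exactly the vertices of `a` and `b`, with addition of the orders. -/
theorem vertexMap_of_merge {a b : β} (ha : a ∈ E.darts) (hb : b ∈ E.darts) (hab : ¬ E.Same a b)
    (mem : ∀ d ∈ E.darts, g d ∈ E'.darts)
    (same : ∀ d ∈ E.darts, ∀ e ∈ E.darts, E'.Same (g d) (g e) ↔ E.Same d e ∨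
      ((E.Same d a ∨ E.Same d b) ∧ (E.Same e a ∨ E.Same e b)))
    (surj : ∀ d' ∈ E'.darts, ∃ d ∈ E.darts, E'.Same (g d) d')
    (hW : ∀ d ∈ E.darts, E'.W (g d) = E.W d)
    (ord : ∀ d ∈ E.darts, ¬ E.Same d a → ¬ E.Same d b →
      E'.ordM M' (E'.vert (g d)) = E.ordM M (E.vert d))
    (ord' : E'.ordM M' (E'.vert (g a)) = E.ordM M (E.vert a) + E.ordM M (E.vert b)) :
    VertexMap E M E' M' g ∧ E'.verts.card + 1 = E.verts.card := by
  have hs : ∀ d ∈ E.darts, ∀ e ∈ E.darts, E.Same d e → E'.Same (g d) (g e) :=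
    fun d hd e he h => (same d hd e he).2 (Or.inl h)
  have hne : E.vert a ≠ E.vert b := fun h => hab ((vert_eq_iff ha).1 h)
  have hga : ∀ d ∈ E.darts, E.Same d a ∨ E.Same d b → E'.Same (g d) (g a) := fun d hd h =>
    (same d hd a ha).2 (Or.inr ⟨h, Or.inl (.refl _ _)⟩)
  refine ⟨⟨mem, hs, surj, hW, fun V' hV' => ?_⟩, ?_⟩
  · obtain ⟨d, hd, rfl⟩ := exists_vert_eq surj hV'
    by_cases hda : E.Same d a ∨ E.Same d b
    · have : E.verts.filter (fun V => vmap E' g V = E'.vert (g a)) = {E.vert a, E.vert b} := by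
        ext V
        rw [mem_fiber mem hs, mem_insert, mem_singleton]
        constructor
        · rintro ⟨e, he, rfl, h2⟩
          rcases (same e he a ha).1 h2 with h3 | ⟨h3 | h3, -⟩
          · exact Or.inl (vert_eq_of_same h3)
          · exact Or.inl (vert_eq_of_same h3)
          · exact Or.inr (vert_eq_of_same h3)
        · rintro (rfl | rfl)
          · exact ⟨a, ha, rfl, .refl _ _⟩
          · exact ⟨b, hb, rfl, hga b hb (Or.inr (.refl _ _))⟩
      rw [vert_eq_of_same (hga d hd hda), this, Finset.sum_pair hne, ord']
    · have : E.verts.filter (fun V => vmap E' g V = E'.vert (g d)) = {E.vert d} := by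
        ext V
        rw [mem_fiber mem hs, mem_singleton]
        refine ⟨fun ⟨e, he, h1, h2⟩ => h1 ▸ vert_eq_of_same ?_,
          fun h => ⟨d, hd, h.symm, .refl _ _⟩⟩
        exact ((same e he d hd).1 h2).resolve_right fun h3 => hda h3.2
      push Not at hda
      rw [this, Finset.sum_singleton, ← ord d hd hda.1 hda.2]
  · have hcard : E'.verts = (E.verts.erase (E.vert b)).image (vmap E' g) := by
      rw [verts_eq_image mem hs surj]
      refine le_antisymm (fun V' h => ?_) (Finset.image_subset_image (Finset.erase_subset _ _))
      obtain ⟨V, hV, rfl⟩ := mem_image.1 h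
      by_cases hVb : V = E.vert b
      · exact mem_image.2 ⟨_, mem_erase.2 ⟨hne, vert_mem_verts ha⟩, by
          rw [hVb, vmap_vert hs ha, vmap_vert hs hb]
          exact (vert_eq_of_same (hga b hb (Or.inr (.refl _ _)))).symm⟩
      · exact mem_image_of_mem _ (mem_erase.2 ⟨hVb, hV⟩)
    rw [hcard, Finset.card_image_of_injOn, card_erase_add_one (vert_mem_verts hb)]
    intro V hV U hU h
    simp only [Finset.coe_erase, Set.mem_sdiff, mem_coe, Set.mem_singleton_iff] at hV hU
    obtain ⟨d, hd, rfl⟩ := mem_verts.1 hV.1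
    obtain ⟨e, he, rfl⟩ := mem_verts.1 hU.1
    simp only [vmap_vert hs hd, vmap_vert hs he, vert_eq_iff (mem d hd)] at h
    have hdb : ¬ E.Same d b := fun h => hV.2 (vert_eq_of_same h)
    have heb : ¬ E.Same e b := fun h => hU.2 (vert_eq_of_same h)
    rcases (same d hd e he).1 h with h3 | ⟨h3, h4⟩
    · exact vert_eq_of_same h3
    · exact vert_eq_of_same ((h3.resolve_right hdb).trans (h4.resolve_right heb).symm)

end Fibers

/-! ### Frames: the structural laws of a graph with rays and sliders -/

/-- `d` is a half of an edge: neither a ray nor a slider. -/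
def IsEdge (E : WGraph β) (M : Set β) (d : β) : Prop :=
  d ∈ E.darts ∧ E.kind d ≠ .ray ∧ d ∉ M

/-- A dart on which the width grows away from the vertex. In names of lemmas `nl` stands for
not leaving. -/
def Leaving (E : WGraph β) (d : β) : Prop :=
  E.kind d = .outgoing ∨ E.kind d = .ray

/-- Adjacency of darts at a vertex or along an edge. -/
def Link (E : WGraph β) (M : Set β) (x y : β) : Prop :=
  y = E.rot x ∨ (E.IsEdge M x ∧ y = E.opp x)

/-- The edges of a graph with sliders. -/
def edgesM (E : WGraph β) (M : Set β) : Finset (Finset β) :=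
  (E.darts.filter (fun d => E.IsEdge M d)).image (fun d => {d, E.opp d})

/-- The laws of a weighted tree which may have rays and in which the darts of `M` are sliders. The
sliders are vertical darts which belong to no edge; nothing is required of `opp` on them. -/
structure Frame (E : WGraph β) (M : Set β) : Prop where
  rot_mem : ∀ d ∈ E.darts, E.rot d ∈ E.darts
  slider_mem : ∀ m ∈ M, m ∈ E.darts
  slider_kind : ∀ m ∈ M, E.kind m = .vertical
  opp_edge : ∀ d, E.IsEdge M d → E.IsEdge M (E.opp d)
  opp_opp : ∀ d, E.IsEdge M d → E.opp (E.opp d) = d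
  opp_ne : ∀ d, E.IsEdge M d → E.opp d ≠ d
  kind_vertical : ∀ d, E.IsEdge M d → E.kind d = .vertical →
    E.kind (E.opp d) = .vertical
  kind_outgoing : ∀ d, E.IsEdge M d → E.kind d = .outgoing →
    E.kind (E.opp d) = .incoming
  kind_incoming : ∀ d, E.IsEdge M d → E.kind d = .incoming →
    E.kind (E.opp d) = .outgoing
  W_rot : ∀ d ∈ E.darts, E.W (E.rot d) = E.W d
  W_le : ∀ d ∈ E.darts, E.kind d = .outgoing → E.W d ≤ E.W (E.opp d)
  W_vertical : ∀ d, E.IsEdge M d → E.kind d = .vertical → E.W d = 0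
  H_opp : ∀ d, E.IsEdge M d → E.kind d = .vertical → E.H (E.opp d) = E.H d
  H_nonneg : ∀ d, E.IsEdge M d → E.kind d = .vertical → 0 ≤ E.H d
  conn : ∀ d ∈ E.darts, ∀ e ∈ E.darts, EqvGen (E.Link M) d e
  count : E.verts.card = (E.edgesM M).card + 1

theorem equivalence_eqvGen (R : β → β → Prop) : Equivalence (EqvGen R) :=
  EqvGen.is_equivalence R

/-- Induction principle for `EqvGen`: it is contained in each equivalence containing `R`. -/
theorem eqvGen_le {R S : β → β → Prop} (hS : Equivalence S) (h : ∀ x y, R x y → S x y)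
    (hxy : EqvGen R x y) : S x y := by
  induction hxy with
  | rel x y h' => exact h x y h'
  | refl x => exact hS.refl x
  | symm x y _ ih => exact hS.symm ih
  | trans x y z _ _ ih1 ih2 => exact hS.trans ih1 ih2

/-- The same with a hypothesis `D` on the elements, invariant under `R`. -/
theorem eqvGen_le_of {D : β → Prop} {R T : β → β → Prop} (hT : Equivalence T)
    (h : ∀ x y, R x y → (D x ↔ D y) ∧ (D x → T x y)) (hx : D x) (hxy : EqvGen R x y) : T x y :=
  (eqvGen_le (S := fun x y => (D x ↔ D y) ∧ (D x → T x y)) ⟨fun _ => ⟨Iff.rfl, fun _ => hT.refl _⟩,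
    fun h => ⟨h.1.symm, fun k => hT.symm (h.2 (h.1.2 k))⟩,
    fun h h' => ⟨h.1.trans h'.1, fun k => hT.trans (h.2 k) (h'.2 (h.1.1 k))⟩⟩ h hxy).2 hx

theorem equivalence_reach (R : β → β → Prop) :
    Equivalence (fun x y => ReflTransGen R x y ∧ ReflTransGen R y x) :=
  ⟨fun _ => ⟨.refl, .refl⟩, fun h => h.symm, fun h k => ⟨h.1.trans k.1, k.2.trans h.2⟩⟩

/-- The passage to the next dart around the vertex or to the opposite dart. -/
abbrev Step (E : WGraph β) (x y : β) : Prop := y = E.rot x ∨ y = E.opp x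

theorem sameCycle_eqvGen {σ : Equiv.Perm β} {R : β → β → Prop} (h : ∀ x, R x (σ x))
    (hxy : σ.SameCycle x y) : EqvGen R x y := by
  obtain ⟨i, rfl⟩ := hxy
  induction i using Int.induction_on with
  | zero => exact EqvGen.refl _
  | succ n ih =>
    rw [add_comm, zpow_add, zpow_one, Equiv.Perm.mul_apply]
    exact ih.trans _ _ _ (EqvGen.rel _ _ (h _))
  | pred n ih =>
    rw [sub_eq_add_neg, add_comm, zpow_add, zpow_neg, zpow_one, Equiv.Perm.mul_apply]
    refine ih.trans _ _ _ (EqvGen.symm _ _ (EqvGen.rel _ _ ?_))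
    simpa using h (σ⁻¹ ((σ ^ (-(n : ℤ))) x))

/-! ### Trees -/

theorem pair_eq_pair_iff {opp : β → β} {p x : β} :
    (({x, opp x} : Finset β) = {p, opp p}) ↔ x = p ∨ x = opp p ∧ opp x = p := by
  constructor
  · intro h
    have hxm : x ∈ ({p, opp p} : Finset β) := by rw [← h]; simp
    have hpm : p ∈ ({x, opp x} : Finset β) := by rw [h]; simp
    simp only [mem_insert, mem_singleton] at hxm hpm
    rcases hxm with hxm | hxm
    · exact Or.inl hxm
    · rcases hpm with hpm | hpm
      · exact Or.inl hpm.symm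
      · exact Or.inr ⟨hxm, hpm.symm⟩
  · rintro (rfl | ⟨h2, h3⟩)
    · rfl
    · rw [h3, ← h2, Finset.pair_comm]

/-- A connected graph has at most one vertex more than it has edges. -/
theorem card_verts_le (E : WGraph β) (D : Finset β) (hrot : ∀ d ∈ E.darts, E.rot d ∈ E.darts)
    (hD : D ⊆ E.darts) (hopp : ∀ d ∈ D, E.opp d ∈ D) (hoo : ∀ d ∈ D, E.opp (E.opp d) = d)
    (hconn : ∀ d ∈ E.darts, ∀ e ∈ E.darts,
      EqvGen (fun x y => y = E.rot x ∨ (x ∈ D ∧ y = E.opp x)) d e) :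
    E.verts.card ≤ (D.image (fun d => ({d, E.opp d} : Finset β))).card + 1 := by
  let Γ : SimpleGraph E.verts :=
    { Adj := fun A B => A ≠ B ∧ ∃ x ∈ D, E.vert x = A ∧ E.vert (E.opp x) = B
      symm := ⟨by
        rintro A B ⟨h1, x, hx, h2, h3⟩
        exact ⟨h1.symm, E.opp x, hopp x hx, h3, by rw [hoo x hx]; exact h2⟩⟩
      loopless := ⟨fun A h => h.1 rfl⟩ }
  by_cases hne : Nonempty E.verts
  swap
  · rw [not_nonempty_iff, ← Fintype.card_eq_zero_iff, Fintype.card_coe] at hne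
    omega
  have hreach : ∀ d e, EqvGen (fun x y => y = E.rot x ∨ (x ∈ D ∧ y = E.opp x)) d e →
      (d ∈ E.darts ↔ e ∈ E.darts) ∧ ∀ (hd : d ∈ E.darts) (he : e ∈ E.darts),
        Γ.Reachable ⟨E.vert d, vert_mem_verts hd⟩ ⟨E.vert e, vert_mem_verts he⟩ := by
    intro d e h
    induction h with
    | rel x y h =>
      rcases h with rfl | ⟨hx, rfl⟩
      · refine ⟨(perm_mem_iff hrot x).symm, fun hd he => ?_⟩
        have : E.vert (E.rot x) = E.vert x := (vert_eq_of_same (same_rot _ x)).symm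
        simp only [this]
        exact SimpleGraph.Reachable.refl _
      · refine ⟨⟨fun _ => hD (hopp x hx), fun _ => hD hx⟩, fun hd he => ?_⟩
        by_cases hv : E.vert x = E.vert (E.opp x)
        · simp only [← hv]
          exact SimpleGraph.Reachable.refl _
        · refine SimpleGraph.Adj.reachable ⟨?_, x, hx, rfl, rfl⟩
          intro h
          exact hv (congrArg Subtype.val h)
    | refl x => exact ⟨Iff.rfl, fun _ _ => SimpleGraph.Reachable.refl _⟩
    | symm x y _ ih => exact ⟨ih.1.symm, fun hd he => (ih.2 he hd).symm⟩
    | trans x y z _ _ ih1 ih2 =>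
      exact ⟨ih1.1.trans ih2.1, fun hd he => (ih1.2 hd (ih1.1.1 hd)).trans (ih2.2 (ih1.1.1 hd) he)⟩
  have hΓ : Γ.Connected := by
    rw [SimpleGraph.connected_iff]
    refine ⟨?_, hne⟩
    rintro ⟨A, hA⟩ ⟨B, hB⟩
    obtain ⟨d, hd, rfl⟩ := mem_verts.1 hA
    obtain ⟨e, he, rfl⟩ := mem_verts.1 hB
    exact (hreach d e (hconn d hd e he)).2 hd he
  have h1 := hΓ.card_vert_le_card_edgeSet_add_one
  rw [Nat.card_eq_fintype_card, Fintype.card_coe] at h1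
  refine h1.trans (Nat.add_le_add_right ?_ 1)
  rw [Nat.card_eq_card_toFinset]
  -- each edge of the simple graph comes from an edge of the graph
  refine Finset.card_le_card_of_forall_subsingleton
    (fun s e => ∃ x, e = {x, E.opp x} ∧ ∃ hx : x ∈ D,
      s = s(⟨E.vert x, vert_mem_verts (hD hx)⟩,
        ⟨E.vert (E.opp x), vert_mem_verts (hD (hopp x hx))⟩)) ?_ ?_
  · intro s
    induction s using Sym2.ind with
    | _ A B =>
      intro hs
      rw [Set.mem_toFinset, SimpleGraph.mem_edgeSet] at hs
      obtain ⟨-, x, hx, hA, hB⟩ := hs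
      exact ⟨_, mem_image_of_mem _ hx, x, rfl, hx,
        by rw [Sym2.eq_iff]; exact Or.inl ⟨Subtype.ext hA.symm, Subtype.ext hB.symm⟩⟩
  · intro e _ s hs t ht
    obtain ⟨-, x, rfl, hx, rfl⟩ := hs
    obtain ⟨-, y, hxy, hy, rfl⟩ := ht
    rcases pair_eq_pair_iff.1 hxy with rfl | ⟨h1, h2⟩
    · rfl
    · rw [Sym2.eq_iff]
      exact Or.inr ⟨Subtype.ext (congrArg E.vert h1), Subtype.ext (congrArg E.vert h2)⟩

namespace Frame

theorem rot_inv_mem (h : Frame E M) (hd : d ∈ E.darts) : E.rot⁻¹ d ∈ E.darts :=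
  perm_inv_mem h.rot_mem hd

theorem mem_of_same (h : Frame E M) (hd : d ∈ E.darts) (hde : E.Same d e) :
    e ∈ E.darts :=
  sameCycle_mem h.rot_mem hd hde

theorem W_same (h : Frame E M) (hd : d ∈ E.darts) (hde : E.Same d e) :
    E.W e = E.W d :=
  (sameCycle_induct h.rot_mem (R := fun x y => E.W y = E.W x)
    ⟨fun _ => rfl, fun h => h.symm, fun h k => k.trans h⟩ h.W_rot hd hde).2

theorem isEdge_out (h : Frame E M) (hd : d ∈ E.darts)
    (hk : E.kind d = .outgoing) : E.IsEdge M d :=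
  ⟨hd, by simp [hk], fun hm => by have := h.slider_kind d hm; simp [hk] at this⟩

theorem isEdge_in (h : Frame E M) (hd : d ∈ E.darts)
    (hk : E.kind d = .incoming) : E.IsEdge M d :=
  ⟨hd, by simp [hk], fun hm => by have := h.slider_kind d hm; simp [hk] at this⟩

theorem opp_mem (h : Frame E M) (hd : d ∈ E.darts)
    (hk : E.kind d = .outgoing) : E.opp d ∈ E.darts :=
  (h.opp_edge d (h.isEdge_out hd hk)).1

theorem kind_opp (h : Frame E M) (hd : d ∈ E.darts)
    (hk : E.kind d = .outgoing) : E.kind (E.opp d) = .incoming :=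
  h.kind_outgoing d (h.isEdge_out hd hk) hk

/-- Adjacency of darts avoiding the edge of `p`. -/
def _root_.WGraph.LinkOff (E : WGraph β) (M : Set β) (p x y : β) : Prop :=
  y = E.rot x ∨ (E.IsEdge M x ∧ x ≠ p ∧ x ≠ E.opp p ∧ y = E.opp x)

theorem _root_.WGraph.linkOff_of_same {p x y : β} (hxy : E.Same x y) :
    EqvGen (E.LinkOff M p) x y :=
  sameCycle_eqvGen (R := E.LinkOff M p) (fun _ => Or.inl rfl) hxy

theorem card_edges_erase (h : Frame E M) {p : β} (hp : E.IsEdge M p) :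
    (((E.darts.filter (fun d => E.IsEdge M d)).filter (fun d => d ≠ p ∧ d ≠ E.opp p)).image
      (fun d => ({d, E.opp d} : Finset β))).card + 1 = (E.edgesM M).card := by
  have key : ((E.darts.filter (fun d => E.IsEdge M d)).filter
      (fun d => d ≠ p ∧ d ≠ E.opp p)).image (fun d => ({d, E.opp d} : Finset β))
      = (E.edgesM M).erase {p, E.opp p} := by
    ext e
    simp only [edgesM, mem_image, mem_erase, mem_filter]
    constructor
    · rintro ⟨d, ⟨⟨hd, hd'⟩, h1, h2⟩, rfl⟩
      refine ⟨fun he => ?_, d, ⟨hd, hd'⟩, rfl⟩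
      rcases pair_eq_pair_iff.1 he with h3 | h3
      · exact h1 h3
      · exact h2 h3.1
    · rintro ⟨he, d, ⟨hd, hd'⟩, rfl⟩
      refine ⟨d, ⟨⟨hd, hd'⟩, fun h1 => he (by rw [h1]), fun h1 => he ?_⟩, rfl⟩
      rw [h1, h.opp_opp p hp, Finset.pair_comm]
  rw [key, card_erase_add_one]
  exact mem_image_of_mem _ (by simp [hp, hp.1])

/-- In a tree each edge is a bridge. -/
theorem bridge (h : Frame E M) {p : β} (hp : E.IsEdge M p) :
    ¬ EqvGen (E.LinkOff M p) p (E.opp p) := by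
  intro hpp
  have h1 := h.card_edges_erase hp
  have h2 := card_verts_le E ((E.darts.filter (fun d => E.IsEdge M d)).filter
    (fun d => d ≠ p ∧ d ≠ E.opp p)) h.rot_mem (fun d hd => by simp at hd; exact hd.1.1)
    (fun d hd => by
      simp only [mem_filter] at hd ⊢
      have ho := h.opp_edge d hd.1.2
      refine ⟨⟨ho.1, ho⟩, fun h3 => hd.2.2 ?_, fun h3 => hd.2.1 ?_⟩
      · rw [← h3, h.opp_opp d hd.1.2]
      · rw [← h.opp_opp d hd.1.2, h3, h.opp_opp p hp])
    (fun d hd => by simp only [mem_filter] at hd; exact h.opp_opp d hd.1.2)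
    (fun d hd e he => by
      refine eqvGen_le (equivalence_eqvGen _) (fun x y hxy => ?_) (h.conn d hd e he)
      have key : ∀ x y, E.LinkOff M p x y → (y = E.rot x ∨ (x ∈ (E.darts.filter
          (fun d => E.IsEdge M d)).filter (fun d => d ≠ p ∧ d ≠ E.opp p) ∧ y = E.opp x)) := by
        rintro x y (h3 | ⟨h3, h4, h5, h6⟩)
        · exact Or.inl h3
        · exact Or.inr ⟨by simp [h3, h3.1, h4, h5], h6⟩
      have hpp' := eqvGen_le (equivalence_eqvGen _) (fun x y hxy => EqvGen.rel _ _ (key x y hxy))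
          hpp
      rcases hxy with hxy | ⟨hx, rfl⟩
      · exact EqvGen.rel _ _ (Or.inl hxy)
      · by_cases hxp : x = p
        · rw [hxp]; exact hpp'
        · by_cases hxp' : x = E.opp p
          · rw [hxp', h.opp_opp p hp]; exact EqvGen.symm _ _ hpp'
          · exact EqvGen.rel _ _ (Or.inr ⟨by simp [hx, hx.1, hxp, hxp'], rfl⟩))
  have h3 := h.count
  omega

theorem not_same_opp (h : Frame E M) {p : β} (hp : E.IsEdge M p) :
    ¬ E.Same p (E.opp p) := fun hs =>
  h.bridge hp (linkOff_of_same hs)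

end Frame

/-- One passage along an oriented edge, or to another dart of the same vertex. -/
def UpStep (E : WGraph β) (x y : β) : Prop :=
  E.Same x y ∨ (x ∈ E.darts ∧ E.kind x = .outgoing ∧ y = E.opp x)

/-- `E.Above x y`: the vertex of `y` is reached from that of `x` along oriented edges. -/
def Above (E : WGraph β) : β → β → Prop := ReflTransGen E.UpStep

theorem above_of_same (h : E.Same x y) : E.Above x y :=
  ReflTransGen.single (Or.inl h)

theorem above_opp (hx : x ∈ E.darts)
    (hk : E.kind x = .outgoing) : E.Above x (E.opp x) :=
  ReflTransGen.single (Or.inr ⟨hx, hk, rfl⟩)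

namespace Frame

theorem mem_of_above (h : Frame E M) (hx : x ∈ E.darts) (hxy : E.Above x y) :
    y ∈ E.darts := by
  induction hxy with
  | refl => exact hx
  | tail _ hs ih =>
    rcases hs with hs | ⟨h1, h2, rfl⟩
    · exact h.mem_of_same ih hs
    · exact h.opp_mem h1 h2

theorem W_above (h : Frame E M) (hx : x ∈ E.darts) (hxy : E.Above x y) :
    E.W x ≤ E.W y := by
  induction hxy with
  | refl => exact le_rfl
  | tail hxy hs ih =>
    rcases hs with hs | ⟨h1, h2, rfl⟩
    · rw [h.W_same (h.mem_of_above hx hxy) hs]; exact ih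
    · exact ih.trans (h.W_le _ h1 h2)

/-- There are no oriented cycles. -/
theorem not_above (h : Frame E M) (hd : d ∈ E.darts)
    (hk : E.kind d = .outgoing) : ¬ E.Above (E.opp d) d := by
  have he := h.isEdge_out hd hk
  intro hab
  have key : ∀ x, E.Above (E.opp d) x → EqvGen (E.LinkOff M d) (E.opp d) x := by
    intro x hx
    induction hx with
    | refl => exact EqvGen.refl _
    | tail _ hs ih =>
      rename_i y z _
      rcases hs with hs | ⟨h1, h2, rfl⟩
      · exact ih.trans _ _ _ (linkOff_of_same hs)
      · by_cases hyd : y = d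
        · subst hyd
          exact absurd (EqvGen.symm _ _ ih) (h.bridge he)
        · refine ih.trans _ _ _ (EqvGen.rel _ _ (Or.inr ⟨h.isEdge_out h1 h2, hyd, ?_, rfl⟩))
          rintro rfl
          rw [h.kind_opp hd hk] at h2
          cases h2
  exact h.bridge he (EqvGen.symm _ _ (key _ hab))

/-- Oriented paths leaving a vertex along different edges do not meet. -/
theorem eq_of_above (h : Frame E M) {d d' : β} (hd : d ∈ E.darts)
    (hk : E.kind d = .outgoing) (hd' : d' ∈ E.darts) (hk' : E.kind d' = .outgoing)
    (hs : E.Same d d') (hab : E.Above (E.opp d') (E.opp d)) : d = d' := by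
  by_contra hne
  have he := h.isEdge_out hd hk
  have he' := h.isEdge_out hd' hk'
  have key : ∀ x, E.Above (E.opp d') x → EqvGen (E.LinkOff M d) d x := by
    intro x hx
    induction hx with
    | refl =>
      refine (linkOff_of_same hs : EqvGen (E.LinkOff M d) d d').trans _ _ _
        (EqvGen.rel _ _ (Or.inr ⟨he', Ne.symm hne, ?_, rfl⟩))
      rintro rfl
      rw [h.kind_opp hd hk] at hk'
      cases hk'
    | tail hx hs' ih =>
      rename_i y z
      rcases hs' with hs' | ⟨h1, h2, rfl⟩
      · exact ih.trans _ _ _ (linkOff_of_same hs')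
      · by_cases hyd : y = d
        · subst hyd
          exact absurd (hx.tail (Or.inl hs)) (h.not_above hd' hk')
        · refine ih.trans _ _ _ (EqvGen.rel _ _ (Or.inr ⟨h.isEdge_out h1 h2, hyd, ?_, rfl⟩))
          rintro rfl
          rw [h.kind_opp hd hk] at h2
          cases h2
  exact h.bridge he (key _ hab)

end Frame

/-! ### Mirror images -/

/-- The mirror image of a graph. -/
def mirror (E : WGraph β) : WGraph β := { E with rot := E.rot⁻¹ }

@[simp] theorem mirror_darts (E : WGraph β) : E.mirror.darts = E.darts := rfl
@[simp] theorem mirror_rot (E : WGraph β) : E.mirror.rot = E.rot⁻¹ := rfl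
@[simp] theorem mirror_opp (E : WGraph β) : E.mirror.opp = E.opp := rfl
@[simp] theorem mirror_kind (E : WGraph β) : E.mirror.kind = E.kind := rfl
@[simp] theorem mirror_W (E : WGraph β) : E.mirror.W = E.W := rfl
@[simp] theorem mirror_mirror (E : WGraph β) : E.mirror.mirror = E := by
  cases E; simp [mirror]

theorem mirror_same (E : WGraph β) :
    E.mirror.Same x y ↔ E.Same x y :=
  Equiv.Perm.sameCycle_inv

theorem mirror_vert (E : WGraph β) (d : β) : E.mirror.vert d = E.vert d := by
  ext x; simp [mem_vert, mirror_same]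

theorem mirror_verts (E : WGraph β) : E.mirror.verts = E.verts := by
  ext V; simp [mem_verts, mirror_vert]

theorem mirror_vmap (E' : WGraph γ) (g : β → γ) : vmap E'.mirror g = vmap E' g := by
  ext V; simp [vmap, mirror_vert]

theorem mirror_leaving (E : WGraph β) (d : β) : E.mirror.Leaving d ↔ E.Leaving d := Iff.rfl

theorem mirror_level (E : WGraph β) (d : β) : E.mirror.level d = E.level d := rfl

theorem mirror_above (E : WGraph β) : E.mirror.Above x y ↔ E.Above x y := by
  have : E.mirror.UpStep = E.UpStep := by
    ext x y; simp [UpStep, mirror_same]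
  simp [Above, this]

theorem eqvGen_link_mirror (h : EqvGen (E.Link M) x y) :
    EqvGen (E.mirror.Link M) x y := by
  refine eqvGen_le (equivalence_eqvGen _) (fun x y hxy => ?_) h
  rcases hxy with rfl | hxy
  · exact EqvGen.symm _ _ (EqvGen.rel _ _ (Or.inl (by simp)))
  · exact EqvGen.rel _ _ (Or.inr hxy)

theorem Frame.mirror (h : Frame E M) : Frame E.mirror M where
  rot_mem d hd := h.rot_inv_mem hd
  slider_mem := h.slider_mem
  slider_kind := h.slider_kind
  opp_edge := h.opp_edge
  opp_opp := h.opp_opp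
  opp_ne := h.opp_ne
  kind_vertical := h.kind_vertical
  kind_outgoing := h.kind_outgoing
  kind_incoming := h.kind_incoming
  W_rot d hd := h.W_same hd (same_rot_inv _ d)
  W_le := h.W_le
  W_vertical := h.W_vertical
  H_opp := h.H_opp
  H_nonneg := h.H_nonneg
  conn d hd e he := eqvGen_link_mirror (h.conn d hd e he)
  count := by rw [mirror_verts]; exact h.count

/-! ### States of the zipping process and chains of edges -/

/-- A stage of the zipping: leaving darts alternate with the other ones around each vertex, and each
vertex has a dart of the latter sort which is not a slider. -/
structure State (E : WGraph β) (M : Set β) : Prop extends Frame E M where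
  alt : ∀ d ∈ E.darts, (E.Leaving (E.rot d) ↔ ¬ E.Leaving d)
  anchor : ∀ x ∈ E.darts, ∃ d, E.IsEdge M d ∧ ¬ E.Leaving d ∧ E.Same x d

theorem nl_of_vertical (h : E.kind d = .vertical) :
    ¬ E.Leaving d := by simp [Leaving, h]

theorem nl_of_incoming (h : E.kind d = .incoming) :
    ¬ E.Leaving d := by simp [Leaving, h]

theorem kind_of_not_leaving (h : ¬ E.Leaving d) :
    E.kind d = .vertical ∨ E.kind d = .incoming := by
  rcases hk : E.kind d <;> simp [Leaving, hk] at h ⊢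

theorem State.mirror (h : State E M) : State E.mirror M where
  toFrame := h.toFrame.mirror
  alt d hd := by
    have := h.alt _ (h.rot_inv_mem hd)
    rw [apply_inv] at this
    simp only [mirror_rot, mirror_leaving]
    rw [this, not_not]
  anchor x hx := by
    obtain ⟨d, h1, h2, h3⟩ := h.anchor x hx
    exact ⟨d, h1, h2, (mirror_same E).2 h3⟩

namespace State

theorem leaving_rot (h : State E M) (hd : d ∈ E.darts) (hl : ¬ E.Leaving d) :
    E.Leaving (E.rot d) := (h.alt d hd).2 hl

theorem nl_rot (h : State E M) (hd : d ∈ E.darts) (hl : E.Leaving d) :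
    ¬ E.Leaving (E.rot d) := fun h' => (h.alt d hd).1 h' hl

theorem leaving_rot_inv (h : State E M) (hd : d ∈ E.darts) (hl : ¬ E.Leaving d) :
    E.Leaving (E.rot⁻¹ d) := h.mirror.leaving_rot hd hl

theorem nl_rot_inv (h : State E M) (hd : d ∈ E.darts) (hl : E.Leaving d) :
    ¬ E.Leaving (E.rot⁻¹ d) := h.mirror.nl_rot hd hl

theorem nl_opp (h : State E M) (hd : d ∈ E.darts)
    (hk : E.kind d = .outgoing) : ¬ E.Leaving (E.opp d) :=
  nl_of_incoming (h.kind_opp hd hk)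

end State

/-- The chain of leaving darts that starts with `s` and has the same half-strip on its right:
each outgoing dart is followed by the dart next to its opposite. -/
inductive Chain (E : WGraph β) (s : β) : β → Prop
  | start : Chain E s s
  | next (o : β) : Chain E s o → E.kind o = .outgoing → Chain E s (E.rot (E.opp o))

namespace Chain

variable {s x y a b : β}

theorem trans (h : Chain E s x) (h' : Chain E x y) : Chain E s y := by
  induction h' with
  | start => exact h
  | next o _ hk ih => exact ih.next o hk

theorem cases_head (h : Chain E s x) :
    x = s ∨ (E.kind s = .outgoing ∧ Chain E (E.rot (E.opp s)) x) := by
  induction h with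
  | start => exact Or.inl rfl
  | next o _ hk ih =>
    right
    rcases ih with rfl | ⟨h1, h2⟩
    · exact ⟨hk, .start⟩
    · exact ⟨h1, h2.next o hk⟩

theorem linear (h : Chain E s x) (h' : Chain E s y) : Chain E x y ∨ Chain E y x := by
  induction h with
  | start => exact Or.inl h'
  | next o ho hk ih =>
    rcases ih with ih | ih
    · rcases ih.cases_head with rfl | ⟨_, ih⟩
      · exact Or.inr (Chain.next _ .start hk)
      · exact Or.inl ih
    · exact Or.inr (ih.next o hk)

theorem mem (hE : State E M) (hs : s ∈ E.darts) (hl : E.Leaving s) (h : Chain E s x) :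
    x ∈ E.darts ∧ E.Leaving x := by
  induction h with
  | start => exact ⟨hs, hl⟩
  | next o _ hk ih =>
    have := hE.opp_mem ih.1 hk
    exact ⟨hE.rot_mem _ this, hE.leaving_rot this (hE.nl_opp ih.1 hk)⟩

theorem above (hE : State E M) (hs : s ∈ E.darts) (hl : E.Leaving s) (h : Chain E s x) :
    E.Above s x := by
  induction h with
  | start => exact ReflTransGen.refl
  | next o ho hk ih =>
    exact (ih.trans (above_opp (ho.mem hE hs hl).1 hk)).trans (above_of_same (same_rot _ _))

theorem W_le (hE : State E M) (hs : s ∈ E.darts) (hl : E.Leaving s) (h : Chain E s x) :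
    E.W s ≤ E.W x := hE.W_above hs (h.above hE hs hl)

/-- A chain passes each vertex only once. -/
theorem eq_of_same (hE : State E M) (hs : s ∈ E.darts) (h : Chain E s x)
    (hsx : E.Same s x) : x = s := by
  rcases h.cases_head with h | ⟨hk, h⟩
  · exact h
  · have h1 := hE.opp_mem hs hk
    have h2 := h.above hE (hE.rot_mem _ h1) (hE.leaving_rot h1 (hE.nl_opp hs hk))
    exact absurd (((above_of_same (same_rot _ _)).trans h2).trans (above_of_same hsx.symm))
      (hE.not_above hs hk)

theorem antisymm (hE : State E M) (hs : s ∈ E.darts) (h : Chain E s x)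
    (h' : Chain E x s) : x = s := by
  rcases h.cases_head with h | ⟨hk, h⟩
  · exact h
  · have h1 := hE.opp_mem hs hk
    have h2 := h.above hE (hE.rot_mem _ h1) (hE.leaving_rot h1 (hE.nl_opp hs hk))
    have h3 := h.mem hE (hE.rot_mem _ h1) (hE.leaving_rot h1 (hE.nl_opp hs hk))
    exact absurd (((above_of_same (same_rot _ _)).trans h2).trans
      (h'.above hE h3.1 h3.2)) (hE.not_above hs hk)

/-- A chain meets each vertex in a single dart. -/
theorem eq_of_same' (hE : State E M) (hs : s ∈ E.darts) (hl : E.Leaving s) (h : Chain E s x)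
    (h' : Chain E s y) (hxy : E.Same x y) : x = y := by
  have hx := h.mem hE hs hl
  have hy := h'.mem hE hs hl
  rcases h.linear h' with h1 | h1
  · exact (h1.eq_of_same hE hx.1 hxy).symm
  · exact h1.eq_of_same hE hy.1 hxy.symm

theorem level_le (hE : State E M) (hs : s ∈ E.darts) (h : Chain E s x)
    (hne : x ≠ s) : E.level s ≤ (E.W x : EReal) := by
  rcases h.cases_head with h | ⟨hk, h⟩
  · exact absurd h hne
  · have h1 := hE.opp_mem hs hk
    have h2 := h.W_le hE (hE.rot_mem _ h1) (hE.leaving_rot h1 (hE.nl_opp hs hk))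
    rw [hE.W_rot _ h1] at h2
    simpa [level, hk] using h2

/-- The chains starting at different corners are disjoint. -/
theorem root_unique (hE : State E M) (ha : a ∈ E.darts) (hb : b ∈ E.darts)
    (hka : E.kind a = .vertical) (hkb : E.kind b = .vertical)
    (h : Chain E (E.rot a) x) (h' : Chain E (E.rot b) x) : a = b := by
  have hl : ∀ c ∈ E.darts, E.kind c = .vertical →
      E.rot c ∈ E.darts ∧ E.Leaving (E.rot c) := fun c hc hk =>
    ⟨hE.rot_mem c hc, hE.leaving_rot hc (nl_of_vertical hk)⟩
  have key : ∀ c ∈ E.darts, E.kind c = .vertical → ∀ o, Chain E (E.rot c) o →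
      E.kind o = .outgoing → ∀ d, E.kind d = .vertical →
      E.rot d ≠ E.rot (E.opp o) := by
    intro c hc hkc o ho hk d hkd he
    have h1 := E.rot.injective he
    have h2 := hE.kind_opp (ho.mem hE (hl c hc hkc).1 (hl c hc hkc).2).1 hk
    rw [← h1, hkd] at h2
    cases h2
  induction h with
  | start =>
    generalize hy : E.rot a = y at h'
    cases h' with
    | start => exact E.rot.injective hy
    | next o ho hk => exact absurd hy (key b hb hkb o ho hk a hka)
  | next o ho hk ih =>
    generalize hy : E.rot (E.opp o) = y at h'
    cases h' with
    | start => exact absurd hy.symm (key a ha hka o ho hk b hkb)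
    | next o' ho' hk' =>
      have h1 := E.rot.injective hy
      have h2 := (ho.mem hE (hl a ha hka).1 (hl a ha hka).2).1
      have h3 := (ho'.mem hE (hl b hb hkb).1 (hl b hb hkb).2).1
      have : o = o' := by
        rw [← hE.opp_opp o (hE.isEdge_out h2 hk), h1,
          hE.opp_opp o' (hE.isEdge_out h3 hk')]
      subst this
      exact ih ho'

end Chain

/-! ### Points and their identifications -/

/-- A pair denoting a point: a vertex, or an interior point of a leaving edge or ray. -/
def IsPoint (E : WGraph β) (P : β × ℝ) : Prop :=
  P.1 ∈ E.darts ∧ (P.2 = E.W P.1 ∨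
    (E.Leaving P.1 ∧ E.W P.1 < P.2 ∧ (P.2 : EReal) < E.level P.1))

/-- The point `P` lies on the side, starting right after the dart `a`, of a half-strip. -/
def OnSide (E : WGraph β) (a : β) (P : β × ℝ) : Prop :=
  E.IsPoint P ∧ Chain E (E.rot a) P.1

/-- A half-strip is given by the darts at its two corners: one side starts right after the first
one, the other side starts right before the second one. -/
def OnStrip (E : WGraph β) (c : β × β) (P : β × ℝ) : Prop :=
  E.OnSide c.1 P ∨ E.mirror.OnSide c.2 P

/-- Elementary identifications of points: pairs denoting the same vertex, and points on the same
level on the sides of a half-strip in `S`. -/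
def Glue (E : WGraph β) (S : Set (β × β)) (P Q : β × ℝ) : Prop :=
  (P.1 ∈ E.darts ∧ Q.1 ∈ E.darts ∧ P.2 = E.W P.1 ∧ Q.2 = E.W Q.1 ∧ E.Same P.1 Q.1) ∨
    ∃ c ∈ S, E.OnStrip c P ∧ E.OnStrip c Q ∧ P.2 = Q.2

/-- Points identified by collapsing the half-strips in `S`. -/
def Ident (E : WGraph β) (S : Set (β × β)) : β × ℝ → β × ℝ → Prop := EqvGen (E.Glue S)

theorem ident_refl : E.Ident S P P := EqvGen.refl _

theorem Ident.symm (h : E.Ident S P Q) :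
    E.Ident S Q P := EqvGen.symm _ _ h

theorem Ident.trans {P Q R : β × ℝ} (h : E.Ident S P Q)
    (h' : E.Ident S Q R) : E.Ident S P R := EqvGen.trans _ _ _ h h'

theorem ident_of_same (hE : Frame E M)
    (hx : x ∈ E.darts) (h : E.Same x y) : E.Ident S (x, E.W x) (y, E.W y) :=
  EqvGen.rel _ _ (Or.inl ⟨hx, hE.mem_of_same hx h, rfl, rfl, h⟩)

theorem ident_of_strip {c : β × β} (hc : c ∈ S)
    (hP : E.OnStrip c P) (hQ : E.OnStrip c Q) (h : P.2 = Q.2) : E.Ident S P Q :=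
  EqvGen.rel _ _ (Or.inr ⟨c, hc, hP, hQ, h⟩)

theorem Ident.snd_eq (hE : Frame E M)
    (h : E.Ident S P Q) : P.2 = Q.2 := by
  refine eqvGen_le (S := fun P Q : β × ℝ => P.2 = Q.2)
    ⟨fun _ => rfl, fun h => h.symm, fun h k => h.trans k⟩ (fun P Q h => ?_) h
  rcases h with ⟨h1, h2, h3, h4, h5⟩ | ⟨c, -, -, -, h⟩
  · rw [h3, h4, hE.W_same h1 h5]
  · exact h

theorem isPoint_vertex (hd : d ∈ E.darts) : E.IsPoint (d, E.W d) :=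
  ⟨hd, Or.inl rfl⟩

theorem mirror_onStrip {c : β × β} :
    E.mirror.OnStrip c.swap P ↔ E.OnStrip c P := by
  simp [OnStrip, or_comm]

theorem glue_mirror (h : E.Glue S P Q) :
    E.mirror.Glue (Prod.swap ⁻¹' S) P Q := by
  rcases h with h | ⟨c, hc, hP, hQ, h⟩
  · left; simpa [mirror_same] using h
  · exact Or.inr ⟨c.swap, by simpa using hc, mirror_onStrip.2 hP, mirror_onStrip.2 hQ, h⟩

theorem ident_mirror :
    E.mirror.Ident (Prod.swap ⁻¹' S) P Q ↔ E.Ident S P Q := by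
  constructor
  · intro h
    refine eqvGen_le (equivalence_eqvGen _) (fun P Q h => EqvGen.rel _ _ ?_) h
    have := glue_mirror h
    rwa [mirror_mirror, ← Set.preimage_comp, Prod.swap_swap_eq, Set.preimage_id] at this
  · exact eqvGen_le (equivalence_eqvGen _) (fun P Q h => EqvGen.rel _ _ (glue_mirror h))

/-- Without half-strips only pairs denoting the same vertex are identified. -/
theorem ident_empty (h : E.Ident ∅ P Q) : P = Q ∨
    (P.1 ∈ E.darts ∧ Q.1 ∈ E.darts ∧ P.2 = E.W P.1 ∧ Q.2 = E.W Q.1 ∧ E.Same P.1 Q.1) := by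
  refine eqvGen_le (S := fun P Q => P = Q ∨ (P.1 ∈ E.darts ∧ Q.1 ∈ E.darts ∧ P.2 = E.W P.1 ∧
    Q.2 = E.W Q.1 ∧ E.Same P.1 Q.1)) ⟨fun _ => Or.inl rfl, ?_, ?_⟩ ?_ h
  · rintro P Q (rfl | ⟨h1, h2, h3, h4, h5⟩)
    · exact Or.inl rfl
    · exact Or.inr ⟨h2, h1, h4, h3, h5.symm⟩
  · rintro P Q R (rfl | ⟨h1, h2, h3, h4, h5⟩) (rfl | ⟨k1, k2, k3, k4, k5⟩)
    · exact Or.inl rfl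
    · exact Or.inr ⟨k1, k2, k3, k4, k5⟩
    · exact Or.inr ⟨h1, h2, h3, h4, h5⟩
    · exact Or.inr ⟨h1, k2, h3, k4, h5.trans k5⟩
  · rintro P Q (h | ⟨c, hc, -⟩)
    · exact Or.inr h
    · exact absurd hc (Set.notMem_empty _)

/-! ### Maps of points -/

/-- `f` maps the points of `E` to those of `E'` compatibly with the width, with the identifications,
and, up to the identifications in `E'`, with vertices, edges of zero weight and the sides of the
half-strips whose corners are related by `C`. -/
structure Hom (E : WGraph β) (S : Set (β × β)) (E' : WGraph γ) (S' : Set (γ × γ))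
    (C : β → γ → Prop) (f : β × ℝ → γ × ℝ) : Prop where
  snd : ∀ P, (f P).2 = P.2
  point : ∀ P, E.IsPoint P → E'.IsPoint (f P)
  ident : ∀ P Q, E.Ident S P Q → E'.Ident S' (f P) (f Q)
  vertex : ∀ d ∈ E.darts, ∃ d' ∈ E'.darts, E'.Ident S' (f (d, E.W d)) (d', E'.W d')
  side : ∀ a a' P, C a a' → E.OnSide a P → ∃ P', E'.OnSide a' P' ∧ E'.Ident S' (f P) P'
  side_mirror : ∀ a a' P, C a a' → E.mirror.OnSide a P →
    ∃ P', E'.mirror.OnSide a' P' ∧ E'.Ident S' (f P) P'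
  zero : ∀ o ∈ E.darts, E.kind o = .outgoing → E.W (E.opp o) = E.W o →
    E'.Ident S' (f (o, E.W o)) (f (E.opp o, E.W (E.opp o))) ∨
    ∃ o' ∈ E'.darts, E'.kind o' = .outgoing ∧ E'.W (E'.opp o') = E'.W o' ∧
      E'.Ident S' (f (o, E.W o)) (o', E'.W o') ∧
      E'.Ident S' (f (E.opp o, E.W (E.opp o))) (E'.opp o', E'.W (E'.opp o'))

namespace Hom

variable {E'' : WGraph δ} {S'' : Set (δ × δ)} {C C₂ : β → γ → Prop} {C' : γ → δ → Prop}
  {f : β × ℝ → γ × ℝ} {f' : γ × ℝ → δ × ℝ}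

theorem mono (h : Hom E S E' S' C f) (hC : ∀ a a', C₂ a a' → C a a') : Hom E S E' S' C₂ f :=
  { h with
    side := fun a a' P ha => h.side a a' P (hC a a' ha)
    side_mirror := fun a a' P ha => h.side_mirror a a' P (hC a a' ha) }

theorem trans (h : Hom E S E' S' C f) (h' : Hom E' S' E'' S'' C' f') :
    Hom E S E'' S'' (Relation.Comp C C') (fun P => f' (f P)) where
  snd P := by rw [h'.snd, h.snd]
  point P hP := h'.point _ (h.point P hP)
  ident P Q hPQ := h'.ident _ _ (h.ident P Q hPQ)
  vertex d hd := by
    obtain ⟨d', hd', h1⟩ := h.vertex d hd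
    obtain ⟨d'', hd'', h2⟩ := h'.vertex d' hd'
    exact ⟨d'', hd'', (h'.ident _ _ h1).trans h2⟩
  side := by
    rintro a a'' P ⟨a', h1, h2⟩ hP
    obtain ⟨P', h3, h4⟩ := h.side a a' P h1 hP
    obtain ⟨P'', h5, h6⟩ := h'.side a' a'' P' h2 h3
    exact ⟨P'', h5, (h'.ident _ _ h4).trans h6⟩
  side_mirror := by
    rintro a a'' P ⟨a', h1, h2⟩ hP
    obtain ⟨P', h3, h4⟩ := h.side_mirror a a' P h1 hP
    obtain ⟨P'', h5, h6⟩ := h'.side_mirror a' a'' P' h2 h3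
    exact ⟨P'', h5, (h'.ident _ _ h4).trans h6⟩
  zero o ho hk hw := by
    rcases h.zero o ho hk hw with h1 | ⟨o', ho', hk', hw', h1, h2⟩
    · exact Or.inl (h'.ident _ _ h1)
    · have i1 := h'.ident _ _ h1
      have i2 := h'.ident _ _ h2
      rcases h'.zero o' ho' hk' hw' with h3 | ⟨o'', ho'', hk'', hw'', h3, h4⟩
      · exact Or.inl ((i1.trans h3).trans i2.symm)
      · exact Or.inr ⟨o'', ho'', hk'', hw'', i1.trans h3, i2.trans h4⟩

theorem mirror (h : Hom E S E' S' C f) :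
    Hom E.mirror (Prod.swap ⁻¹' S) E'.mirror (Prod.swap ⁻¹' S') C f where
  snd := h.snd
  point := h.point
  ident P Q hPQ := ident_mirror.2 (h.ident P Q (ident_mirror.1 hPQ))
  vertex d hd := by
    obtain ⟨d', h1, h2⟩ := h.vertex d hd
    exact ⟨d', h1, ident_mirror.2 h2⟩
  side a a' P ha hP := by
    obtain ⟨P', h1, h2⟩ := h.side_mirror a a' P ha hP
    exact ⟨P', h1, ident_mirror.2 h2⟩
  side_mirror a a' P ha hP := by
    rw [mirror_mirror] at hP
    obtain ⟨P', h1, h2⟩ := h.side a a' P ha hP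
    exact ⟨P', by rwa [mirror_mirror], ident_mirror.2 h2⟩
  zero o ho hk hw := by
    rcases h.zero o ho hk hw with h1 | ⟨o', ho', hk', hw', h1, h2⟩
    · exact Or.inl (ident_mirror.2 h1)
    · exact Or.inr ⟨o', ho', hk', hw', ident_mirror.2 h1, ident_mirror.2 h2⟩

end Hom

/-- The graph `E'` arises from `E` by identification of points: maps of points in both directions
which are inverse to each other up to the identifications by the half-strips that are still to be
collapsed. The map `f` merges vertices with addition of orders and sends the vertex of a dart to the
vertex of the dart related to it by `N`. -/
structure Folding (E : WGraph β) (M : Set β) (S : Set (β × β)) (E' : WGraph γ) (M' : Set γ)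
    (S' : Set (γ × γ)) (C N : β → γ → Prop) where
  f : β × ℝ → γ × ℝ
  h : γ × ℝ → β × ℝ
  hom_f : Hom E S E' S' C f
  hom_h : Hom E' S' E S (flip C) h
  h_f : ∀ P, E.IsPoint P → E.Ident S (h (f P)) P
  f_h : ∀ P, E'.IsPoint P → E'.Ident S' (f (h P)) P
  vertexMap : VertexMap E M E' M' (fun d => (f (d, E.W d)).1)
  name : ∀ d d', N d d' → E'.Same (f (d, E.W d)).1 d'

namespace Folding

variable {E'' : WGraph δ} {M'' : Set δ} {S'' : Set (δ × δ)}
  {C N C₂ N₂ : β → γ → Prop} {C' N' : γ → δ → Prop}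

theorem f_vertex (F : Folding E M S E' M' S' C N) (hd : d ∈ E.darts) :
    F.f (d, E.W d) = ((F.f (d, E.W d)).1, E'.W (F.f (d, E.W d)).1) := by
  ext
  · rfl
  · simp only [F.hom_f.snd, F.vertexMap.W d hd]

/-- Weakening of the relations between corners and names. -/
def mono (F : Folding E M S E' M' S' C N) (hC : ∀ a a', C₂ a a' → C a a')
    (hN : ∀ a a', N₂ a a' → N a a') : Folding E M S E' M' S' C₂ N₂ :=
  { F with
    hom_f := F.hom_f.mono hC
    hom_h := F.hom_h.mono fun a a' h => hC a' a h
    name := fun d d' h => F.name d d' (hN d d' h) }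

/-- Composition of foldings. -/
def trans (F : Folding E M S E' M' S' C N) (F' : Folding E' M' S' E'' M'' S'' C' N')
    (hN : ∀ d d', N d d' → d ∈ E.darts ∧ d' ∈ E'.darts) :
    Folding E M S E'' M'' S'' (Relation.Comp C C') (Relation.Comp N N') where
  f P := F'.f (F.f P)
  h P := F.h (F'.h P)
  hom_f := F.hom_f.trans F'.hom_f
  hom_h := (F'.hom_h.trans F.hom_h).mono (by
    rintro a a'' ⟨a', h1, h2⟩; exact ⟨a', h2, h1⟩)
  h_f P hP := (F.hom_h.ident _ _ (F'.h_f _ (F.hom_f.point P hP))).trans (F.h_f P hP)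
  f_h P hP := (F'.hom_f.ident _ _ (F.f_h _ (F'.hom_h.point P hP))).trans (F'.f_h P hP)
  vertexMap := by
    have h1 := F.vertexMap.trans F'.vertexMap
    have key : ∀ d ∈ E.darts, F'.f (F.f (d, E.W d)) =
        F'.f ((F.f (d, E.W d)).1, E'.W (F.f (d, E.W d)).1) := fun d hd => by
      rw [← F.f_vertex hd]
    refine ⟨fun d hd => ?_, fun d hd e he hde => ?_, fun d' hd' => ?_, fun d hd => ?_,
      fun V' hV' => ?_⟩
    · rw [key d hd]; exact h1.mem d hd
    · rw [key d hd, key e he]; exact h1.same d hd e he hde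
    · obtain ⟨d, hd, h2⟩ := h1.surj d' hd'
      exact ⟨d, hd, by rw [key d hd]; exact h2⟩
    · rw [key d hd]; exact h1.W d hd
    · rw [h1.ord V' hV']
      refine Finset.sum_congr (Finset.filter_congr fun V hV => ?_) fun _ _ => rfl
      obtain ⟨d, hd, rfl⟩ := mem_verts.1 hV
      rw [vmap_vert h1.same hd, vmap_vert _ hd, key d hd]
      intro d hd e he hde
      rw [key d hd, key e he]; exact h1.same d hd e he hde
  name := by
    rintro d d'' ⟨d', h1, h2⟩
    obtain ⟨hd, hd'⟩ := hN d d' h1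
    have h3 := F.name d d' h1
    rw [F.f_vertex hd]
    exact (F'.vertexMap.same _ (F.vertexMap.mem d hd) _ hd' h3).trans (F'.name d' d'' h2)

/-- Foldings and mirror images. -/
def mirror (F : Folding E M S E' M' S' C N) :
    Folding E.mirror M (Prod.swap ⁻¹' S) E'.mirror M' (Prod.swap ⁻¹' S') C N where
  f := F.f
  h := F.h
  hom_f := F.hom_f.mirror
  hom_h := F.hom_h.mirror
  h_f P hP := ident_mirror.2 (F.h_f P hP)
  f_h P hP := ident_mirror.2 (F.f_h P hP)
  vertexMap :=
    ⟨F.vertexMap.mem, fun d hd e he hde =>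
      (mirror_same E').2 (F.vertexMap.same d hd e he ((mirror_same E).1 hde)),
      fun d' hd' => by
        obtain ⟨d, hd, h⟩ := F.vertexMap.surj d' hd'
        exact ⟨d, hd, (mirror_same E').2 h⟩,
      F.vertexMap.W, fun V' hV' => by
        rw [mirror_verts] at hV'
        rw [mirror_verts, mirror_vmap]
        exact F.vertexMap.ord V' hV'⟩
  name d d' h := (mirror_same E').2 (F.name d d' h)

end Folding

/-! ### Contraction of an edge -/

/-- `E'` arises from `E` by contraction of the edge of `p`. Only values at the darts of `E'` are
prescribed, so that the merging of two edges in a step of zipping is a contraction, too. -/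
structure IsContraction (E E' : WGraph β) (p : β) : Prop where
  darts : E'.darts = (E.darts.erase p).erase (E.opp p)
  rot_p : ∀ x ∈ E'.darts, E.rot x = p → E'.rot x = E.rot (E.opp p)
  rot_opp : ∀ x ∈ E'.darts, E.rot x = E.opp p → E'.rot x = E.rot p
  rot_other : ∀ x ∈ E'.darts, E.rot x ≠ p → E.rot x ≠ E.opp p → E'.rot x = E.rot x
  opp : E'.opp = E.opp
  kind : E'.kind = E.kind
  H : E'.H = E.H
  W : ∀ x ∈ E'.darts, E'.W x = E.W x

/-- The edge of `p` is an oriented edge of zero weight whose ends are not leaves. -/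
structure Contractible (E : WGraph β) (M : Set β) (p : β) : Prop extends Frame E M where
  mem : p ∈ E.darts
  outgoing : E.kind p = .outgoing
  W_eq : E.W (E.opp p) = E.W p
  rot_ne : E.rot p ≠ p
  rot_opp_ne : E.rot (E.opp p) ≠ E.opp p

theorem Contractible.mirror {p : β} (h : Contractible E M p) :
    Contractible E.mirror M p :=
  { h.toFrame.mirror with
    mem := h.mem
    outgoing := h.outgoing
    W_eq := h.W_eq
    rot_ne := fun k => h.rot_ne (by rw [mirror_rot, inv_eq_iff_eq] at k; exact k.symm)
    rot_opp_ne := fun k => h.rot_opp_ne (by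
      rw [mirror_rot, inv_eq_iff_eq] at k; exact k.symm) }

/-- The projection of darts in the contraction of the edge of `p`: both halves of the edge are sent
to a dart `z` of the merged vertex. -/
def contractMap (E : WGraph β) (p z x : β) : β := if x = p ∨ x = E.opp p then z else x

namespace IsContraction

variable {E E' : WGraph β} {p z : β}

theorem rot (hc : IsContraction E E' p) (x : β) (hx : x ∈ E'.darts) : E'.rot x =
    if E.rot x = p then E.rot (E.opp p) else if E.rot x = E.opp p then E.rot p else E.rot x := by
  split_ifs with h1 h2
  · exact hc.rot_p x hx h1
  · exact hc.rot_opp x hx h2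
  · exact hc.rot_other x hx h1 h2

theorem edge (h : Contractible E M p) : E.IsEdge M p := h.isEdge_out h.mem h.outgoing

theorem edge_opp (h : Contractible E M p) : E.IsEdge M (E.opp p) := h.opp_edge p (edge h)

theorem not_same (h : Contractible E M p) : ¬ E.Same p (E.opp p) :=
  h.not_same_opp (edge h)

theorem mem_iff (hc : IsContraction E E' p) :
    x ∈ E'.darts ↔ x ≠ E.opp p ∧ x ≠ p ∧ x ∈ E.darts := by
  rw [hc.darts]; simp

theorem rot_mem (hc : IsContraction E E' p) (h : Contractible E M p) :
    ∀ d ∈ E'.darts, E'.rot d ∈ E'.darts := by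
  intro d hd
  have hd' := hc.mem_iff.1 hd
  rw [hc.rot d hd, hc.mem_iff]
  split_ifs with h1 h2
  · refine ⟨h.rot_opp_ne, fun h3 => not_same h ?_, h.rot_mem _ (edge_opp h).1⟩
    have := (same_rot E.rot (E.opp p)).symm
    rwa [h3] at this
  · refine ⟨fun h3 => not_same h ?_, h.rot_ne, h.rot_mem _ h.mem⟩
    have := same_rot E.rot p
    rwa [h3] at this
  · exact ⟨h2, h1, h.rot_mem _ hd'.2.2⟩

theorem rot_p_mem (hc : IsContraction E E' p) (h : Contractible E M p) : E.rot p ∈ E'.darts := by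
  rw [hc.mem_iff]
  refine ⟨fun h3 => not_same h ?_, h.rot_ne, h.rot_mem _ h.mem⟩
  have := same_rot E.rot p
  rwa [h3] at this

theorem rot_inv_p_mem (hc : IsContraction E E' p) (h : Contractible E M p) :
    E.rot⁻¹ p ∈ E'.darts := by
  rw [hc.mem_iff]
  refine ⟨fun h3 => not_same h ?_, fun h3 => h.mirror.rot_ne h3, h.rot_inv_mem h.mem⟩
  have := same_rot_inv E.rot p
  rwa [h3] at this

/-- The ends of the contracted edge are merged. -/
theorem same_merged (hc : IsContraction E E' p) (h : Contractible E M p) :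
    E'.Same (E.rot p) (E.rot (E.opp p)) := by
  have ha : E'.rot (E.rot⁻¹ p) = E.rot (E.opp p) := by
    rw [hc.rot _ (hc.rot_inv_p_mem h), apply_inv, if_pos rfl]
  by_contra hne
  -- otherwise the darts of the merged vertex coming from the first end would form a cycle of `rot`
  let K := E'.darts.filter (fun x => E'.Same (E.rot p) x ∧ E.Same p x)
  have hK : ∀ x ∈ K, E.rot x ∈ K := by
    intro x hx
    obtain ⟨hx, h1, h2⟩ := mem_filter.1 hx
    have h3 : E.rot x ≠ p := by
      intro h3
      have : x = E.rot⁻¹ p := by rw [← h3, inv_apply]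
      rw [← this] at ha
      exact hne (by rw [← ha]; exact h1.trans (same_rot _ _))
    have h4 : E.rot x ≠ E.opp p := by
      intro h4
      exact not_same h (h2.trans (by rw [← h4]; exact same_rot _ _))
    have h5 : E'.rot x = E.rot x := by rw [hc.rot x hx, if_neg h3, if_neg h4]
    exact mem_filter.2 ⟨by rw [← h5]; exact hc.rot_mem h x hx,
      by rw [← h5]; exact h1.trans (same_rot _ _), h2.trans (same_rot _ _)⟩
  have h1 : E.rot p ∈ K :=
    mem_filter.2 ⟨hc.rot_p_mem h, .refl _ _, same_rot _ _⟩
  have h2 := perm_inv_mem hK h1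
  rw [inv_apply] at h2
  exact (hc.mem_iff.1 (mem_filter.1 h2).1).2.1 rfl

theorem map_of_mem (hc : IsContraction E E' p) (hx : x ∈ E'.darts) :
    contractMap E p z x = x := by
  have := hc.mem_iff.1 hx
  rw [contractMap, if_neg (by tauto)]

theorem z_mem (hc : IsContraction E E' p) (h : Contractible E M p) (hz : E.Same p z)
    (hzp : z ≠ p) : z ∈ E'.darts := by
  rw [hc.mem_iff]
  exact ⟨fun h3 => not_same h (by rwa [h3] at hz), hzp, h.mem_of_same h.mem hz⟩

theorem map_mem (hc : IsContraction E E' p) (h : Contractible E M p) (hz : E.Same p z)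
    (hzp : z ≠ p) (hx : x ∈ E.darts) : contractMap E p z x ∈ E'.darts := by
  rw [contractMap]
  split_ifs with h1
  · exact hc.z_mem h hz hzp
  · push Not at h1
    exact hc.mem_iff.2 ⟨h1.2, h1.1, hx⟩

theorem same_rot_p (hc : IsContraction E E' p) (h : Contractible E M p)
    (hx : x ∈ E.darts) (hxy : E.Same x y) :
    E'.Same (contractMap E p (E.rot p) x) (contractMap E p (E.rot p) y) := by
  refine sameCycle_map h.rot_mem (contractMap E p (E.rot p)) (fun x hx => ?_) hx hxy
  by_cases hxp : x = p
  · rw [hc.map_of_mem (x := E.rot x) (by rw [hxp]; exact hc.rot_p_mem h), contractMap,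
      if_pos (Or.inl hxp), hxp]
  by_cases hxp' : x = E.opp p
  · have : E.rot (E.opp p) ∈ E'.darts := by
      have h1 := hc.rot_mem h _ (hc.rot_inv_p_mem h)
      rwa [hc.rot _ (hc.rot_inv_p_mem h), apply_inv, if_pos rfl] at h1
    rw [hxp', hc.map_of_mem this, contractMap, if_pos (Or.inr rfl)]
    exact hc.same_merged h
  have hx' : x ∈ E'.darts := hc.mem_iff.2 ⟨hxp', hxp, hx⟩
  rw [hc.map_of_mem hx']
  have h1 := same_rot E'.rot x
  by_cases h2 : E.rot x = p
  · rw [hc.rot_p x hx' h2] at h1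
    rw [contractMap, if_pos (Or.inl h2)]
    exact h1.trans (hc.same_merged h).symm
  by_cases h3 : E.rot x = E.opp p
  · rw [hc.rot_opp x hx' h3] at h1
    rwa [contractMap, if_pos (Or.inr h3)]
  · rw [hc.rot_other x hx' h2 h3] at h1
    rwa [contractMap, if_neg (by tauto)]

theorem same_map (hc : IsContraction E E' p) (h : Contractible E M p) (hz : E.Same p z)
    (hzp : z ≠ p) (hx : x ∈ E.darts) (hxy : E.Same x y) :
    E'.Same (contractMap E p z x) (contractMap E p z y) := by
  have key : ∀ x ∈ E.darts, E'.Same (contractMap E p z x)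
      (contractMap E p (E.rot p) x) := by
    intro x hx
    by_cases h1 : x = p ∨ x = E.opp p
    · simp only [contractMap, if_pos h1]
      have h2 := hc.same_rot_p h (h.mem_of_same h.mem hz) hz.symm
      rw [hc.map_of_mem (hc.z_mem h hz hzp)] at h2
      simpa [contractMap] using h2
    · simp only [contractMap, if_neg h1]; exact .refl _ _
  exact ((key x hx).trans (hc.same_rot_p h hx hxy)).trans
    (key y (h.mem_of_same hx hxy)).symm

/-- The darts of the two ends of the contracted edge. -/
def AtEnds (E : WGraph β) (p x : β) : Prop :=
  E.Same x p ∨ E.Same x (E.opp p)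

theorem of_same (hc : IsContraction E E' p) (h : Contractible E M p)
    (hx : x ∈ E'.darts) (hxy : E'.Same x y) :
    E.Same x y ∨ (AtEnds E p x ∧ AtEnds E p y) := by
  refine (sameCycle_induct (hc.rot_mem h)
    (R := fun x y => E.Same x y ∨ (AtEnds E p x ∧ AtEnds E p y)) ⟨?_, ?_, ?_⟩ ?_ hx hxy).2
  · exact fun x => Or.inl (.refl _ _)
  · rintro x y (h1 | ⟨h1, h2⟩)
    · exact Or.inl h1.symm
    · exact Or.inr ⟨h2, h1⟩
  · have key : ∀ {x y}, E.Same x y → AtEnds E p y → AtEnds E p x := by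
      rintro x y h1 (h2 | h2)
      · exact Or.inl (h1.trans h2)
      · exact Or.inr (h1.trans h2)
    rintro x y z (h1 | ⟨h1, h2⟩) (h3 | ⟨h3, h4⟩)
    · exact Or.inl (h1.trans h3)
    · exact Or.inr ⟨key h1 h3, h4⟩
    · exact Or.inr ⟨h1, key h3.symm h2⟩
    · exact Or.inr ⟨h1, h4⟩
  · intro x hx
    rw [hc.rot x hx]
    split_ifs with h1 h2
    · exact Or.inr ⟨Or.inl (by rw [← h1]; exact same_rot _ _),
        Or.inr (same_rot _ _).symm⟩
    · exact Or.inr ⟨Or.inr (by rw [← h2]; exact same_rot _ _),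
        Or.inl (same_rot _ _).symm⟩
    · exact Or.inl (same_rot _ _)

theorem same_iff (hc : IsContraction E E' p) (h : Contractible E M p) (hz : E.Same p z)
    (hzp : z ≠ p) (hx : x ∈ E.darts) (hy : y ∈ E.darts) :
    E'.Same (contractMap E p z x) (contractMap E p z y) ↔
      E.Same x y ∨ (AtEnds E p x ∧ AtEnds E p y) := by
  have hgp : contractMap E p z p = z := by simp [contractMap]
  have hgp' : contractMap E p z (E.opp p) = z := by simp [contractMap]
  have h0 : ∀ x, x ∉ E'.darts → x ∈ E.darts → AtEnds E p x := by
    intro x hx hx'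
    rw [hc.mem_iff] at hx
    by_cases h1 : x = p
    · rw [h1]; exact Or.inl (.refl _ _)
    · have : x = E.opp p := by tauto
      rw [this]; exact Or.inr (.refl _ _)
  have hends : ∀ x ∈ E.darts, AtEnds E p (contractMap E p z x) → AtEnds E p x := by
    intro x hx h1
    by_cases h2 : x ∈ E'.darts
    · rwa [hc.map_of_mem h2] at h1
    · exact h0 x h2 hx
  constructor
  · intro h1
    rcases hc.of_same h (hc.map_mem h hz hzp hx) h1 with h2 | ⟨h2, h3⟩
    · by_cases hx' : x ∈ E'.darts
      · by_cases hy' : y ∈ E'.darts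
        · rw [hc.map_of_mem hx', hc.map_of_mem hy'] at h2
          exact Or.inl h2
        · right
          refine ⟨?_, h0 y hy' hy⟩
          have : contractMap E p z y = z := by
            rw [contractMap, if_pos]
            rw [hc.mem_iff] at hy'; tauto
          rw [hc.map_of_mem hx', this] at h2
          exact Or.inl (h2.trans hz.symm)
      · right
        refine ⟨h0 x hx' hx, hends y hy ?_⟩
        have : contractMap E p z x = z := by
          rw [contractMap, if_pos]
          rw [hc.mem_iff] at hx'; tauto
        rw [this] at h2
        exact Or.inl (h2.symm.trans hz.symm)
    · exact Or.inr ⟨hends x hx h2, hends y hy h3⟩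
  · have key : ∀ x ∈ E.darts, AtEnds E p x → E'.Same (contractMap E p z x) z := by
      rintro x hx (h1 | h1)
      · have := hc.same_map h hz hzp hx h1
        rwa [hgp] at this
      · have := hc.same_map h hz hzp hx h1
        rwa [hgp'] at this
    rintro (h1 | ⟨h1, h2⟩)
    · exact hc.same_map h hz hzp hx h1
    · exact (key x hx h1).trans (key y hy h2).symm

theorem vertexMap (hc : IsContraction E E' p) (h : Contractible E M p) (hz : E.Same p z)
    (hzp : z ≠ p) :
    VertexMap E M E' M (contractMap E p z) ∧ E'.verts.card + 1 = E.verts.card := by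
  have hp' := (edge_opp h).1
  have hzm := hc.z_mem h hz hzp
  have hW : ∀ d ∈ E.darts, E'.W (contractMap E p z d) = E.W d := by
    intro d hd
    rw [hc.W _ (hc.map_mem h hz hzp hd), contractMap]
    split_ifs with h1
    · rw [h.W_same h.mem hz]
      rcases h1 with h1 | h1
      · rw [h1]
      · rw [h1, h.W_eq]
    · rfl
  refine vertexMap_of_merge h.mem hp' (not_same h) (fun d hd => hc.map_mem h hz hzp hd)
    (fun d hd e he => hc.same_iff h hz hzp hd he)
    (fun d' hd' => ⟨d', (hc.mem_iff.1 hd').2.2, by rw [hc.map_of_mem hd']⟩) hW ?_ ?_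
  · intro d hd h1 h2
    have hdm : d ∈ E'.darts := hc.mem_iff.2 ⟨by rintro rfl; exact h2 (.refl _ _),
      by rintro rfl; exact h1 (.refl _ _), hd⟩
    have : E'.vert (contractMap E p z d) = E.vert d := by
      ext x
      rw [hc.map_of_mem hdm, mem_vert, mem_vert]
      constructor
      · rintro ⟨hx, h3⟩
        refine ⟨(hc.mem_iff.1 hx).2.2, ?_⟩
        rcases hc.of_same h hdm h3 with h4 | h4
        · exact h4
        · rcases h4.1 with h5 | h5
          · exact absurd h5 h1
          · exact absurd h5 h2
      · rintro ⟨hx, h3⟩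
        have hx' : x ∈ E'.darts := hc.mem_iff.2 ⟨by rintro rfl; exact h2 h3,
          by rintro rfl; exact h1 h3, hx⟩
        have := (hc.same_iff h hz hzp hd hx).2 (Or.inl h3)
        rw [hc.map_of_mem hdm, hc.map_of_mem hx'] at this
        exact ⟨hx', this⟩
    rw [this, ordM, ordM, hc.kind]
  · have hgp : contractMap E p z p = z := by simp [contractMap]
    have hmem : ∀ x, x ∈ E'.vert z ↔
        x ≠ E.opp p ∧ x ≠ p ∧ (x ∈ E.vert p ∨ x ∈ E.vert (E.opp p)) := by
      intro x
      rw [mem_vert, mem_vert, mem_vert, hc.mem_iff]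
      constructor
      · rintro ⟨⟨h1, h2, h3⟩, h4⟩
        refine ⟨h1, h2, ?_⟩
        rcases hc.of_same h hzm h4 with h5 | ⟨-, h5 | h5⟩
        · exact Or.inl ⟨h3, hz.trans h5⟩
        · exact Or.inl ⟨h3, h5.symm⟩
        · exact Or.inr ⟨h3, h5.symm⟩
      · rintro ⟨h1, h2, h3⟩
        have hx : x ∈ E.darts := by tauto
        refine ⟨⟨h1, h2, hx⟩, ?_⟩
        have h4 := (hc.same_iff h hz hzp h.mem hx).2 (Or.inr ⟨Or.inl (.refl _ _), by
          rcases h3 with h3 | h3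
          · exact Or.inl h3.2.symm
          · exact Or.inr h3.2.symm⟩)
        rwa [hgp, hc.map_of_mem (hc.mem_iff.2 ⟨h1, h2, hx⟩)] at h4
    have hdisj : Disjoint (E.vert p) (E.vert (E.opp p)) := by
      rw [Finset.disjoint_left]
      intro x h1 h2
      exact not_same h ((mem_vert.1 h1).2.trans (mem_vert.1 h2).2.symm)
    have hkp' := h.kind_opp h.mem h.outgoing
    have hv : (E'.vert z).filter (fun x => E'.kind x = .vertical ∧ x ∉ M) =
        (E.vert p).filter (fun x => E.kind x = .vertical ∧ x ∉ M) ∪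
        (E.vert (E.opp p)).filter (fun x => E.kind x = .vertical ∧ x ∉ M) := by
      ext x
      simp only [mem_filter, mem_union, hmem, hc.kind]
      constructor
      · tauto
      · have h1 : E.kind x = .vertical → x ≠ E.opp p := by
          intro h1 h2; rw [h2, hkp'] at h1; cases h1
        have h2 : E.kind x = .vertical → x ≠ p := by
          intro h1 h2; rw [h2, h.outgoing] at h1; cases h1
        tauto
    have hi : (E'.vert z).filter (fun x => E'.kind x = .incoming) =
        ((E.vert p).filter (fun x => E.kind x = .incoming) ∪
        (E.vert (E.opp p)).filter (fun x => E.kind x = .incoming)).erase (E.opp p) := by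
      ext x
      simp only [mem_filter, mem_union, hmem, hc.kind, mem_erase]
      have h2 : E.kind x = .incoming → x ≠ p := by
        rintro h1 rfl; rw [h.outgoing] at h1; cases h1
      tauto
    have hi' : E.opp p ∈ (E.vert p).filter (fun x => E.kind x = .incoming) ∪
        (E.vert (E.opp p)).filter (fun x => E.kind x = .incoming) := by
      simp [hkp', self_mem_vert hp']
    have hci := card_erase_add_one hi'
    rw [← hi, Finset.card_union_of_disjoint
      (Finset.disjoint_filter_filter hdisj)] at hci
    rw [hgp, ordM, ordM, ordM, hv,
      Finset.card_union_of_disjoint (Finset.disjoint_filter_filter hdisj)]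
    push_cast
    zify at hci
    linarith

theorem isEdge_iff (hc : IsContraction E E' p) :
    E'.IsEdge M d ↔ E.IsEdge M d ∧ d ≠ p ∧ d ≠ E.opp p := by
  simp only [IsEdge, hc.kind, hc.mem_iff]; tauto

theorem opp_ne_of (h : Contractible E M p) (hd : E.IsEdge M d) (h1 : d ≠ p)
    (h2 : d ≠ E.opp p) : E.opp d ≠ p ∧ E.opp d ≠ E.opp p := by
  constructor
  · intro h3; exact h2 (by rw [← h3, h.opp_opp d hd])
  · intro h3; exact h1 (by rw [← h.opp_opp d hd, h3, h.opp_opp p (edge h)])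

theorem frame (hc : IsContraction E E' p) (h : Contractible E M p) : Frame E' M where
  rot_mem := hc.rot_mem h
  slider_mem m hm := hc.mem_iff.2 ⟨by rintro rfl; exact (edge_opp h).2.2 hm,
    by rintro rfl; exact (edge h).2.2 hm, h.slider_mem m hm⟩
  slider_kind m hm := by rw [hc.kind]; exact h.slider_kind m hm
  opp_edge d hd := by
    rw [hc.isEdge_iff] at hd
    rw [hc.opp, hc.isEdge_iff]
    exact ⟨h.opp_edge d hd.1, opp_ne_of h hd.1 hd.2.1 hd.2.2⟩
  opp_opp d hd := by rw [hc.opp]; exact h.opp_opp d (hc.isEdge_iff.1 hd).1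
  opp_ne d hd := by rw [hc.opp]; exact h.opp_ne d (hc.isEdge_iff.1 hd).1
  kind_vertical d hd := by
    rw [hc.opp, hc.kind]; exact h.kind_vertical d (hc.isEdge_iff.1 hd).1
  kind_outgoing d hd := by
    rw [hc.opp, hc.kind]; exact h.kind_outgoing d (hc.isEdge_iff.1 hd).1
  kind_incoming d hd := by
    rw [hc.opp, hc.kind]; exact h.kind_incoming d (hc.isEdge_iff.1 hd).1
  W_rot d hd := by
    have hd' := (hc.mem_iff.1 hd).2.2
    rw [hc.W _ (hc.rot_mem h d hd), hc.W d hd, hc.rot d hd]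
    split_ifs with h1 h2
    · rw [h.W_rot _ (edge_opp h).1, h.W_eq, ← h1, h.W_rot d hd']
    · rw [h.W_rot _ h.mem, ← h.W_eq, ← h2, h.W_rot d hd']
    · exact h.W_rot d hd'
  W_le d hd hk := by
    rw [hc.kind] at hk
    have hd' := (hc.mem_iff.1 hd)
    have he := h.isEdge_out hd'.2.2 hk
    have ho := opp_ne_of h he hd'.2.1 hd'.1
    rw [hc.opp, hc.W d hd, hc.W _ (hc.mem_iff.2 ⟨ho.2, ho.1, h.opp_mem hd'.2.2 hk⟩)]
    exact h.W_le d hd'.2.2 hk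
  W_vertical d hd hk := by
    rw [hc.kind] at hk
    rw [hc.W d hd.1]; exact h.W_vertical d (hc.isEdge_iff.1 hd).1 hk
  H_opp d hd := by
    rw [hc.kind, hc.H, hc.opp]; exact h.H_opp d (hc.isEdge_iff.1 hd).1
  H_nonneg d hd := by
    rw [hc.kind, hc.H]; exact h.H_nonneg d (hc.isEdge_iff.1 hd).1
  conn d hd e he := by
    have hz := same_rot E.rot p
    have key : EqvGen (E'.Link M) (contractMap E p (E.rot p) d)
        (contractMap E p (E.rot p) e) := by
      refine eqvGen_le_of (T := fun x y => EqvGen (E'.Link M) (contractMap E p (E.rot p) x)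
        (contractMap E p (E.rot p) y)) (equivalence_comap (equivalence_eqvGen _) _) ?_
        (hc.mem_iff.1 hd).2.2 (h.conn d (hc.mem_iff.1 hd).2.2 e (hc.mem_iff.1 he).2.2)
      · rintro x y (rfl | ⟨hx, rfl⟩)
        · refine ⟨(perm_mem_iff h.rot_mem x).symm, fun hx => ?_⟩
          exact sameCycle_eqvGen (R := E'.Link M) (fun _ => Or.inl rfl)
            (hc.same_map h hz h.rot_ne hx (same_rot _ _))
        · refine ⟨⟨fun _ => (h.opp_edge x hx).1, fun _ => hx.1⟩, fun _ => ?_⟩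
          by_cases h1 : x = p ∨ x = E.opp p
          · have h2 : E.opp x = p ∨ E.opp x = E.opp p := by
              rcases h1 with rfl | rfl
              · exact Or.inr rfl
              · exact Or.inl (h.opp_opp p (edge h))
            rw [contractMap, if_pos h1, contractMap, if_pos h2]
            exact EqvGen.refl _
          · push Not at h1
            have h2 := opp_ne_of h hx h1.1 h1.2
            rw [contractMap, if_neg (by tauto), contractMap, if_neg (by tauto)]
            exact EqvGen.rel _ _ (Or.inr ⟨hc.isEdge_iff.2 ⟨hx, h1⟩, by rw [hc.opp]⟩)
    rwa [hc.map_of_mem hd, hc.map_of_mem he] at key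
  count := by
    have h1 := (hc.vertexMap h (same_rot E.rot p) h.rot_ne).2
    have h2 := h.card_edges_erase (edge h)
    have h3 : E'.edgesM M = ((E.darts.filter (fun d => E.IsEdge M d)).filter
        (fun d => d ≠ p ∧ d ≠ E.opp p)).image (fun d => ({d, E.opp d} : Finset β)) := by
      rw [edgesM, hc.opp]
      congr 1
      ext d
      simp only [mem_filter, hc.isEdge_iff, hc.mem_iff]
      tauto
    rw [h3]
    have h4 := h.count
    omega

/-- The description of a contraction does not depend on the orientation of the surface. -/
theorem mirror (hc : IsContraction E E' p) (h : Contractible E M p) :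
    IsContraction E.mirror E'.mirror p where
  darts := hc.darts
  opp := hc.opp
  kind := hc.kind
  H := hc.H
  W := hc.W
  rot_p x hx h1 := by
    rw [mirror_rot] at h1
    rw [mirror_rot, mirror_rot, mirror_opp, inv_eq_iff_eq,
      hc.rot_opp (E.rot⁻¹ (E.opp p)) (hc.mem_iff.2
      ⟨h.mirror.rot_opp_ne, fun h3 => not_same h (by
        have := (same_rot_inv E.rot (E.opp p)).symm; rwa [h3] at this),
        h.rot_inv_mem (edge_opp h).1⟩) (apply_inv _ _), ← h1, apply_inv]
  rot_opp x hx h1 := by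
    rw [mirror_rot] at h1
    rw [mirror_rot, mirror_rot, inv_eq_iff_eq, hc.rot_p _ (hc.rot_inv_p_mem h)
      (apply_inv _ _)]
    rw [mirror_opp] at h1
    rw [← h1, apply_inv]
  rot_other x hx h1 h2 := by
    have hx' := hc.mem_iff.1 hx
    rw [mirror_rot] at h1 h2
    rw [mirror_rot, mirror_rot, inv_eq_iff_eq, hc.rot_other _ (hc.mem_iff.2
      ⟨h2, h1, h.rot_inv_mem hx'.2.2⟩), apply_inv]
    · rw [apply_inv]; exact hx'.2.1
    · rw [apply_inv]; exact hx'.1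

end IsContraction

/-! ### The folding defined by a contraction -/

/-- The half-strips of `S` have their corners at vertical darts. -/
def CornersOK (E : WGraph β) (S : Set (β × β)) : Prop :=
  ∀ c ∈ S, (c.1 ∈ E.darts ∧ E.kind c.1 = .vertical) ∧
    (c.2 ∈ E.darts ∧ E.kind c.2 = .vertical)

theorem CornersOK.mirror (h : CornersOK E S) :
    CornersOK E.mirror (Prod.swap ⁻¹' S) := fun c hc => (h c.swap hc).symm

/-- If points of the sides are mapped to points of the sides up to identifications, then the
elementary identifications by half-strips are respected. -/
theorem ident_of_sides
    (f : β × ℝ → γ × ℝ)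
    (hsame : ∀ x ∈ E.darts, ∀ y ∈ E.darts, E.Same x y →
      E'.Ident S' (f (x, E.W x)) (f (y, E.W y)))
    (hstrip : ∀ c ∈ S, ∀ P Q, E.OnStrip c P → E.OnStrip c Q → P.2 = Q.2 →
      E'.Ident S' (f P) (f Q))
    (h : E.Ident S P Q) : E'.Ident S' (f P) (f Q) := by
  refine eqvGen_le (S := fun P Q => E'.Ident S' (f P) (f Q))
    (equivalence_comap (equivalence_eqvGen _) f) ?_ h
  rintro ⟨x, w⟩ ⟨y, w'⟩ (⟨h1, h2, h3, h4, h5⟩ | ⟨c, hc, hP, hQ, h⟩)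
  · dsimp only at h1 h2 h3 h4 h5
    subst h3 h4
    exact hsame x h1 y h2 h5
  · exact hstrip c hc _ _ hP hQ h

/-- A half-strip both of whose sides are mapped to the corresponding sides. -/
theorem ident_strip_of_sides
    (hE' : Frame E' M') (f : β × ℝ → γ × ℝ) (hsnd : ∀ P, (f P).2 = P.2)
    {c : β × β} {c' : γ × γ} (hc' : c' ∈ S')
    (h1 : ∀ P, E.OnSide c.1 P → ∃ P', E'.OnSide c'.1 P' ∧ E'.Ident S' (f P) P')
    (h2 : ∀ P, E.mirror.OnSide c.2 P → ∃ P', E'.mirror.OnSide c'.2 P' ∧ E'.Ident S' (f P) P')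
    (hP : E.OnStrip c P) (hQ : E.OnStrip c Q) (hPQ : P.2 = Q.2) :
    E'.Ident S' (f P) (f Q) := by
  have key : ∀ P, E.OnStrip c P → ∃ P', E'.OnStrip c' P' ∧ E'.Ident S' (f P) P' := by
    rintro P (hP | hP)
    · obtain ⟨P', h3, h4⟩ := h1 P hP
      exact ⟨P', Or.inl h3, h4⟩
    · obtain ⟨P', h3, h4⟩ := h2 P hP
      exact ⟨P', Or.inr h3, h4⟩
  obtain ⟨P', h3, h4⟩ := key P hP
  obtain ⟨Q', h5, h6⟩ := key Q hQ
  refine (h4.trans (ident_of_strip hc' h3 h5 ?_)).trans h6.symm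
  rw [← h4.snd_eq hE', ← h6.snd_eq hE', hsnd, hsnd, hPQ]

namespace IsContraction

variable {E E' : WGraph β} {p z : β}

theorem _root_.WGraph.State.contractible (hE : State E M) (hp : p ∈ E.darts)
    (hk : E.kind p = .outgoing) (hW : E.W (E.opp p) = E.W p) : Contractible E M p :=
  { hE.toFrame with
    mem := hp
    outgoing := hk
    W_eq := hW
    rot_ne := fun h => by
      have := (hE.alt p hp).1
      rw [h] at this
      exact this (Or.inl hk) (Or.inl hk)
    rot_opp_ne := fun h => by
      have := (hE.alt _ (hE.opp_mem hp hk)).2 (hE.nl_opp hp hk)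
      rw [h] at this
      exact hE.nl_opp hp hk this }

theorem state (hc : IsContraction E E' p) (hE : State E M) (h : Contractible E M p) :
    State E' M where
  toFrame := hc.frame h
  alt d hd := by
    have hd' := hc.mem_iff.1 hd
    have hl : ∀ x, E'.Leaving x ↔ E.Leaving x := fun x => by simp [Leaving, hc.kind]
    have hp : E.Leaving p := Or.inl h.outgoing
    have hp' := hE.nl_opp h.mem h.outgoing
    have hd2 := hE.alt d hd'.2.2
    rw [hl, hl, hc.rot d hd]
    split_ifs with h1 h2
    · rw [h1] at hd2
      simp only [hp, true_iff] at hd2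
      simp [hd2, hE.leaving_rot (edge_opp h).1 hp']
    · rw [h2] at hd2
      simp only [hp', false_iff, not_not] at hd2
      simp [hd2, hE.nl_rot h.mem hp]
    · exact hd2
  anchor x hx := by
    have hl : ∀ x, E'.Leaving x ↔ E.Leaving x := fun x => by simp [Leaving, hc.kind]
    have hz := same_rot E.rot p
    obtain ⟨d, h1, h2, h3⟩ := hE.anchor x (hc.mem_iff.1 hx).2.2
    have hdp : d ≠ p := by rintro rfl; exact h2 (Or.inl h.outgoing)
    by_cases hdp' : d = E.opp p
    · obtain ⟨e, k1, k2, k3⟩ := hE.anchor p h.mem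
      have hep : e ≠ p := by rintro rfl; exact k2 (Or.inl h.outgoing)
      have hep' : e ≠ E.opp p := by rintro rfl; exact not_same h k3
      have hem : e ∈ E'.darts := hc.mem_iff.2 ⟨hep', hep, k1.1⟩
      refine ⟨e, hc.isEdge_iff.2 ⟨k1, hep, hep'⟩, by rwa [hl], ?_⟩
      have := (hc.same_iff h hz h.rot_ne (hc.mem_iff.1 hx).2.2 k1.1).2
        (Or.inr ⟨Or.inr (by rwa [hdp'] at h3), Or.inl k3.symm⟩)
      rwa [hc.map_of_mem hx, hc.map_of_mem hem] at this
    · have hdm : d ∈ E'.darts := hc.mem_iff.2 ⟨hdp', hdp, h1.1⟩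
      refine ⟨d, hc.isEdge_iff.2 ⟨h1, hdp, hdp'⟩, by rwa [hl], ?_⟩
      have := (hc.same_iff h hz h.rot_ne (hc.mem_iff.1 hx).2.2 h1.1).2 (Or.inl h3)
      rwa [hc.map_of_mem hx, hc.map_of_mem hdm] at this

theorem level_eq (hc : IsContraction E E' p) (h : Contractible E M p) (hx : x ∈ E'.darts)
    (hl : E.Leaving x) : E'.level x = E.level x := by
  have hx' := hc.mem_iff.1 hx
  rw [level, level, hc.kind, hc.opp]
  rcases hl with hk | hk
  · have he := h.isEdge_out hx'.2.2 hk
    have ho := opp_ne_of h he hx'.2.1 hx'.1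
    rw [hc.W _ (hc.mem_iff.2 ⟨ho.2, ho.1, h.opp_mem hx'.2.2 hk⟩)]
  · simp [hk]

theorem isPoint_iff (hc : IsContraction E E' p) (h : Contractible E M p)
    (hP : P.1 ∈ E'.darts) : E'.IsPoint P ↔ E.IsPoint P := by
  have hl : E'.Leaving P.1 ↔ E.Leaving P.1 := by simp [Leaving, hc.kind]
  simp only [IsPoint, hP, (hc.mem_iff.1 hP).2.2, hc.W _ hP, hl, true_and]
  refine or_congr_right (and_congr_right fun h1 => ?_)
  rw [hc.level_eq h hP h1]

/-- On the contracted edge there are no interior points. -/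
theorem snd_eq_of_isPoint (h : Contractible E M p) (hP : E.IsPoint P)
    (h1 : P.1 = p ∨ P.1 = E.opp p) : P.2 = E.W p := by
  rcases hP.2 with h2 | ⟨h2, h3, h4⟩
  · rw [h2]
    rcases h1 with h1 | h1 <;> rw [h1]
    exact h.W_eq
  · rcases h1 with h1 | h1
    · rw [h1] at h3 h4
      rw [level, h.outgoing, if_neg (by simp), h.W_eq] at h4
      exact absurd (EReal.coe_lt_coe_iff.1 h4) (not_lt.2 h3.le)
    · rw [h1, Leaving, h.kind_opp h.mem h.outgoing] at h2
      simp at h2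

theorem chain_f (hc : IsContraction E E' p) (hE : State E M) (h : Contractible E M p)
    (ha : a ∈ E.darts) (hk : E.kind a = .vertical) (hx : Chain E (E.rot a) x) :
    Chain E' (E'.rot a) (if x = p then E.rot (E.opp p) else x) := by
  have hnl : ∀ d ∈ E.darts, ¬ E.Leaving d → E.rot d ≠ E.opp p := fun d hd hl h1 =>
    hE.nl_opp h.mem h.outgoing (by rw [← h1]; exact hE.leaving_rot hd hl)
  have key : ∀ d ∈ E'.darts, ¬ E.Leaving d →
      E'.rot d = if E.rot d = p then E.rot (E.opp p) else E.rot d := by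
    intro d hd hl
    rw [hc.rot d hd, if_neg (hnl d (hc.mem_iff.1 hd).2.2 hl)]
  have hne : E.rot (E.opp p) ≠ p := fun h3 => not_same h (by
    have := (same_rot E.rot (E.opp p)).symm
    rwa [h3] at this)
  have hav := nl_of_vertical hk
  induction hx with
  | start =>
    rw [← key a (hc.mem_iff.2 ⟨?_, ?_, ha⟩) hav]
    · exact .start
    · rintro rfl; rw [h.kind_opp h.mem h.outgoing] at hk; cases hk
    · rintro rfl; rw [h.outgoing] at hk; cases hk
  | next o ho hko ih =>
    by_cases hop : o = p
    · rw [if_pos hop] at ih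
      rwa [hop, if_neg hne]
    · rw [if_neg hop] at ih
      have hom := (ho.mem hE (hE.rot_mem a ha) (hE.leaving_rot ha hav)).1
      have hop' : o ≠ E.opp p := by
        rintro rfl; rw [h.kind_opp h.mem h.outgoing] at hko; cases hko
      have h2 := opp_ne_of h (h.isEdge_out hom hko) hop hop'
      rw [← key (E.opp o) (hc.mem_iff.2 ⟨h2.2, h2.1, hE.opp_mem hom hko⟩)
        (hE.nl_opp hom hko)]
      have := Chain.next o ih (by rw [hc.kind]; exact hko)
      rwa [hc.opp] at this

theorem chain_h (hc : IsContraction E E' p) (hE : State E M) (h : Contractible E M p)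
    (ha : a ∈ E.darts) (hk : E.kind a = .vertical)
    (hx : Chain E' (E'.rot a) x) : Chain E (E.rot a) x := by
  have hnl : ∀ d ∈ E.darts, ¬ E.Leaving d → E.rot d ≠ E.opp p := fun d hd hl h1 =>
    hE.nl_opp h.mem h.outgoing (by rw [← h1]; exact hE.leaving_rot hd hl)
  have hav := nl_of_vertical hk
  have key : ∀ d ∈ E'.darts, ¬ E.Leaving d → Chain E (E.rot a) (E.rot d) →
      Chain E (E.rot a) (E'.rot d) := by
    intro d hd hl h1
    rw [hc.rot d hd, if_neg (hnl d (hc.mem_iff.1 hd).2.2 hl)]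
    split_ifs with h2
    · rw [h2] at h1
      exact h1.next p h.outgoing
    · exact h1
  have ha' : a ∈ E'.darts := by
    refine hc.mem_iff.2 ⟨?_, ?_, ha⟩
    · rintro rfl; rw [h.kind_opp h.mem h.outgoing] at hk; cases hk
    · rintro rfl; rw [h.outgoing] at hk; cases hk
  induction hx with
  | start => exact key a ha' hav .start
  | next o ho hko ih =>
    have hE' := hc.state hE h
    have hom := (ho.mem hE' (hE'.rot_mem a ha') (hE'.leaving_rot ha' (by
      rw [Leaving, hc.kind]; exact hav))).1
    have hko' : E.kind o = .outgoing := by rw [← hc.kind]; exact hko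
    have h1 := hE'.opp_mem hom hko
    rw [hc.opp] at h1 ⊢
    exact key _ h1 (hE.nl_opp (hc.mem_iff.1 hom).2.2 hko') (ih.next o hko')

/-- The map of points in the contraction of the edge of `p`. -/
def pointMap (E : WGraph β) (p z : β) (P : β × ℝ) : β × ℝ := (contractMap E p z P.1, P.2)

theorem pointMap_vertex (hc : IsContraction E E' p) (h : Contractible E M p)
    (hz : E.Same p z) (hzp : z ≠ p) (hd : d ∈ E.darts) :
    pointMap E p z (d, E.W d) = (contractMap E p z d, E'.W (contractMap E p z d)) := by
  rw [(hc.vertexMap h hz hzp).1.W d hd, pointMap]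

theorem side_f (hc : IsContraction E E' p) (hE : State E M) (h : Contractible E M p)
    (hz : E.Same p z) (hzp : z ≠ p) (S : Set (β × β)) (ha : a ∈ E.darts)
    (hk : E.kind a = .vertical) (hP : E.OnSide a P) :
    ∃ P', E'.OnSide a P' ∧ E'.Ident S (pointMap E p z P) P' := by
  have hF := hc.frame h
  have h1 := hc.chain_f hE h ha hk hP.2
  obtain ⟨x, w⟩ := P
  by_cases hx : x = p
  · subst hx
    have h0 : w = E.W x := snd_eq_of_isPoint h hP.1 (Or.inl rfl)
    subst h0
    rw [if_pos rfl] at h1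
    have hm : E.rot (E.opp x) ∈ E'.darts := by
      have h2 := hc.rot_mem h _ (hc.rot_inv_p_mem h)
      rwa [hc.rot_p _ (hc.rot_inv_p_mem h) (apply_inv _ _)] at h2
    have hs : E'.Same (contractMap E x z x) (E.rot (E.opp x)) := by
      have := (hc.same_iff h hz hzp h.mem (hc.mem_iff.1 hm).2.2).2
        (Or.inr ⟨Or.inl (.refl _ _), Or.inr (same_rot _ _).symm⟩)
      rwa [hc.map_of_mem hm] at this
    refine ⟨(E.rot (E.opp x), E'.W (E.rot (E.opp x))), ⟨isPoint_vertex hm, h1⟩, ?_⟩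
    rw [hc.pointMap_vertex h hz hzp h.mem]
    exact ident_of_same hF (hc.map_mem h hz hzp h.mem) hs
  · rw [if_neg hx] at h1
    have hm : x ∈ E'.darts := by
      refine hc.mem_iff.2 ⟨?_, hx, hP.1.1⟩
      rintro rfl
      exact hE.nl_opp h.mem h.outgoing
        (hP.2.mem hE (hE.rot_mem a ha) (hE.leaving_rot ha (nl_of_vertical hk))).2
    refine ⟨(x, w), ⟨(hc.isPoint_iff h hm).2 hP.1, h1⟩, ?_⟩
    rw [pointMap, hc.map_of_mem hm]
    exact ident_refl

theorem side_h (hc : IsContraction E E' p) (hE : State E M) (h : Contractible E M p)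
    (ha : a ∈ E.darts) (hk : E.kind a = .vertical) (hP : E'.OnSide a P) :
    E.OnSide a P :=
  ⟨(hc.isPoint_iff h hP.1.1).1 hP.1, hc.chain_h hE h ha hk hP.2⟩

/-- The contraction of an edge whose ends are identified by a half-strip is a folding. The dart `z`
represents the merged vertex. -/
def folding (hc : IsContraction E E' p) (hE : State E M) (h : Contractible E M p)
    (hz : E.Same p z) (hzp : z ≠ p) (hS : CornersOK E S)
    (hpp : E.Ident S (p, E.W p) (E.opp p, E.W (E.opp p))) :
    Folding E M S E' M S (fun a a' => a = a' ∧ a ∈ E.darts ∧ E.kind a = .vertical)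
      (fun a a' => a = a' ∧ a ∈ E'.darts) := by
  have hF := hc.frame h
  have hf : Hom E S E' S (fun a a' => a = a' ∧ a ∈ E.darts ∧ E.kind a = .vertical)
      (pointMap E p z) := by
    have hs1 : ∀ a P, a ∈ E.darts → E.kind a = .vertical → E.OnSide a P →
        ∃ P', E'.OnSide a P' ∧ E'.Ident S (pointMap E p z P) P' := fun a P ha hk hP =>
      hc.side_f hE h hz hzp S ha hk hP
    have hs2 : ∀ a P, a ∈ E.darts → E.kind a = .vertical → E.mirror.OnSide a P →
        ∃ P', E'.mirror.OnSide a P' ∧ E'.Ident S (pointMap E p z P) P' := fun a P ha hk hP => by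
      obtain ⟨P', h1, h2⟩ := (hc.mirror h).side_f hE.mirror h.mirror
        ((mirror_same E).2 hz) hzp (Prod.swap ⁻¹' S) ha hk hP
      exact ⟨P', h1, ident_mirror.1 h2⟩
    refine ⟨fun P => rfl, ?_, ?_, ?_, ?_, ?_, ?_⟩
    · rintro ⟨x, w⟩ hP
      by_cases hx : x ∈ E'.darts
      · rw [pointMap, hc.map_of_mem hx]
        exact (hc.isPoint_iff h hx).2 hP
      · have hx' : x = p ∨ x = E.opp p := by
          have := hP.1
          rw [hc.mem_iff] at hx; tauto
        have h0 : w = E.W x := by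
          have h1 : w = E.W p := snd_eq_of_isPoint h hP hx'
          rcases hx' with rfl | rfl
          · exact h1
          · rw [h1, h.W_eq]
        rw [h0, hc.pointMap_vertex h hz hzp hP.1]
        exact isPoint_vertex (hc.map_mem h hz hzp hP.1)
    · intro P Q hPQ
      refine ident_of_sides (pointMap E p z) ?_ ?_ hPQ
      · intro x hx y hy hxy
        rw [hc.pointMap_vertex h hz hzp hx, hc.pointMap_vertex h hz hzp hy]
        exact ident_of_same hF (hc.map_mem h hz hzp hx) (hc.same_map h hz hzp hx hxy)
      · intro c hcS P Q hP hQ hPQ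
        obtain ⟨h1, h2⟩ := hS c hcS
        exact ident_strip_of_sides hF (pointMap E p z) (fun _ => rfl) hcS
            (fun P => hs1 _ P h1.1 h1.2)
          (fun P => hs2 _ P h2.1 h2.2) hP hQ hPQ
    · intro d hd
      refine ⟨contractMap E p z d, hc.map_mem h hz hzp hd, ?_⟩
      rw [hc.pointMap_vertex h hz hzp hd]
      exact ident_refl
    · rintro a _ P ⟨rfl, ha, hk⟩ hP
      exact hs1 a P ha hk hP
    · rintro a _ P ⟨rfl, ha, hk⟩ hP
      exact hs2 a P ha hk hP
    · intro o ho hk hw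
      by_cases hop : o = p
      · left
        subst hop
        rw [hw, pointMap, pointMap]
        simp only [contractMap, true_or, or_true, if_true]
        exact ident_refl
      · right
        have hop' : o ≠ E.opp p := by
          rintro rfl; rw [h.kind_opp h.mem h.outgoing] at hk; cases hk
        have h2 := opp_ne_of h (h.isEdge_out ho hk) hop hop'
        have hom : o ∈ E'.darts := hc.mem_iff.2 ⟨hop', hop, ho⟩
        have hom' : E.opp o ∈ E'.darts := hc.mem_iff.2 ⟨h2.2, h2.1, h.opp_mem ho hk⟩
        refine ⟨o, hom, by rwa [hc.kind], by rw [hc.opp, hc.W _ hom, hc.W _ hom', hw], ?_, ?_⟩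
        · rw [hc.pointMap_vertex h hz hzp ho, hc.map_of_mem hom]
          exact ident_refl
        · rw [hc.pointMap_vertex h hz hzp (h.opp_mem ho hk), hc.map_of_mem hom', hc.opp]
          exact ident_refl
  have hh : Hom E' S E S
      (flip (fun a a' => a = a' ∧ a ∈ E.darts ∧ E.kind a = .vertical)) id := by
    have hs1 : ∀ a P, a ∈ E.darts → E.kind a = .vertical → E'.OnSide a P →
        ∃ P', E.OnSide a P' ∧ E.Ident S (id P) P' := fun a P ha hk hP =>
      ⟨P, hc.side_h hE h ha hk hP, ident_refl⟩
    have hs2 : ∀ a P, a ∈ E.darts → E.kind a = .vertical → E'.mirror.OnSide a P →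
        ∃ P', E.mirror.OnSide a P' ∧ E.Ident S (id P) P' := fun a P ha hk hP =>
      ⟨P, (hc.mirror h).side_h hE.mirror h.mirror ha hk hP, ident_refl⟩
    refine ⟨fun P => rfl, ?_, ?_, ?_, ?_, ?_, ?_⟩
    · intro P hP
      exact (hc.isPoint_iff h hP.1).1 hP
    · intro P Q hPQ
      refine ident_of_sides id ?_ ?_ hPQ
      · intro x hx y hy hxy
        have hx' := (hc.mem_iff.1 hx).2.2
        have hy' := (hc.mem_iff.1 hy).2.2
        simp only [id, hc.W x hx, hc.W y hy]
        rcases hc.of_same h hx hxy with h1 | ⟨h1, h2⟩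
        · exact ident_of_same h.toFrame hx' h1
        · have key : ∀ x ∈ E.darts, AtEnds E p x → E.Ident S (x, E.W x) (p, E.W p) := by
            rintro x hx (h1 | h1)
            · exact ident_of_same h.toFrame hx h1
            · exact (ident_of_same h.toFrame hx h1).trans hpp.symm
          exact (key x hx' h1).trans (key y hy' h2).symm
      · intro c hcS P Q hP hQ hPQ
        obtain ⟨h1, h2⟩ := hS c hcS
        exact ident_strip_of_sides h.toFrame id (fun _ => rfl) hcS (fun P => hs1 _ P h1.1 h1.2)
          (fun P => hs2 _ P h2.1 h2.2) hP hQ hPQ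
    · intro d hd
      exact ⟨d, (hc.mem_iff.1 hd).2.2, by rw [id, hc.W d hd]; exact ident_refl⟩
    · rintro a _ P ⟨rfl, ha, hk⟩ hP
      exact hs1 _ P ha hk hP
    · rintro a _ P ⟨rfl, ha, hk⟩ hP
      exact hs2 _ P ha hk hP
    · intro o ho hk hw
      right
      have hk' : E'.kind o = .outgoing := hk
      have h1 := hF.opp_mem ho hk'
      have h2 := hc.W _ ho
      have h3 := hc.W _ h1
      rw [hc.opp] at h1 h3 hw
      refine ⟨o, (hc.mem_iff.1 ho).2.2, by rwa [hc.kind] at hk, by rw [← h2, ← h3, hw], ?_, ?_⟩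
      · rw [id, h2]; exact ident_refl
      · rw [id, hc.opp, h3]; exact ident_refl
  have hvm : VertexMap E M E' M (fun d => (pointMap E p z (d, E.W d)).1) :=
    (hc.vertexMap h hz hzp).1
  refine ⟨pointMap E p z, id, hf, hh, ?_, ?_, hvm, ?_⟩
  · rintro ⟨x, w⟩ hP
    by_cases hx : x ∈ E'.darts
    · rw [id, pointMap, hc.map_of_mem hx]; exact ident_refl
    · have hx' : x = p ∨ x = E.opp p := by
        have := hP.1
        rw [hc.mem_iff] at hx; tauto
      have h0 : w = E.W p := snd_eq_of_isPoint h hP hx'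
      have h1 : contractMap E p z x = z := by rw [contractMap, if_pos hx']
      rw [id, pointMap, h1, h0]
      have h2 := (ident_of_same h.toFrame h.mem hz (S := S)).symm
      rw [h.W_same h.mem hz] at h2
      rcases hx' with rfl | rfl
      · exact h2
      · rw [h.W_eq] at hpp
        exact h2.trans hpp
  · rintro ⟨x, w⟩ hP
    rw [id, pointMap, hc.map_of_mem hP.1]; exact ident_refl
  · rintro d _ ⟨rfl, hd⟩
    simp only [pointMap, hc.map_of_mem hd]
    exact .refl _ _

end IsContraction

/-! ### Moving the slider past an edge -/

/-- `E'` arises from `E` when the slider `m`, standing between the first edges `p` and `q` of the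
two sides of the unzipped part, is moved to the end of `p`; the initial part of `q` is glued
to `p`. -/
structure IsSlide (E E' : WGraph β) (p m q : β) : Prop where
  darts : E'.darts = E.darts
  rot_p : E'.rot p = E.rot q
  rot_n : E'.rot (E.rot⁻¹ (E.opp p)) = m
  rot_q : E'.rot q = E.opp p
  rot_other : ∀ x ∈ E.darts, x ≠ p → x ≠ q → x ≠ E.rot⁻¹ (E.opp p) → E'.rot x = E.rot x
  opp : E'.opp = E.opp
  kind : E'.kind = E.kind
  H : E'.H = E.H
  W_q : E'.W q = E.W (E.opp p)
  W_m : E'.W m = E.W (E.opp p)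
  W_other : ∀ x ∈ E.darts, x ≠ q → x ≠ m → E'.W x = E.W x

/-- The conditions under which the slider `m` can be moved past the edge `p`: the end of `p` is not
higher than that of `q`. If the ends are on the same level, then an edge of zero weight is left of
`q`, which is contracted afterwards. -/
structure Slidable (E : WGraph β) (M : Set β) (p m q : β) : Prop extends State E M where
  slider : m ∈ M
  rot_p : E.rot p = m
  rot_m : E.rot m = q
  kind_p : E.kind p = .outgoing
  W_lt : E.W p < E.W (E.opp p)
  level_le : E.level p ≤ E.level q
  ne : p ≠ q

namespace Slidable

variable {p m q : β}

theorem m_mem (h : Slidable E M p m q) : m ∈ E.darts := h.slider_mem m h.slider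

theorem m_kind (h : Slidable E M p m q) : E.kind m = .vertical := h.slider_kind m h.slider

theorem m_nl (h : Slidable E M p m q) : ¬ E.Leaving m := nl_of_vertical h.m_kind

theorem inv_m (h : Slidable E M p m q) : E.rot⁻¹ m = p := by rw [← h.rot_p, inv_apply]

theorem p_mem (h : Slidable E M p m q) : p ∈ E.darts := by
  rw [← h.inv_m]; exact h.rot_inv_mem h.m_mem

theorem q_mem (h : Slidable E M p m q) : q ∈ E.darts := by
  rw [← h.rot_m]; exact h.rot_mem m h.m_mem

theorem p_l (h : Slidable E M p m q) : E.Leaving p := Or.inl h.kind_p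

theorem q_l (h : Slidable E M p m q) : E.Leaving q := by
  rw [← h.rot_m]; exact h.leaving_rot h.m_mem h.m_nl

theorem p'_mem (h : Slidable E M p m q) : E.opp p ∈ E.darts := h.opp_mem h.p_mem h.kind_p

theorem p'_kind (h : Slidable E M p m q) : E.kind (E.opp p) = .incoming :=
  h.kind_opp h.p_mem h.kind_p

theorem p'_nl (h : Slidable E M p m q) : ¬ E.Leaving (E.opp p) :=
  nl_of_incoming h.p'_kind

theorem n_mem (h : Slidable E M p m q) : E.rot⁻¹ (E.opp p) ∈ E.darts := h.rot_inv_mem h.p'_mem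

theorem n_l (h : Slidable E M p m q) : E.Leaving (E.rot⁻¹ (E.opp p)) :=
  h.leaving_rot_inv h.p'_mem h.p'_nl

theorem same_pm (h : Slidable E M p m q) : E.Same p m := by
  rw [← h.rot_p]; exact same_rot _ _

theorem same_mq (h : Slidable E M p m q) : E.Same m q := by
  rw [← h.rot_m]; exact same_rot _ _

theorem same_pq (h : Slidable E M p m q) : E.Same p q := h.same_pm.trans h.same_mq

theorem not_same (h : Slidable E M p m q) : ¬ E.Same p (E.opp p) :=
  h.not_same_opp (h.isEdge_out h.p_mem h.kind_p)

theorem same_n (_h : Slidable E M p m q) : E.Same (E.opp p) (E.rot⁻¹ (E.opp p)) :=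
  same_rot_inv _ _

theorem n_ne_p (h : Slidable E M p m q) : E.rot⁻¹ (E.opp p) ≠ p := fun k =>
  h.not_same (by have := h.same_n.symm; rwa [k] at this)

theorem n_ne_q (h : Slidable E M p m q) : E.rot⁻¹ (E.opp p) ≠ q := fun k =>
  h.not_same (h.same_pq.trans (by have := h.same_n.symm; rwa [k] at this))

theorem ne_of_l (h : Slidable E M p m q) (hx : E.Leaving x) : x ≠ m ∧ x ≠ E.opp p :=
  ⟨fun k => h.m_nl (k ▸ hx), fun k => h.p'_nl (k ▸ hx)⟩

theorem ne_of_nl (h : Slidable E M p m q) (hx : ¬ E.Leaving x) :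
    x ≠ p ∧ x ≠ q ∧ x ≠ E.rot⁻¹ (E.opp p) :=
  ⟨fun k => hx (k ▸ h.p_l), fun k => hx (k ▸ h.q_l), fun k => hx (k ▸ h.n_l)⟩

theorem p'_ne_m (h : Slidable E M p m q) : E.opp p ≠ m := fun k => by
  have := h.p'_kind; rw [k, h.m_kind] at this; cases this

theorem W_m (h : Slidable E M p m q) : E.W m = E.W p := h.W_same h.p_mem h.same_pm

theorem W_q (h : Slidable E M p m q) : E.W q = E.W p := h.W_same h.p_mem h.same_pq

theorem level_p (h : Slidable E M p m q) : E.level p = (E.W (E.opp p) : EReal) := by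
  simp [level, h.kind_p]

theorem W_le_opp_q (h : Slidable E M p m q) (hk : E.kind q = .outgoing) :
    E.W (E.opp p) ≤ E.W (E.opp q) := by
  have := h.level_le
  rw [h.level_p, level, hk, if_neg (by simp)] at this
  exact EReal.coe_le_coe_iff.1 this

/-- The edge `q` is not on the other side of the unzipped part. -/
theorem not_chain_q (h : Slidable E M p m q) : ¬ Chain E.mirror p q := fun hq =>
  h.ne (hq.eq_of_same h.toState.mirror h.p_mem ((mirror_same E).2 h.same_pq)).symm

theorem not_chain_p (h : Slidable E M p m q) : ¬ Chain E.mirror (E.rot⁻¹ (E.opp p)) p := fun hp =>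
  h.n_ne_p (hp.antisymm h.toState.mirror h.n_mem (Chain.next _ .start h.kind_p)).symm

theorem chain_n (h : Slidable E M p m q) (hx : Chain E.mirror (E.rot⁻¹ (E.opp p)) x) :
    Chain E.mirror p x := Chain.trans (Chain.next _ .start h.kind_p) hx

/-- A leaving dart on the first side is not the beginning of the side of another half-strip. -/
theorem root_eq (h : Slidable E M p m q) (ha : a ∈ E.darts)
    (hk : E.kind a = .vertical) (hq : Chain E (E.rot a) q) : a = m :=
  Chain.root_unique h.toState ha h.m_mem hk h.m_kind hq (by rw [h.rot_m]; exact .start)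

theorem root_eq_mirror (h : Slidable E M p m q) (ha : a ∈ E.darts)
    (hk : E.kind a = .vertical) (hp : Chain E.mirror (E.rot⁻¹ a) p) : a = m :=
  Chain.root_unique h.toState.mirror ha h.m_mem hk h.m_kind hp
    (by rw [mirror_rot, h.inv_m]; exact .start)

end Slidable

namespace IsSlide

variable {E E' : WGraph β} {p m q : β}

/-- A dart at the vertex of `x` in the original graph, represented in the graph after the move: the
darts `m` and `q`, which are moved away, are replaced by `p`. -/
def fw (p m q x : β) : β := if x = m ∨ x = q then p else x

/-- A dart at the vertex of `x` in the graph after the move, represented in the original graph: the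
darts `m` and `q`, which have arrived at the end of `p`, are replaced by the opposite of `p`. -/
def bw (E : WGraph β) (p m q x : β) : β := if x = m ∨ x = q then E.opp p else x

theorem leaving (hs : IsSlide E E' p m q) (x : β) : E'.Leaving x ↔ E.Leaving x := by
  simp [Leaving, hs.kind]

theorem isEdge (hs : IsSlide E E' p m q) (x : β) : E'.IsEdge M x ↔ E.IsEdge M x := by
  simp [IsEdge, hs.kind, hs.darts]

theorem rot_nl (hs : IsSlide E E' p m q) (h : Slidable E M p m q) (hx : x ∈ E.darts)
    (hl : ¬ E.Leaving x) : E'.rot x = E.rot x :=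
  hs.rot_other x hx (h.ne_of_nl hl).1 (h.ne_of_nl hl).2.1 (h.ne_of_nl hl).2.2

theorem rot_cases (hs : IsSlide E E' p m q) (x : β) (hx : x ∈ E.darts) {Q : β → β → Prop}
    (h1 : Q p (E.rot q)) (h2 : Q (E.rot⁻¹ (E.opp p)) m) (h3 : Q q (E.opp p))
    (h4 : x ≠ p → x ≠ q → x ≠ E.rot⁻¹ (E.opp p) → Q x (E.rot x)) : Q x (E'.rot x) := by
  by_cases hp : x = p
  · rw [hp, hs.rot_p]; exact h1
  by_cases hn : x = E.rot⁻¹ (E.opp p)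
  · rw [hn, hs.rot_n]; exact h2
  by_cases hq : x = q
  · rw [hq, hs.rot_q]; exact h3
  rw [hs.rot_other x hx hp hq hn]
  exact h4 hp hq hn

theorem rot_mem (hs : IsSlide E E' p m q) (h : Slidable E M p m q) :
    ∀ d ∈ E'.darts, E'.rot d ∈ E'.darts := by
  rw [hs.darts]
  intro d hd
  exact hs.rot_cases d hd (Q := fun _ y => y ∈ E.darts) (h.rot_mem _ h.q_mem) h.m_mem h.p'_mem
    fun _ _ _ => h.rot_mem d hd

theorem same'_q (hs : IsSlide E E' p m q) : E'.Same q (E.opp p) := by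
  rw [← hs.rot_q]; exact same_rot _ _

theorem same'_m (hs : IsSlide E E' p m q) (h : Slidable E M p m q) :
    E'.Same m (E.opp p) := by
  have h1 := same_rot E'.rot m
  rw [hs.rot_nl h h.m_mem h.m_nl, h.rot_m] at h1
  exact h1.trans hs.same'_q

theorem same_fw (hs : IsSlide E E' p m q) (h : Slidable E M p m q) (hx : x ∈ E.darts)
    (hxy : E.Same x y) : E'.Same (fw p m q x) (fw p m q y) := by
  have hm : fw p m q m = p := by simp [fw]
  have hq : fw p m q q = p := by simp [fw]
  have ho : ∀ x, x ≠ m → x ≠ q → fw p m q x = x := fun x h1 h2 => by simp [fw, h1, h2]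
  refine sameCycle_map h.rot_mem _ (fun x hx => ?_) hx hxy
  by_cases hxm : x = m
  · rw [hxm, h.rot_m, hm, hq]
  by_cases hxq : x = q
  · have h1 := h.nl_rot h.q_mem h.q_l
    rw [hxq, hq, ho (E.rot q) ?_ (h.ne_of_nl h1).2.1, ← hs.rot_p]
    · exact same_rot _ _
    · intro k
      rw [← h.rot_p] at k
      exact h.ne (E.rot.injective k).symm
  rw [ho x hxm hxq]
  by_cases hxp : x = p
  · rw [hxp, h.rot_p, hm]
  have h1 : E.rot x ≠ m := fun k => hxp (E.rot.injective (k.trans h.rot_p.symm))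
  have h2 : E.rot x ≠ q := fun k => hxm (E.rot.injective (k.trans h.rot_m.symm))
  rw [ho _ h1 h2]
  by_cases hxn : x = E.rot⁻¹ (E.opp p)
  · have h3 := same_rot E'.rot x
    rw [hxn, hs.rot_n, ← hxn] at h3
    have : E.rot x = E.opp p := by rw [hxn, apply_inv]
    rw [this]
    exact h3.trans (hs.same'_m h)
  · rw [← hs.rot_other x hx hxp hxq hxn]
    exact same_rot _ _

theorem same_bw (hs : IsSlide E E' p m q) (h : Slidable E M p m q) (hx : x ∈ E.darts)
    (hxy : E'.Same x y) : E.Same (bw E p m q x) (bw E p m q y) := by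
  have hm : bw E p m q m = E.opp p := by simp [bw]
  have hq : bw E p m q q = E.opp p := by simp [bw]
  have ho : ∀ x, x ≠ m → x ≠ q → bw E p m q x = x := fun x h1 h2 => by simp [bw, h1, h2]
  refine sameCycle_map (hs.rot_mem h) _ (fun x hx => ?_) (by rw [hs.darts]; exact hx) hxy
  rw [hs.darts] at hx
  have hp' := ho (E.opp p) h.p'_ne_m (h.ne_of_nl h.p'_nl).2.1
  have hpm : p ≠ m := (h.ne_of_l h.p_l).1
  refine hs.rot_cases x hx (Q := fun x y => E.Same (bw E p m q x) (bw E p m q y)) ?_ ?_ ?_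
    fun hxp hxq hxn => ?_
  · have h1 := h.nl_rot h.q_mem h.q_l
    rw [ho p hpm h.ne, ho (E.rot q) ?_ (h.ne_of_nl h1).2.1]
    · exact h.same_pq.trans (same_rot _ _)
    · intro k
      rw [← h.rot_p] at k
      exact h.ne (E.rot.injective k).symm
  · rw [ho _ (h.ne_of_l h.n_l).1 h.n_ne_q, hm]
    exact h.same_n.symm
  · rw [hq, hp']
  · by_cases hxm : x = m
    · rw [hxm, h.rot_m, hm, hq]
    have h1 : E.rot x ≠ m := fun k => hxp (E.rot.injective (k.trans h.rot_p.symm))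
    have h2 : E.rot x ≠ q := fun k => hxm (E.rot.injective (k.trans h.rot_m.symm))
    rw [ho _ h1 h2, ho x hxm hxq]
    exact same_rot _ _

theorem fw_mem (h : Slidable E M p m q) (hx : x ∈ E.darts) : fw p m q x ∈ E.darts := by
  rw [fw]; split_ifs
  · exact h.p_mem
  · exact hx

theorem same_fw_self (h : Slidable E M p m q) (x : β) : E.Same x (fw p m q x) := by
  rw [fw]; split_ifs with h1
  · rcases h1 with rfl | rfl
    · exact h.same_pm.symm
    · exact h.same_pq.symm
  · exact .refl _ _

theorem fw_ne (h : Slidable E M p m q) (x : β) : fw p m q x ≠ m ∧ fw p m q x ≠ q := by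
  rw [fw]; split_ifs with h1
  · exact ⟨(h.ne_of_l h.p_l).1, h.ne⟩
  · push Not at h1; exact h1

theorem same_fw_iff (hs : IsSlide E E' p m q) (h : Slidable E M p m q)
    (hx : x ∈ E.darts) :
    E'.Same (fw p m q x) (fw p m q y) ↔ E.Same x y := by
  refine ⟨fun h1 => ?_, hs.same_fw h hx⟩
  have h2 := hs.same_bw h (fw_mem h hx) h1
  have ho : ∀ x, bw E p m q (fw p m q x) = fw p m q x := fun x => by
    have := fw_ne h x
    rw [bw, if_neg (by tauto)]
  rw [ho, ho] at h2
  exact ((same_fw_self h x).trans h2).trans (same_fw_self h y).symm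

theorem vertexMap (hs : IsSlide E E' p m q) (h : Slidable E M p m q) :
    VertexMap E M E' M (fw p m q) ∧ E'.verts.card = E.verts.card := by
  have hfix : ∀ x, x ≠ m → x ≠ q → fw p m q x = x := fun x h1 h2 => by simp [fw, h1, h2]
  refine vertexMap_of_bijective (fun d hd => by rw [hs.darts]; exact fw_mem h hd)
    (fun d hd e he => (hs.same_fw_iff h hd).symm) (fun d hd => ?_) (fun d hd => ?_)
    (fun d hd => ?_)
  · rw [hs.darts] at hd
    have hp' := hfix (E.opp p) h.p'_ne_m (h.ne_of_nl h.p'_nl).2.1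
    by_cases h1 : d = m
    · exact ⟨E.opp p, h.p'_mem, by rw [hp', h1]; exact (hs.same'_m h).symm⟩
    by_cases h2 : d = q
    · exact ⟨E.opp p, h.p'_mem, by rw [hp', h2]; exact hs.same'_q.symm⟩
    · exact ⟨d, hd, by rw [hfix d h1 h2]⟩
  · rw [hs.W_other _ (fw_mem h hd) (fw_ne h d).2 (fw_ne h d).1]
    exact h.W_same hd (same_fw_self h d)
  · have key : ∀ x, x ≠ m → x ≠ q → (x ∈ E'.vert (fw p m q d) ↔ x ∈ E.vert d) := by
      intro x h1 h2
      rw [mem_vert, mem_vert, hs.darts, ← hs.same_fw_iff h hd, hfix x h1 h2]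
    refine ordM_congr (fun x => ?_) (fun x => ?_)
    · rw [hs.kind]
      refine and_congr_left fun ⟨h1, h2⟩ => key x ?_ (h.ne_of_nl (nl_of_vertical h1)).2.1
      rintro rfl; exact h2 h.slider
    · rw [hs.kind]
      refine and_congr_left fun h1 => key x ?_ (h.ne_of_nl (nl_of_incoming h1)).2.1
      rintro rfl; rw [h.m_kind] at h1; cases h1

theorem state (hs : IsSlide E E' p m q) (h : Slidable E M p m q) : State E' M where
  rot_mem := hs.rot_mem h
  slider_mem m hm := by rw [hs.darts]; exact h.slider_mem m hm
  slider_kind m hm := by rw [hs.kind]; exact h.slider_kind m hm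
  opp_edge d hd := by rw [hs.opp, hs.isEdge]; exact h.opp_edge d ((hs.isEdge d).1 hd)
  opp_opp d hd := by rw [hs.opp]; exact h.opp_opp d ((hs.isEdge d).1 hd)
  opp_ne d hd := by rw [hs.opp]; exact h.opp_ne d ((hs.isEdge d).1 hd)
  kind_vertical d hd := by rw [hs.opp, hs.kind]; exact h.kind_vertical d ((hs.isEdge d).1 hd)
  kind_outgoing d hd := by rw [hs.opp, hs.kind]; exact h.kind_outgoing d ((hs.isEdge d).1 hd)
  kind_incoming d hd := by rw [hs.opp, hs.kind]; exact h.kind_incoming d ((hs.isEdge d).1 hd)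
  W_rot d hd := by
    rw [hs.darts] at hd
    have hpm := (h.ne_of_l h.p_l).1
    refine hs.rot_cases d hd (Q := fun x y => E'.W y = E'.W x) ?_ ?_ ?_ fun h1 h2 h3 => ?_
    · have h1 := h.nl_rot h.q_mem h.q_l
      rw [hs.W_other _ (h.rot_mem q h.q_mem) (h.ne_of_nl h1).2.1 (fun k => h.ne
        (E.rot.injective (k.trans h.rot_p.symm)).symm), hs.W_other p h.p_mem h.ne hpm,
        h.W_rot q h.q_mem, h.W_q]
    · rw [hs.W_m, hs.W_other _ h.n_mem h.n_ne_q (h.ne_of_l h.n_l).1, h.W_same h.p'_mem h.same_n]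
    · rw [hs.W_q, hs.W_other _ h.p'_mem (h.ne_of_nl h.p'_nl).2.1 h.p'_ne_m]
    · by_cases hdm : d = m
      · rw [hdm, h.rot_m, hs.W_q, hs.W_m]
      · rw [hs.W_other d hd h2 hdm, hs.W_other _ (h.rot_mem d hd)
          (fun k => hdm (E.rot.injective (k.trans h.rot_m.symm)))
          (fun k => h1 (E.rot.injective (k.trans h.rot_p.symm))), h.W_rot d hd]
  W_le d hd hk := by
    rw [hs.darts] at hd
    rw [hs.kind] at hk
    have h1 := h.nl_opp hd hk
    have h2 : E.opp d ≠ m := fun k => by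
      have := h.kind_opp hd hk
      rw [k, h.m_kind] at this; cases this
    rw [hs.opp, hs.W_other _ (h.opp_mem hd hk) (h.ne_of_nl h1).2.1 h2]
    by_cases hdq : d = q
    · rw [hdq] at hk ⊢
      rw [hs.W_q]; exact h.W_le_opp_q hk
    · rw [hs.W_other d hd hdq (h.ne_of_l (Or.inl hk)).1]
      exact h.W_le d hd hk
  W_vertical d hd hk := by
    rw [hs.kind] at hk
    rw [hs.isEdge] at hd
    rw [hs.W_other d hd.1 (h.ne_of_nl (nl_of_vertical hk)).2.1
      (fun k => hd.2.2 (k ▸ h.slider))]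
    exact h.W_vertical d hd hk
  H_opp d hd := by rw [hs.kind, hs.opp, hs.H]; exact h.H_opp d ((hs.isEdge d).1 hd)
  H_nonneg d hd := by rw [hs.kind, hs.H]; exact h.H_nonneg d ((hs.isEdge d).1 hd)
  conn d hd e he := by
    rw [hs.darts] at hd he
    have hedge : ∀ x, E.IsEdge M x → EqvGen (E'.Link M) x (E.opp x) := fun x hx =>
      EqvGen.rel _ _ (Or.inr ⟨(hs.isEdge x).2 hx, by rw [hs.opp]⟩)
    have hsame : ∀ x y, E'.Same x y → EqvGen (E'.Link M) x y := fun x y hxy =>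
      sameCycle_eqvGen (R := E'.Link M) (fun _ => Or.inl rfl) hxy
    have hpp := hedge p (h.isEdge_out h.p_mem h.kind_p)
    have hself : ∀ x, EqvGen (E'.Link M) x (fw p m q x) := by
      intro x
      rw [fw]
      split_ifs with h1
      · refine EqvGen.symm _ _ (hpp.trans _ _ _ (EqvGen.symm _ _ ?_))
        rcases h1 with rfl | rfl
        · exact hsame _ _ (hs.same'_m h)
        · exact hsame _ _ hs.same'_q
      · exact EqvGen.refl _
    refine eqvGen_le_of (equivalence_eqvGen _) ?_ hd (h.conn d hd e he)
    rintro x y (rfl | ⟨hx, rfl⟩)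
    · refine ⟨(perm_mem_iff h.rot_mem x).symm, fun hx => ?_⟩
      exact ((hself x).trans _ _ _ (hsame _ _ (hs.same_fw h hx (same_rot _ _)))).trans _ _ _
        (EqvGen.symm _ _ (hself _))
    · exact ⟨⟨fun _ => (h.opp_edge x hx).1, fun _ => hx.1⟩, fun _ => hedge x hx⟩
  count := by
    rw [(hs.vertexMap h).2, h.count]
    have : E'.edgesM M = E.edgesM M := by
      rw [edgesM, edgesM, hs.darts, hs.opp]
      congr 1
      ext x
      simp only [mem_filter, hs.isEdge]
    rw [this]
  alt d hd := by
    rw [hs.darts] at hd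
    rw [hs.leaving, hs.leaving]
    refine hs.rot_cases d hd (Q := fun x y => E.Leaving y ↔ ¬ E.Leaving x) ?_ ?_ ?_
      fun _ _ _ => h.alt d hd
    · simp [h.p_l, h.nl_rot h.q_mem h.q_l]
    · exact iff_of_false h.m_nl (not_not.2 h.n_l)
    · simp [h.p'_nl, h.q_l]
  anchor x hx := by
    rw [hs.darts] at hx
    by_cases h1 : x = m ∨ x = q
    · refine ⟨E.opp p, (hs.isEdge _).2 (h.opp_edge p (h.isEdge_out h.p_mem h.kind_p)),
        by rw [hs.leaving]; exact h.p'_nl, ?_⟩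
      rcases h1 with rfl | rfl
      · exact hs.same'_m h
      · exact hs.same'_q
    · obtain ⟨d, hd, hl, hxd⟩ := h.anchor x hx
      refine ⟨d, (hs.isEdge d).2 hd, by rwa [hs.leaving], ?_⟩
      have := hs.same_fw h hx hxd
      rwa [fw, fw, if_neg h1, if_neg] at this
      rintro (k | k)
      · exact hd.2.2 (k ▸ h.slider)
      · exact (h.ne_of_nl hl).2.1 k

end IsSlide

/-! ### The folding defined by a move of the slider -/

namespace IsSlide

variable {E E' : WGraph β} {p m q : β}

/-- The initial part of the edge `q` is glued to the edge `p`. -/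
def glueMap (E : WGraph β) (p m q : β) (P : β × ℝ) : β × ℝ :=
  if P.1 = m ∨ (P.1 = q ∧ P.2 < E.W (E.opp p)) then (p, P.2) else P

/-- The points of the graph obtained by a move of the slider, as points of the original graph. -/
def liftMap (E : WGraph β) (p m q : β) (P : β × ℝ) : β × ℝ :=
  if P.1 = m ∨ (P.1 = q ∧ P.2 = E.W (E.opp p)) then (E.opp p, P.2) else P

theorem glueMap_of_ne (h1 : x ≠ m) (h2 : x ≠ q) :
    glueMap E p m q (x, w) = (x, w) := by simp [glueMap, h1, h2]

theorem liftMap_of_ne (h1 : x ≠ m) (h2 : x ≠ q) :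
    liftMap E p m q (x, w) = (x, w) := by simp [liftMap, h1, h2]

theorem glueMap_vertex (hs : IsSlide E E' p m q) (h : Slidable E M p m q)
    (hd : d ∈ E.darts) : glueMap E p m q (d, E.W d) = (fw p m q d, E'.W (fw p m q d)) := by
  have hW := (hs.vertexMap h).1.W d hd
  rw [hW, glueMap, fw]
  by_cases h1 : d = m
  · rw [if_pos (Or.inl h1), if_pos (Or.inl h1)]
  by_cases h2 : d = q
  · have : E.W d < E.W (E.opp p) := by rw [h2, h.W_q]; exact h.W_lt
    rw [if_pos (Or.inr ⟨h2, this⟩), if_pos (Or.inr h2)]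
  · rw [if_neg (by tauto), if_neg (by tauto)]

theorem W_bw (hs : IsSlide E E' p m q) (_h : Slidable E M p m q) (hd : d ∈ E.darts) :
    E.W (bw E p m q d) = E'.W d := by
  rw [bw]
  split_ifs with h1
  · rcases h1 with rfl | rfl
    · rw [hs.W_m]
    · rw [hs.W_q]
  · push Not at h1
    rw [hs.W_other d hd h1.2 h1.1]

theorem liftMap_vertex (hs : IsSlide E E' p m q) (h : Slidable E M p m q)
    (hd : d ∈ E.darts) : liftMap E p m q (d, E'.W d) = (bw E p m q d, E.W (bw E p m q d)) := by
  rw [hs.W_bw h hd, liftMap, bw]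
  by_cases h1 : d = m
  · rw [if_pos (Or.inl h1), if_pos (Or.inl h1)]
  by_cases h2 : d = q
  · have : E'.W d = E.W (E.opp p) := by rw [h2, hs.W_q]
    rw [if_pos (Or.inr ⟨h2, this⟩), if_pos (Or.inr h2)]
  · rw [if_neg (by tauto), if_neg (by tauto)]

theorem bw_mem (h : Slidable E M p m q) (hd : d ∈ E.darts) : bw E p m q d ∈ E.darts := by
  rw [bw]; split_ifs
  · exact h.p'_mem
  · exact hd

theorem level_eq (hs : IsSlide E E' p m q) (h : Slidable E M p m q) (hx : x ∈ E.darts)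
    (hl : E.Leaving x) : E'.level x = E.level x := by
  rw [level, level, hs.kind, hs.opp]
  rcases hl with hk | hk
  · have h1 := h.opp_mem hx hk
    have h2 := h.nl_opp hx hk
    have h3 : E.opp x ≠ m := fun k => by
      have := h.kind_opp hx hk
      rw [k, h.m_kind] at this; cases this
    rw [hs.W_other _ h1 (h.ne_of_nl h2).2.1 h3]
  · simp [hk]

theorem isPoint_iff (hs : IsSlide E E' p m q) (h : Slidable E M p m q)
    (hm : x ≠ m) (hq : x ≠ q) : E'.IsPoint (x, w) ↔ E.IsPoint (x, w) := by
  simp only [IsPoint, hs.darts, hs.leaving]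
  refine and_congr_right fun hx => ?_
  rw [hs.W_other x hx hq hm]
  refine or_congr_right (and_congr_right fun h1 => ?_)
  rw [hs.level_eq h hx h1]

theorem isPoint_q (hs : IsSlide E E' p m q) (h : Slidable E M p m q) :
    E'.IsPoint (q, w) ↔ w = E.W (E.opp p) ∨ (E.W (E.opp p) < w ∧ (w : EReal) < E.level q) := by
  simp only [IsPoint, hs.darts, hs.leaving, hs.W_q, h.q_l, hs.level_eq h h.q_mem h.q_l, h.q_mem,
    true_and]

theorem isPoint_q' (h : Slidable E M p m q) :
    E.IsPoint (q, w) ↔ w = E.W p ∨ (E.W p < w ∧ (w : EReal) < E.level q) := by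
  simp only [IsPoint, h.W_q, h.q_l, h.q_mem, true_and]

theorem isPoint_p (h : Slidable E M p m q) :
    E.IsPoint (p, w) ↔ E.W p ≤ w ∧ w < E.W (E.opp p) := by
  simp only [IsPoint, h.p_l, h.p_mem, true_and, h.level_p, EReal.coe_lt_coe_iff]
  constructor
  · rintro (rfl | ⟨h1, h2⟩)
    · exact ⟨le_rfl, h.W_lt⟩
    · exact ⟨h1.le, h2⟩
  · rintro ⟨h1, h2⟩
    rcases h1.eq_or_lt with h3 | h3
    · exact Or.inl h3.symm
    · exact Or.inr ⟨h3, h2⟩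

theorem snd_of_m (h : Slidable E M p m q) (E₁ : WGraph β) (hk : E₁.kind = E.kind)
    (hP : E₁.IsPoint (m, w)) : w = E₁.W m := by
  rcases hP.2 with h1 | ⟨h1, -⟩
  · exact h1
  · exact absurd h1 (by rw [Leaving, hk]; exact h.m_nl)

theorem W_le_snd (hP : E.IsPoint P) : E.W P.1 ≤ P.2 := by
  rcases hP.2 with h1 | ⟨-, h1, -⟩
  · exact h1.ge
  · exact h1.le

theorem glueMap_isPoint (hs : IsSlide E E' p m q) (h : Slidable E M p m q)
    (hP : E.IsPoint P) : E'.IsPoint (glueMap E p m q P) := by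
  obtain ⟨x, w⟩ := P
  have hp := hs.isPoint_iff h (x := p) (w := w) (h.ne_of_l h.p_l).1 h.ne
  by_cases h1 : x = m
  · subst h1
    rw [glueMap, if_pos (Or.inl rfl), hp, isPoint_p h, snd_of_m h E rfl hP, h.W_m]
    exact ⟨le_rfl, h.W_lt⟩
  by_cases h2 : x = q
  · subst h2
    have h3 := W_le_snd hP
    rw [h.W_q] at h3
    by_cases h4 : w < E.W (E.opp p)
    · rw [glueMap, if_pos (Or.inr ⟨rfl, h4⟩), hp, isPoint_p h]
      exact ⟨h3, h4⟩
    · rw [glueMap, if_neg (by tauto), hs.isPoint_q h]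
      rcases (isPoint_q' h).1 hP with h5 | h5
      · exact absurd (h5 ▸ h.W_lt) h4
      · rcases (not_lt.1 h4).eq_or_lt with h6 | h6
        · exact Or.inl h6.symm
        · exact Or.inr ⟨h6, h5.2⟩
  · rw [glueMap_of_ne h1 h2, hs.isPoint_iff h h1 h2]; exact hP

theorem isPoint_q_of (hs : IsSlide E E' p m q) (h : Slidable E M p m q)
    (hP : E'.IsPoint (q, w)) (hw : w ≠ E.W (E.opp p)) : E.IsPoint (q, w) := by
  rcases (hs.isPoint_q h).1 hP with h5 | h5
  · exact absurd h5 hw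
  · exact (isPoint_q' h).2 (Or.inr ⟨h.W_lt.trans h5.1, h5.2⟩)

theorem liftMap_isPoint (hs : IsSlide E E' p m q) (h : Slidable E M p m q)
    (hP : E'.IsPoint P) : E.IsPoint (liftMap E p m q P) := by
  obtain ⟨x, w⟩ := P
  by_cases h1 : x = m
  · subst h1
    rw [liftMap, if_pos (Or.inl rfl), snd_of_m h E' hs.kind hP, hs.W_m]
    exact isPoint_vertex h.p'_mem
  by_cases h2 : x = q
  · subst h2
    by_cases h4 : w = E.W (E.opp p)
    · rw [liftMap, if_pos (Or.inr ⟨rfl, h4⟩), h4]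
      exact isPoint_vertex h.p'_mem
    · rw [liftMap, if_neg (by tauto)]
      exact hs.isPoint_q_of h hP h4
  · rw [liftMap_of_ne h1 h2, ← hs.isPoint_iff h h1 h2]; exact hP

/-! #### Chains -/

theorem chain (hs : IsSlide E E' p m q) (h : Slidable E M p m q) {s : β} (hsm : s ∈ E.darts)
    (hl : E.Leaving s) (hx : Chain E s x) : Chain E' s x := by
  induction hx with
  | start => exact .start
  | next o ho hk ih =>
    have ho' := (ho.mem h.toState hsm hl).1
    have := ih.next o (by rw [hs.kind]; exact hk)
    rwa [hs.opp, hs.rot_nl h (h.opp_mem ho' hk) (h.nl_opp ho' hk)] at this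

theorem chain' (hs : IsSlide E E' p m q) (h : Slidable E M p m q) {s : β} (hsm : s ∈ E.darts)
    (hl : E.Leaving s) (hx : Chain E' s x) : Chain E s x := by
  induction hx with
  | start => exact .start
  | next o _ hk ih =>
    have ho' := (ih.mem h.toState hsm hl).1
    rw [hs.kind] at hk
    have := ih.next o hk
    rwa [hs.opp, hs.rot_nl h (h.opp_mem ho' hk) (h.nl_opp ho' hk)]

theorem rot_inv_rot_q (hs : IsSlide E E' p m q) : E'.rot⁻¹ (E.rot q) = p := by
  rw [← hs.rot_p, inv_apply]

theorem rot_inv_m (hs : IsSlide E E' p m q) : E'.rot⁻¹ m = E.rot⁻¹ (E.opp p) := by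
  rw [← hs.rot_n, inv_apply]

theorem rot_inv_p' (hs : IsSlide E E' p m q) : E'.rot⁻¹ (E.opp p) = q := by
  rw [← hs.rot_q, inv_apply]

theorem rot_inv_other (hs : IsSlide E E' p m q) (h : Slidable E M p m q) (hd : d ∈ E.darts)
    (h1 : d ≠ m) (h2 : d ≠ E.opp p) (h3 : d ≠ E.rot q) : E'.rot⁻¹ d = E.rot⁻¹ d := by
  rw [inv_eq_iff_eq, hs.rot_other _ (h.rot_inv_mem hd), apply_inv]
  · intro k; rw [inv_eq_iff_eq, h.rot_p] at k; exact h1 k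
  · intro k; rw [inv_eq_iff_eq] at k; exact h3 k
  · intro k; exact h2 (E.rot⁻¹.injective k)

theorem opp_ne_m (h : Slidable E M p m q) (ho : o ∈ E.darts)
    (hk : E.kind o = .outgoing) : E.opp o ≠ m := fun k => by
  have := h.kind_opp ho hk
  rw [k, h.m_kind] at this; cases this

theorem opp_ne_p' (h : Slidable E M p m q) (ho : o ∈ E.darts)
    (hk : E.kind o = .outgoing) (hop : o ≠ p) : E.opp o ≠ E.opp p := fun k => hop (by
  rw [← h.opp_opp o (h.isEdge_out ho hk), k,
    h.opp_opp p (h.isEdge_out h.p_mem h.kind_p)])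

theorem corner_ne (h : Slidable E M p m q) (hk : E.kind a = .vertical) :
    a ≠ E.opp p := fun k => by
  have := h.p'_kind
  rw [← k, hk] at this; cases this

/-- On the second side of a half-strip the edge `q` is now preceded by `p`. -/
theorem chain_mirror (hs : IsSlide E E' p m q) (h : Slidable E M p m q) (ha : a ∈ E.darts)
    (hk : E.kind a = .vertical) (ham : a ≠ m) (hx : Chain E.mirror (E.rot⁻¹ a) x) :
    Chain E'.mirror (E'.rot⁻¹ a) x ∧ (x = q → Chain E'.mirror (E'.rot⁻¹ a) p) := by
  have step : ∀ s d, d ∈ E.darts → d ≠ m → d ≠ E.opp p → Chain E'.mirror s (E'.rot⁻¹ d) →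
      Chain E'.mirror s (E.rot⁻¹ d) ∧ (E.rot⁻¹ d = q → Chain E'.mirror s p) := by
    intro s d hd h1 h2 h3
    by_cases h4 : d = E.rot q
    · rw [h4, hs.rot_inv_rot_q] at h3
      rw [h4, inv_apply]
      have := Chain.next p h3 (by rw [mirror_kind, hs.kind]; exact h.kind_p)
      rw [mirror_rot, mirror_opp, hs.opp, hs.rot_inv_p'] at this
      exact ⟨this, fun _ => h3⟩
    · rw [hs.rot_inv_other h hd h1 h2 h4] at h3
      exact ⟨h3, fun k => absurd (by rw [← k, apply_inv]) h4⟩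
  have hl := h.leaving_rot_inv ha (nl_of_vertical hk)
  induction hx with
  | start => exact step _ a ha ham (corner_ne h hk) .start
  | next o ho hko ih =>
    have ho' := (ho.mem h.toState.mirror (h.rot_inv_mem ha) hl).1
    have hop : o ≠ p := fun k => ham (h.root_eq_mirror ha hk (k ▸ ho))
    refine step _ _ (h.opp_mem ho' hko) (opp_ne_m (E := E) h ho' hko)
        (opp_ne_p' (E := E) h ho' hko hop) ?_
    have := ih.1.next o (by rw [mirror_kind, hs.kind]; exact hko)
    rwa [mirror_rot, mirror_opp, hs.opp] at this

theorem chain_mirror' (hs : IsSlide E E' p m q) (h : Slidable E M p m q)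
    (ha : a ∈ E.darts) (hk : E.kind a = .vertical) (ham : a ≠ m)
    (hx : Chain E'.mirror (E'.rot⁻¹ a) x) :
    (x ≠ p → Chain E.mirror (E.rot⁻¹ a) x) ∧ (x = p → Chain E.mirror (E.rot⁻¹ a) q) := by
  have step : ∀ s d, d ∈ E.darts → d ≠ m → d ≠ E.opp p → Chain E.mirror s (E.rot⁻¹ d) →
      (E'.rot⁻¹ d ≠ p → Chain E.mirror s (E'.rot⁻¹ d)) ∧
        (E'.rot⁻¹ d = p → Chain E.mirror s q) := by
    intro s d hd h1 h2 h3
    by_cases h4 : d = E.rot q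
    · rw [h4, inv_apply] at h3
      rw [h4, hs.rot_inv_rot_q]
      exact ⟨fun k => absurd rfl k, fun _ => h3⟩
    · rw [hs.rot_inv_other h hd h1 h2 h4]
      exact ⟨fun _ => h3, fun k => absurd (by rw [inv_eq_iff_eq, h.rot_p] at k; exact k) h1⟩
  have hl := h.leaving_rot_inv ha (nl_of_vertical hk)
  have hs' := hs.state h
  have hl' := hs'.leaving_rot_inv (d := a) (by rw [hs.darts]; exact ha)
    (by rw [hs.leaving]; exact nl_of_vertical hk)
  induction hx with
  | start => exact step _ a ha ham (corner_ne h hk) .start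
  | next o ho hko ih =>
    have ho' := (ho.mem hs'.mirror (hs'.rot_inv_mem (by rw [hs.darts]; exact ha)) hl').1
    rw [mirror_darts, hs.darts] at ho'
    rw [mirror_kind, hs.kind] at hko
    rw [mirror_rot, mirror_opp, hs.opp]
    by_cases hop : o = p
    · rw [hop, hs.rot_inv_p']
      exact ⟨fun _ => ih.2 hop, fun k => absurd k.symm h.ne⟩
    · exact step _ _ (h.opp_mem ho' hko) (opp_ne_m h ho' hko) (opp_ne_p' h ho' hko hop)
        ((ih.1 hop).next o hko)

theorem step_n (hs : IsSlide E E' p m q) (h : Slidable E M p m q)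
    (ho : Chain E.mirror (E.rot⁻¹ (E.opp p)) o) (hk : E.kind o = .outgoing) :
    E'.rot⁻¹ (E.opp o) = E.rot⁻¹ (E.opp o) := by
  have ho' := (ho.mem h.toState.mirror h.n_mem h.n_l).1
  refine hs.rot_inv_other h (h.opp_mem ho' hk) (opp_ne_m h ho' hk)
    (opp_ne_p' h ho' hk fun k => h.not_chain_p (k ▸ ho)) fun k => h.not_chain_q (h.chain_n ?_)
  have := Chain.next o ho hk
  rwa [mirror_rot, mirror_opp, k, inv_apply] at this

/-- The second side of the unzipped part now starts after the edge `p`. -/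
theorem chain_n (hs : IsSlide E E' p m q) (h : Slidable E M p m q)
    (hx : Chain E.mirror (E.rot⁻¹ (E.opp p)) x) : Chain E'.mirror (E.rot⁻¹ (E.opp p)) x := by
  induction hx with
  | start => exact .start
  | next o ho hk ih =>
    have := ih.next o (by rw [mirror_kind, hs.kind]; exact hk)
    rwa [mirror_rot, mirror_opp, hs.opp, hs.step_n h ho hk] at this

theorem chain_n' (hs : IsSlide E E' p m q) (h : Slidable E M p m q)
    (hx : Chain E'.mirror (E.rot⁻¹ (E.opp p)) x) : Chain E.mirror (E.rot⁻¹ (E.opp p)) x := by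
  induction hx with
  | start => exact .start
  | next o _ hk ih =>
    rw [mirror_kind, hs.kind] at hk
    have := ih.next o hk
    rwa [mirror_rot, mirror_opp, hs.opp, hs.step_n h ih hk]

/-! #### Half-strips -/

/-- The points of the collapsing half-strip: the lower ones are glued together, the other ones stay
on the half-strip. -/
theorem strip_glue (hs : IsSlide E E' p m q) (h : Slidable E M p m q)
    (hP : E.OnStrip (m, m) P) :
    (P.2 < E.W (E.opp p) ∧ glueMap E p m q P = (p, P.2)) ∨
      (E.W (E.opp p) ≤ P.2 ∧ E'.OnStrip (m, m) (glueMap E p m q P)) := by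
  obtain ⟨x, w⟩ := P
  rcases hP with ⟨hP, hx⟩ | ⟨hP, hx⟩
  · rw [h.rot_m] at hx
    have hxm := (h.ne_of_l (hx.mem h.toState h.q_mem h.q_l).2).1
    by_cases hw : w < E.W (E.opp p)
    · left
      refine ⟨hw, ?_⟩
      have hxq : x = q := by
        by_contra hne
        have h1 := hx.level_le h.toState h.q_mem hne
        have h2 := h.level_p ▸ (h.level_le.trans h1)
        exact absurd (EReal.coe_le_coe_iff.1 h2) (not_le.2 ((W_le_snd hP).trans_lt hw))
      rw [glueMap, if_pos (Or.inr ⟨hxq, hw⟩)]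
    · right
      have h1 : glueMap E p m q (x, w) = (x, w) := by
        rw [glueMap, if_neg]
        rintro (k | k)
        · exact hxm k
        · exact hw k.2
      have h2 := hs.glueMap_isPoint h hP
      rw [h1] at h2 ⊢
      refine ⟨not_lt.1 hw, Or.inl ⟨h2, ?_⟩⟩
      rw [hs.rot_nl h h.m_mem h.m_nl, h.rot_m]
      exact hs.chain h h.q_mem h.q_l hx
  · rw [mirror_rot, h.inv_m] at hx
    have hxm := (h.ne_of_l (hx.mem h.toState.mirror h.p_mem h.p_l).2).1
    have hxq : x ≠ q := fun k => h.not_chain_q (k ▸ hx)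
    have h1 : glueMap E p m q (x, w) = (x, w) := glueMap_of_ne hxm hxq
    by_cases hxp : x = p
    · left
      rw [h1]
      subst hxp
      exact ⟨((isPoint_p h).1 hP).2, rfl⟩
    · right
      have h2 := hs.glueMap_isPoint h hP
      have h3 := hx.level_le h.toState.mirror h.p_mem hxp
      rw [mirror_level, h.level_p] at h3
      have h4 : E.W (E.opp p) ≤ w := (EReal.coe_le_coe_iff.1 h3).trans (W_le_snd hP)
      rw [h1] at h2 ⊢
      refine ⟨h4, Or.inr ⟨h2, ?_⟩⟩
      rw [mirror_rot, hs.rot_inv_m]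
      exact hs.chain_n h (hx.cases_head.resolve_left hxp).2

theorem onStrip_p (h : Slidable E M p m q) (hP : E.IsPoint (p, w)) :
    E.OnStrip (m, m) (p, w) :=
  Or.inr ⟨hP, by rw [mirror_rot, h.inv_m]; exact .start⟩

theorem onStrip_q (h : Slidable E M p m q) (hP : E.IsPoint (q, w)) :
    E.OnStrip (m, m) (q, w) :=
  Or.inl ⟨hP, by rw [h.rot_m]; exact .start⟩

theorem onStrip_n (h : Slidable E M p m q) :
    E.OnStrip (m, m) (E.rot⁻¹ (E.opp p), E.W (E.rot⁻¹ (E.opp p))) :=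
  Or.inr ⟨isPoint_vertex h.n_mem, by rw [mirror_rot, h.inv_m]; exact h.chain_n .start⟩

theorem ident_n (h : Slidable E M p m q) (S : Set (β × β)) :
    E.Ident S (E.opp p, E.W (E.opp p))
      (E.rot⁻¹ (E.opp p), E.W (E.rot⁻¹ (E.opp p))) :=
  ident_of_same h.toFrame h.p'_mem h.same_n

theorem W_n (h : Slidable E M p m q) : E.W (E.rot⁻¹ (E.opp p)) = E.W (E.opp p) :=
  h.W_same h.p'_mem h.same_n

/-- If the edges `p` and `q` end at the same level, then their ends are identified. -/
theorem ident_opp (h : Slidable E M p m q) (hS : (m, m) ∈ S)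
    (hk : E.kind q = .outgoing) (hW : E.W (E.opp q) = E.W (E.opp p)) :
    E.Ident S (E.opp p, E.W (E.opp p)) (E.opp q, E.W (E.opp q)) := by
  have h1 := h.opp_mem h.q_mem hk
  have h2 := ident_of_same h.toFrame h1 (same_rot E.rot (E.opp q)) (S := S)
  refine (ident_n h S).trans (Ident.trans (ident_of_strip hS (onStrip_n h) (Or.inl
    ⟨isPoint_vertex (h.rot_mem _ h1), ?_⟩) ?_) h2.symm)
  · rw [h.rot_m]; exact Chain.next _ .start hk
  · rw [W_n h, h.W_rot _ h1, hW]

theorem strip_lift (hs : IsSlide E E' p m q) (h : Slidable E M p m q)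
    (hP : E'.OnStrip (m, m) P) :
    ∃ P', E.OnStrip (m, m) P' ∧ E.Ident S (liftMap E p m q P) P' := by
  obtain ⟨x, w⟩ := P
  rcases hP with ⟨hP, hx⟩ | ⟨hP, hx⟩
  · rw [hs.rot_nl h h.m_mem h.m_nl, h.rot_m] at hx
    replace hx := hs.chain' h h.q_mem h.q_l hx
    have hxm := (h.ne_of_l (hx.mem h.toState h.q_mem h.q_l).2).1
    by_cases h1 : x = q ∧ w = E.W (E.opp p)
    · rw [liftMap, if_pos (Or.inr h1), h1.2]
      exact ⟨_, onStrip_n h, ident_n h S⟩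
    · have h2 : liftMap E p m q (x, w) = (x, w) := by
        rw [liftMap, if_neg]
        rintro (k | k)
        · exact hxm k
        · exact h1 k
      have h3 := hs.liftMap_isPoint h hP
      rw [h2] at h3 ⊢
      exact ⟨_, Or.inl ⟨h3, by rw [h.rot_m]; exact hx⟩, ident_refl⟩
  · rw [mirror_rot, hs.rot_inv_m] at hx
    replace hx := h.chain_n (hs.chain_n' h hx)
    have hxm := (h.ne_of_l (hx.mem h.toState.mirror h.p_mem h.p_l).2).1
    have hxq : x ≠ q := fun k => h.not_chain_q (k ▸ hx)
    rw [liftMap_of_ne hxm hxq]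
    exact ⟨_, Or.inr ⟨(hs.isPoint_iff h hxm hxq).1 hP, by rw [mirror_rot, h.inv_m]; exact hx⟩,
      ident_refl⟩

theorem side_glue (hs : IsSlide E E' p m q) (h : Slidable E M p m q) (ha : a ∈ E.darts)
    (hk : E.kind a = .vertical) (ham : a ≠ m) (hP : E.OnSide a P) :
    E'.OnSide a (glueMap E p m q P) := by
  obtain ⟨x, w⟩ := P
  have hl := h.leaving_rot ha (nl_of_vertical hk)
  have hxm := (h.ne_of_l (hP.2.mem h.toState (h.rot_mem a ha) hl).2).1
  have hxq : x ≠ q := fun k => ham (h.root_eq ha hk (k ▸ hP.2))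
  rw [glueMap_of_ne hxm hxq]
  refine ⟨(hs.isPoint_iff h hxm hxq).2 hP.1, ?_⟩
  rw [hs.rot_nl h ha (nl_of_vertical hk)]
  exact hs.chain h (h.rot_mem a ha) hl hP.2

theorem side_lift (hs : IsSlide E E' p m q) (h : Slidable E M p m q) (ha : a ∈ E.darts)
    (hk : E.kind a = .vertical) (ham : a ≠ m) (hP : E'.OnSide a P) :
    E.OnSide a (liftMap E p m q P) := by
  obtain ⟨x, w⟩ := P
  have hl := h.leaving_rot ha (nl_of_vertical hk)
  obtain ⟨hP, hx⟩ := hP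
  rw [hs.rot_nl h ha (nl_of_vertical hk)] at hx
  replace hx := hs.chain' h (h.rot_mem a ha) hl hx
  have hxm := (h.ne_of_l (hx.mem h.toState (h.rot_mem a ha) hl).2).1
  have hxq : x ≠ q := fun k => ham (h.root_eq ha hk (k ▸ hx))
  rw [liftMap_of_ne hxm hxq]
  exact ⟨(hs.isPoint_iff h hxm hxq).1 hP, hx⟩

theorem side_mirror_glue (hs : IsSlide E E' p m q) (h : Slidable E M p m q)
    (ha : a ∈ E.darts) (hk : E.kind a = .vertical) (ham : a ≠ m)
    (hP : E.mirror.OnSide a P) : E'.mirror.OnSide a (glueMap E p m q P) := by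
  obtain ⟨x, w⟩ := P
  have hl := h.leaving_rot_inv ha (nl_of_vertical hk)
  have hxm := (h.ne_of_l (hP.2.mem h.toState.mirror (h.rot_inv_mem ha) hl).2).1
  obtain ⟨h1, h2⟩ := hs.chain_mirror h ha hk ham hP.2
  refine ⟨hs.glueMap_isPoint h hP.1, ?_⟩
  rw [glueMap]
  split_ifs with h3
  · exact h2 (h3.resolve_left hxm).1
  · exact h1

theorem side_mirror_lift (hs : IsSlide E E' p m q) (h : Slidable E M p m q)
    (hS : (m, m) ∈ S) (ha : a ∈ E.darts) (hk : E.kind a = .vertical) (ham : a ≠ m)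
    (hP : E'.mirror.OnSide a P) :
    ∃ P', E.mirror.OnSide a P' ∧ E.Ident S (liftMap E p m q P) P' := by
  obtain ⟨x, w⟩ := P
  obtain ⟨h1, h2⟩ := hs.chain_mirror' h ha hk ham hP.2
  have hpt := hs.liftMap_isPoint h hP.1
  by_cases hxp : x = p
  · subst hxp
    rw [liftMap_of_ne (h.ne_of_l h.p_l).1 h.ne] at hpt ⊢
    have h3 := (isPoint_p h).1 hpt
    have h4 : E.IsPoint (q, w) := by
      rw [isPoint_q' h]
      rcases h3.1.eq_or_lt with h4 | h4
      · exact Or.inl h4.symm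
      · refine Or.inr ⟨h4, lt_of_lt_of_le ?_ h.level_le⟩
        rw [h.level_p]; exact EReal.coe_lt_coe_iff.2 h3.2
    exact ⟨(q, w), ⟨h4, h2 rfl⟩, ident_of_strip hS (onStrip_p h hpt) (onStrip_q h h4) rfl⟩
  replace h1 := h1 hxp
  by_cases h3 : x = q ∧ w = E.W (E.opp p)
  · obtain ⟨rfl, rfl⟩ := h3
    rw [liftMap, if_pos (Or.inr ⟨rfl, rfl⟩)]
    have hle := h.level_le
    rw [h.level_p] at hle
    rcases hle.eq_or_lt with h4 | h4
    · have hkq : E.kind x = .outgoing := by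
        rcases h.q_l with h5 | h5
        · exact h5
        · simp [level, h5] at h4
      rw [level, hkq, if_neg (by simp)] at h4
      have hW : E.W (E.opp x) = E.W (E.opp p) := (EReal.coe_eq_coe_iff.1 h4).symm
      have hq' := h.opp_mem h.q_mem hkq
      refine ⟨(E.rot⁻¹ (E.opp x), E.W (E.rot⁻¹ (E.opp x))),
        ⟨isPoint_vertex (h.rot_inv_mem hq'), Chain.next _ h1 hkq⟩, ?_⟩
      exact (ident_opp h hS hkq hW).trans (ident_of_same h.toFrame hq' (same_rot_inv _ _))
    · have h5 : E.IsPoint (x, E.W (E.opp p)) := (isPoint_q' h).2 (Or.inr ⟨h.W_lt, h4⟩)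
      exact ⟨_, ⟨h5, h1⟩, (ident_n h S).trans
        (ident_of_strip hS (onStrip_n h) (onStrip_q h h5) (W_n h))⟩
  · have hl := (hs.state h).mirror.leaving_rot (d := a) (by rw [mirror_darts, hs.darts]; exact ha)
      (by rw [mirror_leaving, hs.leaving]; exact nl_of_vertical hk)
    have hxl := (hP.2.mem (hs.state h).mirror ((hs.state h).rot_inv_mem
        (by rw [hs.darts]; exact ha))
      hl).2
    rw [mirror_leaving, hs.leaving] at hxl
    have h4 : liftMap E p m q (x, w) = (x, w) := by
      rw [liftMap, if_neg]
      rintro (k | k)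
      · exact (h.ne_of_l hxl).1 k
      · exact h3 k
    rw [h4] at hpt ⊢
    exact ⟨_, ⟨hpt, h1⟩, ident_refl⟩

/-- A move of the slider is a folding. -/
def folding (hs : IsSlide E E' p m q) (h : Slidable E M p m q)
    (hS : CornersOK E S) (hm : (m, m) ∈ S) (hne : ∀ c ∈ S, c = (m, m) ∨ (c.1 ≠ m ∧ c.2 ≠ m)) :
    Folding E M S E' M S
      (fun a a' => a = a' ∧ a ∈ E.darts ∧ E.kind a = .vertical ∧ a ≠ m)
      (fun a a' => a = a' ∧ a ∈ E.darts ∧ a ≠ m ∧ a ≠ q) := by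
  have hF' := (hs.state h).toFrame
  have hf : Hom E S E' S
      (fun a a' => a = a' ∧ a ∈ E.darts ∧ E.kind a = .vertical ∧ a ≠ m)
      (glueMap E p m q) := by
    refine ⟨fun P => ?_, fun P hP => hs.glueMap_isPoint h hP, ?_, ?_, ?_, ?_, ?_⟩
    · rw [glueMap]; split_ifs <;> rfl
    · intro P Q hPQ
      refine ident_of_sides (glueMap E p m q) ?_ ?_ hPQ
      · intro x hx y hy hxy
        rw [hs.glueMap_vertex h hx, hs.glueMap_vertex h hy]
        exact ident_of_same hF' (by rw [hs.darts]; exact fw_mem h hx) (hs.same_fw h hx hxy)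
      · intro c hcS P Q hP hQ hPQ
        rcases hne c hcS with rfl | h1
        · have h2 : ∀ P, (glueMap E p m q P).2 = P.2 := fun P => by
            rw [glueMap]; split_ifs <;> rfl
          rcases hs.strip_glue h hP with ⟨h3, h4⟩ | ⟨h3, h4⟩ <;>
            rcases hs.strip_glue h hQ with ⟨h5, h6⟩ | ⟨h5, h6⟩
          · rw [h4, h6, hPQ]; exact ident_refl
          · exact absurd h3 (by rw [hPQ]; exact not_lt.2 h5)
          · exact absurd h5 (by rw [← hPQ]; exact not_lt.2 h3)
          · exact ident_of_strip hcS h4 h6 (by rw [h2, h2, hPQ])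
        · obtain ⟨h2, h3⟩ := hS c hcS
          exact ident_strip_of_sides hF' (glueMap E p m q)
            (fun P => by rw [glueMap]; split_ifs <;> rfl) hcS
            (fun P hP => ⟨_, hs.side_glue h h2.1 h2.2 h1.1 hP, ident_refl⟩)
            (fun P hP => ⟨_, hs.side_mirror_glue h h3.1 h3.2 h1.2 hP, ident_refl⟩) hP hQ hPQ
    · intro d hd
      refine ⟨fw p m q d, by rw [hs.darts]; exact fw_mem h hd, ?_⟩
      rw [hs.glueMap_vertex h hd]
      exact ident_refl
    · rintro a _ P ⟨rfl, ha, hk, ham⟩ hP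
      exact ⟨_, hs.side_glue h ha hk ham hP, ident_refl⟩
    · rintro a _ P ⟨rfl, ha, hk, ham⟩ hP
      exact ⟨_, hs.side_mirror_glue h ha hk ham hP, ident_refl⟩
    · intro o ho hk hw
      right
      have h1 := h.opp_mem ho hk
      have h2 := h.ne_of_nl (h.nl_opp ho hk)
      have h3 := opp_ne_m h ho hk
      have h4 : o ≠ q := by
        rintro rfl
        have := h.W_le_opp_q hk
        rw [hw, h.W_q] at this
        exact absurd h.W_lt (not_lt.2 this)
      have h5 : o ≠ m := (h.ne_of_l (Or.inl hk)).1
      refine ⟨o, by rwa [hs.darts], by rwa [hs.kind], ?_, ?_, ?_⟩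
      · rw [hs.opp, hs.W_other _ h1 h2.2.1 h3, hs.W_other _ ho h4 h5, hw]
      · rw [glueMap_of_ne h5 h4, hs.W_other _ ho h4 h5]; exact ident_refl
      · rw [glueMap_of_ne h3 h2.2.1, hs.opp, hs.W_other _ h1 h2.2.1 h3]; exact ident_refl
  have hh : Hom E' S E S
      (flip (fun a a' => a = a' ∧ a ∈ E.darts ∧ E.kind a = .vertical ∧ a ≠ m))
      (liftMap E p m q) := by
    refine ⟨fun P => ?_, fun P hP => hs.liftMap_isPoint h hP, ?_, ?_, ?_, ?_, ?_⟩
    · rw [liftMap]; split_ifs <;> rfl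
    · intro P Q hPQ
      refine ident_of_sides (liftMap E p m q) ?_ ?_ hPQ
      · intro x hx y hy hxy
        rw [hs.darts] at hx hy
        rw [hs.liftMap_vertex h hx, hs.liftMap_vertex h hy]
        exact ident_of_same h.toFrame (bw_mem h hx) (hs.same_bw h hx hxy)
      · intro c hcS P Q hP hQ hPQ
        have h0 : ∀ P, (liftMap E p m q P).2 = P.2 := fun P => by
          rw [liftMap]; split_ifs <;> rfl
        rcases hne c hcS with rfl | h1
        · obtain ⟨P', h3, h4⟩ := hs.strip_lift h hP (S := S)
          obtain ⟨Q', h5, h6⟩ := hs.strip_lift h hQ (S := S)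
          refine (h4.trans (ident_of_strip hcS h3 h5 ?_)).trans h6.symm
          rw [← h4.snd_eq h.toFrame, ← h6.snd_eq h.toFrame, h0, h0, hPQ]
        · obtain ⟨h2, h3⟩ := hS c hcS
          exact ident_strip_of_sides h.toFrame (liftMap E p m q) h0 hcS
            (fun P hP => ⟨_, hs.side_lift h h2.1 h2.2 h1.1 hP, ident_refl⟩)
            (fun P hP => hs.side_mirror_lift h hm h3.1 h3.2 h1.2 hP) hP hQ hPQ
    · intro d hd
      rw [hs.darts] at hd
      refine ⟨bw E p m q d, bw_mem h hd, ?_⟩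
      rw [hs.liftMap_vertex h hd]
      exact ident_refl
    · rintro a _ P ⟨rfl, ha, hk, ham⟩ hP
      exact ⟨_, hs.side_lift h ha hk ham hP, ident_refl⟩
    · rintro a _ P ⟨rfl, ha, hk, ham⟩ hP
      exact hs.side_mirror_lift h hm ha hk ham hP
    · intro o ho hk hw
      rw [hs.darts] at ho
      rw [hs.kind] at hk
      have h1 := h.opp_mem ho hk
      have h2 := h.ne_of_nl (h.nl_opp ho hk)
      have h3 := opp_ne_m h ho hk
      have h5 : o ≠ m := (h.ne_of_l (Or.inl hk)).1
      rw [hs.opp, hs.W_other _ h1 h2.2.1 h3] at hw ⊢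
      rw [liftMap_of_ne h3 h2.2.1]
      by_cases h4 : o = q
      · left
        subst h4
        rw [hs.W_q] at hw ⊢
        rw [liftMap, if_pos (Or.inr ⟨rfl, rfl⟩)]
        exact ident_opp h hm hk hw
      · right
        rw [hs.W_other _ ho h4 h5] at hw ⊢
        rw [liftMap_of_ne h5 h4]
        exact ⟨o, ho, hk, hw, ident_refl, ident_refl⟩
  have hfw : ∀ d ∈ E.darts, (glueMap E p m q (d, E.W d)).1 = fw p m q d := fun d hd => by
    rw [hs.glueMap_vertex h hd]
  refine ⟨glueMap E p m q, liftMap E p m q, hf, hh, ?_, ?_, ?_, ?_⟩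
  · rintro ⟨x, w⟩ hP
    by_cases h1 : x = m
    · subst h1
      rw [glueMap, if_pos (Or.inl rfl), liftMap_of_ne (h.ne_of_l h.p_l).1 h.ne,
        snd_of_m h E rfl hP]
      have := (ident_of_same h.toFrame h.p_mem h.same_pm (S := S))
      rwa [← h.W_m] at this
    by_cases h2 : x = q ∧ w < E.W (E.opp p)
    · obtain ⟨rfl, h2⟩ := h2
      rw [glueMap, if_pos (Or.inr ⟨rfl, h2⟩), liftMap_of_ne (h.ne_of_l h.p_l).1 h.ne]
      refine ident_of_strip hm (onStrip_p h ((isPoint_p h).2 ⟨?_, h2⟩)) (onStrip_q h hP) rfl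
      have := W_le_snd hP
      rwa [h.W_q] at this
    rw [glueMap, if_neg (by tauto), liftMap]
    split_ifs with h3
    · obtain ⟨rfl, rfl⟩ := h3.resolve_left h1
      exact (ident_n h S).trans (ident_of_strip hm (onStrip_n h) (onStrip_q h hP) (W_n h))
    · exact ident_refl
  · rintro ⟨x, w⟩ hP
    have hp' : ∀ w, glueMap E p m q (E.opp p, w) = (E.opp p, w) := fun w =>
      glueMap_of_ne h.p'_ne_m (h.ne_of_nl h.p'_nl).2.1
    have hW' := hs.W_other _ h.p'_mem (h.ne_of_nl h.p'_nl).2.1 h.p'_ne_m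
    by_cases h1 : x = m
    · subst h1
      rw [liftMap, if_pos (Or.inl rfl), hp', snd_of_m h E' hs.kind hP]
      have := (ident_of_same hF' hP.1 (hs.same'_m h) (S := S)).symm
      rwa [hW', ← hs.W_m] at this
    by_cases h2 : x = q ∧ w = E.W (E.opp p)
    · obtain ⟨rfl, rfl⟩ := h2
      rw [liftMap, if_pos (Or.inr ⟨rfl, rfl⟩), hp']
      have := (ident_of_same hF' hP.1 hs.same'_q (S := S)).symm
      rwa [hW', hs.W_q] at this
    rw [liftMap, if_neg (by tauto), glueMap, if_neg]
    · exact ident_refl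
    · rintro (k | ⟨k, k'⟩)
      · exact h1 k
      · dsimp only at k k'
        subst k
        have := W_le_snd hP
        rw [hs.W_q] at this
        exact absurd k' (not_lt.2 this)
  · have hv := (hs.vertexMap h).1
    refine ⟨fun d hd => ?_, fun d hd e he hde => ?_, fun d' hd' => ?_, fun d hd => ?_,
      fun V' hV' => ?_⟩
    · rw [hfw d hd]; exact hv.mem d hd
    · rw [hfw d hd, hfw e he]; exact hv.same d hd e he hde
    · obtain ⟨d, hd, h2⟩ := hv.surj d' hd'
      exact ⟨d, hd, by rw [hfw d hd]; exact h2⟩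
    · rw [hfw d hd]; exact hv.W d hd
    · rw [hv.ord V' hV']
      refine Finset.sum_congr (Finset.filter_congr fun V hV => ?_) fun _ _ => rfl
      obtain ⟨d, hd, rfl⟩ := mem_verts.1 hV
      rw [vmap_vert hv.same hd, vmap_vert _ hd, hfw d hd]
      intro d hd e he hde
      rw [hfw d hd, hfw e he]; exact hv.same d hd e he hde
  · rintro d _ ⟨rfl, hd, h1, h2⟩
    rw [hfw d hd, fw, if_neg (by tauto)]

end IsSlide

/-! ### Opening of the zipper -/

/-- The edge of `r` is vertical, and at one of its ends there is another vertical or incoming dart.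
Without such a dart the merged vertex would have none besides the sliders. -/
structure Openable (E : WGraph β) (r : β) : Prop extends State E ∅ where
  mem : r ∈ E.darts
  vertical : E.kind r = .vertical
  other : ∃ d ∈ E.darts, ¬ E.Leaving d ∧ d ≠ r ∧ d ≠ E.opp r ∧
    (E.Same r d ∨ E.Same (E.opp r) d)

namespace Openable

variable {r : β}

theorem edge (h : Openable E r) : E.IsEdge ∅ r :=
  ⟨h.mem, by simp [h.vertical], Set.notMem_empty _⟩

theorem opp_mem (h : Openable E r) : E.opp r ∈ E.darts := (h.opp_edge r h.edge).1

theorem opp_kind (h : Openable E r) : E.kind (E.opp r) = .vertical :=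
  h.kind_vertical r h.edge h.vertical

theorem not_same (h : Openable E r) : ¬ E.Same r (E.opp r) := h.not_same_opp h.edge

theorem W_opp (h : Openable E r) : E.W (E.opp r) = E.W r := by
  rw [h.W_vertical r h.edge h.vertical, h.W_vertical _ (h.opp_edge r h.edge) h.opp_kind]

theorem rot_r (E : WGraph β) (r : β) : (openZipper E r).rot r = E.rot (E.opp r) := by
  simp [openZipper]

theorem rot_opp (E : WGraph β) (r : β) : (openZipper E r).rot (E.opp r) = E.rot r := by
  simp [openZipper]

theorem rot_other (h1 : x ≠ r) (h2 : x ≠ E.opp r) :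
    (openZipper E r).rot x = E.rot x := by
  simp [openZipper, Equiv.swap_apply_of_ne_of_ne h1 h2]

theorem rot_cases {Q : β → β → Prop} (x : β) (h1 : Q r (E.rot (E.opp r)))
    (h2 : Q (E.opp r) (E.rot r)) (h3 : x ≠ r → x ≠ E.opp r → Q x (E.rot x)) :
    Q x ((openZipper E r).rot x) := by
  by_cases hx : x = r
  · rw [hx, rot_r]; exact h1
  by_cases hx' : x = E.opp r
  · rw [hx', rot_opp]; exact h2
  · rw [rot_other hx hx']; exact h3 hx hx'

theorem open_rot_mem (h : Openable E r) : ∀ d ∈ (openZipper E r).darts,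
    (openZipper E r).rot d ∈ (openZipper E r).darts := by
  intro d hd
  exact rot_cases d (Q := fun _ y => y ∈ E.darts) (h.toFrame.rot_mem _ h.opp_mem)
      (h.toFrame.rot_mem _ h.mem)
    fun _ _ => h.toFrame.rot_mem d hd

theorem same_merged (h : Openable E r) : (openZipper E r).Same (E.opp r) r := by
  by_contra hne
  -- otherwise the new vertex of `opp r` would contain a cycle of the old rotation
  let K := E.darts.filter (fun x => (openZipper E r).Same (E.opp r) x ∧
    E.Same r x)
  have hK : ∀ x ∈ K, E.rot x ∈ K := by
    intro x hx
    obtain ⟨hx, h1, h2⟩ := mem_filter.1 hx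
    have h3 : x ≠ r := fun k => hne (k ▸ h1)
    have h4 : x ≠ E.opp r := fun k => h.not_same (k ▸ h2)
    refine mem_filter.2 ⟨h.toFrame.rot_mem x hx, ?_, h2.trans (same_rot _ _)⟩
    rw [← rot_other h3 h4]
    exact h1.trans (same_rot _ _)
  have h1 : E.rot r ∈ K := by
    refine mem_filter.2 ⟨h.toFrame.rot_mem _ h.mem, ?_, same_rot _ _⟩
    rw [← rot_opp]
    exact same_rot _ _
  have h2 := perm_inv_mem hK h1
  rw [inv_apply] at h2
  exact hne (mem_filter.1 h2).2.1

theorem same_open (h : Openable E r) (hx : x ∈ E.darts) (hxy : E.Same x y) :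
    (openZipper E r).Same x y := by
  refine sameCycle_map h.toFrame.rot_mem id (fun x _ => ?_) hx hxy
  by_cases h1 : x = r
  · rw [h1]
    refine h.same_merged.symm.trans ?_
    have := same_rot (openZipper E r).rot (E.opp r)
    rwa [rot_opp] at this
  by_cases h2 : x = E.opp r
  · rw [h2]
    refine h.same_merged.trans ?_
    have := same_rot (openZipper E r).rot r
    rwa [rot_r] at this
  · have := same_rot (openZipper E r).rot x
    rwa [rot_other h1 h2] at this

theorem same_iff (h : Openable E r) (hx : x ∈ E.darts) (hy : y ∈ E.darts) :
    (openZipper E r).Same x y ↔ E.Same x y ∨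
      ((E.Same x r ∨ E.Same x (E.opp r)) ∧
        (E.Same y r ∨ E.Same y (E.opp r))) := by
  constructor
  · intro hxy
    refine (sameCycle_induct h.open_rot_mem (R := fun x y => E.Same x y ∨
      ((E.Same x r ∨ E.Same x (E.opp r)) ∧
        (E.Same y r ∨ E.Same y (E.opp r)))) ⟨?_, ?_, ?_⟩ ?_ hx hxy).2
    · exact fun x => Or.inl (.refl _ _)
    · rintro x y (h1 | ⟨h1, h2⟩)
      · exact Or.inl h1.symm
      · exact Or.inr ⟨h2, h1⟩
    · have key : ∀ {x y}, E.Same x y →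
          (E.Same y r ∨ E.Same y (E.opp r)) →
          (E.Same x r ∨ E.Same x (E.opp r)) := by
        rintro x y h1 (h2 | h2)
        · exact Or.inl (h1.trans h2)
        · exact Or.inr (h1.trans h2)
      rintro x y z (h1 | ⟨h1, h2⟩) (h3 | ⟨h3, h4⟩)
      · exact Or.inl (h1.trans h3)
      · exact Or.inr ⟨key h1 h3, h4⟩
      · exact Or.inr ⟨h1, key h3.symm h2⟩
      · exact Or.inr ⟨h1, h4⟩
    · intro x _
      refine rot_cases x (Q := fun x y => E.Same x y ∨
        ((E.Same x r ∨ E.Same x (E.opp r)) ∧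
          (E.Same y r ∨ E.Same y (E.opp r)))) ?_ ?_ fun _ _ => ?_
      · exact Or.inr ⟨Or.inl (.refl _ _), Or.inr (same_rot _ _).symm⟩
      · exact Or.inr ⟨Or.inr (.refl _ _), Or.inl (same_rot _ _).symm⟩
      · exact Or.inl (same_rot _ _)
  · have key : ∀ x ∈ E.darts, (E.Same x r ∨ E.Same x (E.opp r)) →
        (openZipper E r).Same x r := by
      rintro x hx (h1 | h1)
      · exact h.same_open hx h1
      · exact (h.same_open hx h1).trans h.same_merged
    rintro (h1 | ⟨h1, h2⟩)
    · exact h.same_open hx h1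
    · exact (key x hx h1).trans (key y hy h2).symm

theorem vertexMap (h : Openable E r) :
    VertexMap E ∅ (openZipper E r) {r, E.opp r} id ∧
      (openZipper E r).verts.card + 1 = E.verts.card := by
  obtain ⟨M, hM⟩ : ∃ M : Set β, M = {r, E.opp r} := ⟨_, rfl⟩
  have hMx : ∀ x, x ∈ M ↔ x = r ∨ x = E.opp r := fun x => by rw [hM]; rfl
  rw [← hM]
  refine vertexMap_of_merge h.mem h.opp_mem h.not_same (fun d hd => hd)
    (fun d hd e he => h.same_iff hd he) (fun d hd => ⟨d, hd, .refl _ _⟩) (fun d _ => rfl) ?_ ?_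
  · intro d hd h1 h2
    have h0 : (openZipper E r).vert (id d) = E.vert d := by
      ext x
      rw [mem_vert, mem_vert]
      refine and_congr_right fun hx => ?_
      rw [id, h.same_iff hd hx]
      tauto
    rw [h0, ordM_empty, ordM, ord]
    have h3 : (E.vert d).filter (fun x => (openZipper E r).kind x = .vertical ∧ x ∉ M) =
        (E.vert d).filter (fun x => E.kind x = .vertical) := by
      refine Finset.filter_congr fun x hx => ?_
      have hx' := (mem_vert.1 hx).2
      refine and_iff_left ?_
      rw [hMx]
      rintro (rfl | rfl)
      · exact h1 hx'
      · exact h2 hx'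
    rw [h3]
    rfl
  · have hmem : ∀ x, x ∈ (openZipper E r).vert r ↔ x ∈ E.vert r ∨ x ∈ E.vert (E.opp r) := by
      intro x
      rw [mem_vert, mem_vert, mem_vert, ← and_or_left]
      refine and_congr_right fun hx => ?_
      rw [h.same_iff h.mem hx]
      constructor
      · rintro (h1 | ⟨-, h1 | h1⟩)
        · exact Or.inl h1
        · exact Or.inl h1.symm
        · exact Or.inr h1.symm
      · rintro (h1 | h1)
        · exact Or.inl h1
        · exact Or.inr ⟨Or.inl (.refl _ _), Or.inr h1.symm⟩
    have hdisj : Disjoint (E.vert r) (E.vert (E.opp r)) := by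
      rw [Finset.disjoint_left]
      intro x h1 h2
      exact h.not_same ((mem_vert.1 h1).2.trans (mem_vert.1 h2).2.symm)
    have hv : ((openZipper E r).vert r).filter
        (fun x => (openZipper E r).kind x = .vertical ∧ x ∉ M) =
        (((E.vert r).filter (fun x => E.kind x = .vertical)).erase r) ∪
        (((E.vert (E.opp r)).filter (fun x => E.kind x = .vertical)).erase (E.opp r)) := by
      ext x
      simp only [mem_filter, mem_union, hmem, mem_erase, hMx, not_or]
      have hk : (openZipper E r).kind x = E.kind x := rfl
      rw [hk]
      have h1 : x ∈ E.vert r → x ≠ E.opp r := fun h1 h2 =>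
        h.not_same (h2 ▸ (mem_vert.1 h1).2)
      have h2 : x ∈ E.vert (E.opp r) → x ≠ r := fun h1 h2 =>
        h.not_same (h2 ▸ (mem_vert.1 h1).2).symm
      tauto
    have hi : ((openZipper E r).vert r).filter
        (fun x => (openZipper E r).kind x = .incoming) =
        (E.vert r).filter (fun x => E.kind x = .incoming) ∪
        (E.vert (E.opp r)).filter (fun x => E.kind x = .incoming) := by
      ext x
      simp only [mem_filter, mem_union, hmem]
      have hk : (openZipper E r).kind x = E.kind x := rfl
      rw [hk]; tauto
    have c1 := card_erase_add_one (s := (E.vert r).filter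
      (fun x => E.kind x = .vertical)) (a := r)
      (by simp [self_mem_vert h.mem, h.vertical])
    have c2 := card_erase_add_one (s := (E.vert (E.opp r)).filter
      (fun x => E.kind x = .vertical)) (a := E.opp r)
      (by simp [self_mem_vert h.opp_mem, h.opp_kind])
    rw [ordM_empty, ordM_empty, id, ordM, hv, hi, ord, ord, ← c1, ← c2,
      Finset.card_union_of_disjoint (Finset.disjoint_filter_filter hdisj),
      Finset.card_union_of_disjoint]
    · push_cast; ring
    · exact (Finset.disjoint_filter_filter hdisj).mono (Finset.erase_subset _ _)
        (Finset.erase_subset _ _)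

theorem isEdge_iff : (openZipper E r).IsEdge {r, E.opp r} x ↔
    E.IsEdge ∅ x ∧ x ≠ r ∧ x ≠ E.opp r := by
  simp only [IsEdge, openZipper, Set.mem_insert_iff, Set.mem_singleton_iff, not_or,
    Set.mem_empty_iff_false, not_false_eq_true, and_true]
  tauto

theorem opp_ne_of (h : Openable E r) (hd : E.IsEdge ∅ d) (h1 : d ≠ r)
    (h2 : d ≠ E.opp r) : E.opp d ≠ r ∧ E.opp d ≠ E.opp r := by
  constructor
  · intro h3; exact h2 (by rw [← h3, h.opp_opp d hd])
  · intro h3; exact h1 (by rw [← h.opp_opp d hd, h3, h.opp_opp r h.edge])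

theorem state (h : Openable E r) : State (openZipper E r) {r, E.opp r} where
  rot_mem := h.open_rot_mem
  slider_mem m hm := by
    rcases hm with rfl | rfl
    · exact h.mem
    · exact h.opp_mem
  slider_kind m hm := by
    rcases hm with rfl | rfl
    · exact h.vertical
    · exact h.opp_kind
  opp_edge d hd := by
    rw [isEdge_iff] at hd
    exact isEdge_iff.2 ⟨h.opp_edge d hd.1, h.opp_ne_of hd.1 hd.2.1 hd.2.2⟩
  opp_opp d hd := h.opp_opp d (isEdge_iff.1 hd).1
  opp_ne d hd := h.opp_ne d (isEdge_iff.1 hd).1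
  kind_vertical d hd := h.kind_vertical d (isEdge_iff.1 hd).1
  kind_outgoing d hd := h.kind_outgoing d (isEdge_iff.1 hd).1
  kind_incoming d hd := h.kind_incoming d (isEdge_iff.1 hd).1
  W_rot d hd := by
    have hd' : d ∈ E.darts := hd
    refine rot_cases d (Q := fun x y => E.W y = E.W x) ?_ ?_ fun _ _ => h.W_rot d hd'
    · rw [h.W_rot _ h.opp_mem, h.W_opp]
    · rw [h.W_rot _ h.mem, h.W_opp]
  W_le := h.W_le
  W_vertical d hd := h.W_vertical d (isEdge_iff.1 hd).1
  H_opp d hd := h.H_opp d (isEdge_iff.1 hd).1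
  H_nonneg d hd := h.H_nonneg d (isEdge_iff.1 hd).1
  conn d hd e he := by
    have hsame : ∀ x y, (openZipper E r).Same x y →
        EqvGen ((openZipper E r).Link {r, E.opp r}) x y := fun x y hxy =>
      sameCycle_eqvGen (R := (openZipper E r).Link {r, E.opp r}) (fun _ => Or.inl rfl) hxy
    refine eqvGen_le_of (equivalence_eqvGen _) ?_ hd (h.conn d hd e he)
    rintro x y (rfl | ⟨hx, rfl⟩)
    · exact ⟨(perm_mem_iff h.toFrame.rot_mem x).symm, fun hx => hsame _ _
        (h.same_open hx (same_rot _ _))⟩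
    · refine ⟨⟨fun _ => (h.opp_edge x hx).1, fun _ => hx.1⟩, fun _ => ?_⟩
      by_cases h1 : x = r
      · rw [h1]; exact hsame _ _ h.same_merged.symm
      by_cases h2 : x = E.opp r
      · rw [h2, h.opp_opp r h.edge]; exact hsame _ _ h.same_merged
      · exact EqvGen.rel _ _ (Or.inr ⟨isEdge_iff.2 ⟨hx, h1, h2⟩, rfl⟩)
  count := by
    have h1 := h.vertexMap.2
    have h2 := h.card_edges_erase h.edge
    have h3 := h.count
    have h4 : (openZipper E r).edgesM {r, E.opp r} =
        (((E.darts.filter (fun d => E.IsEdge ∅ d)).filter (fun d => d ≠ r ∧ d ≠ E.opp r)).image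
          (fun d => ({d, E.opp d} : Finset β))) := by
      rw [edgesM]
      congr 1
      ext x
      simp only [mem_filter, isEdge_iff]
      have : x ∈ (openZipper E r).darts ↔ x ∈ E.darts := Iff.rfl
      tauto
    rw [h4]; omega
  alt d hd := by
    have hd' : d ∈ E.darts := hd
    refine rot_cases d (Q := fun x y => E.Leaving y ↔ ¬ E.Leaving x) ?_ ?_ fun _ _ => h.alt d hd'
    · exact iff_of_true (h.leaving_rot h.opp_mem (nl_of_vertical h.opp_kind))
        (nl_of_vertical h.vertical)
    · exact iff_of_true (h.leaving_rot h.mem (nl_of_vertical h.vertical))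
        (nl_of_vertical h.opp_kind)
  anchor x hx := by
    have hx' : x ∈ E.darts := hx
    obtain ⟨d, hd, hl, h1, h2, h3⟩ := h.other
    have hde : E.IsEdge ∅ d := ⟨hd, fun k => hl (Or.inr k), Set.notMem_empty _⟩
    by_cases hend : E.Same x r ∨ E.Same x (E.opp r)
    · refine ⟨d, isEdge_iff.2 ⟨hde, h1, h2⟩, hl, (h.same_iff hx' hd).2 (Or.inr ⟨hend, ?_⟩)⟩
      rcases h3 with h3 | h3
      · exact Or.inl h3.symm
      · exact Or.inr h3.symm
    · obtain ⟨e, he, hel, hxe⟩ := h.anchor x hx'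
      refine ⟨e, isEdge_iff.2 ⟨he, ?_, ?_⟩, hel, h.same_open hx' hxe⟩
      · rintro rfl; exact hend (Or.inl hxe)
      · rintro rfl; exact hend (Or.inr hxe)

theorem rot_inv_nl (h : Openable E r) (hd : d ∈ E.darts) (hl : ¬ E.Leaving d) :
    (openZipper E r).rot⁻¹ d = E.rot⁻¹ d := by
  have h1 := h.leaving_rot_inv hd hl
  rw [inv_eq_iff_eq, rot_other, apply_inv]
  · exact fun k => nl_of_vertical h.vertical (k ▸ h1)
  · exact fun k => nl_of_vertical h.opp_kind (k ▸ h1)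

theorem chain_iff (h : Openable E r) {s : β} (hs : s ∈ E.darts) (hl : E.Leaving s) :
    Chain (openZipper E r) s x ↔ Chain E s x := by
  have key : ∀ o ∈ E.darts, E.kind o = .outgoing →
      (openZipper E r).rot (E.opp o) = E.rot (E.opp o) := by
    intro o ho hk
    have h1 := h.toFrame.kind_opp ho hk
    refine rot_other (fun k => ?_) (fun k => ?_)
    · rw [k, h.vertical] at h1; cases h1
    · rw [k, h.opp_kind] at h1; cases h1
  constructor
  · intro hx
    induction hx with
    | start => exact .start
    | next o _ hk ih =>
      have : (openZipper E r).opp o = E.opp o := rfl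
      rw [this, key o (ih.mem h.toState hs hl).1 hk]
      exact ih.next o hk
  · intro hx
    induction hx with
    | start => exact .start
    | next o ho hk ih =>
      rw [← key o (ho.mem h.toState hs hl).1 hk]
      exact ih.next o hk

theorem chain_mirror_iff (h : Openable E r) {s : β} (hs : s ∈ E.darts) (hl : E.Leaving s) :
    Chain (openZipper E r).mirror s x ↔ Chain E.mirror s x := by
  have key : ∀ o ∈ E.darts, E.kind o = .outgoing →
      (openZipper E r).rot⁻¹ (E.opp o) = E.rot⁻¹ (E.opp o) := fun o ho hk =>
    h.rot_inv_nl (h.toFrame.opp_mem ho hk) (h.nl_opp ho hk)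
  constructor
  · intro hx
    induction hx with
    | start => exact .start
    | next o _ hk ih =>
      have : (openZipper E r).mirror.opp o = E.opp o := rfl
      rw [this, mirror_rot, key o (ih.mem h.toState.mirror hs hl).1 hk]
      exact ih.next o hk
  · intro hx
    induction hx with
    | start => exact .start
    | next o ho hk ih =>
      have h2 : E.mirror.rot (E.mirror.opp o) = (openZipper E r).rot⁻¹ (E.opp o) := by
        rw [key o (ho.mem h.toState.mirror hs hl).1 hk]; rfl
      rw [h2]
      exact ih.next o hk

/-- The opening interchanges the first corners of the two half-strips adjacent to the edge of `r`,
and leaves the second corners in place. -/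
theorem side_iff (h : Openable E r) (ha : a ∈ E.darts)
    (hk : E.kind a = .vertical) :
    (openZipper E r).OnSide (Equiv.swap r (E.opp r) a) P ↔ E.OnSide a P := by
  have h1 : (openZipper E r).rot (Equiv.swap r (E.opp r) a) = E.rot a := by
    simp [openZipper]
  rw [OnSide, OnSide, h1, h.chain_iff (h.toFrame.rot_mem a ha)
    (h.leaving_rot ha (nl_of_vertical hk))]
  rfl

theorem side_mirror_iff (h : Openable E r) (ha : a ∈ E.darts)
    (hk : E.kind a = .vertical) :
    (openZipper E r).mirror.OnSide a P ↔ E.mirror.OnSide a P := by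
  have hl := nl_of_vertical hk
  rw [OnSide, OnSide, mirror_rot, mirror_rot, h.rot_inv_nl ha hl,
    h.chain_mirror_iff (h.rot_inv_mem ha) (h.leaving_rot_inv ha hl)]
  rfl

/-- The half-strips adjacent to the edge of `r`. -/
def _root_.WGraph.adjacentStrips (E : WGraph β) (r : β) : Set (β × β) :=
    {(r, E.opp r), (E.opp r, r)}

theorem ident_ends (h : Openable E r) (hS : adjacentStrips E r ⊆ S) :
    E.Ident S (r, E.W r) (E.opp r, E.W (E.opp r)) := by
  have h1 := ident_of_same h.toFrame h.mem (same_rot E.rot r) (S := S)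
  have h2 := ident_of_same h.toFrame h.opp_mem (same_rot_inv E.rot (E.opp r)) (S := S)
  refine (h1.trans (ident_of_strip (hS (Or.inl rfl))
      (Or.inl ⟨isPoint_vertex (h.toFrame.rot_mem _ h.mem),
    Chain.start⟩) (Or.inr ⟨isPoint_vertex (h.rot_inv_mem h.opp_mem), Chain.start⟩) ?_)).trans
        h2.symm
  exact ((h.W_rot _ h.mem).trans h.W_opp.symm).trans
    (h.W_same h.opp_mem (same_rot_inv E.rot (E.opp r))).symm

/-- The opening of the zipper is a folding: the two half-strips adjacent to the edge of `r` become
the half-strips with the sliders `opp r` and `r`. -/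
def folding (h : Openable E r) {T : Set (β × β)} (hT : CornersOK E T)
    (hne : ∀ c ∈ T, c.1 ≠ r ∧ c.1 ≠ E.opp r) :
    Folding E ∅ (adjacentStrips E r ∪ T) (openZipper E r) {r, E.opp r}
      ({(r, r), (E.opp r, E.opp r)} ∪ T)
      (fun a a' => a = a' ∧ a ∈ E.darts ∧ E.kind a = .vertical ∧ a ≠ r ∧ a ≠ E.opp r)
      (fun a a' => a = a' ∧ a ∈ E.darts) := by
  have hpt : ∀ P, (openZipper E r).IsPoint P ↔ E.IsPoint P := fun P => Iff.rfl
  have hF' := h.state.toFrame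
  have hstrip : ∀ c ∈ adjacentStrips E r ∪ T,
      (Equiv.swap r (E.opp r) c.1, c.2) ∈ ({(r, r), (E.opp r, E.opp r)} ∪ T : Set (β × β)) ∧
      ∀ P, (openZipper E r).OnStrip (Equiv.swap r (E.opp r) c.1, c.2) P ↔ E.OnStrip c P := by
    rintro c hc
    have h0 : ((c.1 ∈ E.darts ∧ E.kind c.1 = .vertical) ∧
        (c.2 ∈ E.darts ∧ E.kind c.2 = .vertical)) := by
      rcases hc with (rfl | rfl) | hc
      · exact ⟨⟨h.mem, h.vertical⟩, h.opp_mem, h.opp_kind⟩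
      · exact ⟨⟨h.opp_mem, h.opp_kind⟩, h.mem, h.vertical⟩
      · exact hT c hc
    refine ⟨?_, fun P => or_congr (h.side_iff h0.1.1 h0.1.2) (h.side_mirror_iff h0.2.1 h0.2.2)⟩
    rcases hc with (rfl | rfl) | hc
    · simp
    · simp
    · rw [Equiv.swap_apply_of_ne_of_ne (hne c hc).1 (hne c hc).2]
      exact Or.inr hc
  have hstrip' : ∀ c ∈ ({(r, r), (E.opp r, E.opp r)} ∪ T : Set (β × β)),
      ∃ c₀ ∈ adjacentStrips E r ∪ T, ∀ P, (openZipper E r).OnStrip c P ↔ E.OnStrip c₀ P := by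
    rintro c hc
    have key : ∀ c₀ ∈ adjacentStrips E r ∪ T, c = (Equiv.swap r (E.opp r) c₀.1, c₀.2) →
        ∃ c₀ ∈ adjacentStrips E r ∪ T, ∀ P, (openZipper E r).OnStrip c P ↔ E.OnStrip c₀ P := by
      rintro c₀ hc₀ rfl
      exact ⟨c₀, hc₀, (hstrip c₀ hc₀).2⟩
    rcases hc with (rfl | rfl) | hc
    · exact key (E.opp r, r) (Or.inl (Or.inr rfl)) (by simp)
    · exact key (r, E.opp r) (Or.inl (Or.inl rfl)) (by simp)
    · exact key c (Or.inr hc) (by rw [Equiv.swap_apply_of_ne_of_ne (hne c hc).1 (hne c hc).2])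
  have hside : ∀ a P, a ∈ E.darts → E.kind a = .vertical → a ≠ r → a ≠ E.opp r →
      ((openZipper E r).OnSide a P ↔ E.OnSide a P) := by
    intro a P ha hk h1 h2
    have := h.side_iff ha hk (P := P)
    rwa [Equiv.swap_apply_of_ne_of_ne h1 h2] at this
  refine ⟨id, id, ⟨fun _ => rfl, fun P => (hpt P).2, ?_, fun d hd => ⟨d, hd, ident_refl⟩,
      ?_, ?_, fun o ho hk hw => Or.inr ⟨o, ho, hk, hw, ident_refl, ident_refl⟩⟩,
    ⟨fun _ => rfl, fun P => (hpt P).1, ?_, fun d hd => ⟨d, hd, ident_refl⟩, ?_, ?_,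
      fun o ho hk hw => Or.inr ⟨o, ho, hk, hw, ident_refl, ident_refl⟩⟩,
    fun _ _ => ident_refl, fun _ _ => ident_refl, h.vertexMap.1, ?_⟩
  · intro P Q hPQ
    refine ident_of_sides (E := E) id (fun x hx y _ hxy => ident_of_same hF' hx
        (h.same_open hx hxy)) ?_ hPQ
    intro c hc P Q hP hQ hPQ
    obtain ⟨h1, h2⟩ := hstrip c hc
    exact ident_of_strip h1 ((h2 P).2 hP) ((h2 Q).2 hQ) hPQ
  · rintro a _ P ⟨rfl, ha, hk, h1, h2⟩ hP
    exact ⟨P, (hside a P ha hk h1 h2).2 hP, ident_refl⟩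
  · rintro a _ P ⟨rfl, ha, hk, h1, h2⟩ hP
    exact ⟨P, (h.side_mirror_iff ha hk).2 hP, ident_refl⟩
  · intro P Q hPQ
    refine ident_of_sides id (fun x hx y hy hxy => ?_) ?_ hPQ
    · have key : ∀ x ∈ E.darts, (E.Same x r ∨ E.Same x (E.opp r)) →
          E.Ident (adjacentStrips E r ∪ T) (x, E.W x) (r, E.W r) := by
        rintro x hx (h1 | h1)
        · exact ident_of_same h.toFrame hx h1
        · exact (ident_of_same h.toFrame hx h1).trans
            (h.ident_ends Set.subset_union_left).symm
      rcases (h.same_iff hx hy).1 hxy with h1 | ⟨h1, h2⟩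
      · exact ident_of_same h.toFrame hx h1
      · exact (key x hx h1).trans (key y hy h2).symm
    · intro c hc P Q hP hQ hPQ
      obtain ⟨c₀, h1, h2⟩ := hstrip' c hc
      exact ident_of_strip h1 ((h2 P).1 hP) ((h2 Q).1 hQ) hPQ
  · rintro _ a P ⟨rfl, ha, hk, h1, h2⟩ hP
    exact ⟨P, (hside a P ha hk h1 h2).1 hP, ident_refl⟩
  · rintro _ a P ⟨rfl, ha, hk, h1, h2⟩ hP
    exact ⟨P, (h.side_mirror_iff ha hk).1 hP, ident_refl⟩
  · rintro d _ ⟨rfl, hd⟩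
    exact .refl _ _

end Openable

/-! ### Elementary modifications of permutations -/

theorem del_self (d : β) (σ : Equiv.Perm β) : del d σ d = d := by simp [del]

theorem del_of_eq {σ : Equiv.Perm β} (h : σ x = d) :
    del d σ x = σ d := by
  simp [del, h]

theorem del_of_ne {σ : Equiv.Perm β} (h : σ x ≠ d) (hx : x ≠ d) :
    del d σ x = σ x := by
  rw [del, Equiv.Perm.mul_apply, Equiv.swap_apply_of_ne_of_ne h]
  exact fun k => hx (σ.injective k)

theorem insertAfter_left (a b : β) (σ : Equiv.Perm β) : insertAfter a b σ a = σ b := by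
  simp [insertAfter]

theorem insertAfter_right (a b : β) (σ : Equiv.Perm β) : insertAfter a b σ b = σ a := by
  simp [insertAfter]

theorem insertAfter_of_ne {a b x : β} {σ : Equiv.Perm β} (h1 : x ≠ a) (h2 : x ≠ b) :
    insertAfter a b σ x = σ x := by
  simp [insertAfter, Equiv.swap_apply_of_ne_of_ne h1 h2]

/-! ### Gluing of the two rays bounding the unzipped part -/

/-- The slider `m` stands between the rays `p` and `q`. -/
structure RayPair (E : WGraph β) (M : Set β) (p m q : β) : Prop extends State E M where
  slider : m ∈ M
  rot_p : E.rot p = m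
  rot_m : E.rot m = q
  kind_p : E.kind p = .ray
  kind_q : E.kind q = .ray
  ne : p ≠ q

namespace RayPair

variable {p m q : β}

theorem m_mem (h : RayPair E M p m q) : m ∈ E.darts := h.slider_mem m h.slider

theorem m_kind (h : RayPair E M p m q) : E.kind m = .vertical := h.slider_kind m h.slider

theorem m_nl (h : RayPair E M p m q) : ¬ E.Leaving m := nl_of_vertical h.m_kind

theorem inv_m (h : RayPair E M p m q) : E.rot⁻¹ m = p := by rw [← h.rot_p, inv_apply]

theorem p_mem (h : RayPair E M p m q) : p ∈ E.darts := by
  rw [← h.inv_m]; exact h.rot_inv_mem h.m_mem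

theorem q_mem (h : RayPair E M p m q) : q ∈ E.darts := by
  rw [← h.rot_m]; exact h.rot_mem m h.m_mem

theorem p_l (h : RayPair E M p m q) : E.Leaving p := Or.inr h.kind_p

theorem q_l (h : RayPair E M p m q) : E.Leaving q := Or.inr h.kind_q

theorem p_ne_m (h : RayPair E M p m q) : p ≠ m := fun k => h.m_nl (k ▸ h.p_l)

theorem q_ne_m (h : RayPair E M p m q) : q ≠ m := fun k => h.m_nl (k ▸ h.q_l)

theorem same_pm (h : RayPair E M p m q) : E.Same p m := by
  rw [← h.rot_p]; exact same_rot _ _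

theorem same_mq (h : RayPair E M p m q) : E.Same m q := by
  rw [← h.rot_m]; exact same_rot _ _

theorem same_pq (h : RayPair E M p m q) : E.Same p q := h.same_pm.trans h.same_mq

theorem W_q (h : RayPair E M p m q) : E.W q = E.W p := h.W_same h.p_mem h.same_pq

theorem root_eq (h : RayPair E M p m q) (ha : a ∈ E.darts)
    (hk : E.kind a = .vertical) (hq : Chain E (E.rot a) q) : a = m :=
  Chain.root_unique h.toState ha h.m_mem hk h.m_kind hq (by rw [h.rot_m]; exact .start)

theorem mem_iff (h : RayPair E M p m q) :
    x ∈ (zipRays m E).darts ↔ x ≠ m ∧ x ≠ q ∧ x ∈ E.darts := by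
  simp [zipRays, h.rot_m]

theorem rot_q_ne (h : RayPair E M p m q) : E.rot q ≠ m ∧ E.rot q ≠ q :=
  ⟨fun k => h.ne (E.rot.injective (h.rot_p.trans k.symm)),
    fun k => h.nl_rot h.q_mem h.q_l (by rw [k]; exact h.q_l)⟩

theorem zip_rot_p (h : RayPair E M p m q) : (zipRays m E).rot p = E.rot q := by
  have h1 : del m E.rot p = q := by rw [del_of_eq h.rot_p, h.rot_m]
  simp only [zipRays, h.rot_m]
  rw [del_of_eq h1, del_of_ne h.rot_q_ne.1 h.q_ne_m]

theorem zip_rot (h : RayPair E M p m q) (hp : x ≠ p) (hm : x ≠ m) (hq : x ≠ q) :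
    (zipRays m E).rot x = E.rot x := by
  have h0 : E.rot x ≠ m := fun k => hp (E.rot.injective (k.trans h.rot_p.symm))
  have h1 : del m E.rot x = E.rot x := del_of_ne h0 hm
  have h2 : E.rot x ≠ q := fun k => hm (E.rot.injective (k.trans h.rot_m.symm))
  simp only [zipRays, h.rot_m]
  rw [del_of_ne (by rw [h1]; exact h2) hq, h1]

theorem zip_rot_nl (h : RayPair E M p m q) (hl : ¬ E.Leaving x) (hm : x ≠ m) :
    (zipRays m E).rot x = E.rot x :=
  h.zip_rot (fun k => hl (k ▸ h.p_l)) hm (fun k => hl (k ▸ h.q_l))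

theorem zip_rot_inv (h : RayPair E M p m q) (hd : d ≠ E.rot q) (hm : d ≠ m) (hq : d ≠ q) :
    (zipRays m E).rot⁻¹ d = E.rot⁻¹ d := by
  rw [inv_eq_iff_eq, h.zip_rot, apply_inv]
  · intro k; rw [inv_eq_iff_eq, h.rot_p] at k; exact hm k
  · intro k; rw [inv_eq_iff_eq, h.rot_m] at k; exact hq k
  · intro k; rw [inv_eq_iff_eq] at k; exact hd k

theorem zip_rot_inv_rot_q (h : RayPair E M p m q) : (zipRays m E).rot⁻¹ (E.rot q) = p := by
  rw [← h.zip_rot_p, inv_apply]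

theorem zip_rot_mem (h : RayPair E M p m q) :
    ∀ d ∈ (zipRays m E).darts, (zipRays m E).rot d ∈ (zipRays m E).darts := by
  intro d hd
  obtain ⟨h1, h2, h3⟩ := h.mem_iff.1 hd
  rw [h.mem_iff]
  by_cases hp : d = p
  · rw [hp, h.zip_rot_p]
    exact ⟨h.rot_q_ne.1, h.rot_q_ne.2, h.rot_mem _ h.q_mem⟩
  · rw [h.zip_rot hp h1 h2]
    exact ⟨fun k => hp (E.rot.injective (k.trans h.rot_p.symm)),
      fun k => h1 (E.rot.injective (k.trans h.rot_m.symm)), h.rot_mem _ h3⟩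

theorem fw_mem (h : RayPair E M p m q) (hx : x ∈ E.darts) :
    IsSlide.fw p m q x ∈ (zipRays m E).darts := by
  rw [h.mem_iff, IsSlide.fw]; split_ifs with h1
  · exact ⟨h.p_ne_m, h.ne, h.p_mem⟩
  · push Not at h1; exact ⟨h1.1, h1.2, hx⟩

theorem fw_of_mem (h : RayPair E M p m q) (hx : x ∈ (zipRays m E).darts) :
    IsSlide.fw p m q x = x := by
  rw [h.mem_iff] at hx
  rw [IsSlide.fw, if_neg (by tauto)]

theorem same_fw_self (h : RayPair E M p m q) (x : β) :
    E.Same x (IsSlide.fw p m q x) := by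
  rw [IsSlide.fw]; split_ifs with h1
  · rcases h1 with rfl | rfl
    · exact h.same_pm.symm
    · exact h.same_pq.symm
  · exact .refl _ _

theorem same_fw (h : RayPair E M p m q) (hx : x ∈ E.darts) (hxy : E.Same x y) :
    (zipRays m E).Same (IsSlide.fw p m q x) (IsSlide.fw p m q y) := by
  have hm : IsSlide.fw p m q m = p := by simp [IsSlide.fw]
  have hq : IsSlide.fw p m q q = p := by simp [IsSlide.fw]
  refine sameCycle_map h.rot_mem _ (fun x hx => ?_) hx hxy
  by_cases hxm : x = m
  · rw [hxm, h.rot_m, hm, hq]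
  by_cases hxq : x = q
  · have h1 := same_rot (zipRays m E).rot p
    rw [h.zip_rot_p] at h1
    rwa [hxq, hq, h.fw_of_mem (h.mem_iff.2 ⟨h.rot_q_ne.1, h.rot_q_ne.2, h.rot_mem _ h.q_mem⟩)]
  by_cases hxp : x = p
  · rw [hxp, h.rot_p, hm, h.fw_of_mem (h.mem_iff.2 ⟨h.p_ne_m, h.ne, h.p_mem⟩)]
  · have h1 := same_rot (zipRays m E).rot x
    have hx' := h.mem_iff.2 ⟨hxm, hxq, hx⟩
    have h2 := h.zip_rot_mem x hx'
    rw [h.zip_rot hxp hxm hxq] at h1 h2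
    rwa [h.fw_of_mem hx', h.fw_of_mem h2]

theorem of_same (h : RayPair E M p m q) (hx : x ∈ (zipRays m E).darts)
    (hxy : (zipRays m E).Same x y) : E.Same x y := by
  refine sameCycle_map h.zip_rot_mem id (fun x hx => ?_) hx hxy
  obtain ⟨h1, h2, h3⟩ := h.mem_iff.1 hx
  by_cases hp : x = p
  · rw [hp, h.zip_rot_p]
    exact h.same_pq.trans (same_rot _ _)
  · rw [h.zip_rot hp h1 h2]
    exact same_rot _ _

theorem same_fw_iff (h : RayPair E M p m q) (hx : x ∈ E.darts) :
    (zipRays m E).Same (IsSlide.fw p m q x) (IsSlide.fw p m q y) ↔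
      E.Same x y :=
  ⟨fun h1 => ((h.same_fw_self x).trans (h.of_same (h.fw_mem hx) h1)).trans
    (h.same_fw_self y).symm, h.same_fw hx⟩

theorem vertexMap (h : RayPair E M p m q) :
    VertexMap E M (zipRays m E) (M \ {m}) (IsSlide.fw p m q) ∧
      (zipRays m E).verts.card = E.verts.card := by
  refine vertexMap_of_bijective (fun d hd => h.fw_mem hd)
    (fun d hd e he => (h.same_fw_iff hd).symm) (fun d hd => ⟨d, (h.mem_iff.1 hd).2.2, by
      rw [h.fw_of_mem hd]⟩) (fun d hd => ?_) (fun d hd => ?_)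
  · exact h.W_same hd (h.same_fw_self d)
  · have key : ∀ x, x ≠ m → x ≠ q →
        (x ∈ (zipRays m E).vert (IsSlide.fw p m q d) ↔ x ∈ E.vert d) := by
      intro x h1 h2
      rw [mem_vert, mem_vert, h.mem_iff, ← h.same_fw_iff hd]
      have : IsSlide.fw p m q x = x := by rw [IsSlide.fw, if_neg (by tauto)]
      rw [this]; tauto
    have hq : ∀ x, ¬ E.Leaving x → x ≠ q := fun x hx k => hx (k ▸ h.q_l)
    refine ordM_congr (fun x => ⟨?_, ?_⟩) fun x => ?_
    · rintro ⟨h1, h2, h3⟩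
      have hm := (h.mem_iff.1 (mem_vert.1 h1).1).1
      exact ⟨(key x hm (hq x (nl_of_vertical h2))).1 h1, h2, fun k => h3 ⟨k, hm⟩⟩
    · rintro ⟨h1, h2, h3⟩
      have hm : x ≠ m := by rintro rfl; exact h3 h.slider
      exact ⟨(key x hm (hq x (nl_of_vertical h2))).2 h1, h2, fun k => h3 k.1⟩
    · refine and_congr_left fun h1 => key x ?_ (hq x (nl_of_incoming h1))
      rintro rfl; exact absurd (h1.symm.trans h.m_kind) (by simp)

theorem isEdge_iff (h : RayPair E M p m q) :
    (zipRays m E).IsEdge (M \ {m}) x ↔ E.IsEdge M x := by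
  have h0 : (zipRays m E).kind = E.kind := rfl
  simp only [IsEdge, h.mem_iff, h0, Set.mem_sdiff, Set.mem_singleton_iff]
  constructor
  · rintro ⟨⟨h1, h2, h3⟩, h4, h5⟩
    exact ⟨h3, h4, fun k => h5 ⟨k, h1⟩⟩
  · rintro ⟨h1, h2, h3⟩
    refine ⟨⟨?_, ?_, h1⟩, h2, fun k => h3 k.1⟩
    · rintro rfl; exact h3 h.slider
    · rintro rfl; exact h2 h.kind_q

theorem state (h : RayPair E M p m q) : State (zipRays m E) (M \ {m}) where
  rot_mem := h.zip_rot_mem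
  slider_mem x hx := h.mem_iff.2 ⟨hx.2, (by
    rintro rfl
    have := h.slider_kind x hx.1
    rw [h.kind_q] at this; cases this), h.slider_mem x hx.1⟩
  slider_kind x hx := h.slider_kind x hx.1
  opp_edge d hd := h.isEdge_iff.2 (h.opp_edge d (h.isEdge_iff.1 hd))
  opp_opp d hd := h.opp_opp d (h.isEdge_iff.1 hd)
  opp_ne d hd := h.opp_ne d (h.isEdge_iff.1 hd)
  kind_vertical d hd := h.kind_vertical d (h.isEdge_iff.1 hd)
  kind_outgoing d hd := h.kind_outgoing d (h.isEdge_iff.1 hd)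
  kind_incoming d hd := h.kind_incoming d (h.isEdge_iff.1 hd)
  W_rot d hd := h.W_same (h.mem_iff.1 hd).2.2 (h.of_same hd (same_rot _ _))
  W_le d hd hk := h.W_le d (h.mem_iff.1 hd).2.2 hk
  W_vertical d hd := h.W_vertical d (h.isEdge_iff.1 hd)
  H_opp d hd := h.H_opp d (h.isEdge_iff.1 hd)
  H_nonneg d hd := h.H_nonneg d (h.isEdge_iff.1 hd)
  conn d hd e he := by
    have hsame : ∀ x y, (zipRays m E).Same x y →
        EqvGen ((zipRays m E).Link (M \ {m})) x y := fun x y hxy =>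
      sameCycle_eqvGen (R := (zipRays m E).Link (M \ {m})) (fun _ => Or.inl rfl) hxy
    rw [← h.fw_of_mem hd, ← h.fw_of_mem he]
    refine eqvGen_le_of (T := fun x y => EqvGen ((zipRays m E).Link (M \ {m}))
        (IsSlide.fw p m q x) (IsSlide.fw p m q y)) (equivalence_comap (equivalence_eqvGen _) _) ?_
      (h.mem_iff.1 hd).2.2 (h.conn d (h.mem_iff.1 hd).2.2 e (h.mem_iff.1 he).2.2)
    rintro x y (rfl | ⟨hx, rfl⟩)
    · exact ⟨(perm_mem_iff h.rot_mem x).symm, fun hx => hsame _ _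
        (h.same_fw hx (same_rot _ _))⟩
    · refine ⟨⟨fun _ => (h.opp_edge x hx).1, fun _ => hx.1⟩, fun _ => ?_⟩
      have h2 := h.isEdge_iff.2 hx
      rw [h.fw_of_mem h2.1, h.fw_of_mem (h.isEdge_iff.2 (h.opp_edge x hx)).1]
      exact EqvGen.rel _ _ (Or.inr ⟨h2, rfl⟩)
  count := by
    rw [h.vertexMap.2, h.count]
    have : (zipRays m E).edgesM (M \ {m}) = E.edgesM M := by
      rw [edgesM, edgesM]
      have h0 : (zipRays m E).opp = E.opp := rfl
      rw [h0]
      congr 1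
      ext x
      simp only [mem_filter, h.isEdge_iff]
      exact and_congr_left fun hx => ⟨fun _ => hx.1, fun _ => (h.isEdge_iff.2 hx).1⟩
    rw [this]
  alt d hd := by
    obtain ⟨h1, h2, h3⟩ := h.mem_iff.1 hd
    have hl : ∀ x, (zipRays m E).Leaving x ↔ E.Leaving x := fun x => Iff.rfl
    rw [hl, hl]
    by_cases hp : d = p
    · rw [hp, h.zip_rot_p]
      exact iff_of_false (h.nl_rot h.q_mem h.q_l) (not_not.2 h.p_l)
    · rw [h.zip_rot hp h1 h2]
      exact h.alt d h3
  anchor x hx := by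
    obtain ⟨d, hd, hl, hxd⟩ := h.anchor x (h.mem_iff.1 hx).2.2
    have hd' := h.isEdge_iff.2 hd
    refine ⟨d, hd', hl, ?_⟩
    have := h.same_fw (h.mem_iff.1 hx).2.2 hxd
    rwa [h.fw_of_mem hx, h.fw_of_mem hd'.1] at this

theorem chain (h : RayPair E M p m q) {s : β} (hsm : s ∈ E.darts)
    (hl : E.Leaving s) : Chain (zipRays m E) s x ↔ Chain E s x := by
  have key : ∀ o ∈ E.darts, E.kind o = .outgoing →
      (zipRays m E).rot (E.opp o) = E.rot (E.opp o) := fun o ho hk =>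
    h.zip_rot_nl (h.nl_opp ho hk) fun k => by
      have := h.kind_opp ho hk
      rw [k, h.m_kind] at this; cases this
  constructor
  · intro hx
    induction hx with
    | start => exact .start
    | next o _ hk ih =>
      have : (zipRays m E).opp o = E.opp o := rfl
      rw [this, key o (ih.mem h.toState hsm hl).1 hk]
      exact ih.next o hk
  · intro hx
    induction hx with
    | start => exact .start
    | next o ho hk ih =>
      rw [← key o (ho.mem h.toState hsm hl).1 hk]
      exact ih.next o hk

theorem chain_mirror (h : RayPair E M p m q) (ha : a ∈ E.darts)
    (hk : E.kind a = .vertical) (ham : a ≠ m) (hx : Chain E.mirror (E.rot⁻¹ a) x) :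
    Chain (zipRays m E).mirror ((zipRays m E).rot⁻¹ a) (if x = q then p else x) := by
  have step : ∀ d ∈ E.darts, ¬ E.Leaving d → d ≠ m →
      (if E.rot⁻¹ d = q then p else E.rot⁻¹ d) = (zipRays m E).rot⁻¹ d := by
    intro d hd hl hdm
    by_cases h4 : d = E.rot q
    · rw [h4, h.zip_rot_inv_rot_q, inv_apply, if_pos rfl]
    · rw [h.zip_rot_inv h4 hdm (fun k => hl (k ▸ h.q_l)), if_neg]
      intro k; exact h4 (by rw [← k, apply_inv])
  have hl := h.leaving_rot_inv ha (nl_of_vertical hk)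
  induction hx with
  | start => rw [step a ha (nl_of_vertical hk) ham]; exact .start
  | next o ho hko ih =>
    have ho' := (ho.mem h.toState.mirror (h.rot_inv_mem ha) hl).1
    have hoq : o ≠ q := by
      rintro rfl
      have h1 := h.kind_q
      rw [mirror_kind, h1] at hko; cases hko
    rw [if_neg hoq] at ih
    have := ih.next o hko
    rw [mirror_rot] at this ⊢
    rw [mirror_opp] at this ⊢
    rw [step _ (h.opp_mem ho' hko) (h.nl_opp ho' hko)]
    · exact this
    · intro k
      have := h.kind_opp ho' hko
      rw [k, h.m_kind] at this; cases this

theorem chain_mirror' (h : RayPair E M p m q) (ha : a ∈ E.darts)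
    (hk : E.kind a = .vertical) (ham : a ≠ m)
    (hx : Chain (zipRays m E).mirror ((zipRays m E).rot⁻¹ a) x) :
    Chain E.mirror (E.rot⁻¹ a) (if x = p then q else x) := by
  have step : ∀ d ∈ E.darts, ¬ E.Leaving d → d ≠ m →
      (if (zipRays m E).rot⁻¹ d = p then q else (zipRays m E).rot⁻¹ d) = E.rot⁻¹ d := by
    intro d hd hl hdm
    by_cases h4 : d = E.rot q
    · rw [h4, h.zip_rot_inv_rot_q, inv_apply, if_pos rfl]
    · rw [h.zip_rot_inv h4 hdm (fun k => hl (k ▸ h.q_l)), if_neg]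
      intro k; exact hdm (by rw [← h.rot_p, ← k, apply_inv])
  have hs' := h.state
  have ha' : a ∈ (zipRays m E).darts := h.mem_iff.2 ⟨ham, (by
    rintro rfl
    rw [h.kind_q] at hk; cases hk), ha⟩
  have hl := hs'.leaving_rot_inv ha' (nl_of_vertical hk)
  induction hx with
  | start => rw [step a ha (nl_of_vertical hk) ham]; exact .start
  | next o ho hko ih =>
    have ho' := (h.mem_iff.1 (ho.mem hs'.mirror (hs'.rot_inv_mem ha') hl).1).2.2
    have hko' : E.kind o = .outgoing := hko
    have hop : o ≠ p := by
      rintro rfl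
      rw [h.kind_p] at hko'; cases hko'
    rw [if_neg hop] at ih
    have := ih.next o hko'
    have h1 : (zipRays m E).mirror.rot ((zipRays m E).mirror.opp o) =
      (zipRays m E).rot⁻¹ (E.opp o) := rfl
    rw [h1, step _ (h.opp_mem ho' hko') (h.nl_opp ho' hko')]
    · exact this
    · intro k
      have := h.kind_opp ho' hko'
      rw [k, h.m_kind] at this; cases this

theorem isPoint_iff (h : RayPair E M p m q) (hm : P.1 ≠ m) (hq : P.1 ≠ q) :
    (zipRays m E).IsPoint P ↔ E.IsPoint P := by
  have : P.1 ∈ (zipRays m E).darts ↔ P.1 ∈ E.darts := by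
    rw [h.mem_iff]; tauto
  simp only [IsPoint, this]
  rfl

theorem isPoint_p (h : RayPair E M p m q) : E.IsPoint (p, w) ↔ E.W p ≤ w := by
  simp only [IsPoint, h.p_l, h.p_mem, true_and, level, h.kind_p, if_true, EReal.coe_lt_top,
    and_true]
  exact ⟨fun h1 => h1.elim (fun k => k.ge) le_of_lt, fun h1 => h1.eq_or_lt.imp_left Eq.symm⟩

theorem isPoint_q (h : RayPair E M p m q) : E.IsPoint (q, w) ↔ E.W p ≤ w := by
  simp only [IsPoint, h.q_l, h.q_mem, true_and, level, h.kind_q, if_true, EReal.coe_lt_top,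
    and_true, h.W_q]
  exact ⟨fun h1 => h1.elim (fun k => k.ge) le_of_lt, fun h1 => h1.eq_or_lt.imp_left Eq.symm⟩

/-- The ray `q` is glued to the ray `p`. -/
def glueMap (p m q : β) (P : β × ℝ) : β × ℝ := (IsSlide.fw p m q P.1, P.2)

theorem glueMap_isPoint (h : RayPair E M p m q) (hP : E.IsPoint P) :
    (zipRays m E).IsPoint (glueMap p m q P) := by
  obtain ⟨x, w⟩ := P
  by_cases hx : x = m ∨ x = q
  · have h1 : glueMap p m q (x, w) = (p, w) := by simp [glueMap, IsSlide.fw, hx]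
    rw [h1, h.isPoint_iff h.p_ne_m h.ne, h.isPoint_p]
    rcases hx with rfl | rfl
    · rcases hP.2 with h2 | h2
      · have h2' : w = E.W x := h2
        rw [h2', h.W_same h.p_mem h.same_pm]
      · exact absurd h2.1 h.m_nl
    · exact h.isPoint_q.1 hP
  · have h1 : glueMap p m q (x, w) = (x, w) := by simp [glueMap, IsSlide.fw, hx]
    push Not at hx
    rw [h1, h.isPoint_iff hx.1 hx.2]; exact hP

theorem glueMap_of_mem (h : RayPair E M p m q) (hP : P.1 ∈ (zipRays m E).darts) :
    glueMap p m q P = P := by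
  rw [glueMap, h.fw_of_mem hP]

theorem side_glue (h : RayPair E M p m q) (ha : a ∈ E.darts)
    (hk : E.kind a = .vertical) (ham : a ≠ m) (hP : E.OnSide a P) :
    (zipRays m E).OnSide a (glueMap p m q P) := by
  have hl := h.leaving_rot ha (nl_of_vertical hk)
  have hx := hP.2.mem h.toState (h.rot_mem a ha) hl
  have hm : P.1 ≠ m := fun k => h.m_nl (k ▸ hx.2)
  have hq : P.1 ≠ q := fun k => ham (h.root_eq ha hk (k ▸ hP.2))
  rw [h.glueMap_of_mem (h.mem_iff.2 ⟨hm, hq, hx.1⟩)]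
  refine ⟨(h.isPoint_iff hm hq).2 hP.1, ?_⟩
  rw [h.zip_rot_nl (nl_of_vertical hk) ham, h.chain (h.rot_mem a ha) hl]
  exact hP.2

theorem side_lift (h : RayPair E M p m q) (ha : a ∈ E.darts)
    (hk : E.kind a = .vertical) (ham : a ≠ m)
    (hP : (zipRays m E).OnSide a P) : E.OnSide a P := by
  have hl := h.leaving_rot ha (nl_of_vertical hk)
  have hx := hP.2
  rw [h.zip_rot_nl (nl_of_vertical hk) ham, h.chain (h.rot_mem a ha) hl] at hx
  have hm := h.mem_iff.1 hP.1.1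
  exact ⟨(h.isPoint_iff hm.1 hm.2.1).1 hP.1, hx⟩

theorem side_mirror_glue (h : RayPair E M p m q) (ha : a ∈ E.darts)
    (hk : E.kind a = .vertical) (ham : a ≠ m) (hP : E.mirror.OnSide a P) :
    (zipRays m E).mirror.OnSide a (glueMap p m q P) := by
  have hl := h.leaving_rot_inv ha (nl_of_vertical hk)
  have hx := hP.2.mem h.toState.mirror (h.rot_inv_mem ha) hl
  have hm : P.1 ≠ m := fun k => h.m_nl (k ▸ hx.2)
  refine ⟨h.glueMap_isPoint hP.1, ?_⟩
  have := h.chain_mirror ha hk ham hP.2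
  have h1 : (glueMap p m q P).1 = if P.1 = q then p else P.1 := by
    simp [glueMap, IsSlide.fw, hm]
  rw [h1]; exact this

theorem onStrip_p (h : RayPair E M p m q) (hP : E.IsPoint (p, w)) :
    E.OnStrip (m, m) (p, w) :=
  Or.inr ⟨hP, by rw [mirror_rot, h.inv_m]; exact .start⟩

theorem onStrip_q (h : RayPair E M p m q) (hP : E.IsPoint (q, w)) :
    E.OnStrip (m, m) (q, w) :=
  Or.inl ⟨hP, by rw [h.rot_m]; exact .start⟩

theorem side_mirror_lift (h : RayPair E M p m q) (hS : (m, m) ∈ S)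
    (ha : a ∈ E.darts) (hk : E.kind a = .vertical) (ham : a ≠ m)
    (hP : (zipRays m E).mirror.OnSide a P) : ∃ P', E.mirror.OnSide a P' ∧ E.Ident S P P' := by
  obtain ⟨x, w⟩ := P
  have hc := h.chain_mirror' ha hk ham hP.2
  have hm := h.mem_iff.1 hP.1.1
  have hpt := (h.isPoint_iff hm.1 hm.2.1).1 hP.1
  by_cases hx : x = p
  · subst hx
    rw [if_pos rfl] at hc
    have hpq : E.IsPoint (q, w) := by
      rw [h.isPoint_q, ← h.isPoint_p]; exact hpt
    exact ⟨(q, w), ⟨hpq, hc⟩, ident_of_strip hS (h.onStrip_p hpt) (h.onStrip_q hpq) rfl⟩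
  · rw [if_neg hx] at hc
    exact ⟨_, ⟨hpt, hc⟩, ident_refl⟩

/-- All points of the unzipped part are glued together levelwise. -/
theorem strip_glue (h : RayPair E M p m q) (hP : E.OnStrip (m, m) P) :
    glueMap p m q P = (p, P.2) := by
  rcases hP with ⟨-, hx⟩ | ⟨-, hx⟩
  · rw [h.rot_m] at hx
    rcases hx.cases_head with h1 | ⟨h1, -⟩
    · rw [glueMap, h1]; simp [IsSlide.fw]
    · rw [h.kind_q] at h1; cases h1
  · rw [mirror_rot, h.inv_m] at hx
    rcases hx.cases_head with h1 | ⟨h1, -⟩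
    · rw [glueMap, h1]; simp [IsSlide.fw]
    · rw [mirror_kind, h.kind_p] at h1; cases h1

/-- The gluing of the two rays is a folding. -/
def folding (h : RayPair E M p m q) {T : Set (β × β)} (hT : CornersOK E T)
    (hne : ∀ c ∈ T, c.1 ≠ m ∧ c.2 ≠ m) :
    Folding E M ({(m, m)} ∪ T) (zipRays m E) (M \ {m}) T
      (fun a a' => a = a' ∧ a ∈ E.darts ∧ E.kind a = .vertical ∧ a ≠ m)
      (fun a a' => a = a' ∧ a ∈ (zipRays m E).darts) := by
  have hF' := h.state.toFrame
  have hm : (m, m) ∈ ({(m, m)} ∪ T : Set (β × β)) := Or.inl rfl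
  refine ⟨glueMap p m q, id, ⟨fun _ => rfl, fun P hP => h.glueMap_isPoint hP, ?_,
      fun d hd => ⟨_, h.fw_mem hd, ?_⟩, ?_, ?_, fun o ho hk hw => Or.inr ?_⟩,
    ⟨fun _ => rfl, fun P hP => ?_, ?_, fun d hd => ⟨d, (h.mem_iff.1 hd).2.2, ident_refl⟩, ?_,
      ?_, fun o ho hk hw => Or.inr ⟨o, (h.mem_iff.1 ho).2.2, hk, hw, ident_refl,
        ident_refl⟩⟩, ?_, ?_, h.vertexMap.1, ?_⟩
  · intro P Q hPQ
    refine ident_of_sides (E := E) (glueMap p m q) (fun x hx y hy hxy => ?_) ?_ hPQ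
    · have h1 : ∀ x ∈ E.darts, glueMap p m q (x, E.W x) =
          (IsSlide.fw p m q x, (zipRays m E).W (IsSlide.fw p m q x)) := fun x hx => by
        rw [h.vertexMap.1.W x hx]; rfl
      rw [h1 x hx, h1 y hy]
      exact ident_of_same hF' (h.fw_mem hx) (h.same_fw hx hxy)
    · rintro c (rfl | hc) P Q hP hQ hPQ
      · rw [h.strip_glue hP, h.strip_glue hQ, hPQ]; exact ident_refl
      · obtain ⟨h2, h3⟩ := hT c hc
        exact ident_strip_of_sides hF' (glueMap p m q) (fun _ => rfl) hc
          (fun P hP => ⟨_, h.side_glue h2.1 h2.2 (hne c hc).1 hP, ident_refl⟩)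
          (fun P hP => ⟨_, h.side_mirror_glue h3.1 h3.2 (hne c hc).2 hP, ident_refl⟩)
          hP hQ hPQ
  · rw [h.vertexMap.1.W d hd]; exact ident_refl
  · rintro a _ P ⟨rfl, ha, hk, ham⟩ hP
    exact ⟨_, h.side_glue ha hk ham hP, ident_refl⟩
  · rintro a _ P ⟨rfl, ha, hk, ham⟩ hP
    exact ⟨_, h.side_mirror_glue ha hk ham hP, ident_refl⟩
  · have h1 := h.isEdge_iff.2 (h.isEdge_out ho hk)
    have h2 := h.isEdge_iff.2 (h.opp_edge o (h.isEdge_out ho hk))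
    refine ⟨o, h1.1, hk, hw, ?_, ?_⟩
    · rw [h.glueMap_of_mem (P := (o, E.W o)) h1.1]; exact ident_refl
    · rw [h.glueMap_of_mem (P := (E.opp o, E.W (E.opp o))) h2.1]; exact ident_refl
  · have := h.mem_iff.1 hP.1
    exact (h.isPoint_iff this.1 this.2.1).1 hP
  · intro P Q hPQ
    refine ident_of_sides (E := zipRays m E) id (fun x hx y hy hxy =>
      ident_of_same h.toFrame (h.mem_iff.1 hx).2.2 (h.of_same hx hxy)) ?_ hPQ
    intro c hc P Q hP hQ hPQ
    obtain ⟨h2, h3⟩ := hT c hc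
    exact ident_strip_of_sides h.toFrame id (fun _ => rfl) (Or.inr hc)
      (fun P hP => ⟨_, h.side_lift h2.1 h2.2 (hne c hc).1 hP, ident_refl⟩)
      (fun P hP => h.side_mirror_lift hm h3.1 h3.2 (hne c hc).2 hP) hP hQ hPQ
  · rintro _ a P ⟨rfl, ha, hk, ham⟩ hP
    exact ⟨_, h.side_lift ha hk ham hP, ident_refl⟩
  · rintro _ a P ⟨rfl, ha, hk, ham⟩ hP
    exact h.side_mirror_lift hm ha hk ham hP
  · rintro ⟨x, w⟩ hP
    by_cases h1 : x = m
    · subst h1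
      rcases hP.2 with h2 | h2
      · have h2' : w = E.W x := h2
        subst h2'
        have := (ident_of_same h.toFrame h.p_mem h.same_pm (S := {(x, x)} ∪ T))
        rw [h.W_same h.p_mem h.same_pm] at this ⊢
        simpa [glueMap, IsSlide.fw] using this
      · exact absurd h2.1 h.m_nl
    by_cases h2 : x = q
    · subst h2
      have h3 : glueMap p m x (x, w) = (p, w) := by simp [glueMap, IsSlide.fw]
      rw [h3]
      exact ident_of_strip hm (h.onStrip_p (h.isPoint_p.2 (h.isPoint_q.1 hP)))
        (h.onStrip_q hP) rfl
    · rw [h.glueMap_of_mem (P := (x, w)) (h.mem_iff.2 ⟨h1, h2, hP.1⟩)]; exact ident_refl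
  · intro P hP
    rw [id, h.glueMap_of_mem hP.1]; exact ident_refl
  · rintro d _ ⟨rfl, hd⟩
    have : IsSlide.fw p m q d = d := h.fw_of_mem hd
    simp only [glueMap, this]
    exact .refl _ _

end RayPair

/-! ### The graphs arising in a step of zipping -/

theorem isContraction_contract {p : β} (h : Contractible E M p) :
    IsContraction E (E.contract p) p := by
  have hne : E.opp p ≠ p := h.opp_ne p (IsContraction.edge h)
  have hns := IsContraction.not_same h
  have h1 : E.rot p ≠ E.opp p := fun k => hns (by rw [← k]; exact same_rot _ _)
  have h2 : E.rot (E.opp p) ≠ p := fun k => hns (by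
    have := (same_rot E.rot (E.opp p)).symm
    rwa [k] at this)
  have hσ : ∀ x, x ≠ p → x ≠ E.opp p → (E.rot * Equiv.swap p (E.opp p)) x = E.rot x := by
    intro x hx hx'
    rw [Equiv.Perm.mul_apply, Equiv.swap_apply_of_ne_of_ne hx hx']
  have hσ1 : (E.rot * Equiv.swap p (E.opp p)) p = E.rot (E.opp p) := by simp
  have hσ2 : (E.rot * Equiv.swap p (E.opp p)) (E.opp p) = E.rot p := by simp
  have hmem : ∀ x, x ∈ (E.contract p).darts → x ≠ p ∧ x ≠ E.opp p := fun x hx => by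
    simp only [contract, mem_erase] at hx; tauto
  refine ⟨rfl, ?_, ?_, ?_, rfl, rfl, rfl, fun _ _ => rfl⟩
  · intro x hx hr
    obtain ⟨hx1, hx2⟩ := hmem x hx
    have h3 : del (E.opp p) (E.rot * Equiv.swap p (E.opp p)) x = p := by
      rw [del_of_ne _ hx2, hσ x hx1 hx2, hr]
      rw [hσ x hx1 hx2, hr]; exact hne.symm
    simp only [contract]
    rw [del_of_eq h3, del_of_ne _ hne.symm, hσ1]
    rw [hσ1]; exact h.rot_opp_ne
  · intro x hx hr
    obtain ⟨hx1, hx2⟩ := hmem x hx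
    have h3 : del (E.opp p) (E.rot * Equiv.swap p (E.opp p)) x = E.rot p := by
      rw [del_of_eq _, hσ2]
      rw [hσ x hx1 hx2, hr]
    simp only [contract]
    rw [del_of_ne _ hx1, h3]
    rw [h3]; exact h.rot_ne
  · intro x hx hr hr'
    obtain ⟨hx1, hx2⟩ := hmem x hx
    have h3 : del (E.opp p) (E.rot * Equiv.swap p (E.opp p)) x = E.rot x := by
      rw [del_of_ne _ hx2, hσ x hx1 hx2]
      rw [hσ x hx1 hx2]; exact hr'
    simp only [contract]
    rw [del_of_ne _ hx1, h3]
    rw [h3]; exact hr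

/-- The graph obtained by moving the slider `m` past the edge `p`. -/
def slideGraph (E : WGraph β) (p m q : β) : WGraph β :=
  { E with
    rot := insertAfter m q (insertAfter (E.rot⁻¹ (E.opp p)) m (del q (del m E.rot)))
    W := Function.update (Function.update E.W q (E.W (E.opp p))) m (E.W (E.opp p)) }

theorem del_del {σ : Equiv.Perm β} {p m q : β} (hp : σ p = m) (hm : σ m = q) (hpq : p ≠ q)
    (hqm : q ≠ m) : del q (del m σ) p = σ q ∧ del q (del m σ) m = m ∧
      del q (del m σ) q = q ∧ ∀ x, x ≠ p → x ≠ m → x ≠ q → del q (del m σ) x = σ x := by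
  have h1 : σ q ≠ m := fun k => hpq (σ.injective (hp.trans k.symm))
  refine ⟨?_, ?_, del_self _ _, fun x h2 h3 h4 => ?_⟩
  · rw [del_of_eq, del_of_ne h1 hqm]
    rw [del_of_eq hp, hm]
  · rw [del_of_ne _ hqm.symm, del_self]
    rw [del_self]; exact hqm.symm
  · have h5 : σ x ≠ m := fun k => h2 (σ.injective (k.trans hp.symm))
    have h6 : σ x ≠ q := fun k => h3 (σ.injective (k.trans hm.symm))
    rw [del_of_ne _ h4, del_of_ne h5 h3]
    rw [del_of_ne h5 h3]; exact h6

theorem isSlide_slideGraph {p m q : β} (h : Slidable E M p m q) :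
    IsSlide E (slideGraph E p m q) p m q := by
  have hqm : q ≠ m := (h.ne_of_l h.q_l).1
  have hpm : p ≠ m := (h.ne_of_l h.p_l).1
  have hnm : E.rot⁻¹ (E.opp p) ≠ m := (h.ne_of_l h.n_l).1
  obtain ⟨h1, h2, h3, h4⟩ := del_del h.rot_p h.rot_m h.ne hqm
  refine ⟨rfl, ?_, ?_, ?_, fun x _ hp hq hn => ?_, rfl, rfl, rfl, ?_, ?_, fun x _ hq hm => ?_⟩
  · simp only [slideGraph]
    rw [insertAfter_of_ne hpm h.ne, insertAfter_of_ne h.n_ne_p.symm hpm, h1]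
  · simp only [slideGraph]
    rw [insertAfter_of_ne hnm h.n_ne_q, insertAfter_left, h2]
  · simp only [slideGraph]
    rw [insertAfter_right, insertAfter_right, h4 _ h.n_ne_p hnm h.n_ne_q, apply_inv]
  · simp only [slideGraph]
    by_cases hm : x = m
    · rw [hm, insertAfter_left, insertAfter_of_ne h.n_ne_q.symm hqm, h3, h.rot_m]
    · rw [insertAfter_of_ne hm hq, insertAfter_of_ne hn hm, h4 x hp hm hq]
  · simp [slideGraph, Function.update_of_ne hqm]
  · simp [slideGraph]
  · simp only [slideGraph]
    rw [Function.update_of_ne hm, Function.update_of_ne hq]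

/-- The graph obtained by moving the slider `m` past the edge `q` of the second side. -/
def slideGraph' (E : WGraph β) (p m q : β) : WGraph β :=
  { E with
    rot := insertAfter p m (insertAfter (E.opp q) p (del p (del m E.rot)))
    W := Function.update (Function.update E.W p (E.W (E.opp q))) m (E.W (E.opp q)) }

theorem isSlide_slideGraph' {p m q : β}
    (h : Slidable E.mirror M q m p) :
    IsSlide E.mirror (slideGraph' E p m q).mirror q m p := by
  have hqm : q ≠ m := (h.ne_of_l h.p_l).1
  have hpm : p ≠ m := (h.ne_of_l h.q_l).1
  have hmp : E.rot p = m := by rw [← h.rot_m, mirror_rot, apply_inv]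
  have hmq : E.rot m = q := by rw [← h.rot_p, mirror_rot, apply_inv]
  have hkl := h.nl_rot h.q_mem h.q_l
  rw [mirror_rot] at hkl
  have hk := h.ne_of_nl hkl
  have hq' := h.ne_of_nl h.p'_nl
  have hns := h.not_same
  rw [mirror_opp] at hq' hns
  rw [mirror_same] at hns
  have hq'm : E.opp q ≠ m := h.p'_ne_m
  have hsp : E.Same q p := (mirror_same E).1 h.same_pq
  have hkm : E.rot⁻¹ p ≠ m := fun k => h.ne (by rw [← hmq, ← k, apply_inv])
  have hkq' : E.rot⁻¹ p ≠ E.opp q := fun k => hns (by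
    rw [← k]; exact hsp.trans (same_rot_inv _ _))
  have a1 : del m E.rot p = q := by rw [del_of_eq hmp, hmq]
  have a2 : ∀ x, x ≠ p → x ≠ m → del m E.rot x = E.rot x := fun x h1 h2 =>
    del_of_ne (fun k => h1 (E.rot.injective (k.trans hmp.symm))) h2
  have b1 : del p (del m E.rot) (E.rot⁻¹ p) = q := by
    rw [del_of_eq, a1]
    rw [a2 _ hk.2.1 hkm, apply_inv]
  have b2 : del p (del m E.rot) m = m := by
    rw [del_of_ne _ hpm.symm, del_self]
    rw [del_self]; exact hpm.symm
  have b3 : ∀ x, x ≠ p → x ≠ m → x ≠ E.rot⁻¹ p → del p (del m E.rot) x = E.rot x := by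
    intro x h1 h2 h3
    rw [del_of_ne _ h1, a2 x h1 h2]
    rw [a2 x h1 h2]
    intro k; exact h3 (by rw [← k, inv_apply])
  have d1 : (slideGraph' E p m q).rot (E.rot⁻¹ p) = q := by
    simp only [slideGraph']
    rw [insertAfter_of_ne hk.2.1 hkm, insertAfter_of_ne hkq' hk.2.1, b1]
  have d2 : (slideGraph' E p m q).rot (E.opp q) = p := by
    simp only [slideGraph']
    rw [insertAfter_of_ne hq'.2.1 hq'm, insertAfter_left, del_self]
  have d3 : (slideGraph' E p m q).rot p = m := by
    simp only [slideGraph']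
    rw [insertAfter_left, insertAfter_of_ne hq'm.symm hpm.symm, b2]
  have d4 : (slideGraph' E p m q).rot m = E.rot (E.opp q) := by
    simp only [slideGraph']
    rw [insertAfter_right, insertAfter_right, b3 _ hq'.2.1 hq'm hkq'.symm]
  have d5 : ∀ x, x ≠ m → x ≠ E.rot⁻¹ p → x ≠ E.opp q → (slideGraph' E p m q).rot x = E.rot x := by
    intro x h1 h2 h3
    by_cases hp : x = p
    · rw [hp, d3, hmp]
    simp only [slideGraph']
    rw [insertAfter_of_ne hp h1, insertAfter_of_ne h3 hp, b3 x hp h1 h2]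
  refine ⟨rfl, ?_, ?_, ?_, fun x _ h1 h2 h3 => ?_, rfl, rfl, rfl, ?_, ?_, fun x _ h1 h2 => ?_⟩
  · rw [mirror_rot, mirror_rot, inv_eq_iff_eq, d1]
  · have h1 : E.mirror.rot⁻¹ (E.mirror.opp q) = E.rot (E.opp q) := by simp
    rw [h1, mirror_rot, inv_eq_iff_eq, d4]
  · rw [mirror_rot, inv_eq_iff_eq, mirror_opp, d2]
  · rw [mirror_rot, mirror_rot, inv_eq_iff_eq, d5, apply_inv]
    · intro k; rw [inv_eq_iff_eq, hmq] at k; exact h1 k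
    · intro k; exact h2 (E.rot⁻¹.injective k)
    · intro k; rw [inv_eq_iff_eq] at k
      apply h3; rw [k]; simp
  · simp [slideGraph', Function.update_of_ne hpm]
  · simp [slideGraph']
  · simp only [slideGraph', mirror_W]
    rw [Function.update_of_ne h2, Function.update_of_ne h1]

/-- The graph obtained by gluing the edges `p` and `q` ending on the same level. -/
def mergeGraph (E : WGraph β) (p m q : β) : WGraph β :=
  { E with
    darts := (E.darts.erase q).erase (E.opp q)
    rot := del (E.opp q) (insertAfter (E.rot⁻¹ (E.opp p)) m
      (Equiv.swap (E.opp p) (E.opp q) * del q (del m E.rot)))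
    W := Function.update E.W m (E.W (E.opp p)) }

/-- The gluing of two edges is a move of the slider followed by a contraction. -/
theorem isContraction_mergeGraph {p m q : β} (h : Slidable E M p m q)
    (hk : E.kind q = .outgoing) :
    IsContraction (slideGraph E p m q) (mergeGraph E p m q) q := by
  have hs := isSlide_slideGraph h
  have hqm : q ≠ m := (h.ne_of_l h.q_l).1
  have hpm : p ≠ m := (h.ne_of_l h.p_l).1
  have hnm : E.rot⁻¹ (E.opp p) ≠ m := (h.ne_of_l h.n_l).1
  obtain ⟨h1, h2, h3, h4⟩ := del_del h.rot_p h.rot_m h.ne hqm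
  have hq'm := h.opp_mem h.q_mem hk
  have hq'l := h.nl_opp h.q_mem hk
  have hq' := h.ne_of_nl hq'l
  have hp' := h.ne_of_nl h.p'_nl
  have hq'nm : E.opp q ≠ m := IsSlide.opp_ne_m h h.q_mem hk
  have hpq' : E.opp p ≠ E.opp q := fun k => h.ne (h.eq_of_above h.p_mem h.kind_p h.q_mem hk
    h.same_pq (by rw [k]; exact ReflTransGen.refl))
  -- the rotation before the deletion of `opp q`
  let ρ := insertAfter (E.rot⁻¹ (E.opp p)) m
      (Equiv.swap (E.opp p) (E.opp q) * del q (del m E.rot))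
  have hrot : (mergeGraph E p m q).rot = del (E.opp q) ρ := rfl
  have r1 : ρ m = E.opp q := by
    simp only [ρ]
    rw [insertAfter_right, Equiv.Perm.mul_apply, h4 _ h.n_ne_p hnm h.n_ne_q, apply_inv,
      Equiv.swap_apply_left]
  have r2 : ρ (E.rot⁻¹ (E.opp p)) = m := by
    simp only [ρ]
    rw [insertAfter_left, Equiv.Perm.mul_apply, h2,
      Equiv.swap_apply_of_ne_of_ne h.p'_ne_m.symm hq'nm.symm]
  have r3 : ρ p = E.rot q := by
    simp only [ρ]
    have h5 : E.rot q ≠ E.opp p := fun k => h.not_same (h.same_pq.trans (by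
      rw [← k]; exact same_rot _ _))
    have h6 : E.rot q ≠ E.opp q := fun k => h.not_same_opp (h.isEdge_out h.q_mem hk) (by
      rw [← k]; exact same_rot _ _)
    rw [insertAfter_of_ne h.n_ne_p.symm hpm, Equiv.Perm.mul_apply, h1,
      Equiv.swap_apply_of_ne_of_ne h5 h6]
  have r4 : ∀ x, x ≠ p → x ≠ m → x ≠ q → x ≠ E.rot⁻¹ (E.opp p) →
      ρ x = Equiv.swap (E.opp p) (E.opp q) (E.rot x) := by
    intro x h5 h6 h7 h8
    simp only [ρ]
    rw [insertAfter_of_ne h8 h6, Equiv.Perm.mul_apply, h4 x h5 h6 h7]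
  have hmem : ∀ x, x ∈ (mergeGraph E p m q).darts → x ≠ q ∧ x ≠ E.opp q ∧ x ∈ E.darts := by
    intro x hx
    simp only [mergeGraph, mem_erase] at hx
    tauto
  have hn0 : ∀ x, x ≠ E.rot⁻¹ (E.opp p) → E.rot x ≠ E.opp p := fun x hx k =>
    hx (by rw [← k, inv_apply])
  have hopp : (slideGraph E p m q).opp q = E.opp q := rfl
  refine ⟨rfl, ?_, ?_, ?_, rfl, rfl, rfl, ?_⟩
  · intro x hx hr
    obtain ⟨hx1, hx2, hx3⟩ := hmem x hx
    have hxm : x = m := by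
      have : (slideGraph E p m q).rot m = q := by
        rw [hs.rot_nl h h.m_mem h.m_nl, h.rot_m]
      exact (slideGraph E p m q).rot.injective (hr.trans this.symm)
    rw [hopp, hs.rot_nl h hq'm hq'l, hxm, hrot, del_of_eq r1]
    have h5 : E.rot (E.opp q) ≠ E.opp q := fun k => hq'l (by
      have := h.leaving_rot hq'm hq'l
      rwa [k] at this)
    rw [r4 _ hq'.1 hq'nm hq'.2.1 hq'.2.2, Equiv.swap_apply_of_ne_of_ne (hn0 _ hq'.2.2) h5]
  · intro x hx hr
    obtain ⟨hx1, hx2, hx3⟩ := hmem x hx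
    rw [hopp] at hr
    have hxm : x ≠ m := by
      rintro rfl
      rw [hs.rot_nl h h.m_mem h.m_nl, h.rot_m] at hr
      exact hq'.2.1 hr.symm
    have hxp : x ≠ p := by
      rintro rfl
      rw [hs.rot_p] at hr
      exact h.not_same_opp (h.isEdge_out h.q_mem hk) (by
        rw [← hr]; exact same_rot _ _)
    have hxn : x ≠ E.rot⁻¹ (E.opp p) := by
      rintro rfl
      rw [hs.rot_n] at hr
      exact hq'nm hr.symm
    rw [hs.rot_other x hx3 hxp hx1 hxn] at hr
    have h5 : ρ x = E.opp p := by rw [r4 x hxp hxm hx1 hxn, hr, Equiv.swap_apply_right]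
    rw [hs.rot_q, hrot, del_of_ne _ hx2, h5]
    rw [h5]; exact hpq'
  · intro x hx hr hr'
    obtain ⟨hx1, hx2, hx3⟩ := hmem x hx
    rw [hopp] at hr'
    have hxm : x ≠ m := by
      rintro rfl
      rw [hs.rot_nl h h.m_mem h.m_nl, h.rot_m] at hr
      exact hr rfl
    have h5 : ρ x = (slideGraph E p m q).rot x := by
      by_cases hxp : x = p
      · rw [hxp, r3, hs.rot_p]
      by_cases hxn : x = E.rot⁻¹ (E.opp p)
      · rw [hxn, r2, hs.rot_n]
      · rw [hs.rot_other x hx3 hxp hx1 hxn] at hr' ⊢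
        rw [r4 x hxp hxm hx1 hxn, Equiv.swap_apply_of_ne_of_ne (hn0 x hxn) hr']
    rw [hrot, del_of_ne _ hx2, h5]
    rw [h5]; exact hr'
  · intro x hx
    obtain ⟨hx1, hx2, hx3⟩ := hmem x hx
    simp only [mergeGraph, slideGraph]
    by_cases hxm : x = m
    · rw [hxm]; simp
    · rw [Function.update_of_ne hxm, Function.update_of_ne hxm, Function.update_of_ne hx1]

/-! ### Complete zipping of a half-strip -/

/-- The graph `E'` arises from `E` in the course of zipping: when points are identified by the
half-strips of `S`, respectively by the half-strips of `S'` which remain, the two graphs have the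
same points. The darts of `X` are used as sliders; all other vertical darts survive. -/
structure Zipped (E : WGraph β) (M : Set β) (S : Set (β × β)) (E' : WGraph β) (M' : Set β)
    (S' : Set (β × β)) (X : Set β) : Prop where
  state : State E' M'
  darts : ∀ d ∈ E'.darts, d ∈ E.darts
  opp : E'.opp = E.opp
  kind : E'.kind = E.kind
  H : E'.H = E.H
  vertical : ∀ d ∈ E.darts, E.kind d = .vertical → d ∉ X → d ∈ E'.darts
  zero : ∀ o ∈ E'.darts, E'.kind o = .outgoing → E'.W (E'.opp o) = E'.W o →
    E.W (E.opp o) = E.W o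
  folding : Nonempty (Folding E M S E' M' S'
    (fun a a' => a = a' ∧ a ∈ E.darts ∧ E.kind a = .vertical ∧ a ∉ X)
    (fun a a' => a = a' ∧ a ∈ E'.darts ∧ ¬ E.Leaving a ∧ a ∉ X))

namespace Zipped

variable {E' E'' : WGraph β} {M' M'' : Set β} {S S' S'' : Set (β × β)} {X Y : Set β}

theorem mono (h : Zipped E M S E' M' S' X) (hXY : X ⊆ Y) : Zipped E M S E' M' S' Y :=
  { h with
    vertical := fun d hd hk hY => h.vertical d hd hk fun hX => hY (hXY hX)
    folding := by
      obtain ⟨F⟩ := h.folding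
      exact ⟨F.mono (fun a a' k => ⟨k.1, k.2.1, k.2.2.1, fun hX => k.2.2.2 (hXY hX)⟩)
        (fun a a' k => ⟨k.1, k.2.1, k.2.2.1, fun hX => k.2.2.2 (hXY hX)⟩)⟩ }

theorem trans (h : Zipped E M S E' M' S' X) (h' : Zipped E' M' S' E'' M'' S'' X) :
    Zipped E M S E'' M'' S'' X where
  state := h'.state
  darts d hd := h.darts d (h'.darts d hd)
  opp := h'.opp.trans h.opp
  kind := h'.kind.trans h.kind
  H := h'.H.trans h.H
  vertical d hd hk hX := h'.vertical d (h.vertical d hd hk hX) (by rwa [h.kind]) hX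
  zero o ho hk hw := h.zero o (h'.darts o ho) (by rw [← h'.kind]; exact hk) (h'.zero o ho hk hw)
  folding := by
    obtain ⟨F⟩ := h.folding
    obtain ⟨F'⟩ := h'.folding
    refine ⟨(F.trans F' fun d d' k => ⟨h.darts d k.2.1, k.1 ▸ k.2.1⟩).mono ?_ ?_⟩
    · rintro a _ ⟨rfl, h1, h2, h3⟩
      exact ⟨a, ⟨rfl, h1, h2, h3⟩, rfl, h.vertical a h1 h2 h3, by rwa [h.kind], h3⟩
    · rintro a _ ⟨rfl, h1, h2, h3⟩
      exact ⟨a, ⟨rfl, h'.darts a h1, h2, h3⟩, rfl, h1, by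
        rw [Leaving, h.kind]; exact h2, h3⟩

theorem mirror (h : Zipped E M S E' M' S' X) :
    Zipped E.mirror M (Prod.swap ⁻¹' S) E'.mirror M' (Prod.swap ⁻¹' S') X where
  state := h.state.mirror
  darts := h.darts
  opp := h.opp
  kind := h.kind
  H := h.H
  vertical := h.vertical
  zero := h.zero
  folding := by
    obtain ⟨F⟩ := h.folding
    exact ⟨F.mirror⟩

end Zipped

/-- The half-strips of `S` have their corners at vertical darts, and the slider `m` belongs to
exactly one of them, the unzipped part, of which it represents both corners. -/
structure SliderStrips (E : WGraph β) (m : β) (S : Set (β × β)) : Prop where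
  corners : CornersOK E S
  mem : (m, m) ∈ S
  ne : ∀ c ∈ S, c = (m, m) ∨ (c.1 ≠ m ∧ c.2 ≠ m)

theorem SliderStrips.mirror {m : β} (h : SliderStrips E m S) :
    SliderStrips E.mirror m (Prod.swap ⁻¹' S) where
  corners := h.corners.mirror
  mem := h.mem
  ne c hc := by
    rcases h.ne c.swap hc with h1 | h1
    · left
      have := congrArg Prod.swap h1
      simpa using this
    · exact Or.inr h1.symm

/-- The number of oriented edges above the slider, which decreases in each step of zipping. -/
def ahead (E : WGraph β) (m : β) : ℕ :=
  (E.darts.filter (fun o => E.kind o = .outgoing ∧ E.Above m o)).card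

theorem ahead_mirror (E : WGraph β) (m : β) : E.mirror.ahead m = E.ahead m := by
  simp only [ahead, mirror_above]
  rfl

theorem ahead_lt {E E' : WGraph β} {m o : β}
    (hsub : ∀ x ∈ E'.darts, E'.kind x = .outgoing → E'.Above m x →
      x ∈ E.darts ∧ E.kind x = .outgoing ∧ E.Above m x)
    (ho : o ∈ E.darts) (hk : E.kind o = .outgoing) (ha : E.Above m o)
    (hno : o ∈ E'.darts → ¬ E'.Above m o) : E'.ahead m < E.ahead m := by
  refine Finset.card_lt_card (Finset.ssubset_iff_subset_ne.2 ⟨fun x hx => ?_, fun heq => ?_⟩)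
  · simp only [mem_filter] at hx ⊢
    exact hsub x hx.1 hx.2.1 hx.2.2
  · have : o ∈ E'.darts.filter (fun o => E'.kind o = .outgoing ∧ E'.Above m o) := by
      rw [heq]; simp [ho, hk, ha]
    simp only [mem_filter] at this
    exact hno this.1 this.2.2

namespace State

variable {m : β}

/-- The two sides of the unzipped part are different. -/
theorem sides_ne (hE : State E M) (hm : m ∈ M) : E.rot⁻¹ m ≠ E.rot m := by
  intro heq
  have hmm := hE.slider_mem m hm
  obtain ⟨d, hd, hl, hs⟩ := hE.anchor m hmm
  have hD : ∀ x ∈ ({m, E.rot m} : Finset β), E.rot x ∈ ({m, E.rot m} : Finset β) := by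
    intro x hx
    simp only [mem_insert, mem_singleton] at hx ⊢
    rcases hx with rfl | rfl
    · exact Or.inr rfl
    · left; rw [← heq, apply_inv]
  have hdD := sameCycle_mem hD (by simp) hs
  simp only [mem_insert, mem_singleton] at hdD
  rcases hdD with rfl | rfl
  · exact hd.2.2 hm
  · exact hl (hE.leaving_rot hmm (nl_of_vertical (hE.slider_kind m hm)))

end State

namespace IsContraction

variable {E E' : WGraph β} {m c : β}

theorem above (hc : IsContraction E E' c) (h : Contractible E M c) (hmc : E.Same m c)
    (hm : m ∈ E'.darts) (hx : E'.Above m x) : E.Above m x := by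
  have hF := hc.frame h
  induction hx with
  | refl => exact ReflTransGen.refl
  | tail hz hs ih =>
    have hz' := hF.mem_of_above hm hz
    rcases hs with hs | ⟨h1, h2, rfl⟩
    · rcases hc.of_same h hz' hs with h3 | ⟨-, h3 | h3⟩
      · exact ih.tail (Or.inl h3)
      · exact above_of_same (hmc.trans h3.symm)
      · exact ((above_of_same hmc).trans (above_opp h.mem h.outgoing)).trans (above_of_same h3.symm)
    · rw [hc.kind] at h2
      rw [hc.opp]
      exact ih.trans (above_opp (hc.mem_iff.1 h1).2.2 h2)

/-- Contraction of an edge on the sides of the unzipped part. -/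
theorem zipped (hc : IsContraction E E' c) (hE : State E M) (h : Contractible E M c) (hm : m ∈ M)
    (hS : SliderStrips E m S) (hmc : E.Same m c)
    (hpp : E.Ident S (c, E.W c) (E.opp c, E.W (E.opp c))) :
    Zipped E M S E' M S {m} ∧ E'.ahead m < E.ahead m := by
  have hmk := hE.slider_kind m hm
  have hmc' : m ≠ c := by rintro rfl; rw [h.outgoing] at hmk; cases hmk
  have hmem : ∀ x, E.kind x = .vertical → x ∈ E.darts → x ∈ E'.darts := by
    intro x hk hx
    refine hc.mem_iff.2 ⟨?_, ?_, hx⟩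
    · rintro rfl; rw [h.kind_opp h.mem h.outgoing] at hk; cases hk
    · rintro rfl; rw [h.outgoing] at hk; cases hk
  have hF := hc.frame h
  refine ⟨⟨hc.state hE h, fun d hd => (hc.mem_iff.1 hd).2.2, hc.opp, hc.kind, hc.H,
    fun d hd hk _ => hmem d hk hd, fun o ho hk hw => ?_,
    ⟨(hc.folding hE h hmc.symm hmc' hS.corners hpp).mono (fun a a' k => ⟨k.1, k.2.1, k.2.2.1⟩)
      (fun a a' k => ⟨k.1, k.2.1⟩)⟩⟩, ahead_lt (o := c) (fun x hx hk ha => ?_) h.mem h.outgoing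
      (above_of_same hmc) (fun hcm => absurd rfl (hc.mem_iff.1 hcm).2.1)⟩
  · rwa [hc.W _ (hF.opp_mem ho hk), hc.W o ho, hc.opp] at hw
  · exact ⟨(hc.mem_iff.1 hx).2.2, by rwa [hc.kind] at hk,
      hc.above h hmc (hmem m hmk (hE.slider_mem m hm)) ha⟩

end IsContraction

namespace IsSlide

variable {E E' : WGraph β} {p m q : β}

theorem above (hs : IsSlide E E' p m q) (h : Slidable E M p m q)
    (hx : E'.Above m x) : E.Above m (bw E p m q x) := by
  have hm : E.Above m (E.opp p) := (above_of_same h.same_pm.symm).trans (above_opp h.p_mem h.kind_p)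
  have hF := (hs.state h).toFrame
  induction hx with
  | refl => simpa [bw] using hm
  | tail hz hs' ih =>
    have hz' := hF.mem_of_above (by rw [hs.darts]; exact h.m_mem) hz
    rw [hs.darts] at hz'
    rcases hs' with hs' | ⟨h1, h2, rfl⟩
    · exact ih.tail (Or.inl (hs.same_bw h hz' hs'))
    · rename_i y
      rw [hs.kind] at h2
      rw [hs.opp]
      have h3 : bw E p m q (E.opp y) = E.opp y := by
        have := h.ne_of_nl (h.nl_opp hz' h2)
        have := opp_ne_m h hz' h2
        rw [bw, if_neg (by tauto)]
      rw [h3]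
      by_cases hyq : y = q
      · rw [hyq] at h2 ⊢
        exact (above_of_same h.same_mq).trans (above_opp h.q_mem h2)
      · have : bw E p m q y = y := by
          have := (h.ne_of_l (Or.inl h2)).1
          rw [bw, if_neg (by tauto)]
        rw [this] at ih
        exact ih.trans (above_opp hz' h2)

/-- Move of the slider past the edge of the first side. -/
theorem zipped (hs : IsSlide E E' p m q) (h : Slidable E M p m q) (hS : SliderStrips E m S)
    (hne : E.kind q = .outgoing → E.W (E.opp q) ≠ E.W (E.opp p)) :
    Zipped E M S E' M S {m} := by
  refine ⟨hs.state h, fun d hd => by rwa [hs.darts] at hd, hs.opp, hs.kind, hs.H,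
    fun d hd _ _ => by rwa [hs.darts], fun o ho hk hw => ?_,
    ⟨(hs.folding h hS.corners hS.mem hS.ne).mono (fun a a' k => k)
      (fun a a' ⟨k1, k2, k3, k4⟩ => ⟨k1, by rwa [hs.darts] at k2, k4, (h.ne_of_nl k3).2.1⟩)⟩⟩
  rw [hs.darts] at ho
  rw [hs.kind] at hk
  have h1 := h.opp_mem ho hk
  have h2 := h.ne_of_nl (h.nl_opp ho hk)
  rw [hs.opp, hs.W_other _ h1 h2.2.1 (opp_ne_m h ho hk)] at hw
  by_cases hoq : o = q
  · rw [hoq, hs.W_q] at hw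
    rw [hoq] at hk
    exact absurd hw (hne hk)
  · rwa [hs.W_other o ho hoq (h.ne_of_l (Or.inl hk)).1] at hw

theorem ahead_lt (hs : IsSlide E E' p m q) (h : Slidable E M p m q) : E'.ahead m < E.ahead m := by
  refine WGraph.ahead_lt (o := p) (fun x hx hk ha => ?_) h.p_mem h.kind_p
    (above_of_same h.same_pm.symm) (fun hp ha => ?_)
  · rw [hs.darts] at hx
    rw [hs.kind] at hk
    refine ⟨hx, hk, ?_⟩
    by_cases hxq : x = q
    · rw [hxq]; exact above_of_same h.same_mq
    · have h1 := hs.above h ha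
      have := (h.ne_of_l (Or.inl hk)).1
      rwa [bw, if_neg (by tauto)] at h1
  · refine (hs.state h).not_above hp (by rw [hs.kind]; exact h.kind_p) ?_
    rw [hs.opp]
    exact (above_of_same (hs.same'_m h).symm).trans ha

end IsSlide

/-- A step of zipping which does something. -/
theorem zipStep_spec {m : β} (hE : State E M)
    (hm : m ∈ M) (hS : SliderStrips E m S)
    (hray : ¬ (E.kind (E.rot⁻¹ m) = .ray ∧ E.kind (E.rot m) = .ray)) :
    Zipped E M S (zipStep m E) M S {m} ∧ (zipStep m E).ahead m < E.ahead m := by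
  have hmm := hE.slider_mem m hm
  have hmk := hE.slider_kind m hm
  have hml := nl_of_vertical hmk
  have hne := hE.sides_ne hm
  have hrp : E.rot (E.rot⁻¹ m) = m := apply_inv _ _
  have hpm := hE.rot_inv_mem hmm
  have hqm := hE.rot_mem m hmm
  have hpl := hE.leaving_rot_inv hmm hml
  have hql := hE.leaving_rot hmm hml
  have hsp := same_rot_inv E.rot m
  have hsq := same_rot E.rot m
  generalize hp : E.rot⁻¹ m = p at *
  generalize hq : E.rot m = q at *
  have hstep : zipStep m E =
      if E.kind p = .ray ∧ E.kind q = .ray then E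
      else if E.kind p = .outgoing ∧ E.W (E.opp p) = E.W p then E.contract p
      else if E.kind q = .outgoing ∧ E.W (E.opp q) = E.W q then E.contract q
      else if E.level p < E.level q then slideGraph E p m q
      else if E.level q < E.level p then slideGraph' E p m q
      else mergeGraph E p m q := by
    subst hp hq
    rfl
  have hlevel : ∀ x ∈ E.darts, E.kind x = .outgoing →
      E.level x = (E.W (E.opp x) : EReal) := fun x _ hk => by simp [level, hk]
  have hlray : ∀ x, E.kind x = .ray → E.level x = ⊤ := fun x hk => by simp [level, hk]
  have hsideq : ∀ P, E.IsPoint P → Chain E q P.1 → E.OnStrip (m, m) P := fun P hP hc =>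
    Or.inl ⟨hP, by rw [hq]; exact hc⟩
  have hsidep : ∀ P, E.IsPoint P → Chain E.mirror p P.1 → E.OnStrip (m, m) P := fun P hP hc =>
    Or.inr ⟨hP, by rw [mirror_rot, hp]; exact hc⟩
  rw [hstep, if_neg hray]
  split_ifs with h1 h2 h3 h4
  · have hcon := hE.contractible hpm h1.1 h1.2
    have hp' := hE.opp_mem hpm h1.1
    refine (isContraction_contract hcon).zipped hE hcon hm hS hsp ?_
    refine (ident_of_strip hS.mem (hsidep (p, E.W p) (isPoint_vertex hpm) .start)
      (hsidep (E.rot⁻¹ (E.opp p), E.W (E.rot⁻¹ (E.opp p))) (isPoint_vertex (hE.rot_inv_mem hp'))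
        (Chain.next _ .start h1.1)) ?_).trans
      (ident_of_same hE.toFrame hp' (same_rot_inv _ _)).symm
    exact (hE.W_same hp' (same_rot_inv E.rot (E.opp p)) ▸ h1.2).symm
  · have hcon := hE.contractible hqm h2.1 h2.2
    have hq' := hE.opp_mem hqm h2.1
    refine (isContraction_contract hcon).zipped hE hcon hm hS hsq ?_
    refine (ident_of_strip hS.mem (hsideq (q, E.W q) (isPoint_vertex hqm) .start)
      (hsideq (E.rot (E.opp q), E.W (E.rot (E.opp q))) (isPoint_vertex (hE.rot_mem _ hq'))
        (Chain.next _ .start h2.1)) ?_).trans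
      (ident_of_same hE.toFrame hq' (same_rot _ _)).symm
    exact (hE.W_rot _ hq' ▸ h2.2).symm
  · have hkp : E.kind p = .outgoing := hpl.resolve_right fun k => by
      rw [hlray p k] at h3; exact not_top_lt h3
    have hsl : Slidable E M p m q := ⟨hE, hm, hrp, hq, hkp,
      lt_of_le_of_ne (hE.W_le p hpm hkp) fun k => h1 ⟨hkp, k.symm⟩, h3.le, hne⟩
    have hs := isSlide_slideGraph hsl
    refine ⟨hs.zipped hsl hS fun hkq k => ?_, hs.ahead_lt hsl⟩
    rw [hlevel p hpm hkp, hlevel q hqm hkq, k] at h3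
    exact lt_irrefl _ h3
  · have hkq : E.kind q = .outgoing := hql.resolve_right fun k => by
      rw [hlray q k] at h4; exact not_top_lt h4
    have hsl : Slidable E.mirror M q m p := ⟨hE.mirror, hm,
      by rw [mirror_rot, ← hq, inv_apply], by rw [mirror_rot, hp], hkq,
      lt_of_le_of_ne (hE.W_le q hqm hkq) fun k => h2 ⟨hkq, k.symm⟩, h4.le, hne.symm⟩
    have hs := isSlide_slideGraph' hsl
    have hz := (hs.zipped hsl hS.mirror fun hkp k => ?_).mirror
    · refine ⟨?_, ?_⟩
      · rwa [mirror_mirror, mirror_mirror, ← Set.preimage_comp, Prod.swap_swap_eq,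
          Set.preimage_id] at hz
      · have := hs.ahead_lt hsl
        rwa [ahead_mirror, ahead_mirror] at this
    · have hkp' : E.kind p = .outgoing := hkp
      have hk' : E.W (E.opp p) = E.W (E.opp q) := k
      rw [hlevel p hpm hkp', hlevel q hqm hkq, hk'] at h4
      exact lt_irrefl _ h4
  · have heq : E.level p = E.level q := le_antisymm (not_lt.1 h4) (not_lt.1 h3)
    have hkp : E.kind p = .outgoing := hpl.resolve_right fun k => by
      rcases hql with k' | k'
      · rw [hlray p k, hlevel q hqm k'] at heq
        exact absurd heq.symm (EReal.coe_ne_top _)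
      · exact hray ⟨k, k'⟩
    have hkq : E.kind q = .outgoing := hql.resolve_right fun k => by
      rw [hlray q k, hlevel p hpm hkp] at heq
      exact absurd heq (EReal.coe_ne_top _)
    have hsl : Slidable E M p m q := ⟨hE, hm, hrp, hq, hkp,
      lt_of_le_of_ne (hE.W_le p hpm hkp) fun k => h1 ⟨hkp, k.symm⟩, heq.le, hne⟩
    have hs := isSlide_slideGraph hsl
    have hc := isContraction_mergeGraph hsl hkq
    have hE' := hs.state hsl
    have hqm' : q ∈ (slideGraph E p m q).darts := hqm
    have hq'n := hsl.ne_of_nl (hE.nl_opp hqm hkq)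
    have hW : (slideGraph E p m q).W (E.opp q) = (slideGraph E p m q).W q := by
      rw [hs.W_q, hs.W_other _ (hE.opp_mem hqm hkq) hq'n.2.1 (IsSlide.opp_ne_m hsl hqm hkq)]
      rw [hlevel p hpm hkp, hlevel q hqm hkq] at heq
      exact (EReal.coe_eq_coe_iff.1 heq).symm
    have hcon := hE'.contractible hqm' hkq hW
    have hS' : SliderStrips (slideGraph E p m q) m S := ⟨hS.corners, hS.mem, hS.ne⟩
    have hrm : (slideGraph E p m q).rot m = q := by rw [hs.rot_nl hsl hmm hml, hq]
    have hq' : E.opp q ∈ (slideGraph E p m q).darts := hE.opp_mem hqm hkq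
    have hsame : (slideGraph E p m q).Same m q := by
      have := same_rot (slideGraph E p m q).rot m
      rwa [hrm] at this
    have hpp : (slideGraph E p m q).Ident S (q, (slideGraph E p m q).W q)
        (E.opp q, (slideGraph E p m q).W (E.opp q)) := by
      refine Ident.trans (ident_of_strip hS.mem (Or.inl ⟨isPoint_vertex hqm', by
        rw [hrm]; exact .start⟩) (Or.inl ⟨isPoint_vertex (hE'.rot_mem _ hq'), by
        rw [hrm]; exact Chain.next _ .start hkq⟩) ?_)
        (ident_of_same hE'.toFrame hq' (same_rot _ _)).symm
      exact hW.symm.trans (hE'.W_rot _ hq').symm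
    obtain ⟨hz, hah⟩ := hc.zipped hE' hcon hm hS' hsame hpp
    refine ⟨⟨hz.state, fun d hd => hz.darts d hd, hz.opp, hz.kind, hz.H,
      fun d hd hk hd' => hz.vertical d hd hk hd', fun o ho hk hw => ?_, ?_⟩,
      hah.trans (hs.ahead_lt hsl)⟩
    · have hoe := hz.darts o ho
      have hoE : o ∈ E.darts := hoe
      have hkE : E.kind o = .outgoing := hk
      have hoq : o ≠ q := by
        rintro rfl
        exact (hc.mem_iff.1 ho).2.1 rfl
      have := hz.zero o ho hk hw
      rw [hs.W_other o hoE hoq (hsl.ne_of_l (Or.inl hkE)).1, hs.opp,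
        hs.W_other _ (hE.opp_mem hoE hkE) (hsl.ne_of_nl (hE.nl_opp hoE hkE)).2.1
          (IsSlide.opp_ne_m hsl hoE hkE)] at this
      exact this
    · obtain ⟨F'⟩ := hz.folding
      refine ⟨((hs.folding hsl hS.corners hS.mem hS.ne).trans F'
        fun d d' k => ⟨k.2.1, by rw [hs.darts, ← k.1]; exact k.2.1⟩).mono ?_ ?_⟩
      · rintro a _ ⟨rfl, k1, k2, k3⟩
        exact ⟨a, ⟨rfl, k1, k2, k3⟩, rfl, k1, k2, k3⟩
      · rintro a _ ⟨rfl, k1, k2, k3⟩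
        exact ⟨a, ⟨rfl, hz.darts a k1, k3, (hsl.ne_of_nl k2).2.1⟩, rfl, k1, k2, k3⟩

theorem SliderStrips.of_zipped {E E' : WGraph β} {m : β}
    (hS : SliderStrips E m S) (hm : m ∈ M) (hz : Zipped E M S E' M S {m}) :
    SliderStrips E' m S where
  corners c hc := by
    have key : ∀ x, x ∈ E.darts ∧ E.kind x = .vertical →
        x ∈ E'.darts ∧ E'.kind x = .vertical := by
      rintro x ⟨h1, h2⟩
      refine ⟨?_, by rwa [hz.kind]⟩
      by_cases hx : x = m
      · rw [hx]; exact hz.state.slider_mem m hm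
      · exact hz.vertical x h1 h2 hx
    exact ⟨key _ (hS.corners c hc).1, key _ (hS.corners c hc).2⟩
  mem := hS.mem
  ne := hS.ne

theorem Zipped.refl (hE : State E M) (S : Set (β × β)) (X : Set β) :
    Zipped E M S E M S X := by
  have hom : ∀ C : β → β → Prop, (∀ a a', C a a' → a = a') → Hom E S E S C id := fun C hC =>
    ⟨fun _ => rfl, fun _ h => h, fun _ _ h => h, fun d hd => ⟨d, hd, ident_refl⟩,
      fun a a' P h hP => ⟨P, hC a a' h ▸ hP, ident_refl⟩,
      fun a a' P h hP => ⟨P, hC a a' h ▸ hP, ident_refl⟩,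
      fun o ho hk hw => Or.inr ⟨o, ho, hk, hw, ident_refl, ident_refl⟩⟩
  refine ⟨hE, fun _ h => h, rfl, rfl, rfl, fun _ h _ _ => h, fun _ _ _ h => h,
    ⟨⟨id, id, hom _ fun a a' h => h.1, hom _ fun a a' h => h.1.symm, fun _ _ => ident_refl,
      fun _ _ => ident_refl, (vertexMap_of_bijective (fun _ h => h) (fun _ _ _ _ => Iff.rfl)
        (fun d hd => ⟨d, hd, .refl _ _⟩) (fun _ _ => rfl) fun _ _ => rfl).1, ?_⟩⟩⟩
  rintro d _ ⟨rfl, -⟩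
  exact .refl _ _

/-- After sufficiently many steps both sides of the unzipped part are rays. -/
theorem zipStep_iterate {m : β} (hm : m ∈ M) (n : ℕ) :
    ∀ E : WGraph β, State E M → SliderStrips E m S → E.ahead m ≤ n →
      Zipped E M S ((zipStep m)^[n] E) M S {m} ∧
        ((zipStep m)^[n] E).kind (((zipStep m)^[n] E).rot⁻¹ m) = .ray ∧
        ((zipStep m)^[n] E).kind (((zipStep m)^[n] E).rot m) = .ray := by
  induction n with
  | zero =>
    intro E hE hS h0
    refine ⟨Zipped.refl hE S _, ?_⟩
    by_contra hray
    have := (zipStep_spec hE hm hS hray).2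
    omega
  | succ n ih =>
    intro E hE hS h0
    rw [Function.iterate_succ_apply]
    by_cases hray : E.kind (E.rot⁻¹ m) = .ray ∧ E.kind (E.rot m) = .ray
    · have h1 : zipStep m E = E := by
        unfold zipStep
        simp only
        rw [if_pos hray]
      have h2 : ∀ n, (zipStep m)^[n] E = E := fun n => Function.iterate_fixed h1 n
      rw [h1, h2]
      exact ⟨Zipped.refl hE S _, hray⟩
    · obtain ⟨hz, hlt⟩ := zipStep_spec hE hm hS hray
      obtain ⟨h1, h2⟩ := ih _ hz.state (hS.of_zipped hm hz) (by omega)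
      exact ⟨hz.trans h1, h2⟩

/-- Zipping of the half-strip marked by the slider `m`. -/
theorem zipStrip_spec {m : β} {T : Set (β × β)} (hE : State E M)
    (hm : m ∈ M) (hT : CornersOK E T) (hne : ∀ c ∈ T, c.1 ≠ m ∧ c.2 ≠ m) :
    Zipped E M ({(m, m)} ∪ T) (zipStrip m E) (M \ {m}) T {m} ∧ m ∉ (zipStrip m E).darts := by
  have hmm := hE.slider_mem m hm
  have hS : SliderStrips E m ({(m, m)} ∪ T) := by
    refine ⟨?_, Or.inl rfl, ?_⟩
    · rintro c (rfl | hc)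
      · exact ⟨⟨hmm, hE.slider_kind m hm⟩, hmm, hE.slider_kind m hm⟩
      · exact hT c hc
    · rintro c (rfl | hc)
      · exact Or.inl rfl
      · exact Or.inr (hne c hc)
  obtain ⟨hz, hp, hq⟩ := zipStep_iterate hm E.darts.card E hE hS (Finset.card_filter_le _ _)
  have hS' := hS.of_zipped hm hz
  rw [zipStrip]
  generalize (zipStep m)^[E.darts.card] E = E₁ at *
  have hr : RayPair E₁ M (E₁.rot⁻¹ m) m (E₁.rot m) :=
    ⟨hz.state, hm, apply_inv _ _, rfl, hp, hq, hz.state.sides_ne hm⟩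
  refine ⟨hz.trans ⟨hr.state, fun d hd => (hr.mem_iff.1 hd).2.2, rfl, rfl, rfl,
    fun d hd hk hX => hr.mem_iff.2 ⟨hX, ?_, hd⟩, fun o ho hk hw => hw,
    ⟨(hr.folding (fun c hc => hS'.corners c (Or.inr hc)) hne).mono (fun a a' k => k)
      (fun a a' k => ⟨k.1, k.2.1⟩)⟩⟩, fun k => (hr.mem_iff.1 k).1 rfl⟩
  rintro rfl
  rw [hr.kind_q] at hk; cases hk

/-- Zipping of both half-strips adjacent to the edge of `r`. -/
theorem zip_spec {r : β} (h : Openable E r) {T : Set (β × β)}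
    (hT : CornersOK E T) (hne : ∀ c ∈ T, (c.1 ≠ r ∧ c.1 ≠ E.opp r) ∧ (c.2 ≠ r ∧ c.2 ≠ E.opp r)) :
    Zipped E ∅ (adjacentStrips E r ∪ T)
      (zipStrip r (zipStrip (E.opp r) (openZipper E r))) ∅ T {r, E.opp r} ∧
      r ∉ (zipStrip r (zipStrip (E.opp r) (openZipper E r))).darts ∧
      E.opp r ∉ (zipStrip r (zipStrip (E.opp r) (openZipper E r))).darts := by
  have hrr : E.opp r ≠ r := h.opp_ne r h.edge
  have z1 : Zipped E ∅ (adjacentStrips E r ∪ T) (openZipper E r) {r, E.opp r}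
      ({(E.opp r, E.opp r)} ∪ ({(r, r)} ∪ T)) {r, E.opp r} := by
    refine ⟨h.state, fun _ h => h, rfl, rfl, rfl, fun _ h _ _ => h, fun _ _ _ h => h, ?_⟩
    have F := h.folding hT fun c hc => (hne c hc).1
    have e : ({(r, r), (E.opp r, E.opp r)} ∪ T : Set (β × β)) =
        {(E.opp r, E.opp r)} ∪ ({(r, r)} ∪ T) := by
      ext c; simp only [Set.mem_union, Set.mem_insert_iff, Set.mem_singleton_iff]; tauto
    rw [e] at F
    refine ⟨F.mono (fun a a' k => ⟨k.1, k.2.1, k.2.2.1, ?_⟩) (fun a a' k => ⟨k.1, k.2.1⟩)⟩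
    have := k.2.2.2
    simpa using this
  obtain ⟨z2, hr2⟩ := zipStrip_spec (T := {(r, r)} ∪ T) z1.state (m := E.opp r) (Or.inr rfl)
    (by
      rintro c (rfl | hc)
      · exact ⟨⟨h.mem, h.vertical⟩, h.mem, h.vertical⟩
      · exact hT c hc)
    (by
      rintro c (rfl | hc)
      · exact ⟨hrr.symm, hrr.symm⟩
      · exact ⟨(hne c hc).1.2, (hne c hc).2.2⟩)
  have hM : ({r, E.opp r} : Set β) \ {E.opp r} = {r} := by
    ext x
    simp only [Set.mem_sdiff, Set.mem_insert_iff, Set.mem_singleton_iff]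
    constructor
    · tauto
    · rintro rfl; exact ⟨Or.inl rfl, hrr.symm⟩
  rw [hM] at z2
  obtain ⟨z3, hr3⟩ := zipStrip_spec (T := T) z2.state (m := r) rfl
    (by
      intro c hc
      have key : ∀ x, x ∈ E.darts ∧ E.kind x = .vertical → x ≠ E.opp r →
          x ∈ (zipStrip (E.opp r) (openZipper E r)).darts ∧
            (zipStrip (E.opp r) (openZipper E r)).kind x = .vertical := by
        rintro x ⟨h1, h2⟩ h3
        exact ⟨z2.vertical x h1 h2 h3, by rw [z2.kind]; exact h2⟩
      exact ⟨key _ (hT c hc).1 (hne c hc).1.2, key _ (hT c hc).2 (hne c hc).2.2⟩)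
    (fun c hc => ⟨(hne c hc).1.1, (hne c hc).2.1⟩)
  have hM' : ({r} : Set β) \ {r} = ∅ := Set.sdiff_self
  rw [hM'] at z3
  refine ⟨(z1.trans (z2.mono ?_)).trans (z3.mono ?_), hr3, fun k => hr2 (z3.darts _ k)⟩
  · rintro x rfl; exact Or.inr rfl
  · rintro x rfl; exact Or.inl rfl

/-! ### Maps of points induced by maps of darts -/

/-- A map of darts preserving the structure of the graph. -/
structure DartMap (E : WGraph β) (E' : WGraph γ) (φ : β → γ) : Prop where
  mem : ∀ x ∈ E.darts, φ x ∈ E'.darts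
  rot : ∀ x ∈ E.darts, φ (E.rot x) = E'.rot (φ x)
  opp : ∀ x ∈ E.darts, E.kind x = .outgoing → φ (E.opp x) = E'.opp (φ x)
  kind : ∀ x ∈ E.darts, E'.kind (φ x) = E.kind x
  W : ∀ x ∈ E.darts, E'.W (φ x) = E.W x

namespace DartMap

variable {φ : β → γ} {ψ : γ → β}

theorem mirror (h : DartMap E E' φ) (hE : Frame E M) : DartMap E.mirror E'.mirror φ where
  mem := h.mem
  rot x hx := by
    rw [mirror_rot, mirror_rot, eq_comm, inv_eq_iff_eq, ← h.rot _ (hE.rot_inv_mem hx),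
      apply_inv]
  opp := h.opp
  kind := h.kind
  W := h.W

theorem same (h : DartMap E E' φ) (hE : ∀ x ∈ E.darts, E.rot x ∈ E.darts) (hx : x ∈ E.darts)
    (hxy : E.Same x y) : E'.Same (φ x) (φ y) :=
  sameCycle_map hE φ (fun x hx => by rw [h.rot x hx]; exact same_rot _ _) hx hxy

theorem leaving (h : DartMap E E' φ) (hx : x ∈ E.darts) :
    E'.Leaving (φ x) ↔ E.Leaving x := by
  rw [Leaving, Leaving, h.kind x hx]

theorem level (h : DartMap E E' φ) (hE : Frame E M) (hx : x ∈ E.darts)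
    (hl : E.Leaving x) : E'.level (φ x) = E.level x := by
  rw [WGraph.level, WGraph.level, h.kind x hx]
  rcases hl with hk | hk
  · rw [← h.opp x hx hk, h.W _ (hE.opp_mem hx hk)]
  · simp [hk]

/-- The map of points induced by a map of darts. -/
def pointMap (φ : β → γ) (P : β × ℝ) : γ × ℝ := (φ P.1, P.2)

theorem isPoint (h : DartMap E E' φ) (hE : Frame E M) (hP : E.IsPoint P) :
    E'.IsPoint (pointMap φ P) := by
  refine ⟨h.mem _ hP.1, ?_⟩
  rw [pointMap, h.W _ hP.1]
  rcases hP.2 with h1 | ⟨h1, h2, h3⟩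
  · exact Or.inl h1
  · right
    rw [h.level hE hP.1 h1]
    exact ⟨(h.leaving hP.1).2 h1, h2, h3⟩

theorem chain (h : DartMap E E' φ) (hE : State E M) {s : β} (hs : s ∈ E.darts)
    (hl : E.Leaving s) (hx : Chain E s x) : Chain E' (φ s) (φ x) := by
  induction hx with
  | start => exact .start
  | next o ho hk ih =>
    have h1 := (ho.mem hE hs hl).1
    rw [h.rot _ (hE.opp_mem h1 hk), h.opp o h1 hk]
    exact ih.next _ (by rw [h.kind o h1]; exact hk)

theorem side (h : DartMap E E' φ) (hE : State E M) (ha : a ∈ E.darts)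
    (hk : E.kind a = .vertical) (hP : E.OnSide a P) :
    E'.OnSide (φ a) (pointMap φ P) := by
  refine ⟨h.isPoint hE.toFrame hP.1, ?_⟩
  rw [← h.rot a ha]
  exact h.chain hE (hE.rot_mem a ha) (hE.leaving_rot ha (nl_of_vertical hk)) hP.2

theorem hom (h : DartMap E E' φ) (hE : State E M) (hE' : Frame E' M')
    (hS : CornersOK E S)
    (hSS : ∀ c ∈ S, (φ c.1, φ c.2) ∈ S') :
    Hom E S E' S' (fun a a' => a' = φ a ∧ a ∈ E.darts ∧ E.kind a = .vertical)
      (pointMap φ) where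
  snd _ := rfl
  point P hP := h.isPoint hE.toFrame hP
  ident P Q hPQ := by
    refine ident_of_sides (E := E) (pointMap φ) (fun x hx y hy hxy => ?_) ?_ hPQ
    · rw [pointMap, pointMap, ← h.W x hx, ← h.W y hy]
      exact ident_of_same hE' (h.mem x hx) (h.same hE.rot_mem hx hxy)
    · intro c hc P Q hP hQ hPQ
      obtain ⟨h1, h2⟩ := hS c hc
      exact ident_strip_of_sides hE' (pointMap φ) (fun _ => rfl) (hSS c hc)
        (fun P hP => ⟨_, h.side hE h1.1 h1.2 hP, ident_refl⟩)
        (fun P hP => ⟨_, (h.mirror hE.toFrame).side hE.mirror h2.1 h2.2 hP, ident_refl⟩)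
        hP hQ hPQ
  vertex d hd := ⟨φ d, h.mem d hd, by rw [h.W d hd]; exact ident_refl⟩
  side := by
    rintro a _ P ⟨rfl, ha, hk⟩ hP
    exact ⟨_, h.side hE ha hk hP, ident_refl⟩
  side_mirror := by
    rintro a _ P ⟨rfl, ha, hk⟩ hP
    exact ⟨_, (h.mirror hE.toFrame).side hE.mirror ha hk hP, ident_refl⟩
  zero o ho hk hw := by
    have h1 := hE.opp_mem ho hk
    refine Or.inr ⟨φ o, h.mem o ho, by rw [h.kind o ho]; exact hk, ?_, ?_, ?_⟩
    · rw [← h.opp o ho hk, h.W _ h1, h.W o ho, hw]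
    · rw [h.W o ho]; exact ident_refl
    · rw [← h.opp o ho hk, h.W _ h1]; exact ident_refl

/-- The bijection of vertices induced by an isomorphism. -/
theorem vertexMap (h : DartMap E E' φ) (h' : DartMap E' E ψ)
    (hE : ∀ x ∈ E.darts, E.rot x ∈ E.darts) (hE' : ∀ x ∈ E'.darts, E'.rot x ∈ E'.darts)
    (h1 : ∀ x ∈ E.darts, ψ (φ x) = x) (h2 : ∀ x ∈ E'.darts, φ (ψ x) = x) :
    VertexMap E ∅ E' ∅ φ ∧ E'.verts.card = E.verts.card := by
  have hsame : ∀ d ∈ E.darts, ∀ e ∈ E.darts,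
      E.Same d e ↔ E'.Same (φ d) (φ e) := fun d hd e he =>
    ⟨h.same hE hd, fun k => by
      have := h'.same hE' (h.mem d hd) k
      rwa [h1 d hd, h1 e he] at this⟩
  refine vertexMap_of_bijective h.mem hsame
    (fun d' hd' => ⟨ψ d', h'.mem d' hd', by rw [h2 d' hd']⟩) h.W fun d hd => ?_
  have key : ∀ k : DartKind, ((E'.vert (φ d)).filter (fun x => E'.kind x = k)).card =
      ((E.vert d).filter (fun x => E.kind x = k)).card := by
    intro k
    symm
    refine Finset.card_bij (fun x _ => φ x) ?_ ?_ ?_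
    · intro x hx
      simp only [mem_filter, mem_vert] at hx ⊢
      exact ⟨⟨h.mem x hx.1.1, h.same hE hd hx.1.2⟩, by rw [h.kind x hx.1.1]; exact hx.2⟩
    · intro x hx y hy hxy
      simp only [mem_filter, mem_vert] at hx hy
      rw [← h1 x hx.1.1, hxy, h1 y hy.1.1]
    · intro x hx
      simp only [mem_filter, mem_vert] at hx
      have hm := h'.mem x hx.1.1
      refine ⟨ψ x, ?_, h2 x hx.1.1⟩
      simp only [mem_filter, mem_vert]
      refine ⟨⟨hm, (hsame d hd _ hm).2 ?_⟩, ?_⟩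
      · rw [h2 x hx.1.1]; exact hx.1.2
      · rw [h'.kind x hx.1.1]; exact hx.2
  rw [ordM_empty, ordM_empty, ord, ord, key, key]

/-- Isomorphic graphs are foldings of each other. -/
def folding (h : DartMap E E' φ) (h' : DartMap E' E ψ) (hE : State E ∅) (hE' : State E' ∅)
    (h1 : ∀ x ∈ E.darts, ψ (φ x) = x) (h2 : ∀ x ∈ E'.darts, φ (ψ x) = x)
    (hS : CornersOK E S) (hS' : CornersOK E' S')
    (hSS : ∀ c ∈ S, (φ c.1, φ c.2) ∈ S') (hSS' : ∀ c ∈ S', (ψ c.1, ψ c.2) ∈ S) :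
    Folding E ∅ S E' ∅ S' (fun a a' => a' = φ a ∧ a ∈ E.darts ∧ E.kind a = .vertical)
      (fun a a' => a' = φ a ∧ a ∈ E.darts) where
  f := pointMap φ
  h := pointMap ψ
  hom_f := h.hom hE hE'.toFrame hS hSS
  hom_h := (h'.hom hE' hE.toFrame hS' hSS').mono (by
    rintro a' a ⟨rfl, ha, hk⟩
    exact ⟨(h1 a ha).symm, h.mem a ha, by rw [h.kind a ha]; exact hk⟩)
  h_f P hP := by
    rw [pointMap, pointMap, h1 _ hP.1]; exact ident_refl
  f_h P hP := by
    rw [pointMap, pointMap, h2 _ hP.1]; exact ident_refl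
  vertexMap := (h.vertexMap h' hE.rot_mem hE'.rot_mem h1 h2).1
  name := by
    rintro d _ ⟨rfl, hd⟩
    exact .refl _ _

end DartMap

/-! ### The extended graph of a plane tree -/

/-- The axioms of a weighted plane tree, except those on the vertices of order zero and on the sum
of the weights of the vertical edges. -/
structure PlaneTree (G : WGraph α) : Prop where
  isGraph : G.IsGraph
  isTree : G.IsTree
  outgoingSeparated : G.OutgoingSeparated
  weakWidth : G.WeakWidth
  H_nonneg : ∀ d ∈ G.darts, G.kind d = .vertical → 0 ≤ G.H d

theorem WeaklyAdmissible.planeTree (h : G.WeaklyAdmissible) : G.PlaneTree :=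
  ⟨h.isGraph, h.isTree, h.outgoingSeparated, h.weakWidth, h.weakHeights.1⟩

theorem mem_rayCorners {d : α} : d ∈ G.rayCorners ↔ d ∈ G.darts ∧
    G.kind d ≠ .outgoing ∧ G.kind (G.rot d) ≠ .outgoing := by
  simp [rayCorners]

theorem ext_rot_inl {d : α} (h : d ∉ G.rayCorners) :
    G.ext.rot (inl d) = inl (G.rot d) := by
  show Sum.map G.rot id (if d ∈ G.rayCorners then inr d else inl d) = _
  rw [if_neg h]
  rfl

theorem ext_rot_corner {d : α} (h : d ∈ G.rayCorners) :
    G.ext.rot (inl d) = inr d := by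
  show Sum.map G.rot id (if d ∈ G.rayCorners then inr d else inl d) = _
  rw [if_pos h]
  rfl

theorem ext_rot_inr {d : α} (h : d ∈ G.rayCorners) :
    G.ext.rot (inr d) = inl (G.rot d) := by
  show Sum.map G.rot id (if d ∈ G.rayCorners then inl d else inr d) = _
  rw [if_pos h]
  rfl

theorem inl_mem_ext {d : α} : inl d ∈ G.ext.darts ↔ d ∈ G.darts := by
  simp [ext]

theorem inr_mem_ext {d : α} : inr d ∈ G.ext.darts ↔ d ∈ G.rayCorners := by
  simp [ext]

theorem ext_same_rot (G : WGraph α) (d : α) :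
    G.ext.Same (inl d) (inl (G.rot d)) := by
  by_cases h : d ∈ G.rayCorners
  · have h1 := same_rot G.ext.rot (inl d)
    have h2 := same_rot G.ext.rot (inr d)
    rw [ext_rot_corner h] at h1
    rw [ext_rot_inr h] at h2
    exact h1.trans h2
  · have h1 := same_rot G.ext.rot (inl d)
    rwa [ext_rot_inl h] at h1

theorem ext_same_corner {d : α} (h : d ∈ G.rayCorners) :
    G.ext.Same (inl d) (inr d) := by
  have h1 := same_rot G.ext.rot (inl d)
  rwa [ext_rot_corner h] at h1

/-- The dart of the original graph that represents the vertex of a dart of the extended graph. -/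
def base (x : α ⊕ α) : α := Sum.elim id id x

theorem mem_of_ext {x : α ⊕ α} (hx : x ∈ G.ext.darts) : base x ∈ G.darts := by
  rcases x with d | d
  · exact inl_mem_ext.1 hx
  · exact (mem_rayCorners.1 (inr_mem_ext.1 hx)).1

theorem ext_same_base {x : α ⊕ α} (hx : x ∈ G.ext.darts) :
    G.ext.Same (inl (base x)) x := by
  rcases x with d | d
  · exact .refl _ _
  · exact ext_same_corner (inr_mem_ext.1 hx)

namespace IsGraph

theorem ext_rot_mem (h : G.IsGraph) : ∀ x ∈ G.ext.darts, G.ext.rot x ∈ G.ext.darts := by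
  rintro (d | d) hx
  · rw [inl_mem_ext] at hx
    by_cases hd : d ∈ G.rayCorners
    · rw [ext_rot_corner hd, inr_mem_ext]; exact hd
    · rw [ext_rot_inl hd, inl_mem_ext, h.rot_mem]; exact hx
  · rw [inr_mem_ext] at hx
    rw [ext_rot_inr hx, inl_mem_ext, h.rot_mem]; exact (mem_rayCorners.1 hx).1

theorem ext_same (h : G.IsGraph) {d e : α} (hd : d ∈ G.darts) (hde : G.Same d e) :
    G.ext.Same (inl d) (inl e) :=
  sameCycle_map (fun d hd => (h.rot_mem d).2 hd) inl (fun x _ => G.ext_same_rot x) hd hde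

theorem same_of_ext (h : G.IsGraph) {x y : α ⊕ α} (hx : x ∈ G.ext.darts)
    (hxy : G.ext.Same x y) : G.Same (base x) (base y) := by
  refine sameCycle_map h.ext_rot_mem base (fun x hx => ?_) hx hxy
  rcases x with d | d
  · by_cases hd : d ∈ G.rayCorners
    · rw [ext_rot_corner hd]; exact .refl _ _
    · rw [ext_rot_inl hd]; exact same_rot _ _
  · rw [ext_rot_inr (inr_mem_ext.1 hx)]; exact same_rot _ _

theorem ext_same_iff (h : G.IsGraph) {d e : α} (hd : d ∈ G.darts) :
    G.Same d e ↔ G.ext.Same (inl d) (inl e) :=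
  ⟨h.ext_same hd, fun k => h.same_of_ext (inl_mem_ext.2 hd) k⟩

theorem ext_ord (h : G.IsGraph) {d : α} (hd : d ∈ G.darts) :
    G.ext.ord (G.ext.vert (inl d)) = G.ord (G.vert d) := by
  have key : ∀ k : DartKind, k ≠ .ray →
      ((G.ext.vert (inl d)).filter (fun x => G.ext.kind x = k)).card =
      ((G.vert d).filter (fun x => G.kind x = k)).card := by
    intro k hk
    symm
    refine Finset.card_bij (fun x _ => inl x) ?_ ?_ ?_
    · intro x hx
      simp only [mem_filter, mem_vert] at hx ⊢
      exact ⟨⟨inl_mem_ext.2 hx.1.1, h.ext_same hd hx.1.2⟩, hx.2⟩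
    · intro x _ y _ hxy
      exact inl_injective hxy
    · rintro (x | x) hx
      · simp only [mem_filter, mem_vert] at hx
        refine ⟨x, ?_, rfl⟩
        simp only [mem_filter, mem_vert]
        exact ⟨⟨inl_mem_ext.1 hx.1.1, (h.ext_same_iff hd).2 hx.1.2⟩, hx.2⟩
      · simp only [mem_filter] at hx
        exact absurd hx.2.symm hk
  rw [ord, ord, key _ (by simp), key _ (by simp)]

/-- The vertices of the extended graph are those of the original graph. -/
theorem ext_vertexMap (h : G.IsGraph) :
    VertexMap G ∅ G.ext ∅ inl ∧ G.ext.verts.card = G.verts.card :=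
  vertexMap_of_bijective (fun d hd => inl_mem_ext.2 hd)
    (fun d hd e _ => h.ext_same_iff hd)
    (fun x hx => ⟨base x, mem_of_ext hx, ext_same_base hx⟩) (fun _ _ => rfl) fun d hd => by
      rw [ordM_empty, ordM_empty, h.ext_ord hd]

theorem base_vertexMap (h : G.IsGraph) : VertexMap G.ext ∅ G ∅ base :=
  (vertexMap_of_bijective (fun _ hd => mem_of_ext hd)
    (fun x hx y hy => ⟨h.same_of_ext hx, fun k => ((ext_same_base hx).symm.trans
      (h.ext_same (mem_of_ext hx) k)).trans (ext_same_base hy)⟩)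
    (fun d hd => ⟨inl d, inl_mem_ext.2 hd, .refl _ _⟩)
    (fun x hx => by rcases x with d | d <;> rfl) fun x hx => by
      rw [ordM_empty, ordM_empty, ← h.ext_ord (mem_of_ext hx),
        vert_eq_of_same (ext_same_base hx)]).1

end IsGraph

theorem ext_isEdge (h : G.IsGraph) {x : α ⊕ α} :
    G.ext.IsEdge ∅ x ↔ ∃ d ∈ G.darts, x = inl d := by
  constructor
  · rintro ⟨h1, h2, -⟩
    rcases x with d | d
    · exact ⟨d, inl_mem_ext.1 h1, rfl⟩
    · exact absurd rfl h2
  · rintro ⟨d, hd, rfl⟩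
    exact ⟨inl_mem_ext.2 hd, h.kind_ne_ray d hd, Set.notMem_empty _⟩

theorem ext_leaving_inl (h : G.IsGraph) {d : α} (hd : d ∈ G.darts) :
    G.ext.Leaving (inl d) ↔ G.kind d = .outgoing := by
  have := h.kind_ne_ray d hd
  simp only [Leaving, ext, Sum.elim_inl]
  tauto

theorem ext_leaving_inr {d : α} : G.ext.Leaving (inr d) := by
  simp [Leaving, ext]

/-- The extended graph of a plane tree. -/
theorem PlaneTree.ext_state (hG : G.PlaneTree) : State G.ext ∅ where
  rot_mem := hG.isGraph.ext_rot_mem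
  slider_mem m hm := absurd hm (Set.notMem_empty _)
  slider_kind m hm := absurd hm (Set.notMem_empty _)
  opp_edge x hx := by
    obtain ⟨d, hd, rfl⟩ := (ext_isEdge hG.isGraph).1 hx
    exact (ext_isEdge hG.isGraph).2 ⟨_, hG.isGraph.opp_mem d hd, rfl⟩
  opp_opp x hx := by
    obtain ⟨d, hd, rfl⟩ := (ext_isEdge hG.isGraph).1 hx
    exact congrArg inl (hG.isGraph.opp_opp d hd)
  opp_ne x hx := by
    obtain ⟨d, hd, rfl⟩ := (ext_isEdge hG.isGraph).1 hx
    exact fun k => hG.isGraph.opp_ne d hd (inl_injective k)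
  kind_vertical x hx := by
    obtain ⟨d, hd, rfl⟩ := (ext_isEdge hG.isGraph).1 hx
    exact hG.isGraph.kind_opp_vertical d hd
  kind_outgoing x hx := by
    obtain ⟨d, hd, rfl⟩ := (ext_isEdge hG.isGraph).1 hx
    exact hG.isGraph.kind_opp_outgoing d hd
  kind_incoming x hx := by
    obtain ⟨d, hd, rfl⟩ := (ext_isEdge hG.isGraph).1 hx
    exact hG.isGraph.kind_opp_incoming d hd
  W_rot x hx := by
    rcases x with d | d
    · by_cases hd : d ∈ G.rayCorners
      · rw [ext_rot_corner hd]; rfl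
      · rw [ext_rot_inl hd]; exact hG.isGraph.W_rot d (inl_mem_ext.1 hx)
    · have hd := inr_mem_ext.1 hx
      rw [ext_rot_inr hd]; exact hG.isGraph.W_rot d (mem_rayCorners.1 hd).1
  W_le x hx hk := by
    rcases x with d | d
    · exact hG.weakWidth.1 d (inl_mem_ext.1 hx) hk
    · cases hk
  W_vertical x hx hk := by
    obtain ⟨d, hd, rfl⟩ := (ext_isEdge hG.isGraph).1 hx
    exact hG.weakWidth.2 d hd hk
  H_opp x hx hk := by
    obtain ⟨d, hd, rfl⟩ := (ext_isEdge hG.isGraph).1 hx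
    exact hG.isGraph.H_opp d hd hk
  H_nonneg x hx hk := by
    obtain ⟨d, hd, rfl⟩ := (ext_isEdge hG.isGraph).1 hx
    exact hG.H_nonneg d hd hk
  conn x hx y hy := by
    have hsame : ∀ x y, G.ext.Same x y → EqvGen (G.ext.Link ∅) x y := fun x y hxy =>
      sameCycle_eqvGen (R := G.ext.Link ∅) (fun _ => Or.inl rfl) hxy
    have key : ∀ d ∈ G.darts, ∀ e, ReflTransGen G.Step d e →
        e ∈ G.darts ∧ EqvGen (G.ext.Link ∅) (inl d) (inl e) := by
      intro d hd e hde
      induction hde with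
      | refl => exact ⟨hd, EqvGen.refl _⟩
      | tail _ hs ih =>
        rcases hs with rfl | rfl
        · exact ⟨(hG.isGraph.rot_mem _).2 ih.1, ih.2.trans _ _ _ (hsame _ _ (G.ext_same_rot _))⟩
        · exact ⟨hG.isGraph.opp_mem _ ih.1, ih.2.trans _ _ _ (EqvGen.rel _ _
            (Or.inr ⟨(ext_isEdge hG.isGraph).2 ⟨_, ih.1, rfl⟩, rfl⟩))⟩
    exact ((EqvGen.symm _ _ (hsame _ _ (ext_same_base hx))).trans _ _ _
      (key _ (mem_of_ext hx) _ (hG.isTree.1 _ (mem_of_ext hx) _ (mem_of_ext hy))).2).trans _ _ _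
      (hsame _ _ (ext_same_base hy))
  count := by
    rw [hG.isGraph.ext_vertexMap.2, hG.isTree.2]
    congr 1
    symm
    have : G.ext.edgesM ∅ = G.edges.image (fun e => e.image inl) := by
      ext e
      simp only [edgesM, edges, mem_image, mem_filter]
      constructor
      · rintro ⟨x, ⟨-, hx⟩, rfl⟩
        obtain ⟨d, hd, rfl⟩ := (ext_isEdge hG.isGraph).1 hx
        refine ⟨_, ⟨d, hd, rfl⟩, ?_⟩
        ext y
        simp [ext]
      · rintro ⟨_, ⟨d, hd, rfl⟩, rfl⟩
        refine ⟨inl d, ⟨inl_mem_ext.2 hd, (ext_isEdge hG.isGraph).2 ⟨d, hd, rfl⟩⟩, ?_⟩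
        ext y
        simp [ext]
    rw [this, Finset.card_image_of_injective]
    exact Finset.image_injective inl_injective
  alt x hx := by
    rcases x with d | d
    · have hd' := inl_mem_ext.1 hx
      rw [ext_leaving_inl hG.isGraph hd']
      by_cases hd : d ∈ G.rayCorners
      · rw [ext_rot_corner hd]
        exact iff_of_true ext_leaving_inr (mem_rayCorners.1 hd).2.1
      · rw [ext_rot_inl hd, ext_leaving_inl hG.isGraph ((hG.isGraph.rot_mem d).2 hd')]
        rw [mem_rayCorners] at hd
        have := hG.outgoingSeparated d hd'
        tauto
    · have hd := inr_mem_ext.1 hx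
      have hd' := mem_rayCorners.1 hd
      rw [ext_rot_inr hd, ext_leaving_inl hG.isGraph ((hG.isGraph.rot_mem d).2 hd'.1)]
      exact iff_of_false hd'.2.2 (not_not.2 ext_leaving_inr)
  anchor x hx := by
    have hb := mem_of_ext hx
    by_cases hk : G.kind (base x) = .outgoing
    · have h1 := (hG.isGraph.rot_mem (base x)).2 hb
      exact ⟨inl (G.rot (base x)), (ext_isEdge hG.isGraph).2 ⟨_, h1, rfl⟩, by
        rw [ext_leaving_inl hG.isGraph h1]; exact hG.outgoingSeparated _ hb hk,
        (ext_same_base hx).symm.trans (G.ext_same_rot _)⟩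
    · exact ⟨inl (base x), (ext_isEdge hG.isGraph).2 ⟨_, hb, rfl⟩, by
        rwa [ext_leaving_inl hG.isGraph hb], (ext_same_base hx).symm⟩

/-! ### Identification of vertices -/

theorem firstSide_iff {v x : β} : E.FirstSide v x ↔ Chain E (E.rot v) x := by
  constructor
  · intro h
    induction h with
    | start => exact .start
    | next o _ hk ih => exact ih.next o hk
  · intro h
    induction h with
    | start => exact .start
    | next o _ hk ih => exact ih.next o hk

theorem secondSide_iff {v x : β} :
    E.SecondSide v x ↔ Chain E.mirror (E.rot⁻¹ (E.opp v)) x := by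
  constructor
  · intro h
    induction h with
    | start => exact .start
    | next o _ hk ih => exact ih.next o hk
  · intro h
    induction h with
    | start => exact .start
    | next o _ hk ih => exact ih.next o hk

theorem onStripSides_iff (hE : State E M) {v : β} (hv : E.IsEdge M v)
    (hk : E.kind v = .vertical) :
    E.OnStripSides v P ↔ E.OnStrip (v, E.opp v) P := by
  have hv' := hE.opp_edge v hv
  have hk' := hE.kind_vertical v hv hk
  rw [OnStripSides, firstSide_iff, secondSide_iff, OnStrip, OnSide, OnSide]
  have h1 : Chain E (E.rot v) P.1 → P.1 ∈ E.darts ∧ E.Leaving P.1 := fun h =>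
    h.mem hE (hE.rot_mem v hv.1) (hE.leaving_rot hv.1 (nl_of_vertical hk))
  have h2 : Chain E.mirror (E.rot⁻¹ (E.opp v)) P.1 → P.1 ∈ E.darts ∧ E.Leaving P.1 := fun h =>
    Chain.mem (E := E.mirror) hE.mirror (hE.rot_inv_mem hv'.1)
      (hE.leaving_rot_inv hv'.1 (nl_of_vertical hk')) h
  simp only [mirror_rot, IsPoint]
  tauto

/-- The relation between merged vertices in terms of identifications of points. -/
theorem zipSame_iff (hG : G.PlaneTree) {r : α} (hr : r ∈ G.darts)
    (hk : G.kind r = .vertical) {d e : α} (hd : d ∈ G.darts) :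
    G.ZipSame r d e ↔ G.ext.Ident (adjacentStrips G.ext (inl r))
      (inl d, G.W d) (inl e, G.W e) := by
  have hE := hG.ext_state
  have hr1 : G.ext.IsEdge ∅ (inl r) := (ext_isEdge hG.isGraph).2 ⟨r, hr, rfl⟩
  have hr2 := hE.opp_edge _ hr1
  have hk1 : G.ext.kind (inl r) = .vertical := hk
  have hk2 := hE.kind_vertical _ hr1 hk1
  have hstrip : ∀ v, v = r ∨ v = G.opp r →
      (inl v, G.ext.opp (inl v)) ∈ adjacentStrips G.ext (inl r) ∧
      ∀ P, G.ext.OnStripSides (inl v) P ↔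
        G.ext.OnStrip (inl v, G.ext.opp (inl v)) P := by
    rintro v (rfl | rfl)
    · exact ⟨Or.inl rfl, fun P => onStripSides_iff hE hr1 hk1⟩
    · refine ⟨Or.inr ?_, fun P => onStripSides_iff hE hr2 hk2⟩
      have := hE.opp_opp _ hr1
      exact Prod.ext rfl this
  constructor
  · intro h
    refine eqvGen_le_of (D := fun P => P.1 ∈ G.ext.darts) (equivalence_eqvGen _) ?_
      (inl_mem_ext.2 hd) h
    rintro P Q (⟨x, y, hxy⟩ | ⟨v, x, y, w, hv, hP, hQ⟩)
    · exact ⟨⟨fun hx => hE.mem_of_same hx hxy, fun hy => hE.mem_of_same hy hxy.symm⟩,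
        fun hx => ident_of_same hE.toFrame hx hxy⟩
    · obtain ⟨h1, h2⟩ := hstrip v hv
      rw [h2] at hP hQ
      have h3 : ∀ P c, G.ext.OnStrip c P → P.1 ∈ G.ext.darts := fun P c h =>
        h.elim (fun k => k.1.1) (fun k => k.1.1)
      exact ⟨iff_of_true (h3 _ _ hP) (h3 _ _ hQ), fun _ => ident_of_strip h1 hP hQ rfl⟩
  · refine eqvGen_le (equivalence_eqvGen _) ?_
    rintro ⟨x, w⟩ ⟨y, w'⟩ (⟨-, -, h1, h2, h3⟩ | ⟨c, hc, hP, hQ, h⟩)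
    · dsimp only at h1 h2 h3
      subst h1 h2
      exact EqvGen.rel _ _ (ZipGlue.vertex x y h3)
    · dsimp only at h
      subst h
      rcases hc with rfl | hc
      · obtain ⟨-, h2⟩ := hstrip r (Or.inl rfl)
        exact EqvGen.rel _ _ (ZipGlue.strip r x y w (Or.inl rfl) ((h2 _).2 hP) ((h2 _).2 hQ))
      · obtain ⟨-, h2⟩ := hstrip (G.opp r) (Or.inr rfl)
        have hc' : c = (G.ext.opp (inl r), inl r) := hc
        have h4 : c = (inl (G.opp r), G.ext.opp (inl (G.opp r))) := by
          rw [hc']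
          exact Prod.ext rfl (hE.opp_opp _ hr1).symm
        rw [h4] at hP hQ
        exact EqvGen.rel _ _ (ZipGlue.strip (G.opp r) x y w (Or.inr rfl) ((h2 _).2 hP)
          ((h2 _).2 hQ))

/-! ### Removal of rays -/

theorem foldr_del {σ : Equiv.Perm β} {l : List β} (hl : l.Nodup) (h : ∀ x ∈ l, σ x ∉ l) (x : β) :
    (l.foldr del σ) x = if x ∈ l then x else if σ x ∈ l then σ (σ x) else σ x := by
  induction l generalizing x with
  | nil => simp
  | cons a l ih =>
    obtain ⟨ha, hl'⟩ := List.nodup_cons.1 hl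
    have ih := ih hl' fun y hy k => h y (List.mem_cons_of_mem _ hy) (List.mem_cons_of_mem _ k)
    have hσa := h a List.mem_cons_self
    rw [List.mem_cons, not_or] at hσa
    have hτa : (l.foldr del σ) a = σ a := by rw [ih, if_neg ha, if_neg hσa.2]
    rw [List.foldr_cons]
    by_cases hxa : x = a
    · rw [hxa, del_self, if_pos List.mem_cons_self]
    by_cases hxl : x ∈ l
    · rw [if_pos (List.mem_cons_of_mem _ hxl), del_of_ne _ hxa, ih, if_pos hxl]
      rw [ih, if_pos hxl]; exact hxa
    rw [if_neg (by rw [List.mem_cons, not_or]; exact ⟨hxa, hxl⟩)]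
    have hx := ih x
    rw [if_neg hxl] at hx
    by_cases h1 : σ x = a
    · rw [h1, if_neg ha] at hx
      rw [del_of_eq hx, hτa, h1, if_pos List.mem_cons_self]
    · by_cases h2 : σ x ∈ l
      · rw [if_pos h2] at hx
        have h3 := h _ (List.mem_cons_of_mem a h2)
        rw [List.mem_cons, not_or] at h3
        rw [if_pos (List.mem_cons_of_mem _ h2), del_of_ne _ hxa, hx]
        rw [hx]; exact h3.1
      · rw [if_neg h2] at hx
        rw [if_neg (by rw [List.mem_cons, not_or]; exact ⟨h1, h2⟩), del_of_ne _ hxa, hx]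
        rw [hx]; exact h1

section RemoveRays

theorem mem_removeRays :
    x ∈ (removeRays E).darts ↔ x ∈ E.darts ∧ E.kind x ≠ .ray := by
  simp [removeRays]

theorem leaving_of_ray (h : E.kind x = .ray) : E.Leaving x := Or.inr h

theorem removeRays_rot (hE : State E ∅) (hx : x ∈ E.darts) (hk : E.kind x ≠ .ray) :
    (removeRays E).rot x =
      if E.kind (E.rot x) = .ray then E.rot (E.rot x) else E.rot x := by
  have key := foldr_del (σ := E.rot)
    (l := (E.darts.filter (fun d => E.kind d = .ray)).toList) (Finset.nodup_toList _)
    (by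
      intro y hy
      simp only [Finset.mem_toList, mem_filter] at hy ⊢
      exact fun k => hE.nl_rot hy.1 (leaving_of_ray hy.2) (leaving_of_ray k.2)) x
  simp only [Finset.mem_toList, mem_filter, hx, hE.rot_mem x hx, hk, true_and,
    if_false] at key
  exact key

theorem kind_rot_of_ray (hE : State E ∅) (hx : x ∈ E.darts) (h : E.kind (E.rot x) = .ray) :
    E.kind x ≠ .ray ∧ ¬ E.Leaving x := by
  have : ¬ E.Leaving x := fun k => hE.nl_rot hx k (leaving_of_ray h)
  exact ⟨fun k => this (leaving_of_ray k), this⟩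

theorem kind_rot_ray (hE : State E ∅) (hx : x ∈ E.darts) (h : E.kind x = .ray) :
    E.kind (E.rot x) ≠ .ray := fun k => (kind_rot_of_ray hE hx k).1 h

theorem removeRays_rot_mem (hE : State E ∅) (hx : x ∈ (removeRays E).darts) :
    (removeRays E).rot x ∈ (removeRays E).darts := by
  rw [mem_removeRays] at hx ⊢
  have h1 := hE.rot_mem x hx.1
  rw [removeRays_rot hE hx.1 hx.2]
  split_ifs with h
  · exact ⟨hE.rot_mem _ h1, kind_rot_ray hE h1 h⟩
  · exact ⟨h1, h⟩

theorem mem_rayCorners_removeRays (hE : State E ∅) : x ∈ (removeRays E).rayCorners ↔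
    x ∈ E.darts ∧ E.kind (E.rot x) = .ray := by
  rw [mem_rayCorners, mem_removeRays]
  constructor
  · rintro ⟨⟨h1, h2⟩, h3, h4⟩
    refine ⟨h1, ?_⟩
    by_contra h
    rw [removeRays_rot hE h1 h2, if_neg h] at h4
    rcases hE.leaving_rot h1 (fun k => k.elim h3 h2) with k | k
    · exact h4 k
    · exact h k
  · rintro ⟨h1, h⟩
    obtain ⟨h2, h3⟩ := kind_rot_of_ray hE h1 h
    refine ⟨⟨h1, h2⟩, fun k => h3 (Or.inl k), fun k => ?_⟩
    rw [removeRays_rot hE h1 h2, if_pos h] at k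
    exact hE.nl_rot (hE.rot_mem x h1) (leaving_of_ray h) (Or.inl k)

theorem removeRays_isEdge (hx : x ∈ (removeRays E).darts) : E.IsEdge ∅ x :=
  ⟨(mem_removeRays.1 hx).1, (mem_removeRays.1 hx).2, Set.notMem_empty _⟩

theorem removeRays_isGraph (hE : State E ∅) : (removeRays E).IsGraph where
  rot_mem := perm_mem_iff fun _ hx => removeRays_rot_mem hE hx
  opp_mem d hd := mem_removeRays.2
    ⟨(hE.opp_edge d (removeRays_isEdge hd)).1, (hE.opp_edge d (removeRays_isEdge hd)).2.1⟩
  opp_opp d hd := hE.opp_opp d (removeRays_isEdge hd)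
  opp_ne d hd := hE.opp_ne d (removeRays_isEdge hd)
  kind_ne_ray d hd := (mem_removeRays.1 hd).2
  kind_opp_vertical d hd := hE.kind_vertical d (removeRays_isEdge hd)
  kind_opp_outgoing d hd := hE.kind_outgoing d (removeRays_isEdge hd)
  kind_opp_incoming d hd := hE.kind_incoming d (removeRays_isEdge hd)
  W_rot d hd := by
    obtain ⟨h1, h2⟩ := mem_removeRays.1 hd
    show E.W _ = E.W d
    rw [removeRays_rot hE h1 h2]
    split_ifs
    · rw [hE.W_rot _ (hE.rot_mem d h1), hE.W_rot d h1]
    · exact hE.W_rot d h1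
  H_opp d hd := hE.H_opp d (removeRays_isEdge hd)

/-- A graph without sliders is isomorphic to the extended graph of the graph obtained by the removal
of the rays. -/
def toExt (E : WGraph β) (x : β) : β ⊕ β :=
  if E.kind x = .ray then inr (E.rot⁻¹ x) else inl x

/-- The inverse of `toExt`. -/
def ofExt (E : WGraph β) : β ⊕ β → β := Sum.elim id E.rot

theorem toExt_ray (h : E.kind x = .ray) : toExt E x = inr (E.rot⁻¹ x) := if_pos h

theorem toExt_of_ne (h : E.kind x ≠ .ray) : toExt E x = inl x := if_neg h

theorem toExt_dartMap (hE : State E ∅) : DartMap E (removeRays E).ext (toExt E) where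
  mem x hx := by
    by_cases h : E.kind x = .ray
    · rw [toExt_ray h, inr_mem_ext, mem_rayCorners_removeRays hE, apply_inv]
      exact ⟨hE.rot_inv_mem hx, h⟩
    · rw [toExt_of_ne h, inl_mem_ext, mem_removeRays]; exact ⟨hx, h⟩
  rot x hx := by
    by_cases h : E.kind x = .ray
    · have hx' := hE.rot_inv_mem hx
      have hc : E.rot⁻¹ x ∈ (removeRays E).rayCorners := by
        rw [mem_rayCorners_removeRays hE, apply_inv]; exact ⟨hx', h⟩
      rw [toExt_of_ne (kind_rot_ray hE hx h), toExt_ray h, ext_rot_inr hc, removeRays_rot hE hx'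
        (kind_rot_of_ray hE hx' (by rwa [apply_inv])).1, apply_inv, if_pos h]
    · rw [toExt_of_ne h]
      by_cases h' : E.kind (E.rot x) = .ray
      · rw [toExt_ray h', ext_rot_corner ((mem_rayCorners_removeRays hE).2 ⟨hx, h'⟩),
          inv_apply]
      · rw [toExt_of_ne h', ext_rot_inl fun k => h' ((mem_rayCorners_removeRays hE).1 k).2,
          removeRays_rot hE hx h, if_neg h']
  opp x hx hk := by
    have h : E.kind x ≠ .ray := by simp [hk]
    have h' : E.kind (E.opp x) ≠ .ray := by simp [hE.kind_opp hx hk]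
    rw [toExt_of_ne h, toExt_of_ne h']
    rfl
  kind x hx := by
    by_cases h : E.kind x = .ray
    · rw [toExt_ray h, h]; rfl
    · rw [toExt_of_ne h]; rfl
  W x hx := by
    by_cases h : E.kind x = .ray
    · rw [toExt_ray h]
      exact hE.W_same (hE.rot_inv_mem hx) (same_rot_inv _ _).symm |>.symm
    · rw [toExt_of_ne h]; rfl

theorem ofExt_dartMap (hE : State E ∅) : DartMap (removeRays E).ext E (ofExt E) where
  mem := by
    rintro (x | x) hx
    · exact (mem_removeRays.1 (inl_mem_ext.1 hx)).1
    · exact hE.rot_mem x ((mem_rayCorners_removeRays hE).1 (inr_mem_ext.1 hx)).1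
  rot := by
    rintro (x | x) hx
    · by_cases hc : x ∈ (removeRays E).rayCorners
      · rw [ext_rot_corner hc]; rfl
      · obtain ⟨h1, h2⟩ := mem_removeRays.1 (inl_mem_ext.1 hx)
        rw [ext_rot_inl hc]
        rw [mem_rayCorners_removeRays hE] at hc
        exact (removeRays_rot hE h1 h2).trans (if_neg fun k => hc ⟨h1, k⟩)
    · have hc := inr_mem_ext.1 hx
      obtain ⟨h1, h2⟩ := (mem_rayCorners_removeRays hE).1 hc
      rw [ext_rot_inr hc]
      exact (removeRays_rot hE h1 (kind_rot_of_ray hE h1 h2).1).trans (if_pos h2)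
  opp := by
    rintro (x | x) _ hk
    · rfl
    · cases hk
  kind := by
    rintro (x | x) hx
    · rfl
    · exact ((mem_rayCorners_removeRays hE).1 (inr_mem_ext.1 hx)).2
  W := by
    rintro (x | x) hx
    · rfl
    · exact hE.W_rot x ((mem_rayCorners_removeRays hE).1 (inr_mem_ext.1 hx)).1

theorem ofExt_toExt : ofExt E (toExt E x) = x := by
  by_cases h : E.kind x = .ray
  · rw [toExt_ray h]; exact apply_inv _ _
  · rw [toExt_of_ne h]; rfl

theorem toExt_ofExt (hE : State E ∅) {x : β ⊕ β} (hx : x ∈ (removeRays E).ext.darts) :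
    toExt E (ofExt E x) = x := by
  rcases x with x | x
  · exact toExt_of_ne (mem_removeRays.1 (inl_mem_ext.1 hx)).2
  · refine (toExt_ray ((mem_rayCorners_removeRays hE).1 (inr_mem_ext.1 hx)).2).trans ?_
    rw [inv_apply]

/-- Along a finite cycle each dart can be reached from the next one. -/
theorem reach_of_rot {G : WGraph β} (hG : G.IsGraph) {R : β → β → Prop}
    (hR : ∀ d, R d (G.rot d)) (hd : d ∈ G.darts) : ReflTransGen R (G.rot d) d := by
  have hD : ∀ x ∈ G.darts.filter (fun x => ReflTransGen R (G.rot d) x),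
      G.rot x ∈ G.darts.filter (fun x => ReflTransGen R (G.rot d) x) := by
    intro x hx
    rw [mem_filter] at hx ⊢
    exact ⟨(hG.rot_mem x).2 hx.1, hx.2.tail (hR x)⟩
  refine (mem_filter.1 ((perm_mem_iff hD d).1 ?_)).2
  exact mem_filter.2 ⟨(hG.rot_mem d).2 hd, .refl⟩

theorem removeRays_reach (hE : State E ∅) (hx : x ∈ E.darts) (hxy : EqvGen (E.Link ∅) x y) :
    ReflTransGen (removeRays E).Step (base (toExt E x)) (base (toExt E y)) := by
  have hb : ∀ x ∈ E.darts, base (toExt E x) ∈ (removeRays E).darts := fun x hx =>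
    mem_of_ext ((toExt_dartMap hE).mem x hx)
  have hG := removeRays_isGraph hE
  refine (eqvGen_le_of (equivalence_comap (equivalence_reach (removeRays E).Step)
    (fun x => base (toExt E x))) ?_ hx hxy).1
  · rintro x _ (rfl | ⟨h, rfl⟩)
    · refine ⟨(perm_mem_iff hE.rot_mem x).symm, fun hx => ?_⟩
      rw [(toExt_dartMap hE).rot x hx]
      have hx' := (toExt_dartMap hE).mem x hx
      have hm := mem_of_ext hx'
      have h1 : ∀ z ∈ (removeRays E).ext.darts, base ((removeRays E).ext.rot z) = base z ∨
          base ((removeRays E).ext.rot z) = (removeRays E).rot (base z) := by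
        rintro (d | d) hz
        · by_cases hd : d ∈ (removeRays E).rayCorners
          · rw [ext_rot_corner hd]; exact Or.inl rfl
          · rw [ext_rot_inl hd]; exact Or.inr rfl
        · rw [ext_rot_inr (inr_mem_ext.1 hz)]; exact Or.inr rfl
      replace h1 := h1 _ hx'
      rcases h1 with h1 | h1
      · rw [h1]; exact ⟨.refl, .refl⟩
      · rw [h1]; exact ⟨.single (Or.inl rfl), reach_of_rot hG (fun _ => Or.inl rfl) hm⟩
    · have h' := hE.opp_edge x h
      refine ⟨iff_of_true h.1 h'.1, fun _ => ?_⟩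
      rw [toExt_of_ne h.2.1, toExt_of_ne h'.2.1]
      exact ⟨.single (Or.inr rfl), .single (Or.inr (hE.opp_opp x h).symm)⟩

theorem removeRays_planeTree (hE : State E ∅) : (removeRays E).PlaneTree where
  isGraph := removeRays_isGraph hE
  isTree := by
    refine ⟨fun d hd e he => ?_, ?_⟩
    · obtain ⟨h1, h2⟩ := mem_removeRays.1 hd
      obtain ⟨h3, h4⟩ := mem_removeRays.1 he
      have := removeRays_reach hE h1 (hE.conn d h1 e h3)
      rwa [toExt_of_ne h2, toExt_of_ne h4] at this
    · rw [← (removeRays_isGraph hE).ext_vertexMap.2, ((toExt_dartMap hE).vertexMap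
        (ofExt_dartMap hE) hE.rot_mem (removeRays_isGraph hE).ext_rot_mem
        (fun x _ => ofExt_toExt) (fun x hx => toExt_ofExt hE hx)).2, hE.count]
      have : E.darts.filter (fun d => E.IsEdge ∅ d) = (removeRays E).darts := by
        ext x
        simp only [mem_filter, mem_removeRays, IsEdge, Set.mem_empty_iff_false,
          not_false_eq_true, and_true]
        tauto
      rw [edgesM, this]
      rfl
  outgoingSeparated d hd hk := by
    obtain ⟨h1, h2⟩ := mem_removeRays.1 hd
    have h3 := hE.nl_rot h1 (Or.inl hk)
    rw [removeRays_rot hE h1 h2, if_neg fun k => h3 (leaving_of_ray k)]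
    exact fun k => h3 (Or.inl k)
  weakWidth := ⟨fun d hd => hE.W_le d (mem_removeRays.1 hd).1,
    fun d hd => hE.W_vertical d (removeRays_isEdge hd)⟩
  H_nonneg d hd := hE.H_nonneg d (removeRays_isEdge hd)

end RemoveRays

/-! ### Zipping of an edge of a plane tree -/

/-- The properties of the zipping of the edge of `r`. The half-strips of `T`, not adjacent to this
edge, remain half-strips of the extended graph of the zipped tree; for the zipping of two edges they
are those adjacent to the second one. -/
structure ZipData (G : WGraph α) (r : α) (T : Set ((α ⊕ α) × (α ⊕ α))) : Prop where
  planeTree : (G.zip r).PlaneTree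
  mem : ∀ d ∈ (G.zip r).darts, ∃ x ∈ G.darts, x ≠ r ∧ x ≠ G.opp r ∧ d = inl x
  opp : (G.zip r).opp = G.ext.opp
  kind : (G.zip r).kind = G.ext.kind
  H : (G.zip r).H = G.ext.H
  vertical : ∀ x ∈ G.darts, G.kind x = .vertical → x ≠ r → x ≠ G.opp r →
    inl x ∈ (G.zip r).darts
  zero : ∀ o ∈ (G.zip r).darts, (G.zip r).kind o = .outgoing →
    (G.zip r).W ((G.zip r).opp o) = (G.zip r).W o → G.ext.W (G.ext.opp o) = G.ext.W o
  folding : Nonempty (Folding G.ext ∅ (adjacentStrips G.ext (inl r) ∪ T)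
    (G.zip r).ext ∅ (Prod.map inl inl '' T)
    (fun a a' => ∃ x ∈ G.darts, a = inl x ∧ a' = inl (inl x) ∧
      G.kind x = .vertical ∧ x ≠ r ∧ x ≠ G.opp r)
    (fun a a' => ∃ x ∈ G.darts, a = inl x ∧ a' = inl (inl x) ∧
      G.kind x ≠ .outgoing ∧ inl x ∈ (G.zip r).darts))

theorem zipData (hG : G.PlaneTree) {r : α} (h : Openable G.ext (inl r))
    {T : Set ((α ⊕ α) × (α ⊕ α))} (hT : CornersOK G.ext T)
    (hne : ∀ c ∈ T, (c.1 ≠ inl r ∧ c.1 ≠ G.ext.opp (inl r)) ∧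
      (c.2 ≠ inl r ∧ c.2 ≠ G.ext.opp (inl r))) : ZipData G r T := by
  obtain ⟨z, h1, h2⟩ := zip_spec h hT hne
  have hzip : G.zip r = removeRays (zipStrip (inl r) (zipStrip (G.ext.opp (inl r))
    (openZipper G.ext (inl r)))) := rfl
  rw [show G.ext.opp (inl r) = inl (G.opp r) from rfl] at *
  generalize zipStrip (inl r) (zipStrip (inl (G.opp r))
    (openZipper G.ext (inl r))) = Z at *
  have hmem : ∀ d, d ∈ (G.zip r).darts ↔ d ∈ Z.darts ∧ G.ext.kind d ≠ .ray := by
    intro d; rw [hzip, mem_removeRays, z.kind]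
  have hX : ∀ x : α, (inl x ∉ ({inl r, inl (G.opp r)} : Set (α ⊕ α))) ↔
      x ≠ r ∧ x ≠ G.opp r := by
    intro x
    simp
  have hker : ∀ x : α, inl x ∈ Z.darts → x ≠ r ∧ x ≠ G.opp r := fun x hx =>
    ⟨fun k => h1 (k ▸ hx), fun k => h2 (k ▸ hx)⟩
  have hZT : CornersOK Z T := by
    intro c hc
    have key : ∀ d : α ⊕ α, d ∈ G.ext.darts → G.ext.kind d = .vertical →
        d ≠ inl r → d ≠ inl (G.opp r) → d ∈ Z.darts ∧ Z.kind d = .vertical :=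
      fun d hd hk k1 k2 => ⟨z.vertical d hd hk (by simp [k1, k2]), by rw [z.kind]; exact hk⟩
    have h3 := hT c hc
    have h4 := hne c hc
    exact ⟨key _ h3.1.1 h3.1.2 h4.1.1 h4.1.2, key _ h3.2.1 h3.2.2 h4.2.1 h4.2.2⟩
  have hto : ∀ d : α ⊕ α, Z.kind d = .vertical → toExt Z d = inl d := fun d hd =>
    toExt_of_ne (by simp [hd])
  have hpt : (G.zip r).PlaneTree := by rw [hzip]; exact removeRays_planeTree z.state
  refine ⟨hpt, fun d hd => ?_, ?_, ?_, ?_, fun x hx hk k1 k2 => ?_, fun o ho hk hw => ?_, ?_⟩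
  · obtain ⟨h3, h4⟩ := (hmem d).1 hd
    rcases d with x | x
    · exact ⟨x, inl_mem_ext.1 (z.darts _ h3), (hker x h3).1, (hker x h3).2, rfl⟩
    · exact absurd rfl h4
  · rw [hzip]; exact z.opp
  · rw [hzip]; exact z.kind
  · rw [hzip]; exact z.H
  · exact (hmem _).2 ⟨z.vertical _ (inl_mem_ext.2 hx) hk ((hX x).2 ⟨k1, k2⟩), fun k => by
      rw [show G.kind x = .ray from k] at hk; cases hk⟩
  · rw [hzip] at hk hw
    exact z.zero o ((hmem o).1 ho).1 hk hw
  · obtain ⟨F⟩ := z.folding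
    have hcT : CornersOK (G.zip r).ext (Prod.map inl inl '' T) := by
      rintro _ ⟨c, hc, rfl⟩
      have key : ∀ d, d ∈ Z.darts ∧ Z.kind d = .vertical →
          inl d ∈ (G.zip r).ext.darts ∧ (G.zip r).ext.kind (inl d) = .vertical := by
        rintro d ⟨k1, k2⟩
        rw [z.kind] at k2
        refine ⟨inl_mem_ext.2 ((hmem d).2 ⟨k1, by simp [k2]⟩), ?_⟩
        rw [← k2, ← z.kind, hzip]; rfl
      exact ⟨key _ (hZT c hc).1, key _ (hZT c hc).2⟩
    have F' := (toExt_dartMap z.state).folding (ofExt_dartMap z.state) z.state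
      (by rw [← hzip]; exact hpt.ext_state) (fun x _ => ofExt_toExt)
      (fun x hx => toExt_ofExt z.state hx) hZT (S' := Prod.map inl inl '' T)
      (by rw [← hzip]; exact hcT) (fun c hc => ⟨c, hc, by
        rw [hto _ (hZT c hc).1.2, hto _ (hZT c hc).2.2]; rfl⟩)
      (by rintro _ ⟨c, hc, rfl⟩; exact hc)
    rw [← hzip] at F'
    refine ⟨(F.trans F' fun d d' k => ⟨z.darts d k.2.1, k.1 ▸ k.2.1⟩).mono ?_ ?_⟩
    · rintro _ _ ⟨x, hx, rfl, rfl, hk, hne⟩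
      have hx1 := z.vertical _ (inl_mem_ext.2 hx) hk ((hX x).2 hne)
      have hk1 : Z.kind (inl x) = .vertical := by rw [z.kind]; exact hk
      exact ⟨inl x, ⟨rfl, inl_mem_ext.2 hx, hk, (hX x).2 hne⟩, (hto _ hk1).symm, hx1, hk1⟩
    · rintro _ _ ⟨x, hx, rfl, rfl, hk, hxz⟩
      have hx1 := ((hmem _).1 hxz).1
      exact ⟨inl x, ⟨rfl, hx1, fun k => hk ((ext_leaving_inl hG.isGraph hx).1 k),
        (hX x).2 (hker x hx1)⟩, (toExt_of_ne (by
          rw [z.kind]; exact hG.isGraph.kind_ne_ray x hx)).symm, hx1⟩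

/-! ### Connection by edges of zero weight -/

/-- Two darts start at the same vertex or are the halves of an edge of zero weight. -/
def ZeroLink (E : WGraph β) (x y : β) : Prop :=
  x ∈ E.darts ∧ (E.Same x y ∨
    (E.kind x ≠ .ray ∧ E.weight x = 0 ∧ y = E.opp x))

/-- The vertices of the two darts are connected by edges of zero weight. -/
def ZeroConn (E : WGraph β) : β → β → Prop := EqvGen E.ZeroLink

theorem ZeroConn.trans {x y z : β} (h : E.ZeroConn x y) (h' : E.ZeroConn y z) :
    E.ZeroConn x z := EqvGen.trans _ _ _ h h'

theorem ZeroConn.symm (h : E.ZeroConn x y) : E.ZeroConn y x :=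
  EqvGen.symm _ _ h

theorem zeroConn_of_same (hx : x ∈ E.darts) (h : E.Same x y) :
    E.ZeroConn x y := EqvGen.rel _ _ ⟨hx, Or.inl h⟩

theorem zeroConn_opp (hx : x ∈ E.darts) (hk : E.kind x ≠ .ray)
    (hw : E.weight x = 0) : E.ZeroConn x (E.opp x) := EqvGen.rel _ _ ⟨hx, Or.inr ⟨hk, hw, rfl⟩⟩

theorem weight_of_outgoing (hk : E.kind x = .outgoing) :
    E.weight x = 0 ↔ E.W (E.opp x) = E.W x := by
  simp [weight, hk, abs_eq_zero, sub_eq_zero]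

theorem weight_of_vertical (hk : E.kind x = .vertical) :
    E.weight x = E.H x := if_pos hk

/-- Branchpoints on the level `w` that are connected by edges of zero weight coincide. -/
def BranchpointsApartAt (G : WGraph β) (w : ℝ) : Prop :=
  ∀ d ∈ G.darts, ∀ e ∈ G.darts, G.W d = w → Odd (G.ord (G.vert d)) → Odd (G.ord (G.vert e)) →
    G.ZeroConn d e → G.vert d = G.vert e

namespace HasWalk

variable {G : WGraph β}

theorem of_same {d e f : β} {l : ℝ} (h : G.Same d e) (h' : G.HasWalk e f l) :
    G.HasWalk d f l := by
  cases h' with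
  | nil _ _ h1 => exact .nil _ _ (h.trans h1)
  | cons _ c _ l h1 h2 => exact .cons _ c _ l (h.trans h1) h2

theorem trans {d e f : β} {l l' : ℝ} (h : G.HasWalk d e l) (h' : G.HasWalk e f l') :
    G.HasWalk d f (l + l') := by
  induction h with
  | nil _ _ h1 => rw [zero_add]; exact h'.of_same h1
  | cons _ c _ l h1 _ ih => rw [add_assoc]; exact .cons _ c _ _ h1 (ih h')

end HasWalk

namespace PlaneTree

theorem weight_nonneg (hG : G.PlaneTree) {d : α} (hd : d ∈ G.darts) : 0 ≤ G.weight d := by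
  by_cases hk : G.kind d = .vertical
  · rw [weight_of_vertical hk]; exact hG.H_nonneg d hd hk
  · rw [weight, if_neg hk]; exact abs_nonneg _

theorem weight_opp (hG : G.PlaneTree) {d : α} (hd : d ∈ G.darts) :
    G.weight (G.opp d) = G.weight d := by
  have h1 := hG.isGraph.kind_opp_vertical d hd
  have h2 := hG.isGraph.kind_opp_vertical _ (hG.isGraph.opp_mem d hd)
  rw [hG.isGraph.opp_opp d hd] at h2
  by_cases hk : G.kind d = .vertical
  · rw [weight_of_vertical hk, weight_of_vertical (h1 hk), hG.isGraph.H_opp d hd hk]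
  · rw [weight, weight, if_neg hk, if_neg (fun k => hk (h2 k)), hG.isGraph.opp_opp d hd,
      abs_sub_comm]

theorem walk_nonneg (hG : G.PlaneTree) {d e : α} {l : ℝ} (h : G.HasWalk d e l)
    (hd : d ∈ G.darts) : 0 ≤ l := by
  induction h with
  | nil => exact le_rfl
  | cons _ c _ l h1 _ ih =>
    have hc := sameCycle_mem (fun d hd => (hG.isGraph.rot_mem d).2 hd) hd h1
    exact add_nonneg (hG.weight_nonneg hc) (ih (hG.isGraph.opp_mem c hc))

theorem walk_of_zeroConn (hG : G.PlaneTree) {d e : α} (h : G.ZeroConn d e) (hd : d ∈ G.darts) :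
    G.HasWalk d e 0 := by
  refine (eqvGen_le_of (T := fun d e => G.HasWalk d e 0 ∧ G.HasWalk e d 0) ?_ ?_ hd h).1
  · refine ⟨fun d => ⟨.nil _ _ (.refl _ _), .nil _ _ (.refl _ _)⟩, fun h => h.symm,
      fun h1 h2 => ?_⟩
    have h3 := h1.1.trans h2.1
    have h4 := h2.2.trans h1.2
    rw [add_zero] at h3 h4
    exact ⟨h3, h4⟩
  · rintro x y ⟨hx, hxy | ⟨-, hw, rfl⟩⟩
    · exact ⟨iff_of_true hx (sameCycle_mem (fun d hd => (hG.isGraph.rot_mem d).2 hd) hx hxy),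
        fun _ => ⟨.nil _ _ hxy, .nil _ _ hxy.symm⟩⟩
    · refine ⟨iff_of_true hx (hG.isGraph.opp_mem x hx), fun _ => ?_⟩
      have h1 := HasWalk.cons x x (G.opp x) 0 (.refl _ _) (.nil _ _ (.refl _ _))
      have h2 := HasWalk.cons (G.opp x) (G.opp x) x 0 (.refl _ _)
        (.nil _ _ (by rw [hG.isGraph.opp_opp x hx]))
      rw [hG.weight_opp hx] at h2
      rw [hw, add_zero] at h1 h2
      exact ⟨h1, h2⟩

theorem branchpointsApartAt (hG : G.PlaneTree) (hB : G.BranchpointsApart) (w : ℝ) :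
    G.BranchpointsApartAt w := by
  intro d hd e he _ h1 h2 h
  by_contra hne
  have h3 := hB d hd e he h1 h2 hne
  have h4 : G.dist d e ≤ 0 := csInf_le ⟨0, fun l hl => hG.walk_nonneg hl hd⟩
    (hG.walk_of_zeroConn h hd)
  exact absurd h3 (not_lt.2 h4)

/-! ### Orders of vertices -/

/-- Each vertex has a vertical or incoming dart. -/
theorem exists_not_outgoing (hG : G.PlaneTree) {d : α} (hd : d ∈ G.darts) :
    ∃ x ∈ G.vert d, G.kind x = .vertical ∨ G.kind x = .incoming := by
  have key : ∀ x ∈ G.darts, G.kind x ≠ .outgoing →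
      G.kind x = .vertical ∨ G.kind x = .incoming := by
    intro x hx h
    have := hG.isGraph.kind_ne_ray x hx
    rcases hk : G.kind x <;> simp_all
  by_cases hk : G.kind d = .outgoing
  · have h1 := (hG.isGraph.rot_mem d).2 hd
    exact ⟨_, mem_vert.2 ⟨h1, same_rot _ _⟩, key _ h1 (hG.outgoingSeparated d hd hk)⟩
  · exact ⟨d, self_mem_vert hd, key d hd hk⟩

theorem ord_ge (hG : G.PlaneTree) {d : α} (hd : d ∈ G.darts) : -1 ≤ G.ord (G.vert d) := by
  obtain ⟨x, hx, hk | hk⟩ := hG.exists_not_outgoing hd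
  · have : 0 < ((G.vert d).filter (fun x => G.kind x = .vertical)).card :=
      Finset.card_pos.2 ⟨x, mem_filter.2 ⟨hx, hk⟩⟩
    rw [ord]; omega
  · have : 0 < ((G.vert d).filter (fun x => G.kind x = .incoming)).card :=
      Finset.card_pos.2 ⟨x, mem_filter.2 ⟨hx, hk⟩⟩
    rw [ord]; omega

end PlaneTree

namespace WeaklyAdmissible

theorem ord_pos (hG : G.WeaklyAdmissible) {d x : α} (hd : d ∈ G.darts) (hx : x ∈ G.vert d)
    (hk : G.kind x = .incoming) : 0 ≤ G.ord (G.vert d) ∧ G.ord (G.vert d) ≠ 0 := by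
  have h1 : 0 < ((G.vert d).filter (fun x => G.kind x = .incoming)).card :=
    Finset.card_pos.2 ⟨x, mem_filter.2 ⟨hx, hk⟩⟩
  refine ⟨by rw [ord]; omega, fun h => ?_⟩
  obtain ⟨⟨y, hy, hky⟩, -⟩ := hG.orderZero _ (vert_mem_verts hd) h
  have h2 : 0 < ((G.vert d).filter (fun x => G.kind x = .vertical)).card :=
    Finset.card_pos.2 ⟨y, mem_filter.2 ⟨hy, hky⟩⟩
  rw [ord] at h
  omega

/-- A vertex of order zero has two vertical edges, no incoming ones, and an outgoing one. -/
theorem ord_zero (hG : G.WeaklyAdmissible) {d : α} (hd : d ∈ G.darts)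
    (h : G.ord (G.vert d) = 0) :
    ((G.vert d).filter (fun x => G.kind x = .vertical)).card = 2 ∧
    (∀ x ∈ G.vert d, G.kind x ≠ .incoming) ∧
    ∃ o ∈ G.vert d, G.kind o = .outgoing := by
  have h1 : ∀ x ∈ G.vert d, G.kind x ≠ .incoming := fun x hx hk =>
    (hG.ord_pos hd hx hk).2 h
  have h2 : (G.vert d).filter (fun x => G.kind x = .incoming) = ∅ :=
    Finset.filter_eq_empty_iff.2 fun x hx => h1 x hx
  obtain ⟨-, o, ho, hk⟩ := hG.orderZero _ (vert_mem_verts hd) h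
  refine ⟨?_, h1, o, ho, hk.resolve_right (h1 o ho)⟩
  rw [ord, h2, Finset.card_empty] at h
  omega

end WeaklyAdmissible

theorem all_eq_zero_of_sum {ι : Type*} {s : Finset ι} {f : ι → ℤ} (h : ∑ i ∈ s, f i = 0)
    (h1 : ∀ i ∈ s, -1 ≤ f i) (h2 : ∀ i ∈ s, ∀ j ∈ s, Odd (f i) → Odd (f j) → i = j) :
    ∀ i ∈ s, f i = 0 := by
  have h3 : ∀ i ∈ s, ¬ Odd (f i) := by
    intro i hi ho
    rw [← Finset.add_sum_erase s f hi] at h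
    have h4 : Even (∑ j ∈ s.erase i, f j) := Finset.even_sum _ fun j hj => by
      rw [mem_erase] at hj
      exact Int.not_odd_iff_even.1 fun k => hj.1 (h2 j hj.2 i hi k ho)
    have := ho.add_even h4
    rw [h] at this
    simp at this
  refine (Finset.sum_eq_zero_iff_of_nonneg fun i hi => ?_).1 h
  have := h1 i hi
  by_contra k
  exact h3 i hi (by rw [show f i = -1 by omega]; decide)

/-! ### Consequences of the addition of orders -/

theorem IsGraph.W_same {G : WGraph β} (hG : G.IsGraph) (hd : d ∈ G.darts)
    (h : G.Same d e) : G.W e = G.W d :=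
  (sameCycle_induct (fun d hd => (hG.rot_mem d).2 hd)
    (R := fun x y => G.W y = G.W x) ⟨fun _ => rfl, fun k => k.symm, fun k k' => k'.trans k⟩
    (fun x hx => hG.W_rot x hx) hd h).2

section Merge

variable {G' : WGraph β} {g : α → β}

theorem merges_of_vertexMap (hG' : G'.IsGraph) (h : VertexMap G ∅ G' ∅ g) {ι : α → β}
    {same : α → α → Prop}
    (hsame : ∀ d ∈ G.darts, ∀ e ∈ G.darts, G'.Same (g d) (g e) ↔ same d e)
    (hname : ∀ d ∈ G.darts, G.kind d ≠ .outgoing → ι d ∈ G'.darts →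
      G'.Same (g d) (ι d)) : G.MergesAddingOrders G' ι same := by
  have hv := fun d (hd : d ∈ G.darts) => vmap_vert h.same hd
  refine ⟨vmap G' g, fun V hV => h.vmap_mem hV, fun V' hV' => ?_, fun d hd e he => ?_,
    fun d hd hk hι => ?_, fun d hd d' hd' hdd => ?_, fun V' hV' => ?_⟩
  · obtain ⟨d', hd', rfl⟩ := mem_verts.1 hV'
    obtain ⟨d, hd, hdd⟩ := h.surj d' hd'
    exact ⟨_, vert_mem_verts hd, by rw [hv d hd]; exact vert_eq_of_same hdd⟩
  · rw [hv d hd, hv e he, vert_eq_iff (h.mem d hd), hsame d hd e he]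
  · rw [hv d hd]; exact vert_eq_of_same (hname d hd hk hι)
  · rw [hv d hd, vert_eq_iff (h.mem d hd)] at hdd
    rw [← h.W d hd]
    exact hG'.W_same (h.mem d hd) hdd
  · have := h.ord V' hV'
    simpa only [ordM_empty] using this

theorem VertexMap.ord_eq (h : VertexMap G ∅ G' ∅ g) {d' : β} (hd' : d' ∈ G'.darts) :
    G'.ord (G'.vert d') = ∑ V ∈ G.verts.filter (fun V => vmap G' g V = G'.vert d'), G.ord V := by
  simpa only [ordM_empty] using h.ord _ (vert_mem_verts hd')

theorem VertexMap.mem_fiber (h : VertexMap G ∅ G' ∅ g) {d' : β} {V : Finset α} :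
    V ∈ G.verts.filter (fun V => vmap G' g V = G'.vert d') ↔
      ∃ d ∈ G.darts, G.vert d = V ∧ G'.Same (g d) d' :=
  WGraph.mem_fiber h.mem h.same

/-- The vertices merged to a vertex of order zero have order zero: orders are at least `-1`, their
sum is zero, and at most one of them is odd, hence none is. -/
theorem ord_zero_of_merge (hG : G.WeaklyAdmissible) (h : VertexMap G ∅ G' ∅ g)
    (hG' : G'.IsGraph)
    (hB : ∀ d ∈ G.darts, ∀ e ∈ G.darts, G.W d = 0 → Odd (G.ord (G.vert d)) →
      Odd (G.ord (G.vert e)) → G'.Same (g d) (g e) → G.vert d = G.vert e)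
    {d : α} (hd : d ∈ G.darts) (hord : G'.ord (G'.vert (g d)) = 0) :
    G.ord (G.vert d) = 0 := by
  rw [h.ord_eq (h.mem d hd)] at hord
  have hdF : G.vert d ∈ G.verts.filter (fun V => vmap G' g V = G'.vert (g d)) :=
    h.mem_fiber.2 ⟨d, hd, rfl, .refl _ _⟩
  by_cases hw : G.W d = 0
  · refine all_eq_zero_of_sum hord ?_ ?_ _ hdF
    · intro V hV
      obtain ⟨e, he, rfl, -⟩ := h.mem_fiber.1 hV
      exact hG.planeTree.ord_ge he
    · intro V hV V₁ hV₁ ho ho₁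
      obtain ⟨e, he, rfl, h1⟩ := h.mem_fiber.1 hV
      obtain ⟨e₁, he₁, rfl, h2⟩ := h.mem_fiber.1 hV₁
      refine hB e he e₁ he₁ ?_ ho ho₁ (h1.trans h2.symm)
      rw [← hw, ← h.W e he, ← h.W d hd, ← hG'.W_same (h.mem e he) h1]
  · refine (Finset.sum_eq_zero_iff_of_nonneg fun V hV => ?_).1 hord _ hdF
    obtain ⟨e, he, rfl, h1⟩ := h.mem_fiber.1 hV
    obtain ⟨x, hx, hk | hk⟩ := hG.planeTree.exists_not_outgoing he
    · refine absurd ?_ hw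
      have h2 := mem_vert.1 hx
      rw [← h.W d hd, hG'.W_same (h.mem e he) h1, ← hG'.W_same (h.mem e he)
          (h.same e he x h2.1 h2.2), h.W x h2.1]
      exact hG.weakWidth.2 x h2.1 hk
    · exact (hG.ord_pos he hx hk).1

/-- A branchpoint of the new tree contains one of the old tree, by the additivity of the orders. -/
theorem branchpointsApartAt_of_merge (h : VertexMap G ∅ G' ∅ g) (hG' : G'.IsGraph)
    (hB : G.BranchpointsApartAt w)
    (hconn : ∀ d ∈ G.darts, ∀ e ∈ G.darts, G.W d = w → G'.ZeroConn (g d) (g e) →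
      G.ZeroConn d e) : G'.BranchpointsApartAt w := by
  intro d' hd' e' he' hw ho ho' hc
  have key : ∀ x ∈ G'.darts, Odd (G'.ord (G'.vert x)) →
      ∃ d ∈ G.darts, Odd (G.ord (G.vert d)) ∧ G'.Same (g d) x := by
    intro x hx hx'
    rw [h.ord_eq hx] at hx'
    by_contra hno
    refine Int.not_even_iff_odd.2 hx' (Finset.even_sum _ fun V hV => ?_)
    obtain ⟨d, hd, rfl, h1⟩ := h.mem_fiber.1 hV
    exact Int.not_odd_iff_even.1 fun k => hno ⟨d, hd, k, h1⟩
  obtain ⟨d, hd, hdo, h1⟩ := key d' hd' ho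
  obtain ⟨e, he, heo, h2⟩ := key e' he' ho'
  have hwd : G.W d = w := by rw [← h.W d hd, ← hG'.W_same (h.mem d hd) h1, hw]
  have h3 := hB d hd e he hwd hdo heo (hconn d hd e he hwd
    (((zeroConn_of_same (h.mem d hd) h1).trans hc).trans
      (zeroConn_of_same (h.mem e he) h2).symm))
  have h4 := h.same d hd e he ((vert_eq_iff hd).1 h3)
  exact vert_eq_of_same ((h1.symm.trans h4).trans h2)

end Merge

/-! ### Identifications on the level of the vertical edges -/

theorem zeroConn_base (hG : G.IsGraph) {x y : α ⊕ α} (h : G.ext.ZeroConn x y) :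
    G.ZeroConn (base x) (base y) := by
  refine eqvGen_le (S := fun x y => G.ZeroConn (base x) (base y))
    (equivalence_comap (equivalence_eqvGen _) base) ?_ h
  rintro x y ⟨hx, hxy | ⟨hk, hw, rfl⟩⟩
  · exact zeroConn_of_same (mem_of_ext hx) (hG.same_of_ext hx hxy)
  · rcases x with d | d
    · exact zeroConn_opp (inl_mem_ext.1 hx) hk hw
    · exact absurd rfl hk

theorem zeroConn_mirror (h : E.mirror.ZeroConn x y) : E.ZeroConn x y := by
  refine eqvGen_le (equivalence_eqvGen _) ?_ h
  rintro x y ⟨hx, hxy | hxy⟩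
  · exact zeroConn_of_same hx ((mirror_same E).1 hxy)
  · exact EqvGen.rel _ _ ⟨hx, Or.inr hxy⟩

theorem zeroConn_of_chain (hE : State E M) {s : β} (hs : s ∈ E.darts)
    (hl : E.Leaving s) (h : Chain E s x) (hw : E.W x ≤ E.W s) : E.ZeroConn s x := by
  induction h with
  | start => exact EqvGen.refl _
  | next o ho hk ih =>
    obtain ⟨h1, -⟩ := ho.mem hE hs hl
    have h2 := hE.opp_mem h1 hk
    have h3 := ho.W_le hE hs hl
    have h4 := hE.W_le o h1 hk
    rw [hE.W_rot _ h2] at hw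
    exact ((ih (h4.trans hw)).trans (zeroConn_opp h1 (by simp [hk])
      ((weight_of_outgoing hk).2 (le_antisymm (hw.trans h3) h4)))).trans
      (zeroConn_of_same h2 (same_rot _ _))

theorem zeroConn_of_side (hE : State E M) (ha : E.IsEdge M a)
    (hk : E.kind a = .vertical) (hP : E.OnSide a P) (hw : P.2 = 0) :
    E.ZeroConn a P.1 := by
  have hl := nl_of_vertical hk
  refine (zeroConn_of_same ha.1 (same_rot _ _)).trans
    (zeroConn_of_chain hE (hE.rot_mem a ha.1) (hE.leaving_rot ha.1 hl) hP.2 ?_)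
  rw [hE.W_rot a ha.1, hE.W_vertical a ha hk, ← hw]
  rcases hP.1.2 with h | h
  · exact h.ge
  · exact h.2.1.le

/-- The collapse of the half-strips adjacent to an edge of zero weight identifies points on the
level zero only if they are connected by edges of zero weight. -/
theorem zeroConn_of_ident (hE : State E ∅) {r : β} (hr : E.IsEdge ∅ r)
    (hk : E.kind r = .vertical) (hH : E.H r = 0)
    (h : E.Ident (adjacentStrips E r) P Q) (hP : P.2 = 0) : E.ZeroConn P.1 Q.1 := by
  refine (eqvGen_le (S := fun P Q : β × ℝ => P.2 = Q.2 ∧ (P.2 = 0 → E.ZeroConn P.1 Q.1))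
    ⟨fun _ => ⟨rfl, fun _ => EqvGen.refl _⟩, fun h => ⟨h.1.symm, fun k => (h.2 (h.1.trans k)).symm⟩,
      fun h h' => ⟨h.1.trans h'.1, fun k => (h.2 k).trans (h'.2 (h.1 ▸ k))⟩⟩ ?_ h).2 hP
  have hr' := hE.opp_edge r hr
  have hk' := hE.kind_vertical r hr hk
  have hrr : E.ZeroConn r (E.opp r) :=
    zeroConn_opp hr.1 hr.2.1 (by rw [weight_of_vertical hk, hH])
  rintro P Q (⟨h1, -, h3, h4, h5⟩ | ⟨c, hc, hP, hQ, h⟩)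
  · exact ⟨by rw [h3, h4, hE.W_same h1 h5], fun _ => zeroConn_of_same h1 h5⟩
  · refine ⟨h, fun k => ?_⟩
    have key : ∀ P, E.OnStrip c P → P.2 = 0 → E.ZeroConn r P.1 := by
      intro P hP k
      rcases hc with rfl | hc
      · rcases hP with hP | hP
        · exact zeroConn_of_side hE hr hk hP k
        · exact hrr.trans (zeroConn_mirror (zeroConn_of_side hE.mirror hr' hk' hP k))
      · rw [show c = (E.opp r, r) from hc] at hP
        rcases hP with hP | hP
        · exact hrr.trans (zeroConn_of_side hE hr' hk' hP k)
        · exact zeroConn_mirror (zeroConn_of_side hE.mirror hr hk hP k)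
    exact (key P hP k).symm.trans (key Q hQ (h ▸ k))

/-! ### Vertices under a folding of extended graphs -/

section Base

variable {G' : WGraph β} {S₀ : Set ((α ⊕ α) × (α ⊕ α))} {S₀' : Set ((β ⊕ β) × (β ⊕ β))}
  {C N : α ⊕ α → β ⊕ β → Prop}

/-- The map of darts of plane trees that represents the map of vertices defined by a folding. -/
def Folding.onDarts (F : Folding G.ext ∅ S₀ G'.ext ∅ S₀' C N) (d : α) : β :=
  base (F.f (inl d, G.W d)).1

theorem Folding.onDarts_vertexMap (F : Folding G.ext ∅ S₀ G'.ext ∅ S₀' C N) (hG : G.IsGraph)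
    (hG' : G'.IsGraph) : VertexMap G ∅ G' ∅ F.onDarts :=
  (hG.ext_vertexMap.1.trans F.vertexMap).trans hG'.base_vertexMap

theorem Folding.ident_f_iff {C N : β → γ → Prop} (F : Folding E M S E' M' S' C N)
    (hP : E.IsPoint P) (hQ : E.IsPoint Q) :
    E'.Ident S' (F.f P) (F.f Q) ↔ E.Ident S P Q :=
  ⟨fun h => ((F.h_f P hP).symm.trans (F.hom_h.ident _ _ h)).trans (F.h_f Q hQ),
    F.hom_f.ident P Q⟩

theorem ident_empty_vertex (hE : Frame E M)
    (hx : x ∈ E.darts) :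
    E.Ident ∅ (x, E.W x) (y, E.W y) ↔ E.Same x y := by
  refine ⟨fun h => ?_, ident_of_same hE hx⟩
  rcases ident_empty h with h | h
  · rw [(Prod.mk.inj h).1]
  · exact h.2.2.2.2

theorem Folding.onDarts_same_iff (F : Folding G.ext ∅ S₀ G'.ext ∅ ∅ C N)
    (hG' : G'.PlaneTree) {d e : α} (hd : d ∈ G.darts) (he : e ∈ G.darts) :
    G'.Same (F.onDarts d) (F.onDarts e) ↔
      G.ext.Ident S₀ (inl d, G.W d) (inl e, G.W e) := by
  have h1 : ∀ x ∈ G.darts, G.ext.IsPoint (inl x, G.W x) := fun x hx =>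
    isPoint_vertex (inl_mem_ext.2 hx)
  have h2 : ∀ x ∈ G.darts, (F.f (inl x, G.W x)).1 ∈ G'.ext.darts := fun x hx =>
    (F.hom_f.point _ (h1 x hx)).1
  have h3 : ∀ x ∈ G.darts, F.f (inl x, G.W x) =
      ((F.f (inl x, G.W x)).1, G'.ext.W (F.f (inl x, G.W x)).1) := fun x hx =>
    F.f_vertex (inl_mem_ext.2 hx)
  rw [← F.ident_f_iff (h1 d hd) (h1 e he), h3 d hd, h3 e he,
    ident_empty_vertex hG'.ext_state.toFrame (h2 d hd)]
  exact ⟨fun k => ((ext_same_base (h2 d hd)).symm.trans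
    (hG'.isGraph.ext_same (mem_of_ext (h2 d hd)) k)).trans (ext_same_base (h2 e he)),
    fun k => hG'.isGraph.same_of_ext (h2 d hd) k⟩

/-- A connection by edges of zero weight on the level zero can be lifted through a folding. -/
theorem Folding.zeroConn_of_onDarts (F : Folding G.ext ∅ S₀ G'.ext ∅ ∅ C N) (hG : G.IsGraph)
    (hG' : G'.PlaneTree)
    (hS : ∀ P Q, G.ext.Ident S₀ P Q → P.2 = 0 → G.ext.ZeroConn P.1 Q.1)
    (hv : ∀ x ∈ G'.darts, G'.kind x = .vertical → G'.H x = 0 →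
      ∃ d ∈ G.darts, G'.Same (F.onDarts d) x ∧
        G'.Same (F.onDarts (G.opp d)) (G'.opp x) ∧ G.ZeroConn d (G.opp d))
    {d e : α} (hd : d ∈ G.darts) (he : e ∈ G.darts) (hw : G.W d = 0)
    (h : G'.ZeroConn (F.onDarts d) (F.onDarts e)) : G.ZeroConn d e := by
  have hV := F.onDarts_vertexMap hG hG'.isGraph
  have hid : ∀ d ∈ G.darts, ∀ e ∈ G.darts, G.W d = 0 →
      G'.Same (F.onDarts d) (F.onDarts e) → G.ZeroConn d e := fun d hd e he hw k =>
    zeroConn_base hG (hS _ _ ((F.onDarts_same_iff hG' hd he).1 k) hw)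
  have hW : ∀ d ∈ G.darts, ∀ x, G'.Same (F.onDarts d) x → G'.W x = G.W d :=
    fun d hd x hx => by rw [hG'.isGraph.W_same (hV.mem d hd) hx, hV.W d hd]
  have hh : ∀ d ∈ G.darts, ∀ x, G'.Same (F.onDarts d) x → G.W d = 0 →
      G.ext.ZeroConn (inl d) (F.h (inl x, G'.W x)).1 := by
    intro d hd x hx hw
    have hp : G.ext.IsPoint (inl d, G.W d) := isPoint_vertex (inl_mem_ext.2 hd)
    have hm := (F.hom_f.point _ hp).1
    have h1 : G'.ext.Ident ∅ (F.f (inl d, G.W d)) (inl x, G'.W x) := by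
      rw [show F.f (inl d, G.W d) = _ from F.f_vertex (inl_mem_ext.2 hd)]
      exact ident_of_same hG'.ext_state.toFrame hm
        ((ext_same_base hm).symm.trans (hG'.isGraph.ext_same (mem_of_ext hm) hx))
    exact hS _ _ ((F.h_f _ hp).symm.trans (F.hom_h.ident _ _ h1)) hw
  have hout : ∀ x ∈ G'.darts, G'.kind x = .outgoing → G'.W (G'.opp x) = G'.W x →
      G'.W x = 0 → ∀ d ∈ G.darts, ∀ e ∈ G.darts, G'.Same (F.onDarts d) x →
      G'.Same (F.onDarts e) (G'.opp x) → G.ZeroConn d e := by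
    intro x hx hk hxx hx0 d hd e he h1 h2
    have hd0 : G.W d = 0 := by rw [← hW d hd x h1, hx0]
    have he0 : G.W e = 0 := by rw [← hW e he _ h2, hxx, hx0]
    have k1 := hh d hd x h1 hd0
    have k2 := hh e he _ h2 he0
    refine zeroConn_base hG (x := inl d) (y := inl e) (k1.trans (.trans ?_ k2.symm))
    rcases F.hom_h.zero (inl x) (inl_mem_ext.2 hx) hk hxx with h3 | ⟨o, ho, hko, hwo, h3, h4⟩
    · exact hS _ _ h3 (by rw [F.hom_h.snd]; exact hx0)
    · have h5 := hS _ _ h3 (by rw [F.hom_h.snd]; exact hx0)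
      have h6 := hS _ _ h4 (by rw [F.hom_h.snd]; exact hxx.trans hx0)
      exact (h5.trans (zeroConn_opp ho (by simp [hko]) ((weight_of_outgoing hko).2 hwo))).trans
        h6.symm
  refine (eqvGen_le (S := fun x y => (x ∈ G'.darts ∧ G'.W x = 0 ↔ y ∈ G'.darts ∧ G'.W y = 0) ∧
    (x ∈ G'.darts ∧ G'.W x = 0 → ∀ d ∈ G.darts, ∀ e ∈ G.darts,
      G'.Same (F.onDarts d) x → G'.Same (F.onDarts e) y → G.ZeroConn d e))
    ⟨fun x => ⟨Iff.rfl, fun hx d hd e he h1 h2 => hid d hd e he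
        (by rw [← hW d hd x h1, hx.2]) (h1.trans h2.symm)⟩,
      fun h => ⟨h.1.symm, fun hx d hd e he h1 h2 => (h.2 (h.1.2 hx) e he d hd h2 h1).symm⟩,
      fun {x y z} h h' => ⟨h.1.trans h'.1, fun hx d hd e he h1 h2 => ?_⟩⟩ ?_ h).2
      ⟨hV.mem d hd, by rw [hV.W d hd, hw]⟩ d hd e he (.refl _ _) (.refl _ _)
  · have hy := h.1.1 hx
    obtain ⟨c, hc, hcy⟩ := hV.surj y hy.1
    exact (h.2 hx d hd c hc h1 hcy).trans (h'.2 hy c hc e he hcy h2)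
  · rintro x y ⟨hx, hxy | ⟨-, hwx, rfl⟩⟩
    · have hy := sameCycle_mem (fun d hd => (hG'.isGraph.rot_mem d).2 hd) hx hxy
      refine ⟨by rw [hG'.isGraph.W_same hx hxy]; simp [hx, hy], fun h0 d hd e he h1 h2 => ?_⟩
      exact hid d hd e he (by rw [← hW d hd x h1, h0.2]) ((h1.trans hxy).trans h2.symm)
    · have hx' := hG'.isGraph.opp_mem x hx
      have hkr := hG'.isGraph.kind_ne_ray x hx
      rcases hk : G'.kind x with _ | _ | _ | _
      · have hk' := hG'.isGraph.kind_opp_vertical x hx hk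
        refine ⟨iff_of_true ⟨hx, hG'.weakWidth.2 x hx hk⟩ ⟨hx', hG'.weakWidth.2 _ hx' hk'⟩,
          fun h0 d hd e he h1 h2 => ?_⟩
        rw [weight_of_vertical hk] at hwx
        obtain ⟨c, hc, h3, h4, h5⟩ := hv x hx hk hwx
        have hc' := hG.opp_mem c hc
        exact ((hid d hd c hc (by rw [← hW d hd x h1, h0.2]) (h1.trans h3.symm)).trans h5).trans
          (hid _ hc' e he (by rw [← hW _ hc' _ h4, hG'.weakWidth.2 _ hx' hk'])
            (h4.trans h2.symm))
      · have hxx := (weight_of_outgoing hk).1 hwx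
        exact ⟨by rw [hxx]; simp [hx, hx'], fun h0 d hd e he h1 h2 =>
          hout x hx hk hxx h0.2 d hd e he h1 h2⟩
      · have hk' := hG'.isGraph.kind_opp_incoming x hx hk
        have hoo := hG'.isGraph.opp_opp x hx
        rw [← hG'.weight_opp hx] at hwx
        have hxx := (weight_of_outgoing hk').1 hwx
        rw [hoo] at hxx
        refine ⟨by rw [hxx]; simp [hx, hx'], fun h0 d hd e he h1 h2 => ?_⟩
        exact (hout _ hx' hk' (by rw [hoo, hxx]) (by rw [← hxx, h0.2]) e he d hd h2
          (by rw [hoo]; exact h1)).symm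
      · exact absurd hk hkr

end Base

/-- If the side beginning after the image of a corner is a ray, then the side edge at the corner is
contracted by the folding. -/
theorem Folding.same_of_ray {C N : β → γ → Prop} (F : Folding E ∅ S E' ∅ S' C N) (hS' : S' = ∅)
    (hE : State E ∅)
    {a' : γ} (hC : C a a') (ha : a ∈ E.darts)
    (ho : E.kind (E.rot a) = .outgoing)
    (hray : E'.kind (E'.rot a') ≠ .outgoing) :
    E'.Same (F.f (E.opp (E.rot a), E.W (E.opp (E.rot a)))).1 a' := by
  subst hS'
  have h1 := hE.opp_mem (hE.rot_mem a ha) ho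
  have h2 := hE.rot_mem _ h1
  have hP : E.OnSide a (E.rot (E.opp (E.rot a)), E.W (E.rot (E.opp (E.rot a)))) :=
    ⟨isPoint_vertex h2, Chain.start.next _ ho⟩
  obtain ⟨P', hP', hi⟩ := F.hom_f.side a a' _ hC hP
  have h3 : P'.1 = E'.rot a' := by
    rcases hP'.2.cases_head with h | h
    · exact h
    · exact absurd h.1 hray
  rw [F.f_vertex h2] at hi
  have h4 : E'.Same (F.f (E.rot (E.opp (E.rot a)), E.W (E.rot (E.opp (E.rot a))))).1
      P'.1 := by
    rcases ident_empty hi with h | h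
    · rw [← h]
    · exact h.2.2.2.2
  rw [h3] at h4
  exact ((F.vertexMap.same _ h1 _ h2 (same_rot _ _)).trans h4).trans (same_rot _ _).symm

/-! ### Zipping preserves admissibility -/

namespace WeaklyAdmissible

variable {r : α}

/-- If no other vertical or incoming dart started at the ends of the edge, then the ends would be
different branchpoints at distance zero. -/
theorem openable (hG : G.WeaklyAdmissible) (hB : G.BranchpointsApartAt 0) (hr : r ∈ G.darts)
    (hk : G.kind r = .vertical) (hw : G.weight r = 0) : Openable G.ext (inl r) := by
  have hE := hG.planeTree.ext_state
  have hr1 : G.ext.IsEdge ∅ (inl r) := (ext_isEdge hG.isGraph).2 ⟨r, hr, rfl⟩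
  refine { hE with mem := hr1.1, vertical := hk, other := ?_ }
  have hns : ¬ G.Same r (G.opp r) := fun k =>
    hE.not_same_opp hr1 (hG.isGraph.ext_same hr k)
  have hr' := hG.isGraph.opp_mem r hr
  by_contra hno
  push Not at hno
  -- Otherwise both ends of the edge have order `-1`.
  have key : ∀ x ∈ G.darts, G.kind x = .vertical → (x = r ∨ x = G.opp r) →
      (∀ y ∈ G.darts, (y = r ∨ y = G.opp r) → G.Same x y → y = x) →
      Odd (G.ord (G.vert x)) := by
    intro x hx hkx hxr huniq
    have h1 : ∀ y ∈ G.vert x, G.kind y ≠ .outgoing → y = x := by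
      intro y hy hky
      obtain ⟨hy, hxy⟩ := mem_vert.1 hy
      have h2 : y = r ∨ y = G.opp r := by
        by_contra hne
        rw [not_or] at hne
        have h3 := hno (inl y) (inl_mem_ext.2 hy)
          (by rwa [ext_leaving_inl hG.isGraph hy])
          (fun k => hne.1 (inl_injective k)) (fun k => hne.2 (inl_injective k))
        rcases hxr with rfl | rfl
        · exact h3.1 (hG.isGraph.ext_same hx hxy)
        · exact h3.2 (hG.isGraph.ext_same hx hxy)
      exact huniq y hy h2 hxy
    have h2 : (G.vert x).filter (fun y => G.kind y = .vertical) = {x} := by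
      ext y
      rw [mem_filter, mem_singleton]
      constructor
      · exact fun h => h1 y h.1 (by simp [h.2])
      · rintro rfl; exact ⟨self_mem_vert hx, hkx⟩
    have h3 : (G.vert x).filter (fun y => G.kind y = .incoming) = ∅ := by
      refine Finset.filter_eq_empty_iff.2 fun y hy hky => ?_
      rw [h1 y hy (by simp [hky]), hkx] at hky
      cases hky
    rw [ord, h2, h3, Finset.card_singleton, Finset.card_empty]
    decide
  refine hns ((vert_eq_iff hr).1 (hB r hr _ hr' (hG.weakWidth.2 r hr hk)
    (key r hr hk (Or.inl rfl) ?_) (key _ hr' (hG.isGraph.kind_opp_vertical r hr hk)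
    (Or.inr rfl) ?_) (zeroConn_opp hr (hG.isGraph.kind_ne_ray r hr) hw)))
  · rintro y - (rfl | rfl) h
    · rfl
    · exact absurd h hns
  · rintro y - (rfl | rfl) h
    · exact absurd h.symm hns
    · rfl

end WeaklyAdmissible

/-- A vertical edge of zero weight of an admissible tree, and the tree obtained by its zipping. -/
structure ZipFolding (G : WGraph α) (r : α) : Prop where
  admissible : G.WeaklyAdmissible
  mem : r ∈ G.darts
  vertical : G.kind r = .vertical
  weight : G.weight r = 0
  apart : G.BranchpointsApartAt 0
  data : ZipData G r ∅

namespace ZipFolding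

variable {r : α}

theorem _root_.WGraph.WeaklyAdmissible.zipFolding (hG : G.WeaklyAdmissible)
    (hB : G.BranchpointsApartAt 0) (hr : r ∈ G.darts)
    (hk : G.kind r = .vertical) (hw : G.weight r = 0) : ZipFolding G r :=
  ⟨hG, hr, hk, hw, hB, zipData hG.planeTree (hG.openable hB hr hk hw)
    (fun _ hc => absurd hc (Set.notMem_empty _)) (fun _ hc => absurd hc (Set.notMem_empty _))⟩

theorem exists_folding (Z : ZipFolding G r) :
    ∃ C N, (∀ x ∈ G.darts, G.kind x = .vertical → x ≠ r → x ≠ G.opp r →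
        C (inl x) (inl (inl x))) ∧
      (∀ x ∈ G.darts, G.kind x ≠ .outgoing → inl x ∈ (G.zip r).darts →
        N (inl x) (inl (inl x))) ∧
      Nonempty (Folding G.ext ∅ (adjacentStrips G.ext (inl r))
        (G.zip r).ext ∅ ∅ C N) := by
  obtain ⟨F⟩ := Z.data.folding
  rw [Set.union_empty, Set.image_empty] at F
  exact ⟨_, _, fun x hx hk h1 h2 => ⟨x, hx, rfl, rfl, hk, h1, h2⟩,
    fun x hx hk h => ⟨x, hx, rfl, rfl, hk, h⟩, ⟨F⟩⟩

theorem isEdge (Z : ZipFolding G r) : G.ext.IsEdge ∅ (inl r) :=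
  (ext_isEdge Z.admissible.isGraph).2 ⟨r, Z.mem, rfl⟩

theorem H_eq (Z : ZipFolding G r) : G.H r = 0 := by
  rw [← weight_of_vertical Z.vertical]; exact Z.weight

theorem not_same (Z : ZipFolding G r) : ¬ G.Same r (G.opp r) := fun k =>
  Z.admissible.planeTree.ext_state.not_same_opp Z.isEdge (Z.admissible.isGraph.ext_same Z.mem k)

theorem zeroConn (Z : ZipFolding G r) : ∀ P Q : (α ⊕ α) × ℝ,
    G.ext.Ident (adjacentStrips G.ext (inl r)) P Q → P.2 = 0 →
      G.ext.ZeroConn P.1 Q.1 := fun _ _ h hP =>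
  zeroConn_of_ident Z.admissible.planeTree.ext_state Z.isEdge Z.vertical Z.H_eq h hP

theorem opp_inl (Z : ZipFolding G r) (x : α) : (G.zip r).opp (inl x) = inl (G.opp x) := by
  rw [Z.data.opp]; rfl

theorem kind_inl (Z : ZipFolding G r) (x : α) : (G.zip r).kind (inl x) = G.kind x := by
  rw [Z.data.kind]; rfl

theorem H_inl (Z : ZipFolding G r) (x : α) : (G.zip r).H (inl x) = G.H x := by
  rw [Z.data.H]; rfl

theorem merges (Z : ZipFolding G r) :
    G.MergesAddingOrders (G.zip r) inl (G.ZipSame r) := by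
  obtain ⟨C, N, -, hN, ⟨F⟩⟩ := Z.exists_folding
  have hG := Z.admissible.isGraph
  refine merges_of_vertexMap Z.data.planeTree.isGraph
    (F.onDarts_vertexMap hG Z.data.planeTree.isGraph) (fun d hd e he => ?_) fun d hd hk hz => ?_
  · rw [zipSame_iff Z.admissible.planeTree Z.mem Z.vertical hd]
    exact F.onDarts_same_iff Z.data.planeTree hd he
  · exact Z.data.planeTree.isGraph.same_of_ext
      (F.hom_f.point _ (isPoint_vertex (inl_mem_ext.2 hd))).1 (F.name _ _ (hN d hd hk hz))

theorem apart_zip (Z : ZipFolding G r) : (G.zip r).BranchpointsApartAt 0 := by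
  obtain ⟨C, N, -, hN, ⟨F⟩⟩ := Z.exists_folding
  have hG := Z.admissible.isGraph
  have hG' := Z.data.planeTree
  refine branchpointsApartAt_of_merge (F.onDarts_vertexMap hG hG'.isGraph) hG'.isGraph Z.apart
    fun d hd e he hw h => F.zeroConn_of_onDarts hG hG' Z.zeroConn (fun x hx hk hH => ?_)
      hd he hw h
  have hx' := hG'.isGraph.opp_mem x hx
  have hk' := hG'.isGraph.kind_opp_vertical x hx hk
  obtain ⟨d, hd, -, -, rfl⟩ := Z.data.mem x hx
  rw [Z.opp_inl] at hx' hk'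
  rw [Z.kind_inl] at hk hk'
  rw [Z.H_inl] at hH
  have key : ∀ d ∈ G.darts, G.kind d = .vertical → inl d ∈ (G.zip r).darts →
      (G.zip r).Same (F.onDarts d) (inl d) := fun d hd hk hz =>
    hG'.isGraph.same_of_ext (F.hom_f.point _ (isPoint_vertex (inl_mem_ext.2 hd))).1
      (F.name _ _ (hN d hd (by simp [hk]) hz))
  refine ⟨d, hd, key d hd hk hx, ?_, zeroConn_opp hd (hG.kind_ne_ray d hd)
    (by rw [weight_of_vertical hk, hH])⟩
  rw [Z.opp_inl]
  exact key _ (hG.opp_mem d hd) hk' hx'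

/-- A vertex of order zero of the zipped tree is merged from such vertices. Of the two vertical
darts next to an outgoing dart there, at least one survives, and beside it there remains an
outgoing dart, as otherwise the outgoing edge would be contracted. -/
theorem orderZero (Z : ZipFolding G r) : (G.zip r).OrderZeroCondition := by
  obtain ⟨C, N, hC, hN, ⟨F⟩⟩ := Z.exists_folding
  have hG := Z.admissible
  have hE := hG.planeTree.ext_state
  have hG' := Z.data.planeTree
  have hE' := hG'.ext_state
  have hV := F.onDarts_vertexMap hG.isGraph hG'.isGraph
  intro V' hV' hord
  obtain ⟨d', hd', rfl⟩ := mem_verts.1 hV'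
  obtain ⟨d, hd, hdd⟩ := hV.surj d' hd'
  rw [← vert_eq_of_same hdd] at hord ⊢
  have hzero : ∀ e ∈ G.darts, (G.zip r).Same (F.onDarts d) (F.onDarts e) →
      G.ord (G.vert e) = 0 := by
    intro e he hde
    refine ord_zero_of_merge hG hV hG'.isGraph (fun a ha b hb hw h1 h2 h => ?_) he
      (by rw [← vert_eq_of_same hde]; exact hord)
    exact Z.apart a ha b hb hw h1 h2 (zeroConn_base hG.isGraph (x := inl a) (y := inl b)
      (Z.zeroConn _ _ ((F.onDarts_same_iff hG' ha hb).1 h) hw))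
  obtain ⟨hcard, hin, o, ho, hko⟩ := hG.ord_zero hd (hzero d hd (.refl _ _))
  obtain ⟨ho, hdo⟩ := mem_vert.1 ho
  have hvert : ∀ x ∈ G.darts, G.Same d x → G.kind x ≠ .outgoing →
      G.kind x = .vertical := by
    intro x hx hdx hk
    have h1 := hin x (mem_vert.2 ⟨hx, hdx⟩)
    have h2 := hG.isGraph.kind_ne_ray x hx
    rcases h : G.kind x <;> simp_all
  -- The two neighbours of an outgoing dart are vertical, and they are different.
  have hra := (hG.isGraph.rot_mem o).2 ho
  have hrb := perm_inv_mem (fun x hx => (hG.isGraph.rot_mem x).2 hx) ho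
  have hda := hdo.trans (same_rot _ o)
  have hdb := hdo.trans (same_rot_inv _ o)
  have hka := hvert _ hra hda (hG.outgoingSeparated o ho hko)
  have hkb := hvert _ hrb hdb fun k => hG.outgoingSeparated _ hrb k (by rw [apply_inv, hko])
  have hrota : G.ext.rot (inl o) = inl (G.rot o) :=
    ext_rot_inl fun k => (mem_rayCorners.1 k).2.1 hko
  have hrotb : G.ext.rot (inl (G.rot⁻¹ o)) = inl o := by
    rw [ext_rot_inl fun k => (mem_rayCorners.1 k).2.2 (by rw [apply_inv, hko]),
      apply_inv]
  have hab : G.rot o ≠ G.rot⁻¹ o := by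
    intro hab
    obtain ⟨c, hc, hcb⟩ := Finset.exists_mem_ne (by rw [hcard]; norm_num) (G.rot o)
    obtain ⟨hc, hkc⟩ := mem_filter.1 hc
    have h1 := sameCycle_mem (D := G.darts.filter (fun x => x = o ∨ x = G.rot o))
      (σ := G.rot) (x := o) (y := c) (by
        intro x hx
        rw [mem_filter] at hx ⊢
        refine ⟨(hG.isGraph.rot_mem x).2 hx.1, ?_⟩
        rcases hx.2 with rfl | rfl
        · exact Or.inr rfl
        · left; rw [hab, apply_inv])
      (mem_filter.2 ⟨ho, Or.inl rfl⟩) (hdo.symm.trans (mem_vert.1 hc).2)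
    rcases (mem_filter.1 h1).2 with rfl | h
    · rw [hko] at hkc; cases hkc
    · exact hcb h
  have hsurv : ∀ x ∈ G.darts, G.Same d x → G.kind x = .vertical → x ≠ r →
      x ≠ G.opp r → inl x ∈ (G.zip r).darts ∧
        (G.zip r).Same (F.onDarts d) (inl x) := by
    intro x hx hdx hk h1 h2
    have h3 := Z.data.vertical x hx hk h1 h2
    exact ⟨h3, (hV.same d hd x hx hdx).trans (hG'.isGraph.same_of_ext
      (F.hom_f.point _ (isPoint_vertex (inl_mem_ext.2 hx))).1 (F.name _ _
        (hN x hx (by simp [hk]) h3)))⟩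
  -- An edge leaving the vertex is not contracted, because its end has positive order.
  have hopp : ¬ (G.zip r).Same (F.onDarts d) (F.onDarts (G.opp o)) := by
    have h1 := hG.isGraph.opp_mem o ho
    intro h
    exact (hG.ord_pos h1 (self_mem_vert h1) (hG.isGraph.kind_opp_outgoing o ho hko)).2
      (hzero _ h1 h)
  have hfin : ∀ x ∈ G.darts, G.Same d x → G.kind x = .vertical → x ≠ r →
      x ≠ G.opp r → ∀ s ∈ (G.zip r).ext.darts,
      (G.zip r).ext.Same (inl (inl x)) s →
      ((G.zip r).ext.kind s ≠ .outgoing → (G.zip r).ext.Same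
        (F.f (inl (G.opp o), G.W (G.opp o))).1 (inl (inl x))) →
      (∃ y ∈ (G.zip r).vert (F.onDarts d), (G.zip r).kind y = .vertical) ∧
      ∃ y ∈ (G.zip r).vert (F.onDarts d),
        (G.zip r).kind y = .outgoing ∨ (G.zip r).kind y = .incoming := by
    intro x hx hdx hk h1 h2 s hs hxs himp
    obtain ⟨h3, h4⟩ := hsurv x hx hdx hk h1 h2
    have h5 := hG'.isGraph.same_of_ext (inl_mem_ext.2 h3) hxs
    refine ⟨⟨_, mem_vert.2 ⟨h3, h4⟩, by rw [Z.kind_inl]; exact hk⟩, base s,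
      mem_vert.2 ⟨mem_of_ext hs, h4.trans h5⟩, Or.inl ?_⟩
    by_contra hks
    refine hopp (h4.trans (hG'.isGraph.same_of_ext (F.hom_f.point _ (isPoint_vertex
      (inl_mem_ext.2 (hG.isGraph.opp_mem o ho)))).1 (himp fun k => hks ?_)).symm)
    rcases s with y | y
    · exact k
    · cases k
  by_cases hb : G.rot⁻¹ o ≠ r ∧ G.rot⁻¹ o ≠ G.opp r
  · have hx := inl_mem_ext.2 ((hsurv _ hrb hdb hkb hb.1 hb.2).1)
    refine hfin _ hrb hdb hkb hb.1 hb.2 _ (hE'.rot_mem _ hx) (same_rot _ _) fun k => ?_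
    have := F.same_of_ray rfl hE (hC _ hrb hkb hb.1 hb.2) (inl_mem_ext.2 hrb)
      (by rw [hrotb]; exact hko) k
    rw [hrotb] at this
    exact this
  · have ha : G.rot o ≠ r ∧ G.rot o ≠ G.opp r := by
      have h1 : G.Same (G.rot⁻¹ o) (G.rot o) := hdb.symm.trans hda
      constructor
      · intro h
        refine hb ⟨fun k => hab (h.trans k.symm), fun k => Z.not_same ?_⟩
        rw [← k, ← h]; exact h1.symm
      · intro h
        refine hb ⟨fun k => Z.not_same ?_, fun k => hab (h.trans k.symm)⟩
        rw [← h, ← k]; exact h1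
    have hx := inl_mem_ext.2 ((hsurv _ hra hda hka ha.1 ha.2).1)
    have hro : G.ext.mirror.rot (inl (G.rot o)) = inl o := by
      rw [mirror_rot, ← hrota, inv_apply]
    refine hfin _ hra hda hka ha.1 ha.2 _ (hE'.rot_inv_mem hx) (same_rot_inv _ _)
      fun k => ?_
    have := F.mirror.same_of_ray (S' := Prod.swap ⁻¹' ∅) rfl hE.mirror
      (hC _ hra hka ha.1 ha.2) (inl_mem_ext.2 hra) (by rw [hro]; exact hko) k
    rw [hro] at this
    exact (mirror_same _).1 this

theorem weakHeights (Z : ZipFolding G r) : (G.zip r).WeakHeights := by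
  have hG := Z.admissible
  refine ⟨Z.data.planeTree.H_nonneg, ?_⟩
  rw [← hG.weakHeights.2]
  congr 1
  refine Finset.sum_of_injOn base ?_ ?_ ?_ ?_
  · intro x hx y hy hxy
    obtain ⟨d, -, -, -, rfl⟩ := Z.data.mem x (mem_filter.1 hx).1
    obtain ⟨e, -, -, -, rfl⟩ := Z.data.mem y (mem_filter.1 hy).1
    exact congrArg inl hxy
  · intro x hx
    obtain ⟨hx, hk⟩ := mem_filter.1 hx
    obtain ⟨d, hd, -, -, rfl⟩ := Z.data.mem x hx
    rw [Z.kind_inl] at hk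
    exact mem_coe.2 (mem_filter.2 ⟨hd, hk⟩)
  · intro d hd himg
    obtain ⟨hd, hk⟩ := mem_filter.1 hd
    by_cases h1 : d = r
    · rw [h1]; exact Z.H_eq
    by_cases h2 : d = G.opp r
    · rw [h2, hG.isGraph.H_opp r Z.mem Z.vertical]; exact Z.H_eq
    exact absurd ⟨inl d, mem_coe.2 (mem_filter.2
      ⟨Z.data.vertical d hd hk h1 h2, by rw [Z.kind_inl]; exact hk⟩), rfl⟩ himg
  · intro x hx
    obtain ⟨d, -, -, -, rfl⟩ := Z.data.mem x (mem_filter.1 hx).1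
    exact Z.H_inl d

theorem weaklyAdmissible (Z : ZipFolding G r) : (G.zip r).WeaklyAdmissible where
  isGraph := Z.data.planeTree.isGraph
  isTree := Z.data.planeTree.isTree
  outgoingSeparated := Z.data.planeTree.outgoingSeparated
  orderZero := Z.orderZero
  weakWidth := Z.data.planeTree.weakWidth
  weakHeights := Z.weakHeights

theorem weight_eq_zero (Z : ZipFolding G r) {x : α} (hx : inl x ∈ (G.zip r).darts)
    (h : (G.zip r).weight (inl x) = 0) : G.weight x = 0 := by
  have hG := Z.admissible
  have hG' := Z.data.planeTree
  have hxG : ∀ x, inl x ∈ (G.zip r).darts → x ∈ G.darts := by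
    intro x hx
    obtain ⟨d, hd, -, -, h⟩ := Z.data.mem _ hx
    exact inl_injective h ▸ hd
  have hout : ∀ x, inl x ∈ (G.zip r).darts → G.kind x = .outgoing →
      (G.zip r).weight (inl x) = 0 → G.weight x = 0 := by
    intro x hx hk h
    have hk' : (G.zip r).kind (inl x) = .outgoing := by rw [Z.kind_inl]; exact hk
    exact (weight_of_outgoing hk).2 (Z.data.zero _ hx hk' ((weight_of_outgoing hk').1 h))
  have hr := hG.isGraph.kind_ne_ray x (hxG x hx)
  rcases hk : G.kind x with _ | _ | _ | _
  · rw [weight_of_vertical (by rw [Z.kind_inl]; exact hk), Z.H_inl] at h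
    rw [weight_of_vertical hk, h]
  · exact hout x hx hk h
  · have h1 := hG'.isGraph.opp_mem _ hx
    rw [← hG'.weight_opp hx] at h
    rw [Z.opp_inl] at h1 h
    rw [← hG.planeTree.weight_opp (hxG x hx)]
    exact hout _ h1 (hG.isGraph.kind_opp_incoming x (hxG x hx) hk) h
  · exact absurd hk hr

theorem _root_.WGraph.mem_zeroEdges {G : WGraph β} {e : Finset β} (he : e ∈ G.zeroEdges) :
    ∃ x ∈ G.darts, G.weight x = 0 ∧ ∀ y, y ∈ e ↔ y = x ∨ y = G.opp x := by
  obtain ⟨x, hx, rfl⟩ := mem_image.1 he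
  obtain ⟨hx, hw⟩ := mem_filter.1 hx
  exact ⟨x, hx, hw, by simp⟩

theorem zeroEdges_lt (Z : ZipFolding G r) : (G.zip r).zeroEdges.card < G.zeroEdges.card := by
  have hrz : {r, G.opp r} ∈ G.zeroEdges :=
    mem_image.2 ⟨r, mem_filter.2 ⟨Z.mem, Z.weight⟩, rfl⟩
  refine lt_of_le_of_lt ?_ (Finset.card_erase_lt_of_mem hrz)
  refine Finset.card_le_card_of_surjOn (fun e => e.map Function.Embedding.inl) fun e he => ?_
  obtain ⟨x, hx, hw, hxe⟩ := mem_zeroEdges (mem_coe.1 he)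
  obtain ⟨d, hd, h1, h2, rfl⟩ := Z.data.mem x hx
  refine ⟨{d, G.opp d}, mem_coe.2 (mem_erase.2 ⟨fun h => ?_, mem_image.2
    ⟨d, mem_filter.2 ⟨hd, Z.weight_eq_zero hx hw⟩, rfl⟩⟩), ?_⟩
  · have : d ∈ ({r, G.opp r} : Finset α) := h ▸ Finset.mem_insert_self _ _
    rw [mem_insert, mem_singleton] at this
    exact this.elim h1 h2
  · ext y
    rw [hxe, Z.opp_inl]
    simp

end ZipFolding

/-! ### Involutions of points reversing the orientation -/

/-- `φ` is an involutive map of points reversing the orientation, and `σ` describes its action on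
the vertical darts. -/
structure MirrorHom (E : WGraph β) (σ : β → β) (φ : β × ℝ → β × ℝ) : Prop where
  state : State E ∅
  hom : Hom E ∅ E.mirror ∅
    (fun a a' => a ∈ E.darts ∧ E.kind a = .vertical ∧ a' = σ a) φ
  corner : ∀ v ∈ E.darts, E.kind v = .vertical →
    σ v ∈ E.darts ∧ E.kind (σ v) = .vertical ∧ σ (σ v) = v
  invol : ∀ P, E.IsPoint P → E.Ident ∅ (φ (φ P)) P

/-- The image of the vertex of a dart. -/
def onVertex (E : WGraph β) (φ : β × ℝ → β × ℝ) (d : β) : β := (φ (d, E.W d)).1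

/-- The dart `o'` corresponds to `o`: the darts `o` and `o'` follow the corners `v` and `σ v`, and
the vertex of `o'` is the image of that of `o`. -/
def Matched (E : WGraph β) (σ : β → β) (φ : β × ℝ → β × ℝ) (v o o' : β) : Prop :=
  Chain E (E.rot v) o ∧ Chain E.mirror (E.rot⁻¹ (σ v)) o' ∧ E.Same (onVertex E φ o) o'

namespace MirrorHom

variable {σ : β → β} {φ : β × ℝ → β × ℝ}

theorem mirror (h : MirrorHom E σ φ) : MirrorHom E.mirror σ φ where
  state := h.state.mirror
  hom := h.hom.mirror
  corner := h.corner
  invol P hP := ident_mirror.2 (h.invol P hP)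

theorem onVertex_mem (h : MirrorHom E σ φ) (hd : d ∈ E.darts) :
    onVertex E φ d ∈ E.darts := (h.hom.point _ (isPoint_vertex hd)).1

theorem eq_onVertex (h : MirrorHom E σ φ) (hd : d ∈ E.darts) :
    φ (d, E.W d) = (onVertex E φ d, E.W (onVertex E φ d)) := by
  obtain ⟨d', -, hi⟩ := h.hom.vertex d hd
  refine Prod.ext rfl ?_
  rcases ident_empty hi with h1 | h1
  · rw [onVertex, h1]; rfl
  · exact h1.2.2.1

theorem W_onVertex (h : MirrorHom E σ φ) (hd : d ∈ E.darts) :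
    E.W (onVertex E φ d) = E.W d := by
  have := h.hom.snd (d, E.W d)
  rw [h.eq_onVertex hd] at this
  exact this

theorem same (h : MirrorHom E σ φ) (hd : d ∈ E.darts) (hde : E.Same d e) :
    E.Same (onVertex E φ d) (onVertex E φ e) := by
  have h1 := h.hom.ident _ _ (ident_of_same h.state.toFrame (S := ∅) hd hde)
  rw [h.eq_onVertex hd, h.eq_onVertex (h.state.mem_of_same hd hde)] at h1
  exact (mirror_same E).1
    ((ident_empty_vertex h.state.mirror.toFrame (h.onVertex_mem hd)).1 h1)

theorem onVertex_onVertex (h : MirrorHom E σ φ) (hd : d ∈ E.darts) :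
    E.Same (onVertex E φ (onVertex E φ d)) d := by
  have h1 := h.invol _ (isPoint_vertex hd)
  rw [h.eq_onVertex hd, h.eq_onVertex (h.onVertex_mem hd)] at h1
  exact (ident_empty_vertex h.state.toFrame (h.onVertex_mem (h.onVertex_mem hd))).1 h1

section Matched

variable {v o o' x x' y y' : β}

theorem start (h : MirrorHom E σ φ) (hv : v ∈ E.darts) (hk : E.kind v = .vertical) :
    E.rot v ∈ E.darts ∧ E.Leaving (E.rot v) :=
  ⟨h.state.rot_mem v hv, h.state.leaving_rot hv (nl_of_vertical hk)⟩

theorem start_mirror (h : MirrorHom E σ φ) (hv : v ∈ E.darts) (hk : E.kind v = .vertical) :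
    E.rot⁻¹ (σ v) ∈ E.darts ∧ E.Leaving (E.rot⁻¹ (σ v)) :=
  h.mirror.start (h.corner v hv hk).1 (h.corner v hv hk).2.1

theorem mem (h : MirrorHom E σ φ) (hv : v ∈ E.darts) (hk : E.kind v = .vertical)
    (m : Matched E σ φ v o o') :
    (o ∈ E.darts ∧ E.Leaving o) ∧ o' ∈ E.darts ∧ E.Leaving o' :=
  ⟨m.1.mem h.state (h.start hv hk).1 (h.start hv hk).2,
    Chain.mem (E := E.mirror) h.state.mirror (h.start_mirror hv hk).1 (h.start_mirror hv hk).2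
        m.2.1⟩

theorem exists_matched (h : MirrorHom E σ φ) (hv : v ∈ E.darts)
    (hk : E.kind v = .vertical) (ho : Chain E (E.rot v) o) :
    ∃ o', Matched E σ φ v o o' := by
  have hm := (ho.mem h.state (h.start hv hk).1 (h.start hv hk).2).1
  obtain ⟨P', hP', hi⟩ := h.hom.side v (σ v) (o, E.W o) ⟨hv, hk, rfl⟩ ⟨isPoint_vertex hm, ho⟩
  refine ⟨P'.1, ho, hP'.2, ?_⟩
  rcases ident_empty hi with h1 | h1
  · rw [onVertex, h1]
  · exact (mirror_same E).1 h1.2.2.2.2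

theorem symm (h : MirrorHom E σ φ) (hv : v ∈ E.darts) (hk : E.kind v = .vertical)
    (m : Matched E σ φ v o o') : Matched E.mirror σ φ (σ v) o' o := by
  have hm := h.mem hv hk m
  refine ⟨m.2.1, ?_, (mirror_same E).2 ?_⟩
  · rw [(h.corner v hv hk).2.2]; simpa using m.1
  · exact (h.same (h.onVertex_mem hm.1.1) m.2.2).symm.trans (h.onVertex_onVertex hm.1.1)

theorem matched_unique (h : MirrorHom E σ φ) (hv : v ∈ E.darts)
    (hk : E.kind v = .vertical) (m : Matched E σ φ v o x) (m' : Matched E σ φ v o y) :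
    x = y :=
  Chain.eq_of_same' (E := E.mirror) h.state.mirror (h.start_mirror hv hk).1
    (h.start_mirror hv hk).2 m.2.1 m'.2.1 ((mirror_same E).2 (m.2.2.symm.trans m'.2.2))

theorem matched_unique' (h : MirrorHom E σ φ) (hv : v ∈ E.darts)
    (hk : E.kind v = .vertical) (m : Matched E σ φ v x o) (m' : Matched E σ φ v y o) :
    x = y :=
  h.mirror.matched_unique (h.corner v hv hk).1 (h.corner v hv hk).2.1 (h.symm hv hk m)
    (h.symm hv hk m')

theorem chain_of_chain (h : MirrorHom E σ φ) (hv : v ∈ E.darts)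
    (hk : E.kind v = .vertical) (m : Matched E σ φ v x x') (m' : Matched E σ φ v y y')
    (hxy : Chain E x y) : Chain E.mirror x' y' := by
  have hE := h.state
  have hx := (h.mem hv hk m).1
  induction hxy generalizing y' with
  | start => rw [h.matched_unique hv hk m m']; exact .start
  | next o ho hko ih =>
    obtain ⟨o', mo⟩ := h.exists_matched hv hk (m.1.trans ho)
    refine (ih mo).trans ?_
    have h1 := h.mem hv hk mo
    have h2 := h.mem hv hk m'
    have h3 := hE.opp_mem h1.1.1 hko
    rcases Chain.linear (E := E.mirror) mo.2.1 m'.2.1 with h4 | h4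
    · exact h4
    -- Otherwise the edge of `o` has zero weight, and it is mapped to an edge or to a vertex.
    have h5 : E.W y' ≤ E.W o' := Chain.W_le (E := E.mirror) hE.mirror h2.2.1 h2.2.2 h4
    have hW : ∀ a a', Matched E σ φ v a a' → E.W a' = E.W a := fun a a' k => by
      have := (h.mem hv hk k).1.1
      rw [hE.W_same (h.onVertex_mem this) k.2.2, h.W_onVertex this]
    rw [hW _ _ mo, hW _ _ m', hE.W_rot _ h3] at h5
    have h6 : E.Same (onVertex E φ (E.opp o)) y' :=
      (h.same h3 (same_rot _ _)).trans m'.2.2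
    rcases h.hom.zero o h1.1.1 hko (le_antisymm h5 (hE.W_le o h1.1.1 hko)) with
      h7 | ⟨q, hq, hkq, -, h7, h8⟩
    · rw [h.eq_onVertex h1.1.1, h.eq_onVertex h3] at h7
      have h8 := (ident_empty_vertex hE.mirror.toFrame (h.onVertex_mem h1.1.1)).1 h7
      have h9 := mo.2.2.symm.trans (((mirror_same E).1 h8).trans h6)
      rw [Chain.eq_of_same' (E := E.mirror) hE.mirror (h.start_mirror hv hk).1
        (h.start_mirror hv hk).2 mo.2.1 m'.2.1 ((mirror_same E).2 h9)]
      exact .start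
    · rw [h.eq_onVertex h1.1.1] at h7
      rw [h.eq_onVertex h3] at h8
      have h9 := (mirror_same E).1 ((ident_empty_vertex hE.mirror.toFrame
        (h.onVertex_mem h1.1.1)).1 h7)
      have h10 := (mirror_same E).1 ((ident_empty_vertex hE.mirror.toFrame
        (h.onVertex_mem h3)).1 h8)
      have h11 := (mirror_above E).1 (Chain.above (E := E.mirror) hE.mirror h2.2.1 h2.2.2 h4)
      exact absurd (((above_of_same (h10.symm.trans h6)).trans h11).trans
        (above_of_same (mo.2.2.symm.trans h9))) (hE.not_above hq hkq)

theorem matched_next (h : MirrorHom E σ φ) (hv : v ∈ E.darts)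
    (hk : E.kind v = .vertical) (m : Matched E σ φ v o o')
    (hko : E.kind o = .outgoing) :
    E.kind o' = .outgoing ∧
      Matched E σ φ v (E.rot (E.opp o)) (E.rot⁻¹ (E.opp o')) := by
  have hE := h.state
  have hm := h.mem hv hk m
  have h1 := hE.opp_mem hm.1.1 hko
  obtain ⟨y, my⟩ := h.exists_matched hv hk (m.1.next o hko)
  have hne : E.rot (E.opp o) ≠ o := fun k => hE.not_same_opp (hE.isEdge_out hm.1.1 hko) (by
    have := (same_rot E.rot (E.opp o)).symm
    rwa [k] at this)
  rcases Chain.cases_head (E := E.mirror)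
    (h.chain_of_chain hv hk m my (Chain.start.next _ hko)) with h2 | ⟨h2, h3⟩
  · exact absurd (h.matched_unique' hv hk (h2 ▸ my) m) hne
  · refine ⟨h2, ?_⟩
    have hc := h.corner v hv hk
    have h4 : Chain E.mirror (E.mirror.rot (σ v)) (E.rot⁻¹ (E.opp o')) :=
      Chain.next (E := E.mirror) o' m.2.1 h2
    obtain ⟨x, mx⟩ := h.mirror.exists_matched hc.1 hc.2.1 h4
    have mx' := h.mirror.symm hc.1 hc.2.1 mx
    rw [mirror_mirror, hc.2.2] at mx'
    have h5 := h.mirror.chain_of_chain hc.1 hc.2.1 (h.symm hv hk m) mx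
      (Chain.next (E := E.mirror) o' .start h2)
    have h6 := h.mirror.chain_of_chain hc.1 hc.2.1 mx (h.symm hv hk my) h3
    rw [mirror_mirror] at h5 h6
    rcases h5.cases_head with h7 | ⟨-, h7⟩
    · rw [h7] at mx'
      have h8 := h.matched_unique hv hk m mx'
      refine absurd ?_ (hE.not_same_opp (hE.isEdge_out hm.2.1 h2))
      have := (same_rot_inv E.rot (E.opp o')).symm
      rwa [← h8] at this
    · have h8 := hE.rot_mem _ h1
      rw [h6.antisymm hE (h.mem hv hk mx').1.1 h7] at *
      exact mx'

theorem matched_start (h : MirrorHom E σ φ) (hv : v ∈ E.darts)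
    (hk : E.kind v = .vertical) : Matched E σ φ v (E.rot v) (E.rot⁻¹ (σ v)) := by
  have hc := h.corner v hv hk
  obtain ⟨x, mx⟩ := h.exists_matched hv hk .start
  obtain ⟨y, my⟩ := h.mirror.exists_matched hc.1 hc.2.1 .start
  have my' := h.mirror.symm hc.1 hc.2.1 my
  rw [mirror_mirror, hc.2.2] at my'
  have h1 := h.chain_of_chain hv hk mx my' my'.1
  have h2 : x = E.rot⁻¹ (σ v) := Chain.antisymm (E := E.mirror) h.state.mirror
    (h.start_mirror hv hk).1 mx.2.1 h1
  rwa [h2] at mx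

theorem matched_kind (h : MirrorHom E σ φ) (hv : v ∈ E.darts)
    (hk : E.kind v = .vertical) (m : Matched E σ φ v o o') : E.kind o' = E.kind o := by
  have hc := h.corner v hv hk
  have hm := h.mem hv hk m
  rcases hm.1.2 with h1 | h1
  · rw [h1, (h.matched_next hv hk m h1).1]
  · rcases hm.2.2 with h2 | h2
    · have := (h.mirror.matched_next hc.1 hc.2.1 (h.symm hv hk m) h2).1
      cases h1.symm.trans this
    · rw [h1, h2]

/-- The point of a ray beyond all vertices is mapped to a point of the corresponding ray. -/
theorem matched_ray (h : MirrorHom E σ φ) (hv : v ∈ E.darts)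
    (hk : E.kind v = .vertical) (m : Matched E σ φ v o o')
    (hko : E.kind o = .ray) (hw : ∀ d ∈ E.darts, E.W d < w) :
    φ (o, w) = (o', w) := by
  have hm := h.mem hv hk m
  have hP : E.IsPoint (o, w) := ⟨hm.1.1, Or.inr ⟨hm.1.2, hw o hm.1.1, by
    simp [level, hko, EReal.coe_lt_top]⟩⟩
  obtain ⟨P', hP', hi⟩ := h.hom.side v (σ v) (o, w) ⟨hv, hk, rfl⟩ ⟨hP, m.1⟩
  have h1 : φ (o, w) = P' := by
    rcases ident_empty hi with h1 | h1
    · exact h1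
    · have h2 := h1.2.2.1
      rw [h.hom.snd] at h2
      exact absurd h2 (hw _ h1.1).ne'
  have h2 : P'.2 = w := by rw [← h1, h.hom.snd]
  have h3 : E.kind P'.1 = .ray := by
    have hl := Chain.mem (E := E.mirror) h.state.mirror (h.start_mirror hv hk).1
      (h.start_mirror hv hk).2 hP'.2
    rcases hl.2 with h3 | h3
    · rcases hP'.1.2 with h4 | ⟨-, -, h4⟩
      · exact absurd (h2.symm.trans h4) (hw _ hP'.1.1).ne'
      · rw [level, if_neg (by rw [h3]; exact fun k => by cases k), EReal.coe_lt_coe_iff, h2] at h4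
        exact absurd h4 (hw _ (h.state.opp_mem hl.1 h3)).le.not_gt
    · exact h3
  have h4 := h.matched_kind hv hk m
  rw [hko] at h4
  have h5 : ∀ a b, E.kind a = .ray → Chain E.mirror a b → b = a := fun a b ha hab => by
    rcases Chain.cases_head (E := E.mirror) hab with k | k
    · exact k
    · have := k.1.symm.trans ha; cases this
  have h6 : P'.1 = o' := by
    rcases Chain.linear (E := E.mirror) hP'.2 m.2.1 with k | k
    · exact (h5 _ _ h3 k).symm
    · exact h5 _ _ h4 k
  rw [h1]
  exact Prod.ext h6 h2

/-- The corresponding dart does not depend on the side of a half-strip that is used. -/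
theorem matched_eq (h : MirrorHom E σ φ) (hv : v ∈ E.darts)
    (hk : E.kind v = .vertical) (m : Matched E σ φ v o x) {v' : β} (hv' : v' ∈ E.darts)
    (hk' : E.kind v' = .vertical) (m' : Matched E.mirror σ φ v' o y) : x = y := by
  have hE := h.state
  have hm := h.mem hv hk m
  have hm' := h.mirror.mem hv' hk' m'
  have hxy : E.Same x y := m.2.2.symm.trans ((mirror_same E).1 m'.2.2)
  rcases hm.1.2 with ho | ho
  · have h1 := hE.opp_mem hm.1.1 ho
    obtain ⟨hx, n⟩ := h.matched_next hv hk m ho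
    obtain ⟨hy, n'⟩ := h.mirror.matched_next hv' hk' m' ho
    refine hE.eq_of_above hm.2.1 hx hm'.2.1 hy hxy (above_of_same ?_)
    have h2 := ((h.same h1 (same_rot _ _)).trans n.2.2).trans (same_rot_inv _ _).symm
    have h3 := ((h.mirror.same h1 (same_rot _ _)).trans n'.2.2).trans
      (same_rot_inv _ _).symm
    exact ((mirror_same E).1 h3).symm.trans h2
  · obtain ⟨M, hM⟩ := (E.darts.image E.W).exists_le
    have hw : ∀ d ∈ E.darts, E.W d < M + 1 := fun d hd =>
      (hM _ (mem_image_of_mem _ hd)).trans_lt (lt_add_one M)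
    exact (Prod.mk.inj ((h.matched_ray hv hk m ho hw).symm.trans
      (h.mirror.matched_ray hv' hk' m' ho hw))).1

end Matched

end MirrorHom

/-- Each leaving dart belongs to the side of a half-strip. -/
theorem exists_corner (hE : State E ∅) (n : ℕ) : ∀ o ∈ E.darts, E.Leaving o →
    (E.darts.filter (fun d => E.kind d = .outgoing ∧ E.Above (E.opp d) o)).card < n →
    ∃ v ∈ E.darts, E.kind v = .vertical ∧ Chain E (E.rot v) o := by
  induction n with
  | zero => intro o _ _ h; omega
  | succ n ih =>
    intro o ho hl hn
    have h1 := hE.rot_inv_mem ho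
    have h2 := hE.nl_rot_inv ho hl
    rcases kind_of_not_leaving h2 with hk | hk
    · exact ⟨_, h1, hk, by rw [apply_inv]; exact .start⟩
    · have he := hE.isEdge_in h1 hk
      have h3 := (hE.opp_edge _ he).1
      have h4 := hE.kind_incoming _ he hk
      have h5 := hE.opp_opp _ he
      have h6 : E.Above (E.opp (E.opp (E.rot⁻¹ o))) o := by
        rw [h5]; exact above_of_same (same_rot_inv _ _).symm
      obtain ⟨v, hv, hkv, hc⟩ := ih _ h3 (Or.inl h4) (by
        refine lt_of_lt_of_le (Finset.card_lt_card (Finset.ssubset_iff_of_subset ?_ |>.2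
          ⟨E.opp (E.rot⁻¹ o), ?_, ?_⟩)) (Nat.lt_succ_iff.1 hn)
        · intro d hd
          rw [mem_filter] at hd ⊢
          exact ⟨hd.1, hd.2.1, (hd.2.2.trans (above_opp h3 h4)).trans h6⟩
        · exact mem_filter.2 ⟨h3, h4, h6⟩
        · exact fun k => hE.not_above h3 h4 (mem_filter.1 k).2.2)
      refine ⟨v, hv, hkv, ?_⟩
      have := hc.next _ h4
      rwa [h5, apply_inv] at this

namespace MirrorHom

variable {σ : β → β} {φ : β × ℝ → β × ℝ}

/-- The map of leaving darts induced by a map of points; it has the same properties in the mirror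
image of the graph. -/
def IsDartMap (E : WGraph β) (σ : β → β) (φ : β × ℝ → β × ℝ) (T : β → β) : Prop :=
  ∀ o ∈ E.darts, E.Leaving o →
    (∃ v ∈ E.darts, E.kind v = .vertical ∧ Matched E σ φ v o (T o)) ∧
    (∃ v ∈ E.darts, E.kind v = .vertical ∧ Matched E.mirror σ φ v o (T o))

theorem exists_dartMap (h : MirrorHom E σ φ) : ∃ T, IsDartMap E σ φ T := by
  have key : ∀ o, ∃ o', o ∈ E.darts → E.Leaving o →
      (∃ v ∈ E.darts, E.kind v = .vertical ∧ Matched E σ φ v o o') ∧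
      (∃ v ∈ E.darts, E.kind v = .vertical ∧ Matched E.mirror σ φ v o o') := by
    intro o
    by_cases ho : o ∈ E.darts ∧ E.Leaving o
    · obtain ⟨v, hv, hk, hc⟩ := exists_corner h.state _ o ho.1 ho.2 (Nat.lt_succ_self _)
      obtain ⟨v', hv', hk', hc'⟩ := exists_corner h.state.mirror _ o ho.1 ho.2 (Nat.lt_succ_self _)
      obtain ⟨x, m⟩ := h.exists_matched hv hk hc
      obtain ⟨y, m'⟩ := h.mirror.exists_matched hv' hk' hc'
      exact ⟨x, fun _ _ => ⟨⟨v, hv, hk, m⟩, v', hv', hk', by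
        rw [h.matched_eq hv hk m hv' hk' m']; exact m'⟩⟩
    · exact ⟨o, fun h1 h2 => absurd ⟨h1, h2⟩ ho⟩
  choose T hT using key
  exact ⟨T, hT⟩

variable {T : β → β}

theorem IsDartMap.mirror (hT : IsDartMap E σ φ T) : IsDartMap E.mirror σ φ T :=
  fun o ho hl => (hT o ho hl).symm

theorem dartMap_eq (h : MirrorHom E σ φ) (hT : IsDartMap E σ φ T) {v o o' : β} (hv : v ∈ E.darts)
    (hk : E.kind v = .vertical) (m : Matched E σ φ v o o') : T o = o' := by
  have hm := (h.mem hv hk m).1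
  obtain ⟨-, v', hv', hk', m'⟩ := hT o hm.1 hm.2
  exact (h.matched_eq hv hk m hv' hk' m').symm

theorem dartMap_spec (h : MirrorHom E σ φ) (hT : IsDartMap E σ φ T) (ho : o ∈ E.darts)
    (hl : E.Leaving o) : T o ∈ E.darts ∧ E.kind (T o) = E.kind o ∧ E.W (T o) = E.W o ∧
      T (T o) = o := by
  obtain ⟨⟨v, hv, hk, m⟩, -⟩ := hT o ho hl
  have hc := h.corner v hv hk
  have m' := h.symm hv hk m
  exact ⟨(h.mem hv hk m).2.1, h.matched_kind hv hk m, by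
    rw [h.state.W_same (h.onVertex_mem ho) m.2.2, h.W_onVertex ho],
    h.mirror.dartMap_eq hT.mirror hc.1 hc.2.1 m'⟩

theorem dartMap_start (h : MirrorHom E σ φ) (hT : IsDartMap E σ φ T) {v : β} (hv : v ∈ E.darts)
    (hk : E.kind v = .vertical) : T (E.rot v) = E.rot⁻¹ (σ v) :=
  h.dartMap_eq hT hv hk (h.matched_start hv hk)

/-- The extension of the map of leaving darts to all darts. -/
def allDarts (E : WGraph β) (σ T : β → β) (x : β) : β :=
  if E.kind x = .vertical then σ x
  else if E.kind x = .incoming then E.opp (T (E.opp x)) else T x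

theorem allDarts_leaving (hl : E.Leaving x) : allDarts E σ T x = T x := by
  rw [allDarts, if_neg fun k => nl_of_vertical k hl,
    if_neg fun k => nl_of_incoming k hl]

theorem allDarts_vertical (hk : E.kind x = .vertical) :
    allDarts E σ T x = σ x := if_pos hk

theorem allDarts_incoming (hk : E.kind x = .incoming) :
    allDarts E σ T x = E.opp (T (E.opp x)) := by
  rw [allDarts, if_neg (by simp [hk]), if_pos hk]

theorem allDarts_spec (h : MirrorHom E σ φ) (hT : IsDartMap E σ φ T) (hx : x ∈ E.darts) :
    allDarts E σ T x ∈ E.darts ∧ E.kind (allDarts E σ T x) = E.kind x ∧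
      E.W (allDarts E σ T x) = E.W x ∧ allDarts E σ T (allDarts E σ T x) = x ∧
      (¬ E.Leaving x → T (E.rot x) = E.rot⁻¹ (allDarts E σ T x)) := by
  have hE := h.state
  by_cases hl : E.Leaving x
  · have h1 := h.dartMap_spec hT hx hl
    have hl' : E.Leaving (T x) := by rw [Leaving, h1.2.1]; exact hl
    rw [allDarts_leaving hl, allDarts_leaving hl']
    exact ⟨h1.1, h1.2.1, h1.2.2.1, h1.2.2.2, fun k => absurd hl k⟩
  rcases kind_of_not_leaving hl with hk | hk
  · have hc := h.corner x hx hk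
    have he : ∀ y ∈ E.darts, E.kind y = .vertical → E.W y = 0 := fun y hy hky =>
      hE.W_vertical y ⟨hy, by simp [hky], Set.notMem_empty _⟩ hky
    rw [allDarts_vertical hk, allDarts_vertical hc.2.1, hk, he x hx hk, he _ hc.1 hc.2.1]
    exact ⟨hc.1, hc.2.1, rfl, hc.2.2, fun _ => h.dartMap_start hT hx hk⟩
  · have he := hE.isEdge_in hx hk
    have hx' := (hE.opp_edge x he).1
    have hk' := hE.kind_incoming x he hk
    obtain ⟨⟨v, hv, hkv, m⟩, -⟩ := hT _ hx' (Or.inl hk')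
    have n := (h.matched_next hv hkv m hk').2
    have h1 := h.dartMap_spec hT hx' (Or.inl hk')
    rw [hk'] at h1
    have h2 := hE.kind_opp h1.1 h1.2.1
    have h3 := hE.opp_mem h1.1 h1.2.1
    rw [allDarts_incoming hk, allDarts_incoming h2,
      hE.opp_opp _ (hE.isEdge_out h1.1 h1.2.1), h1.2.2.2, hE.opp_opp x he, hk, h2]
    rw [hE.opp_opp x he] at n
    refine ⟨h3, rfl, ?_, rfl, fun _ => h.dartMap_eq hT hv hkv n⟩
    have hr := h.mem hv hkv n
    rw [← hE.W_same h3 (same_rot_inv _ _), hE.W_same (h.onVertex_mem hr.1.1) n.2.2,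
      h.W_onVertex hr.1.1, hE.W_rot x hx]

theorem allDarts_rot (h : MirrorHom E σ φ) (hT : IsDartMap E σ φ T) (hx : x ∈ E.darts) :
    E.rot (allDarts E σ T (E.rot x)) = allDarts E σ T x := by
  have hx' := h.state.rot_mem x hx
  by_cases hl : E.Leaving x
  · have hl' := h.state.nl_rot hx hl
    have h1 := (h.mirror.allDarts_spec hT.mirror hx').2.2.2.2 hl'
    rw [mirror_rot, inv_apply, inv_inv] at h1
    rw [allDarts_leaving hl]
    exact h1.symm
  · rw [allDarts_leaving (h.state.leaving_rot hx hl), (h.allDarts_spec hT hx).2.2.2.2 hl,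
      apply_inv]

/-- A map of points of the extended graph that reverses the orientation comes from a mirror
symmetry. -/
theorem mirrorSymmetric (hG : G.IsGraph) {σ : α ⊕ α → α ⊕ α}
    {φ : (α ⊕ α) × ℝ → (α ⊕ α) × ℝ} (h : MirrorHom G.ext σ φ)
    (hσ : ∀ d ∈ G.darts, G.kind d = .vertical →
      σ (inl (G.opp d)) = G.ext.opp (σ (inl d)) ∧ G.ext.H (σ (inl d)) = G.H d) :
    G.MirrorSymmetric := by
  obtain ⟨T, hT⟩ := h.exists_dartMap
  have hE := h.state
  have hspec := fun d (hd : d ∈ G.darts) => h.allDarts_spec hT (inl_mem_ext.2 hd)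
  have hinl : ∀ d ∈ G.darts, ∃ e ∈ G.darts, allDarts G.ext σ T (inl d) = inl e := by
    intro d hd
    obtain ⟨h1, h2, -⟩ := hspec d hd
    rcases he : allDarts G.ext σ T (inl d) with e | e
    · rw [he] at h1; exact ⟨e, inl_mem_ext.1 h1, rfl⟩
    · rw [he] at h2; exact absurd h2.symm (hG.kind_ne_ray d hd)
  choose! τ hτ hτe using hinl
  refine ⟨τ, hτ, fun d hd => ?_, fun d hd => ?_, fun d hd => ?_, fun d hd => ?_, fun d hd => ?_,
    fun d hd hk => ?_⟩
  · have := (hspec d hd).2.2.2.1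
    rw [hτe d hd, hτe _ (hτ d hd)] at this
    exact inl_injective this
  · refine inl_injective ((hτe _ (hG.opp_mem d hd)).symm.trans ?_)
    show _ = G.ext.opp (inl (τ d))
    rw [← hτe d hd]
    have hr := hG.kind_ne_ray d hd
    rcases hk : G.kind d with _ | _ | _ | _
    · rw [allDarts_vertical (E := G.ext) (x := inl d) hk,
        allDarts_vertical (E := G.ext) (x := inl (G.opp d)) (hG.kind_opp_vertical d hd hk)]
      exact (hσ d hd hk).1
    · rw [allDarts_leaving (E := G.ext) (x := inl d) (Or.inl hk),
        allDarts_incoming (E := G.ext) (x := inl (G.opp d)) (hG.kind_opp_outgoing d hd hk)]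
      show G.ext.opp (T (inl (G.opp (G.opp d)))) = _
      rw [hG.opp_opp d hd]
    · have h1 := hG.kind_opp_incoming d hd hk
      have h2 := hG.opp_mem d hd
      have h3 := h.dartMap_spec hT (inl_mem_ext.2 h2) (Or.inl h1)
      rw [allDarts_incoming (E := G.ext) (x := inl d) hk,
        allDarts_leaving (E := G.ext) (x := inl (G.opp d)) (Or.inl h1)]
      exact (hE.opp_opp _ (hE.isEdge_out h3.1 (h3.2.1.trans h1))).symm
    · exact absurd hk hr
  · rw [Equiv.Perm.eq_inv_iff_eq]
    have hd' := (hG.rot_mem d).2 hd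
    have h1 := h.allDarts_rot hT (inl_mem_ext.2 hd)
    rw [hτe d hd] at h1
    by_cases hc : d ∈ G.rayCorners
    · have h2 := h.allDarts_rot hT (inr_mem_ext.2 hc)
      rw [ext_rot_inr hc, hτe _ hd'] at h2
      rw [ext_rot_corner hc, ← h2] at h1
      by_cases hc' : τ (G.rot d) ∈ G.rayCorners
      · rw [ext_rot_corner hc', ext_rot_inr hc'] at h1
        exact inl_injective h1
      · have h3 := (h.allDarts_spec hT (inr_mem_ext.2 hc)).2.1
        rw [← h2, ext_rot_inl hc'] at h3
        exact absurd h3 (hG.kind_ne_ray _ ((hG.rot_mem _).2 (hτ _ hd')))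
    · rw [ext_rot_inl hc, hτe _ hd'] at h1
      by_cases hc' : τ (G.rot d) ∈ G.rayCorners
      · rw [ext_rot_corner hc'] at h1; cases h1
      · rw [ext_rot_inl hc'] at h1
        exact inl_injective h1
  · have := (hspec d hd).2.1
    rw [hτe d hd] at this
    exact this
  · have := (hspec d hd).2.2.1
    rw [hτe d hd] at this
    exact this
  · have := (hσ d hd hk).2
    rw [← allDarts_vertical (E := G.ext) (σ := σ) (T := T) (x := inl d) hk, hτe d hd] at this
    exact this

end MirrorHom

/-! ### Mirror symmetry of the zipped tree -/

/-- The map of darts of the extended graph induced by a mirror symmetry. -/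
def extMirror (G : WGraph α) (τ : α → α) : α ⊕ α → α ⊕ α :=
  Sum.map τ fun h => τ (G.rot h)

section

variable {τ : α → α}

theorem IsMirror.rot_map (hτ : G.IsMirror τ) {d : α} (hd : d ∈ G.darts) :
    G.rot (τ (G.rot d)) = τ d := by
  rw [hτ.rot d hd, apply_inv]

theorem IsMirror.rot_corner (hτ : G.IsMirror τ) (hG : G.IsGraph) {d : α} (hd : d ∈ G.rayCorners) :
    τ (G.rot d) ∈ G.rayCorners := by
  obtain ⟨h1, h2, h3⟩ := mem_rayCorners.1 hd
  have h4 := (hG.rot_mem d).2 h1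
  rw [mem_rayCorners, hτ.rot_map h1, hτ.kind _ h4, hτ.kind d h1]
  exact ⟨hτ.mem _ h4, h3, h2⟩

theorem IsMirror.corner_iff (hτ : G.IsMirror τ) (hG : G.IsGraph) {d : α} (hd : d ∈ G.darts) :
    τ (G.rot d) ∈ G.rayCorners ↔ d ∈ G.rayCorners := by
  refine ⟨fun h => ?_, hτ.rot_corner hG⟩
  have := hτ.rot_corner hG h
  rw [hτ.rot_map hd, hτ.invol d hd] at this
  exact this

theorem IsMirror.extMirror_invol (hτ : G.IsMirror τ) :
    ∀ x ∈ G.ext.darts, extMirror G τ (extMirror G τ x) = x := by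
  rintro (d | d) hx
  · exact congrArg inl (hτ.invol d (inl_mem_ext.1 hx))
  · have hd := (mem_rayCorners.1 (inr_mem_ext.1 hx)).1
    show inr (τ (G.rot (τ (G.rot d)))) = inr d
    rw [hτ.rot_map hd, hτ.invol d hd]

theorem IsMirror.extMirror_dartMap (hτ : G.IsMirror τ) (hG : G.IsGraph) :
    DartMap G.ext G.ext.mirror (extMirror G τ) where
  mem := by
    rintro (d | d) hx
    · exact inl_mem_ext.2 (hτ.mem d (inl_mem_ext.1 hx))
    · exact inr_mem_ext.2 (hτ.rot_corner hG (inr_mem_ext.1 hx))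
  rot := by
    rintro (d | d) hx
    · rw [mirror_rot, Equiv.Perm.eq_inv_iff_eq]
      have hd := inl_mem_ext.1 hx
      by_cases hc : d ∈ G.rayCorners
      · rw [ext_rot_corner hc]
        refine (ext_rot_inr (hτ.rot_corner hG hc)).trans ?_
        rw [hτ.rot_map hd]; rfl
      · rw [ext_rot_inl hc]
        refine (ext_rot_inl fun k => hc ((hτ.corner_iff hG hd).1 k)).trans ?_
        rw [hτ.rot_map hd]; rfl
    · have hc := inr_mem_ext.1 hx
      rw [mirror_rot, Equiv.Perm.eq_inv_iff_eq, ext_rot_inr hc]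
      exact ext_rot_corner (hτ.rot_corner hG hc)
  opp := by
    rintro (d | d) hx hk
    · exact congrArg inl (hτ.opp d (inl_mem_ext.1 hx))
    · cases hk
  kind := by
    rintro (d | d) hx
    · exact hτ.kind d (inl_mem_ext.1 hx)
    · rfl
  W := by
    rintro (d | d) hx
    · exact hτ.W d (inl_mem_ext.1 hx)
    · have hd := (mem_rayCorners.1 (inr_mem_ext.1 hx)).1
      exact (hτ.W _ ((hG.rot_mem d).2 hd)).trans (hG.W_rot d hd)

end

/-- If the collapsed half-strips form a symmetric family, then the graph obtained has a mirror
symmetry. -/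
theorem mirrorSymmetric_of_folding {τ : α → α} (hG : G.PlaneTree)
    (hτ : G.IsMirror τ) {G' : WGraph β} (hG' : G'.PlaneTree) {S : Set ((α ⊕ α) × (α ⊕ α))}
    {C N : α ⊕ α → β ⊕ β → Prop} (F : Folding G.ext ∅ S G'.ext ∅ ∅ C N) (hS : CornersOK G.ext S)
    (hSτ : ∀ c ∈ S, (extMirror G τ c.2, extMirror G τ c.1) ∈ S) (ι : α → β) (κ : β → α)
    (hκ : ∀ x, κ (ι x) = x)
    (hι : ∀ v ∈ G'.darts, G'.kind v = .vertical → ∃ x ∈ G.darts, v = ι x ∧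
      G.kind x = .vertical ∧ ι (τ x) ∈ G'.darts ∧ C (inl x) (inl (ι x)) ∧
      C (inl (τ x)) (inl (ι (τ x))))
    (hk : ∀ x, G'.kind (ι x) = G.kind x) (hopp : ∀ x, G'.opp (ι x) = ι (G.opp x))
    (hH : ∀ x, G'.H (ι x) = G.H x) : G'.MirrorSymmetric := by
  have hE := hG.ext_state
  have hE' := hG'.ext_state
  have ht := hτ.extMirror_dartMap hG.isGraph
  have hhom := ht.hom hE hE.mirror.toFrame (S' := Prod.swap ⁻¹' S) hS hSτ
  have htt : ∀ P Q, G.ext.Ident S P Q → G.ext.Ident S (DartMap.pointMap (extMirror G τ) P)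
      (DartMap.pointMap (extMirror G τ) Q) := fun P Q h => ident_mirror.1 (hhom.ident P Q h)
  have hvert : ∀ x ∈ G'.ext.darts, G'.ext.kind x = .vertical →
      ∃ v ∈ G'.darts, x = inl v ∧ G'.kind v = .vertical := by
    rintro (x | x) hx hk
    · exact ⟨x, inl_mem_ext.1 hx, rfl, hk⟩
    · cases hk
  refine MirrorHom.mirrorSymmetric (σ := fun x => inl (ι (τ (κ (base x)))))
    (φ := fun P => F.f (DartMap.pointMap (extMirror G τ) (F.h P))) hG'.isGraph
    ⟨hE', ?_, ?_, ?_⟩ ?_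
  · refine ((F.hom_h.trans hhom).trans F.mirror.hom_f).mono ?_
    rintro a a' ⟨ha, hka, rfl⟩
    obtain ⟨v, hv, rfl, hkv⟩ := hvert a ha hka
    obtain ⟨x, hx, rfl, hkx, -, hC, hC'⟩ := hι v hv hkv
    refine ⟨inl (τ x), ⟨inl x, hC, rfl, inl_mem_ext.2 hx, hkx⟩, ?_⟩
    show C _ (inl (ι (τ (κ (ι x)))))
    rw [hκ]; exact hC'
  · intro a ha hka
    obtain ⟨v, hv, rfl, hkv⟩ := hvert a ha hka
    obtain ⟨x, hx, rfl, hkx, hm, -⟩ := hι v hv hkv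
    show inl (ι (τ (κ (ι x)))) ∈ _ ∧ G'.kind (ι (τ (κ (ι x)))) = _ ∧
      (inl (ι (τ (κ (ι (τ (κ (ι x))))))) : β ⊕ β) = _
    rw [hκ, hκ, hτ.invol x hx, hk, hτ.kind x hx]
    exact ⟨inl_mem_ext.2 hm, hkx, rfl⟩
  · intro P hP
    have h1 := F.hom_h.point P hP
    have h2 := ht.isPoint hE.toFrame h1
    have h3 := htt _ _ (F.h_f _ h2)
    have h4 : DartMap.pointMap (extMirror G τ) (DartMap.pointMap (extMirror G τ) (F.h P)) = F.h P :=
      Prod.ext (hτ.extMirror_invol _ h1.1) rfl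
    rw [h4] at h3
    exact (F.hom_f.ident _ _ h3).trans (F.f_h P hP)
  · intro v hv hkv
    obtain ⟨x, hx, rfl, hkx, -⟩ := hι v hv hkv
    show (inl (ι (τ (κ (G'.opp (ι x))))) : β ⊕ β) = inl (G'.opp (ι (τ (κ (ι x))))) ∧
      G'.H (ι (τ (κ (ι x)))) = G'.H (ι x)
    rw [hopp, hκ, hκ, hopp, hτ.opp x hx, hH, hH, hτ.H x hx hkx]
    exact ⟨rfl, rfl⟩

theorem adjacentStrips_cornersOK (hE : Frame E M) {r : β}
    (hr : E.IsEdge M r) (hk : E.kind r = .vertical) :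
    CornersOK E (adjacentStrips E r) := by
  have h1 := hE.opp_edge r hr
  have h2 := hE.kind_vertical r hr hk
  rintro c (rfl | hc)
  · exact ⟨⟨hr.1, hk⟩, h1.1, h2⟩
  · rw [show c = (E.opp r, r) from hc]
    exact ⟨⟨h1.1, h2⟩, hr.1, hk⟩

theorem extMirror_adjacentStrips {τ : α → α} (hτ : G.IsMirror τ) {r : α}
    (hr : r ∈ G.darts) : ∀ c ∈ adjacentStrips G.ext (inl r),
    (extMirror G τ c.2, extMirror G τ c.1) ∈ adjacentStrips G.ext (inl (τ r)) := by
  have h1 : extMirror G τ (G.ext.opp (inl r)) = G.ext.opp (inl (τ r)) :=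
    congrArg inl (hτ.opp r hr)
  rintro c (rfl | hc)
  · right
    show (_, _) = (_, _)
    rw [h1]; rfl
  · rw [show c = (G.ext.opp (inl r), inl r) from hc]
    left
    show (_, _) = (_, _)
    rw [h1]; rfl

namespace ZipFolding

variable {r : α} {τ : α → α}

theorem mirrorSymmetric (Z : ZipFolding G r) (hτ : G.IsMirror τ) (h : τ r = r ∨ τ r = G.opp r) :
    (G.zip r).MirrorSymmetric := by
  obtain ⟨C, N, hC, -, ⟨F⟩⟩ := Z.exists_folding
  have hG := Z.admissible.isGraph
  have hS : adjacentStrips G.ext (inl (τ r)) =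
      adjacentStrips G.ext (inl r) := by
    rcases h with h | h
    · rw [h]
    · have h1 : G.ext.opp (inl (G.opp r)) = inl r :=
        congrArg inl (hG.opp_opp r Z.mem)
      rw [h, adjacentStrips, adjacentStrips, h1]
      exact Set.pair_comm _ _
  have hτr : τ (G.opp r) = r ∨ τ (G.opp r) = G.opp r := by
    rw [hτ.opp r Z.mem]
    rcases h with h | h
    · exact Or.inr (by rw [h])
    · exact Or.inl (by rw [h, hG.opp_opp r Z.mem])
  refine mirrorSymmetric_of_folding Z.admissible.planeTree hτ Z.data.planeTree F
    (adjacentStrips_cornersOK Z.admissible.planeTree.ext_state.toFrame Z.isEdge Z.vertical)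
    (by
      have := extMirror_adjacentStrips hτ Z.mem
      rwa [hS] at this) inl base (fun _ => rfl) ?_ Z.kind_inl Z.opp_inl Z.H_inl
  intro v hv hk
  obtain ⟨x, hx, h1, h2, rfl⟩ := Z.data.mem v hv
  rw [Z.kind_inl] at hk
  have hx' := hτ.mem x hx
  have hk' : G.kind (τ x) = .vertical := by rw [hτ.kind x hx, hk]
  have hne : ∀ s ∈ G.darts, (τ s = r ∨ τ s = G.opp r) → x ≠ τ s → τ x ≠ s := by
    rintro s hs - h3 h4
    exact h3 (by rw [← h4, hτ.invol x hx])
  have h3 : τ x ≠ r := hne r Z.mem h (by rcases h with h | h <;> rw [h] <;> assumption)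
  have h4 : τ x ≠ G.opp r := hne _ (hG.opp_mem r Z.mem) hτr
    (by rcases hτr with h | h <;> rw [h] <;> assumption)
  exact ⟨x, hx, rfl, hk, Z.data.vertical _ hx' hk' h3 h4, hC x hx hk h1 h2, hC _ hx' hk' h3 h4⟩

/-- After the zipping of the edge of `r`, its mirror image can be zipped. -/
theorem next (Z : ZipFolding G r) (hτ : G.IsMirror τ) (h1 : τ r ≠ r) (h2 : τ r ≠ G.opp r) :
    ZipFolding (G.zip r) (inl (τ r)) := by
  have hk : G.kind (τ r) = .vertical := by rw [hτ.kind r Z.mem, Z.vertical]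
  have hk' : (G.zip r).kind (inl (τ r)) = .vertical := by rw [Z.kind_inl, hk]
  refine Z.weaklyAdmissible.zipFolding Z.apart_zip
    (Z.data.vertical _ (hτ.mem r Z.mem) hk h1 h2) hk' ?_
  rw [weight_of_vertical hk', Z.H_inl, hτ.H r Z.mem Z.vertical, Z.H_eq]

theorem mirrorSymmetric_next (Z : ZipFolding G r) (hτ : G.IsMirror τ) (h1 : τ r ≠ r)
    (h2 : τ r ≠ G.opp r) : ((G.zip r).zip (inl (τ r))).MirrorSymmetric := by
  have hG := Z.admissible
  have hE := hG.planeTree.ext_state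
  have Z2 := Z.next hτ h1 h2
  obtain ⟨C, N, hC, -, ⟨F2⟩⟩ := Z2.exists_folding
  have hr := Z.mem
  have hr' := hτ.mem r hr
  have hor := hG.isGraph.opp_opp r hr
  have hk' : G.kind (τ r) = .vertical := by rw [hτ.kind r hr, Z.vertical]
  have hcr' := adjacentStrips_cornersOK hE.toFrame
    ((ext_isEdge hG.isGraph).2 ⟨τ r, hr', rfl⟩) (r := inl (τ r)) hk'
  have h3 : G.opp (τ r) ≠ r := fun k =>
    h2 ((hG.isGraph.opp_opp _ hr').symm.trans (congrArg G.opp k))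
  have h4 : G.opp (τ r) ≠ G.opp r := fun k =>
    h1 ((hG.isGraph.opp_opp _ hr').symm.trans ((congrArg G.opp k).trans hor))
  have hinl : ∀ a b : α, a ≠ b → (inl a : α ⊕ α) ≠ inl b :=
    fun a b h k => h (inl_injective k)
  have D := zipData hG.planeTree (hG.openable Z.apart hr Z.vertical Z.weight)
    (T := adjacentStrips G.ext (inl (τ r))) hcr' (by
      rintro c (rfl | hc)
      · exact ⟨⟨hinl _ _ h1, hinl _ _ h2⟩, hinl _ _ h3, hinl _ _ h4⟩
      · rw [show c = (_, _) from hc]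
        exact ⟨⟨hinl _ _ h3, hinl _ _ h4⟩, hinl _ _ h1, hinl _ _ h2⟩)
  obtain ⟨F1⟩ := D.folding
  have himg : Prod.map inl inl '' adjacentStrips G.ext (inl (τ r)) =
      adjacentStrips (G.zip r).ext (inl (inl (τ r))) := by
    rw [adjacentStrips, adjacentStrips, Set.image_pair,
      show (G.zip r).ext.opp (inl (inl (τ r))) = inl (inl (G.opp (τ r))) from
        congrArg inl (Z.opp_inl _)]
    rfl
  rw [himg] at F1
  have F := F1.trans F2 fun d d' k => by
    obtain ⟨x, hx, rfl, rfl, -, hz⟩ := k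
    exact ⟨inl_mem_ext.2 hx, inl_mem_ext.2 hz⟩
  have hop : ∀ x, ((G.zip r).zip (inl (τ r))).opp (inl (inl x)) =
      inl (inl (G.opp x)) := fun x => by rw [Z2.opp_inl, Z.opp_inl]
  refine mirrorSymmetric_of_folding hG.planeTree hτ Z2.data.planeTree F ?_ ?_
    (fun x => inl (inl x)) (fun x => base (base x)) (fun _ => rfl) ?_
    (fun x => by rw [Z2.kind_inl, Z.kind_inl]) hop (fun x => by rw [Z2.H_inl, Z.H_inl])
  · rintro c (hc | hc)
    · exact adjacentStrips_cornersOK hE.toFrame Z.isEdge Z.vertical c hc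
    · exact hcr' c hc
  · rintro c (hc | hc)
    · exact Or.inr (extMirror_adjacentStrips hτ hr c hc)
    · left
      have := extMirror_adjacentStrips hτ hr' c hc
      rwa [hτ.invol r hr] at this
  · intro v hv hk
    obtain ⟨y, hy, k1, k2, rfl⟩ := Z2.data.mem v hv
    obtain ⟨x, hx, k3, k4, rfl⟩ := Z.data.mem y hy
    rw [Z2.kind_inl, Z.kind_inl] at hk
    rw [Z.opp_inl] at k2
    have k1' : x ≠ τ r := fun k => k1 (by rw [k])
    have k2' : x ≠ G.opp (τ r) := fun k => k2 (by rw [k])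
    have hx' := hτ.mem x hx
    have hkx : G.kind (τ x) = .vertical := by rw [hτ.kind x hx, hk]
    -- The surviving vertical edges are permuted by the symmetry.
    have key : ∀ s ∈ G.darts, x ≠ τ s → τ x ≠ s := fun s _ h k => h (by rw [← k, hτ.invol x hx])
    have m1 := key r hr k1'
    have m2 := key _ (hG.isGraph.opp_mem r hr) (by rw [hτ.opp r hr]; exact k2')
    have m3 := key _ hr' (by rw [hτ.invol r hr]; exact k3)
    have m4 := key _ (hG.isGraph.opp_mem _ hr') (by
      rw [hτ.opp _ hr', hτ.invol r hr]; exact k4)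
    have hz := D.vertical _ hx' hkx m1 m2
    have hkz : ∀ x, G.kind x = .vertical →
        (G.zip r).kind (inl x) = .vertical := fun x k => by rw [Z.kind_inl, k]
    have n1 : (inl (τ x) : α ⊕ α) ≠ inl (τ r) := fun k => m3 (inl_injective k)
    have n2 : (inl (τ x) : α ⊕ α) ≠ (G.zip r).opp (inl (τ r)) := by
      rw [Z.opp_inl]; exact fun k => m4 (inl_injective k)
    rw [← Z.opp_inl] at k2
    exact ⟨x, hx, rfl, hk, Z2.data.vertical _ hz (hkz _ hkx) n1 n2,
      ⟨inl (inl x), ⟨x, hx, rfl, rfl, hk, k3, k4⟩, hC _ hy (hkz x hk) k1 k2⟩,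
      ⟨inl (inl (τ x)), ⟨τ x, hx', rfl, rfl, hkx, m1, m2⟩,
        hC _ hz (hkz _ hkx) n1 n2⟩⟩

end ZipFolding

/-! ### Contraction of an edge of a plane tree -/

theorem edgesM_empty (hray : ∀ d ∈ G.darts, G.kind d ≠ .ray) :
    G.edgesM ∅ = G.edges := by
  have : G.darts.filter (fun d => G.IsEdge ∅ d) = G.darts :=
    Finset.filter_true_of_mem fun d hd => ⟨hd, hray d hd, Set.notMem_empty _⟩
  rw [edgesM, this, edges]

theorem PlaneTree.frame (hG : G.PlaneTree) : Frame G ∅ where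
  rot_mem d hd := (hG.isGraph.rot_mem d).2 hd
  slider_mem m hm := absurd hm (Set.notMem_empty _)
  slider_kind m hm := absurd hm (Set.notMem_empty _)
  opp_edge d hd := ⟨hG.isGraph.opp_mem d hd.1, hG.isGraph.kind_ne_ray _ (hG.isGraph.opp_mem d hd.1),
    Set.notMem_empty _⟩
  opp_opp d hd := hG.isGraph.opp_opp d hd.1
  opp_ne d hd := hG.isGraph.opp_ne d hd.1
  kind_vertical d hd := hG.isGraph.kind_opp_vertical d hd.1
  kind_outgoing d hd := hG.isGraph.kind_opp_outgoing d hd.1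
  kind_incoming d hd := hG.isGraph.kind_opp_incoming d hd.1
  W_rot := hG.isGraph.W_rot
  W_le := hG.weakWidth.1
  W_vertical d hd := hG.weakWidth.2 d hd.1
  H_opp d hd := hG.isGraph.H_opp d hd.1
  H_nonneg d hd := hG.H_nonneg d hd.1
  conn d hd e he := by
    have : ∀ e, ReflTransGen G.Step d e →
        e ∈ G.darts ∧ EqvGen (G.Link ∅) d e := by
      intro e hde
      induction hde with
      | refl => exact ⟨hd, EqvGen.refl _⟩
      | tail _ hs ih =>
        rcases hs with rfl | rfl
        · exact ⟨(hG.isGraph.rot_mem _).2 ih.1, ih.2.trans _ _ _ (EqvGen.rel _ _ (Or.inl rfl))⟩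
        · exact ⟨hG.isGraph.opp_mem _ ih.1, ih.2.trans _ _ _ (EqvGen.rel _ _
            (Or.inr ⟨⟨ih.1, hG.isGraph.kind_ne_ray _ ih.1, Set.notMem_empty _⟩, rfl⟩))⟩
    exact (this e (hG.isTree.1 d hd e he)).2
  count := by rw [edgesM_empty hG.isGraph.kind_ne_ray, hG.isTree.2]

theorem Frame.planeTree (hG : Frame G ∅)
    (hray : ∀ d ∈ G.darts, G.kind d ≠ .ray) (hs : G.OutgoingSeparated) : G.PlaneTree := by
  have he : ∀ d ∈ G.darts, G.IsEdge ∅ d := fun d hd => ⟨hd, hray d hd, Set.notMem_empty _⟩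
  have hgr : G.IsGraph := ⟨perm_mem_iff hG.rot_mem, fun d hd => (hG.opp_edge d (he d hd)).1,
    fun d hd => hG.opp_opp d (he d hd), fun d hd => hG.opp_ne d (he d hd), hray,
    fun d hd => hG.kind_vertical d (he d hd), fun d hd => hG.kind_outgoing d (he d hd),
    fun d hd => hG.kind_incoming d (he d hd), hG.W_rot, fun d hd => hG.H_opp d (he d hd)⟩
  refine ⟨hgr, ⟨fun d hd e he' => ?_, ?_⟩, hs, ⟨hG.W_le, fun d hd => hG.W_vertical d (he d hd)⟩,
    fun d hd => hG.H_nonneg d (he d hd)⟩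
  · refine (eqvGen_le_of (equivalence_reach G.Step) ?_ hd (hG.conn d hd e he')).1
    rintro x _ (rfl | ⟨h, rfl⟩)
    · exact ⟨(hgr.rot_mem x).symm, fun hx => ⟨.single (Or.inl rfl),
        reach_of_rot hgr (fun _ => Or.inl rfl) hx⟩⟩
    · exact ⟨iff_of_true h.1 (hgr.opp_mem x h.1), fun hx => ⟨.single (Or.inr rfl),
        .single (Or.inr (hgr.opp_opp x hx).symm)⟩⟩
  · rw [hG.count, edgesM_empty hray]

namespace WeaklyAdmissible

variable {r : α}

theorem contractible (hG : G.WeaklyAdmissible) (hr : r ∈ G.darts)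
    (hk : G.kind r = .outgoing) (hw : G.weight r = 0) : Contractible G ∅ r :=
  { hG.planeTree.frame with
    mem := hr
    outgoing := hk
    W_eq := (weight_of_outgoing hk).1 hw
    rot_ne := fun k => hG.outgoingSeparated r hr hk (by rw [k, hk])
    rot_opp_ne := fun k => by
      -- A vertex of degree one with an incoming edge has order zero and no vertical edge.
      have hr' := hG.isGraph.opp_mem r hr
      have hk' := hG.isGraph.kind_opp_outgoing r hr hk
      obtain ⟨h1, h2⟩ := hG.ord_pos hr' (self_mem_vert hr') hk'
      have h3 : G.vert (G.opp r) = {G.opp r} := by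
        ext x
        rw [mem_vert, mem_singleton]
        refine ⟨fun h => ?_, fun h => by rw [h]; exact ⟨hr', .refl _ _⟩⟩
        obtain ⟨i, hi⟩ := h.2
        rw [← hi, Equiv.Perm.zpow_apply_eq_self_of_apply_eq_self k]
      apply h2
      rw [ord, h3, Finset.filter_singleton, Finset.filter_singleton, if_neg (by simp [hk']),
        if_pos hk']
      simp }

end WeaklyAdmissible

/-- An edge of zero weight of an admissible tree, and the tree obtained by its contraction. -/
structure Contraction (G : WGraph α) (r : α) : Prop where
  admissible : G.WeaklyAdmissible
  apart : ∀ w, G.BranchpointsApartAt w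
  mem : r ∈ G.darts
  outgoing : G.kind r = .outgoing
  weight : G.weight r = 0

namespace Contraction

variable {r : α}

theorem contractible (C : Contraction G r) : Contractible G ∅ r :=
  C.admissible.contractible C.mem C.outgoing C.weight

theorem spec (C : Contraction G r) : IsContraction G (G.contract r) r :=
  isContraction_contract C.contractible

theorem mem_iff (C : Contraction G r) {x : α} :
    x ∈ (G.contract r).darts ↔ x ∈ G.darts ∧ x ≠ r ∧ x ≠ G.opp r := by
  rw [C.spec.mem_iff]
  tauto

theorem vertexMap (C : Contraction G r) :
    VertexMap G ∅ (G.contract r) ∅ (contractMap G r (G.rot r)) :=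
  (C.spec.vertexMap C.contractible (same_rot _ _) C.contractible.rot_ne).1

theorem same_iff (C : Contraction G r) {x y : α} (hx : x ∈ G.darts) (hy : y ∈ G.darts) :
    (G.contract r).Same (contractMap G r (G.rot r) x) (contractMap G r (G.rot r) y) ↔
      G.Same x y ∨ (IsContraction.AtEnds G r x ∧ IsContraction.AtEnds G r y) :=
  C.spec.same_iff C.contractible (same_rot _ _) C.contractible.rot_ne hx hy

theorem map_of_mem (C : Contraction G r) {x : α} (hx : x ∈ (G.contract r).darts) :
    contractMap G r (G.rot r) x = x := C.spec.map_of_mem hx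

theorem opp_mem (C : Contraction G r) : G.opp r ∈ G.darts :=
  C.admissible.isGraph.opp_mem r C.mem

theorem opp_kind (C : Contraction G r) : G.kind (G.opp r) = .incoming :=
  C.admissible.isGraph.kind_opp_outgoing r C.mem C.outgoing

theorem zeroConn_ends (C : Contraction G r) : G.ZeroConn r (G.opp r) :=
  zeroConn_opp C.mem (by simp [C.outgoing]) C.weight

theorem zeroConn_of_same (C : Contraction G r) {x y : α} (hx : x ∈ G.darts) (hy : y ∈ G.darts)
    (h : (G.contract r).Same (contractMap G r (G.rot r) x)
      (contractMap G r (G.rot r) y)) : G.ZeroConn x y := by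
  have key : ∀ x ∈ G.darts, IsContraction.AtEnds G r x → G.ZeroConn x r := by
    rintro x hx (h | h)
    · exact WGraph.zeroConn_of_same hx h
    · exact (WGraph.zeroConn_of_same hx h).trans C.zeroConn_ends.symm
  rcases (C.same_iff hx hy).1 h with h | ⟨h1, h2⟩
  · exact WGraph.zeroConn_of_same hx h
  · exact (key x hx h1).trans (key y hy h2).symm

theorem planeTree (C : Contraction G r) : (G.contract r).PlaneTree := by
  have hG := C.admissible
  refine (C.spec.frame C.contractible).planeTree
    (fun d hd => hG.isGraph.kind_ne_ray d (C.mem_iff.1 hd).1) fun d hd hk => ?_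
  have hd' := (C.mem_iff.1 hd).1
  have h1 := hG.outgoingSeparated d hd' hk
  show G.kind ((G.contract r).rot d) ≠ _
  rw [C.spec.rot d hd]
  split_ifs with h2 h3
  · rw [h2] at h1; exact absurd C.outgoing h1
  · exact hG.outgoingSeparated r C.mem C.outgoing
  · exact h1

theorem zeroConn_of_contract (C : Contraction G r) {x y : α}
    (h : (G.contract r).ZeroConn x y) : G.ZeroConn x y := by
  refine eqvGen_le (equivalence_eqvGen _) ?_ h
  rintro x y ⟨hx, hxy | ⟨hk, hw, rfl⟩⟩
  · have hy := (C.spec.frame C.contractible).mem_of_same hx hxy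
    refine C.zeroConn_of_same (C.mem_iff.1 hx).1 (C.mem_iff.1 hy).1 ?_
    rwa [C.map_of_mem hx, C.map_of_mem hy]
  · exact zeroConn_opp (C.mem_iff.1 hx).1 hk hw

theorem apart_contract (C : Contraction G r) (w : ℝ) : (G.contract r).BranchpointsApartAt w := by
  refine branchpointsApartAt_of_merge C.vertexMap C.planeTree.isGraph (C.apart w)
    fun d hd e he _ h => ?_
  have key : ∀ d ∈ G.darts, G.ZeroConn d (contractMap G r (G.rot r) d) := by
    intro d hd
    have h1 := WGraph.zeroConn_of_same C.mem (same_rot G.rot r)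
    rw [contractMap]
    split_ifs with h2
    · rcases h2 with rfl | rfl
      · exact h1
      · exact C.zeroConn_ends.symm.trans h1
    · exact EqvGen.refl _
  exact ((key d hd).trans (C.zeroConn_of_contract h)).trans (key e he).symm

theorem orderZero (C : Contraction G r) : (G.contract r).OrderZeroCondition := by
  have hG := C.admissible
  intro V' hV' hord
  obtain ⟨d, hd, rfl⟩ := mem_verts.1 hV'
  have hd' := (C.mem_iff.1 hd).1
  have hzero : ∀ e ∈ G.darts, (G.contract r).Same d (contractMap G r (G.rot r) e) →
      G.ord (G.vert e) = 0 := by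
    intro e he hde
    refine ord_zero_of_merge hG C.vertexMap C.planeTree.isGraph (fun a ha b hb hw h1 h2 h => ?_) he
      (by rw [← vert_eq_of_same hde]; exact hord)
    exact C.apart 0 a ha b hb hw h1 h2 (C.zeroConn_of_same ha hb h)
  have h0 := hzero d hd' (by rw [C.map_of_mem hd])
  obtain ⟨⟨v, hv, hkv⟩, -⟩ := hG.orderZero _ (vert_mem_verts hd') h0
  obtain ⟨-, -, o, ho, hko⟩ := hG.ord_zero hd' h0
  have key : ∀ x ∈ G.vert d, x ≠ r → x ≠ G.opp r → x ∈ (G.contract r).vert d := by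
    intro x hx h1 h2
    obtain ⟨hx, hdx⟩ := mem_vert.1 hx
    have hx' := C.mem_iff.2 ⟨hx, h1, h2⟩
    have := C.vertexMap.same d hd' x hx hdx
    rw [C.map_of_mem hd, C.map_of_mem hx'] at this
    exact mem_vert.2 ⟨hx', this⟩
  have hne : ∀ x, ∀ k : DartKind, G.kind x = k → k ≠ .incoming → x ≠ G.opp r := by
    rintro x k hx hk rfl
    exact hk (hx.symm.trans C.opp_kind)
  refine ⟨⟨v, key v hv (fun k => ?_) (hne v _ hkv (by simp)), hkv⟩, o,
    key o ho (fun k => ?_) (hne o _ hko (by simp)), Or.inl hko⟩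
  · rw [k, C.outgoing] at hkv; cases hkv
  · -- Otherwise the vertex is merged with the other end of the edge, which has positive order.
    refine (hG.ord_pos C.opp_mem (self_mem_vert C.opp_mem) C.opp_kind).2 (hzero _ C.opp_mem ?_)
    have h1 := (C.same_iff hd' C.opp_mem).2
      (Or.inr ⟨Or.inl (k ▸ (mem_vert.1 ho).2), Or.inr (.refl _ _)⟩)
    rwa [C.map_of_mem hd] at h1

theorem weaklyAdmissible (C : Contraction G r) : (G.contract r).WeaklyAdmissible where
  isGraph := C.planeTree.isGraph
  isTree := C.planeTree.isTree
  outgoingSeparated := C.planeTree.outgoingSeparated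
  orderZero := C.orderZero
  weakWidth := C.planeTree.weakWidth
  weakHeights := by
    refine ⟨C.planeTree.H_nonneg, ?_⟩
    rw [← C.admissible.weakHeights.2]
    have : (G.contract r).darts.filter (fun d => (G.contract r).kind d = .vertical) =
        G.darts.filter (fun d => G.kind d = .vertical) := by
      ext x
      rw [mem_filter, mem_filter, C.mem_iff]
      refine ⟨fun h => ⟨h.1.1, h.2⟩, fun h => ⟨⟨h.1, ?_, ?_⟩, h.2⟩⟩
      · rintro rfl; cases C.outgoing.symm.trans h.2
      · rintro rfl; cases C.opp_kind.symm.trans h.2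
    rw [this]
    rfl

theorem zeroEdges_lt (C : Contraction G r) :
    (G.contract r).zeroEdges.card < G.zeroEdges.card := by
  refine Finset.card_lt_card (Finset.ssubset_iff_of_subset (fun e he => ?_) |>.2
    ⟨{r, G.opp r}, mem_image.2 ⟨r, mem_filter.2 ⟨C.mem, C.weight⟩, rfl⟩, fun h => ?_⟩)
  · obtain ⟨x, hx, rfl⟩ := mem_image.1 he
    obtain ⟨hx, hw⟩ := mem_filter.1 hx
    exact mem_image.2 ⟨x, mem_filter.2 ⟨(C.mem_iff.1 hx).1, hw⟩, rfl⟩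
  · obtain ⟨x, hx, -, he⟩ := mem_zeroEdges h
    have := (he x).2 (Or.inl rfl)
    rw [mem_insert, mem_singleton] at this
    exact this.elim (C.mem_iff.1 hx).2.1 (C.mem_iff.1 hx).2.2

theorem merges (C : Contraction G r) :
    G.MergesAddingOrders (G.contract r) id (G.ContractSame r) := by
  refine merges_of_vertexMap C.planeTree.isGraph C.vertexMap (fun d hd e he => ?_)
    fun d hd _ hm => by rw [C.map_of_mem (x := d) hm]; exact .refl _ _
  rw [C.same_iff hd he, ContractSame, IsContraction.AtEnds, IsContraction.AtEnds, vert_eq_iff hd,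
    vert_eq_iff hd, vert_eq_iff hd, vert_eq_iff he, vert_eq_iff he]

end Contraction

/-! ### Mirror symmetry of the contracted tree -/

/-- `y` is the first dart outside `S` met in going around the part of the tree formed by the edges
of `S`, starting after the dart `x`. -/
inductive Next (G : WGraph α) (S : Set α) : α → α → Prop
  | last (x : α) : G.rot x ∉ S → Next G S x (G.rot x)
  | skip (x y : α) : G.rot x ∈ S → Next G S (G.opp (G.rot x)) y → Next G S x y

namespace Next

variable {G G' : WGraph α} {S S' : Set α} {x y z : α}

theorem unique (h : Next G S x y) (h' : Next G S x z) : y = z := by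
  induction h with
  | last x hx =>
    cases h' with
    | last => rfl
    | skip _ _ hx' => exact absurd hx' hx
  | skip x y hx _ ih =>
    cases h' with
    | last _ hx' => exact absurd hx hx'
    | skip _ _ _ h => exact ih h

theorem lift (hS : S ⊆ S') (h : Next G S x y) : (y ∉ S' → Next G S' x y) ∧
    (y ∈ S' → ∀ z, Next G S' (G.opp y) z → Next G S' x z) := by
  induction h with
  | last x hx => exact ⟨fun h => .last x h, fun h z hz => .skip x z h hz⟩
  | skip x y hx _ ih =>
    exact ⟨fun h => .skip x _ (hS hx) (ih.1 h), fun h z hz => .skip x _ (hS hx) (ih.2 h z hz)⟩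

theorem comp (hopp : G'.opp = G.opp) (hG' : G'.IsGraph)
    (h : ∀ x ∈ G'.darts, Next G S x (G'.rot x)) (hS : ∀ x ∈ G'.darts, x ∉ S)
    (hx : x ∈ G'.darts) (hxy : Next G' S' x y) : Next G (S ∪ S') x y := by
  induction hxy with
  | last x hx' =>
    exact ((h x hx).lift Set.subset_union_left).1
      fun k => k.elim (hS _ ((hG'.rot_mem x).2 hx)) hx'
  | skip x y hx' _ ih =>
    have h1 := (hG'.rot_mem x).2 hx
    refine ((h x hx).lift Set.subset_union_left).2 (Or.inr hx') y ?_
    have := ih (hG'.opp_mem _ h1)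
    rwa [hopp] at this

/-- Going around in the opposite direction. -/
theorem reverse {τ : α → α} (hG : G.IsGraph) (hτ : G.IsMirror τ)
    (hS : ∀ x ∈ G.darts, x ∈ S ↔ τ x ∈ S) (hSo : ∀ x ∈ G.darts, x ∈ S → G.opp x ∈ S)
    (hx : x ∈ G.darts) (h : Next G S x y) :
    ∀ z, (τ x ∉ S → z = τ x) → (τ x ∈ S → Next G S (G.opp (τ x)) z) → Next G S (τ y) z := by
  have hrot : ∀ x ∈ G.darts, G.rot (τ (G.rot x)) = τ x := fun x hx => hτ.rot_map hx
  have hstep : ∀ x ∈ G.darts, ∀ z, (τ x ∉ S → z = τ x) →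
      (τ x ∈ S → Next G S (G.opp (τ x)) z) → Next G S (τ (G.rot x)) z := by
    intro x hx z h1 h2
    by_cases hm : τ x ∈ S
    · exact .skip _ _ (by rwa [hrot x hx]) (by rw [hrot x hx]; exact h2 hm)
    · rw [h1 hm, ← hrot x hx]
      exact .last _ (by rwa [hrot x hx])
  induction h with
  | last x _ => exact hstep x hx
  | skip x y hxS _ ih =>
    intro z h1 h2
    have h3 := (hG.rot_mem x).2 hx
    have h4 := hG.opp_mem _ h3
    have h5 : τ (G.opp (G.rot x)) ∈ S := (hS _ h4).1 (hSo _ h3 hxS)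
    refine ih h4 z (fun k => absurd h5 k) fun _ => ?_
    rw [hτ.opp _ h3, hG.opp_opp _ (hτ.mem _ h3)]
    exact hstep x hx z h1 h2

end Next

/-- If the edges of a symmetric set are contracted, then the mirror symmetry is inherited. -/
theorem IsMirror.of_next {G G' : WGraph α} {S : Set α} {τ : α → α} (hG : G.IsGraph)
    (hτ : G.IsMirror τ) (hG' : G'.IsGraph) (hd : ∀ x, x ∈ G'.darts ↔ x ∈ G.darts ∧ x ∉ S)
    (hn : ∀ x ∈ G'.darts, Next G S x (G'.rot x)) (hS : ∀ x ∈ G.darts, x ∈ S ↔ τ x ∈ S)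
    (hSo : ∀ x ∈ G.darts, x ∈ S → G.opp x ∈ S) (hopp : G'.opp = G.opp) (hk : G'.kind = G.kind)
    (hW : G'.W = G.W) (hH : G'.H = G.H) : G'.IsMirror τ := by
  have hm : ∀ x ∈ G'.darts, x ∈ G.darts := fun x hx => ((hd x).1 hx).1
  have hmτ : ∀ x ∈ G'.darts, τ x ∈ G'.darts := fun x hx =>
    (hd _).2 ⟨hτ.mem x (hm x hx), fun k => ((hd x).1 hx).2 ((hS x (hm x hx)).2 k)⟩
  refine ⟨hmτ, fun x hx => hτ.invol x (hm x hx), fun x hx => ?_, fun x hx => ?_, fun x hx => ?_,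
    fun x hx => ?_, fun x hx hkx => ?_⟩
  · rw [hopp]; exact hτ.opp x (hm x hx)
  · rw [Equiv.Perm.eq_inv_iff_eq]
    have h1 := hmτ _ ((hG'.rot_mem x).2 hx)
    exact (hn _ h1).unique ((hn x hx).reverse hG hτ hS hSo (hm x hx) _ (fun _ => rfl)
      fun k => absurd k ((hd _).1 (hmτ x hx)).2)
  · rw [hk]; exact hτ.kind x (hm x hx)
  · rw [hW]; exact hτ.W x (hm x hx)
  · rw [hH]; exact hτ.H x (hm x hx) (hk ▸ hkx)

namespace Contraction

variable {r : α} {τ : α → α}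

theorem next (C : Contraction G r) {x : α} (hx : x ∈ (G.contract r).darts) :
    WGraph.Next G {r, G.opp r} x ((G.contract r).rot x) := by
  have hm : ∀ x, x ∈ (G.contract r).darts → x ∉ ({r, G.opp r} : Set α) := fun x hx => by
    simpa using (C.mem_iff.1 hx).2
  have h0 := hm _ ((C.planeTree.isGraph.rot_mem x).2 hx)
  rw [C.spec.rot x hx] at h0 ⊢
  split_ifs at h0 ⊢ with h1 h2
  · refine .skip _ _ (by rw [h1]; exact Or.inl rfl) ?_
    rw [h1]
    exact .last _ h0
  · refine .skip _ _ (by rw [h2]; exact Or.inr rfl) ?_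
    rw [h2, C.admissible.isGraph.opp_opp r C.mem]
    exact .last _ h0
  · exact .last _ h0

theorem mirrorSymmetric (C : Contraction G r) (hτ : G.IsMirror τ) (h : τ r = r) :
    (G.contract r).MirrorSymmetric := by
  have hG := C.admissible.isGraph
  have h' : τ (G.opp r) = G.opp r := by rw [hτ.opp r C.mem, h]
  refine ⟨τ, hτ.of_next hG C.planeTree.isGraph (S := {r, G.opp r})
    (fun x => by rw [C.mem_iff]; simp) (fun x hx => C.next hx) (fun x hx => ?_) (fun x hx k => ?_)
    rfl rfl rfl rfl⟩
  · have key : ∀ a, τ a = a → (x = a ↔ τ x = a) := fun a ha =>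
      ⟨fun k => by rw [k, ha], fun k => by rw [← hτ.invol x hx, k, ha]⟩
    simp only [Set.mem_insert_iff, Set.mem_singleton_iff]
    rw [← key r h, ← key _ h']
  · rcases k with rfl | rfl
    · exact Or.inr rfl
    · left; exact hG.opp_opp r C.mem

/-- After the contraction of the edge of `r`, its mirror image can be contracted. -/
theorem second (C : Contraction G r) (hτ : G.IsMirror τ) (h : τ r ≠ r) :
    Contraction (G.contract r) (τ r) := by
  have hk : G.kind (τ r) = .outgoing := by rw [hτ.kind r C.mem, C.outgoing]
  refine ⟨C.weaklyAdmissible, C.apart_contract, C.mem_iff.2 ⟨hτ.mem r C.mem, h, fun k => ?_⟩, hk,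
      ?_⟩
  · rw [k, C.opp_kind] at hk; cases hk
  · refine (weight_of_outgoing hk).2 ?_
    show G.W (G.opp (τ r)) = G.W (τ r)
    rw [← hτ.opp r C.mem, hτ.W _ C.opp_mem, hτ.W r C.mem]
    exact (weight_of_outgoing C.outgoing).1 C.weight

theorem mirrorSymmetric_second (C : Contraction G r) (hτ : G.IsMirror τ) (h : τ r ≠ r) :
    ((G.contract r).contract (τ r)).MirrorSymmetric := by
  have hG := C.admissible.isGraph
  have C2 := C.second hτ h
  have hr' := hτ.mem r C.mem
  refine ⟨τ, hτ.of_next hG C2.planeTree.isGraph (S := {r, G.opp r} ∪ {τ r, G.opp (τ r)})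
    (fun x => ?_) (fun x hx => WGraph.Next.comp (G := G) (G' := G.contract r) rfl
        C.planeTree.isGraph (fun y hy => C.next hy)
      (fun y hy => by simpa using (C.mem_iff.1 hy).2) (C2.mem_iff.1 hx).1 (C2.next hx))
    (fun x hx => ?_) (fun x hx k => ?_) rfl rfl rfl rfl⟩
  · rw [C2.mem_iff, C.mem_iff]
    simp only [Set.mem_union, Set.mem_insert_iff, Set.mem_singleton_iff, not_or, and_assoc]
    rfl
  · have key : ∀ a ∈ G.darts, (x = a ↔ τ x = τ a) := fun a ha =>
      ⟨fun k => by rw [k], fun k => by rw [← hτ.invol x hx, k, hτ.invol a ha]⟩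
    have k1 := key r C.mem
    have k2 := key _ C.opp_mem
    have k3 := key _ hr'
    have k4 := key _ (hG.opp_mem _ hr')
    rw [hτ.opp r C.mem] at k2
    rw [hτ.invol r C.mem] at k3
    rw [hτ.opp _ hr', hτ.invol r C.mem] at k4
    simp only [Set.mem_union, Set.mem_insert_iff, Set.mem_singleton_iff]
    rw [← k1, ← k2, ← k3, ← k4]
    exact or_comm
  · rcases k with (rfl | rfl) | (rfl | rfl)
    · exact Or.inl (Or.inr rfl)
    · exact Or.inl (Or.inl (hG.opp_opp r C.mem))
    · exact Or.inr (Or.inr rfl)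
    · exact Or.inr (Or.inl (hG.opp_opp _ hr'))

end Contraction

end

end WGraph

theorem mainTheorem2 {α : Type*} (G : WGraph α) (hG : G.WeaklyAdmissible)
    (hB : G.BranchpointsApart) :
    (∀ r ∈ G.darts, G.kind r = DartKind.outgoing → G.weight r = 0 →
      (G.contract r).WeaklyAdmissible ∧
      (G.contract r).zeroEdges.card < G.zeroEdges.card ∧
      G.MergesAddingOrders (G.contract r) id (G.ContractSame r) ∧
      ∀ τ : α → α, G.IsMirror τ →
        (τ r = r → (G.contract r).MirrorSymmetric) ∧
        (τ r ≠ r →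
          ((G.contract r).contract (τ r)).WeaklyAdmissible ∧
          ((G.contract r).contract (τ r)).MirrorSymmetric ∧
          ((G.contract r).contract (τ r)).zeroEdges.card < (G.contract r).zeroEdges.card)) ∧
    (∀ r ∈ G.darts, G.kind r = DartKind.vertical → G.weight r = 0 →
      (G.zip r).WeaklyAdmissible ∧
      (G.zip r).zeroEdges.card < G.zeroEdges.card ∧
      G.MergesAddingOrders (G.zip r) Sum.inl (G.ZipSame r) ∧
      ∀ τ : α → α, G.IsMirror τ →
        (τ r = r ∨ τ r = G.opp r → (G.zip r).MirrorSymmetric) ∧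
        (τ r ≠ r ∧ τ r ≠ G.opp r →
          ((G.zip r).zip (Sum.inl (τ r))).WeaklyAdmissible ∧
          ((G.zip r).zip (Sum.inl (τ r))).MirrorSymmetric ∧
          ((G.zip r).zip (Sum.inl (τ r))).zeroEdges.card < (G.zip r).zeroEdges.card)) := by
  have hB' := hG.planeTree.branchpointsApartAt hB
  refine ⟨fun r hr hk hw => ?_, fun r hr hk hw => ?_⟩
  · have C : WGraph.Contraction G r := ⟨hG, hB', hr, hk, hw⟩
    exact ⟨C.weaklyAdmissible, C.zeroEdges_lt, C.merges, fun τ hτ =>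
      ⟨fun h => C.mirrorSymmetric hτ h, fun h => ⟨(C.second hτ h).weaklyAdmissible,
        C.mirrorSymmetric_second hτ h, (C.second hτ h).zeroEdges_lt⟩⟩⟩
  · have Z := hG.zipFolding (hB' 0) hr hk hw
    exact ⟨Z.weaklyAdmissible, Z.zeroEdges_lt, Z.merges, fun τ hτ =>
      ⟨fun h => Z.mirrorSymmetric hτ h, fun h => ⟨(Z.next hτ h.1 h.2).weaklyAdmissible,
        Z.mirrorSymmetric_next hτ h.1 h.2, (Z.next hτ h.1 h.2).zeroEdges_lt⟩⟩⟩
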